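/- **Setting.** Let $d\in\mathbb N=\{1,2,\dots\}$, $p_1,p_2\in[1,\infty)$, $c,T\in(0,\infty)$ with $\frac6{p_1}+\frac2{p_2}\le 1$, let $\|\cdot\|$ be a norm on $\mathbb R^d$, let $f\in C(\mathbb R,\mathbb R)$, $g\in C(\mathbb R^d,\mathbb R)$, $V\in C([0,T]\times\mathbb R^d,[1,\infty))$, and let $(\Omega,\mathcal F,\mathbb P)$ be a probability space. Write $\|Z\|_r=(\mathbb E[|Z|^r])^{1/r}\in[0,\infty]$ for real random variables $Z$ and $r\in[1,\infty)$, and $\|Z\|_r=\|\,\|Z\|\,\|_r$ for $\mathbb R^d$-valued $Z$. *Forward process.* Let $(s,t,x,\omega)\mapsto X^x_{s,t}(\omega)\in\mathbb R^d$ ($0\le s\le t\le T$, $x\in\mathbb R^d$) be measurable, and for every $t$ let $(r,x,\omega)\mapsto X^x_{t,r}(\omega)$ ($r\in[t,T]$) also be measurable with respect to the product of the Borel $\sigma$-algebra and the $\sigma$-algebra generated by the random variables $X^x_{t,r}$, $r\in[t,T]$, $x\in\mathbb R^d$, and the $\mathbb P$-null events. Assume for all $0\le s\le t\le r\le T$,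 $x,y,\tilde x,\tilde y\in\mathbb R^d$, $v,w,\tilde v,\tilde w\in\mathbb R$ that $|g(x)|\le V(T,x)$, $|Tf(0)|\le V(s,x)$, $$|(g(x)-g(y))-(g(\tilde x)-g(\tilde y))|\le\tfrac{V(T,x)+V(T,y)+V(T,\tilde x)+V(T,\tilde y)}4\Big(\tfrac{\|(x-y)-(\tilde x-\tilde y)\|}{\sqrt T}+\tfrac{(\|x-y\|+\|\tilde x-\tilde y\|)\|x-\tilde x\|}{2T}\Big),$$ $$|(f(v)-f(w))-(f(\tilde v)-f(\tilde w))|\le c|(v-w)-(\tilde v-\tilde w)|+\tfrac{c(|v-w|+|\tilde v-\tilde w|)|v-\tilde v|}2,$$ that $\mathbb P(X_{t,r}^{X_{s,t}^x}=X_{s,r}^x)=1$, that the random fields $(X_{s,t}^{y})_{y\in\mathbb R^d}$ and $(X_{t,\rho}^{y})_{\rho\in[t,T],y\in\mathbb R^d}$ are independent, and that $$\|(X^x_{s,t}-X^y_{s,t})-(X^{\tilde x}_{s,t}-X^{\tilde y}_{s,t})\|_{p_2}\le\tfrac{V(s,x)+V(s,y)+V(s,\tilde x)+V(s,\tilde y)}4\Big[\|(x-y)-(\tilde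 x-\tilde y)\|+\tfrac{(\|x-y\|+\|\tilde x-\tilde y\|)\|x-\tilde x\|}{2\sqrt T}\Big],$$ $$\|(X^x_{s,t}-X^y_{s,t})-(x-y)\|_{p_2}\le\tfrac{V(s,x)+V(s,y)}2\|x-y\|\tfrac{|t-s|^{1/2}}{\sqrt T}.$$ *Approximations.* Let $\Theta=\bigcup_{n\in\mathbb N}\mathbb Z^n$ (with $0\in\mathbb Z^1\subseteq\Theta$), let $\mathfrak r^\theta\colon\Omega\to[0,1]$, $\theta\in\Theta$, be i.i.d. random variables with $\mathbb P(\mathfrak r^0\le t)=t$ for $t\in[0,1]$. For $n\in\mathbb N$, $\theta\in\Theta$ let $(s,t,x,\omega)\mapsto\mathcal X^{n,\theta,x}_{s,t}(\omega)\in\mathbb R^d$ ($0\le s\le t\le T$) be measurable, also with respect to the product of the Borel $\sigma$-algebra and the $\sigma$-algebra generated by the random variables $\mathcal X^{k,\theta,y}_{\rho,\eta}$, $k\in\mathbb N$, $0\le \rho\le \eta\le T$, $y\in\mathbb R^d$, and the $\mathbb P$-null events. Assume that the random fields $(\mathcal X^{n,\theta,x}_{s,t})_{n\in\mathbb N,0\le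 s\le t\le T,x\in\mathbb R^d}$, $\theta\in\Theta$, are i.i.d., that the family $\big((X^x_{s,t})_{s,t,x},(\mathcal X^{n,\theta,x}_{s,t})_{n,\theta,s,t,x}\big)$ and the family $(\mathfrak r^\theta)_{\theta\in\Theta}$ are independent, and that for all $n\in\mathbb N$, $0\le s\le t\le T$, $s\le\tilde s\le\tilde t\le T$, $x,\tilde x\in\mathbb R^d$ $$\|\mathcal X^{n,0,x}_{s,t}-\mathcal X^{n,0,\tilde x}_{\tilde s,\tilde t}\|_{p_2}\le\tfrac{V(s,x)+V(\tilde s,\tilde x)}2\,\tfrac{|s-\tilde s|^{1/2}+|t-\tilde t|^{1/2}}2+e^{cT}\|x-\tilde x\|,$$ $$\|(\mathcal X^{n,0,x}_{s,t}-X^x_{s,t})-(\mathcal X^{n,0,\tilde x}_{\tilde s,\tilde t}-X^{\tilde x}_{\tilde s,\tilde t})\|_{p_2}\le\tfrac{V(s,x)+V(\tilde s,\tilde x)}2\Big[\tfrac{|s-\tilde s|^{1/2}+|t-\tilde t|^{1/2}}2+\|x-\tilde x\|\Big]\tfrac1{\sqrt n},$$ $$\mathbb P(X^x_{s,s}=x)=\mathbb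 P(\mathcal X^{n,0,x}_{s,s}=x)=1,\qquad e^{cT}\le\|V(t,\mathcal X^{n,0,x}_{s,t})\|_{p_1}\le V(s,x).$$ For $m\in\mathbb N$, $\theta\in\Theta$ let $U^\theta_{-1,m}=U^\theta_{0,m}=0$ and, for $n\in\mathbb N$, $t\in[0,T]$, $x\in\mathbb R^d$, with $\eta=(\theta,\ell,i)$ and $\rho=t+(T-t)\mathfrak r^{\eta}$, $$U^\theta_{n,m}(t,x)=\sum_{\ell=0}^{n-1}\frac1{m^{n-\ell}}\sum_{i=1}^{m^{n-\ell}}\Big[g(\mathcal X^{m^\ell,\eta,x}_{t,T})-1_{\mathbb N}(\ell)g(\mathcal X^{m^{\ell-1},\eta,x}_{t,T})+(T-t)f\big(U^{\eta}_{\ell,m}(\rho,\mathcal X^{m^\ell,\eta,x}_{t,\rho})\big)-1_{\mathbb N}(\ell)(T-t)f\big(U^{(\theta,\ell,-i)}_{\ell-1,m}(\rho,\mathcal X^{m^{\ell-1},\eta,x}_{t,\rho})\big)\Big].$$ Let $p\in[2,\infty)$, $q_1\in[3,\infty)$, $q_2\in[9,\infty)$ satisfy $\frac{q_2+1}{p_1}+\frac2{p_2}\le\frac1p$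 and $q_1+2\le q_2$, let $(\bar\theta_n)_{n\in\mathbb N_0}\subseteq\Theta$, and for $k\in\mathbb N$, $t\in[0,T]$ let $\lfloor t\rfloor_k=\max\big(([0,t]\setminus\{T\})\cap\{0,\frac Tk,\frac{2T}k,\dots\}\big)$, $\lceil t\rceil_k=\min\big(((t,\infty)\cup\{T\})\cap\{0,\frac Tk,\frac{2T}k,\dots\}\big)$. For $n,m,k\in\mathbb N$, $\ell\in\{0,\dots,n-1\}$, $t\in[0,T]$ put $Z_\ell(s)=U^{\bar\theta_\ell}_{n-\ell,m}(s,\mathcal X^{m^n,0,0}_{0,s})$, $I_k[Z_\ell](t)=\frac{\lceil t\rceil_k-t}{T/k}Z_\ell(\lfloor t\rfloor_k)+\frac{t-\lfloor t\rfloor_k}{T/k}Z_\ell(\lceil t\rceil_k)$ and $$\mathcal Y^{n,m}_t=\sum_{\ell=0}^{n-1}\Big(I_{m^{\ell+1}}[Z_\ell](t)-1_{\mathbb N}(\ell)\,I_{m^\ell}[Z_\ell](t)\Big).$$ **Theorem.** (i) There is a unique measurable $u\colon[0,T]\times\mathbb R^d\to\mathbb R$ such that for all $t\in[0,T]$, $x\in\mathbb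 R^d$ $$\mathbb E[|g(X^x_{t,T})|]+\int_t^T\mathbb E[|f(u(r,X^x_{t,r}))|]\,dr+\sup_{r\in[0,T],\xi\in\mathbb R^d}\tfrac{|u(r,\xi)|}{V(r,\xi)}<\infty,\qquad u(t,x)=\mathbb E[g(X^x_{t,T})]+\int_t^T\mathbb E[f(u(r,X^x_{t,r}))]\,dr.$$ (ii) For all $t\in[0,T]$, $s\in[0,T]\setminus\{t\}$: $\ \|u(t,X^0_{0,t})\|_p\le 2e^{2cT}V(0,0)^{q_1}$ and $\ \dfrac{\sqrt T\,\|u(t,X^0_{0,t})-u(s,X^0_{0,s})\|_p}{|t-s|^{1/2}}\le 12e^{2cT}V(0,0)^{q_2+1}.$ (iii) For all $n,m\in\mathbb N$, $t\in[0,T]$: $$\|\mathcal Y^{n,m}_t-u(t,X^0_{0,t})\|_p\le 959\,m\,e^{6cT}e^{m^{p/2}/p}m^{-n/2}\,74^n e^{4ncT}(p-1)^{n/2}V(0,0)^{q_2+1}.$$ -/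

import Mathlib

open MeasureTheory ProbabilityTheory Set
open scoped ENNReal

namespace MultigridFBSDE

noncomputable section

/-- The index set `Θ = ⋃_{n ≥ 1} ℤⁿ`: nonempty finite tuples of integers. -/
def Idx : Type := {l : List ℤ // l ≠ []}

/-- The index `0 ∈ ℤ¹ ⊆ Θ`. -/
def Idx.zero : Idx := ⟨[0], by simp⟩

/-- The index `(θ, ℓ, i)`. -/
def Idx.ext (θ : Idx) (ℓ i : ℤ) : Idx := ⟨θ.1 ++ [ℓ, i], by simp⟩

/-- The time pairs `(s, t)` with `0 ≤ s ≤ t ≤ T`. -/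
abbrev TimePair (T : ℝ) : Type := {q : ℝ × ℝ // 0 ≤ q.1 ∧ q.1 ≤ q.2 ∧ q.2 ≤ T}

/-- The norm `‖Z‖_r = (E[‖Z‖^r])^{1/r} ∈ [0, ∞]` for real `r ≥ 1`. -/
abbrev rNorm {Ω F : Type*} [MeasurableSpace Ω] [NormedAddCommGroup F]
    (P : Measure Ω) (r : ℝ) (Z : Ω → F) : ℝ≥0∞ :=
  eLpNorm Z (ENNReal.ofReal r) P

/-- The σ-algebra generated by `m` and the `P`-null events. -/
abbrev augment {Ω : Type*} [MeasurableSpace Ω] (P : Measure Ω) (m : MeasurableSpace Ω) :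
    MeasurableSpace Ω :=
  m ⊔ MeasurableSpace.generateFrom {A | MeasurableSet A ∧ P A = 0}

/-- Joint measurability of a random field `(a, x, ω) ↦ F a x ω` with values in `E`, where `Ω` is
equipped with the σ-algebra `m`. -/
def JointlyMeasurable {ι E Ω : Type*} [MeasurableSpace ι] [MeasurableSpace E]
    (m : MeasurableSpace Ω) (F : ι → E → Ω → E) : Prop :=
  Measurable[(inferInstance : MeasurableSpace ι).prod
    ((inferInstance : MeasurableSpace E).prod m)]
    (fun z : ι × E × Ω => F z.1 z.2.1 z.2.2)

section Fields

variable {E Ω : Type*}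

/-- The random field `(X^x_{s,t})_{0 ≤ s ≤ t ≤ T, x}` as a map into the space of its
realizations. -/
def flowField (T : ℝ) (X : ℝ → ℝ → E → Ω → E) (ω : Ω) : TimePair T × E → E :=
  fun z => X z.1.1.1 z.1.1.2 z.2 ω

/-- The random field `(X^x_{t,r})_{t ≤ r ≤ T, x}` for fixed `t`. -/
def futureField (T t : ℝ) (X : ℝ → ℝ → E → Ω → E) (ω : Ω) : Icc t T × E → E :=
  fun z => X t z.1 z.2 ω

/-- The random field `(𝒳^{n,x}_{s,t})_{n ≥ 1, 0 ≤ s ≤ t ≤ T, x}` belonging to one index `θ`. -/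
def approxField (T : ℝ) (Y : ℕ → ℝ → ℝ → E → Ω → E) (ω : Ω) : ℕ+ × TimePair T × E → E :=
  fun z => Y z.1 z.2.1.1.1 z.2.1.1.2 z.2.2 ω

end Fields

section Main

variable {E Ω : Type*} [NormedAddCommGroup E] [NormedSpace ℝ E]
  [MeasurableSpace E] [MeasurableSpace Ω]

/-- The assumptions on the exponents `p₁, p₂`, the constants `c, T`, the functions `f, g, V` and
the forward process `X^x_{s,t}` (written `X s t x ω`; only its values for `0 ≤ s ≤ t ≤ T`
matter). -/
structure ForwardSetting (P : Measure Ω) (p₁ p₂ c T : ℝ) (f : ℝ → ℝ) (g : E → ℝ)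
    (V : ℝ → E → ℝ) (X : ℝ → ℝ → E → Ω → E) : Prop where
  one_le_p₁ : 1 ≤ p₁
  one_le_p₂ : 1 ≤ p₂
  exponents : 6 / p₁ + 2 / p₂ ≤ 1
  c_pos : 0 < c
  T_pos : 0 < T
  f_cont : Continuous f
  g_cont : Continuous g
  V_cont : ContinuousOn (fun z : ℝ × E => V z.1 z.2) (Icc 0 T ×ˢ univ)
  one_le_V : ∀ t ∈ Icc 0 T, ∀ x, 1 ≤ V t x
  /-- `(s, t, x, ω) ↦ X^x_{s,t}(ω)` is measurable. -/
  X_meas : JointlyMeasurable inferInstance (fun (q : TimePair T) x ω => X q.1.1 q.1.2 x ω)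
  /-- `(r, x, ω) ↦ X^x_{t,r}(ω)` is measurable with respect to the information carried by the
  field `(X^x_{t,r})_{r, x}` itself, up to null events. -/
  X_meas_self : ∀ t ∈ Icc 0 T,
    JointlyMeasurable (augment P (MeasurableSpace.comap (futureField T t X) inferInstance))
      (fun (r : Icc t T) x ω => X t r x ω)
  g_le : ∀ x, |g x| ≤ V T x
  f_zero_le : ∀ s ∈ Icc 0 T, ∀ x, |T * f 0| ≤ V s x
  g_diff : ∀ x y x' y' : E,
    |(g x - g y) - (g x' - g y')| ≤ (V T x + V T y + V T x' + V T y') / 4 *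
      (‖(x - y) - (x' - y')‖ / √T + (‖x - y‖ + ‖x' - y'‖) * ‖x - x'‖ / (2 * T))
  f_diff : ∀ v w v' w' : ℝ,
    |(f v - f w) - (f v' - f w')| ≤ c * |(v - w) - (v' - w')|
      + c * (|v - w| + |v' - w'|) * |v - v'| / 2
  flow : ∀ s t r, 0 ≤ s → s ≤ t → t ≤ r → r ≤ T → ∀ x,
    ∀ᵐ ω ∂P, X t r (X s t x ω) ω = X s r x ω
  flow_indep : ∀ s t, 0 ≤ s → s ≤ t → t ≤ T →
    IndepFun (fun ω (x : E) => X s t x ω) (futureField T t X) P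
  X_diff : ∀ s t, 0 ≤ s → s ≤ t → t ≤ T → ∀ x y x' y',
    rNorm P p₂ (fun ω => (X s t x ω - X s t y ω) - (X s t x' ω - X s t y' ω)) ≤
      ENNReal.ofReal ((V s x + V s y + V s x' + V s y') / 4 *
        (‖(x - y) - (x' - y')‖ + (‖x - y‖ + ‖x' - y'‖) * ‖x - x'‖ / (2 * √T)))
  X_incr : ∀ s t, 0 ≤ s → s ≤ t → t ≤ T → ∀ x y,
    rNorm P p₂ (fun ω => (X s t x ω - X s t y ω) - (x - y)) ≤
      ENNReal.ofReal ((V s x + V s y) / 2 * ‖x - y‖ * (√|t - s| / √T))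

/-- The assumptions on the uniform random times `𝔯^θ` and on the approximating processes
`𝒳^{n,θ,x}_{s,t}` (written `Y n θ s t x ω`; only `n ≥ 1` and `0 ≤ s ≤ t ≤ T` matter). -/
structure ApproxSetting (P : Measure Ω) (p₁ p₂ c T : ℝ) (V : ℝ → E → ℝ)
    (X : ℝ → ℝ → E → Ω → E) (τ : Idx → Ω → ℝ) (Y : ℕ → Idx → ℝ → ℝ → E → Ω → E) : Prop where
  τ_meas : ∀ θ, Measurable (τ θ)
  τ_mem : ∀ θ ω, τ θ ω ∈ Icc (0 : ℝ) 1
  τ_indep : iIndepFun τ P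
  τ_ident : ∀ θ, IdentDistrib (τ θ) (τ Idx.zero) P P
  τ_law : ∀ t ∈ Icc (0 : ℝ) 1, P {ω | τ Idx.zero ω ≤ t} = ENNReal.ofReal t
  /-- `(s, t, x, ω) ↦ 𝒳^{n,θ,x}_{s,t}(ω)` is measurable. -/
  Y_meas : ∀ n, 1 ≤ n → ∀ θ,
    JointlyMeasurable inferInstance (fun (q : TimePair T) x ω => Y n θ q.1.1 q.1.2 x ω)
  /-- `(s, t, x, ω) ↦ 𝒳^{n,θ,x}_{s,t}(ω)` is measurable with respect to the information carried
  by the random field with index `θ` itself, up to null events. -/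
  Y_meas_self : ∀ n, 1 ≤ n → ∀ θ,
    JointlyMeasurable
      (augment P (MeasurableSpace.comap (approxField T (fun k => Y k θ)) inferInstance))
      (fun (q : TimePair T) x ω => Y n θ q.1.1 q.1.2 x ω)
  Y_indep : iIndepFun (fun θ : Idx => approxField T (fun k => Y k θ)) P
  Y_ident : ∀ θ, IdentDistrib (approxField T (fun k => Y k θ))
    (approxField T (fun k => Y k Idx.zero)) P P
  XY_τ_indep : IndepFun
    (fun ω => (flowField T X ω, fun θ : Idx => approxField T (fun k => Y k θ) ω))
    (fun ω (θ : Idx) => τ θ ω) P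
  Y_diff : ∀ n, 1 ≤ n → ∀ s t s' t', 0 ≤ s → s ≤ t → t ≤ T → s ≤ s' → s' ≤ t' → t' ≤ T →
    ∀ x x', rNorm P p₂ (fun ω => Y n Idx.zero s t x ω - Y n Idx.zero s' t' x' ω) ≤
      ENNReal.ofReal ((V s x + V s' x') / 2 * ((√|s - s'| + √|t - t'|) / 2)
        + Real.exp (c * T) * ‖x - x'‖)
  YX_diff : ∀ n, 1 ≤ n → ∀ s t s' t', 0 ≤ s → s ≤ t → t ≤ T → s ≤ s' → s' ≤ t' → t' ≤ T →
    ∀ x x', rNorm P p₂ (fun ω => (Y n Idx.zero s t x ω - X s t x ω)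
        - (Y n Idx.zero s' t' x' ω - X s' t' x' ω)) ≤
      ENNReal.ofReal ((V s x + V s' x') / 2 *
        ((√|s - s'| + √|t - t'|) / 2 + ‖x - x'‖) * (1 / √(n : ℝ)))
  X_start : ∀ s ∈ Icc 0 T, ∀ x, ∀ᵐ ω ∂P, X s s x ω = x
  Y_start : ∀ n, 1 ≤ n → ∀ s ∈ Icc 0 T, ∀ x, ∀ᵐ ω ∂P, Y n Idx.zero s s x ω = x
  le_V_Y : ∀ n, 1 ≤ n → ∀ s t, 0 ≤ s → s ≤ t → t ≤ T → ∀ x,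
    ENNReal.ofReal (Real.exp (c * T)) ≤ rNorm P p₁ (fun ω => V t (Y n Idx.zero s t x ω))
  V_Y_le : ∀ n, 1 ≤ n → ∀ s t, 0 ≤ s → s ≤ t → t ≤ T → ∀ x,
    rNorm P p₁ (fun ω => V t (Y n Idx.zero s t x ω)) ≤ ENNReal.ofReal (V s x)

/-- The multilevel Picard approximations `U^θ_{n,m}(t, x)`, `mlp T f g τ Y m n θ t x ω`, defined
by recursion on `n`. For `n = 0` the sum is empty, so `U^θ_{0,m} = 0`; the functions with index
`n = -1` occur only with the factor `1_ℕ(0) = 0`. -/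
def mlp (T : ℝ) (f : ℝ → ℝ) (g : E → ℝ) (τ : Idx → Ω → ℝ)
    (Y : ℕ → Idx → ℝ → ℝ → E → Ω → E) (m : ℕ) : ℕ → Idx → ℝ → E → Ω → ℝ
  | n => fun θ t x ω =>
    ∑ ℓ : Fin n, 1 / (m : ℝ) ^ (n - (ℓ : ℕ)) * ∑ i ∈ Finset.Icc 1 (m ^ (n - (ℓ : ℕ))),
      (g (Y (m ^ (ℓ : ℕ)) (θ.ext (ℓ : ℕ) i) t T x ω)
        - (if 1 ≤ (ℓ : ℕ) then g (Y (m ^ ((ℓ : ℕ) - 1)) (θ.ext (ℓ : ℕ) i) t T x ω) else 0)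
        + (T - t) * f (mlp T f g τ Y m ℓ (θ.ext (ℓ : ℕ) i)
            (t + (T - t) * τ (θ.ext (ℓ : ℕ) i) ω)
            (Y (m ^ (ℓ : ℕ)) (θ.ext (ℓ : ℕ) i) t (t + (T - t) * τ (θ.ext (ℓ : ℕ) i) ω) x ω) ω)
        - (if 1 ≤ (ℓ : ℕ) then
            (T - t) * f (mlp T f g τ Y m ((ℓ : ℕ) - 1) (θ.ext (ℓ : ℕ) (-(i : ℤ)))
              (t + (T - t) * τ (θ.ext (ℓ : ℕ) i) ω)
              (Y (m ^ ((ℓ : ℕ) - 1)) (θ.ext (ℓ : ℕ) i) t (t + (T - t) * τ (θ.ext (ℓ : ℕ) i) ω) x ω) ω)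
          else 0))
  termination_by n => n
  decreasing_by all_goals omega

/-- The time grid `{0, T/m, 2T/m, …}`. -/
def grid (T : ℝ) (m : ℕ) : Set ℝ := range fun k : ℕ => (k : ℝ) * T / m

/-- `⌊t⌋_m`, the maximum of `([0,t] \ {T}) ∩ {0, T/m, 2T/m, …}`; for `0 ≤ t ≤ T`, `0 < T` and
`1 ≤ m` this set is finite and nonempty. -/
def gridFloor (T : ℝ) (m : ℕ) (t : ℝ) : ℝ := sSup ((Icc 0 t \ {T}) ∩ grid T m)

/-- `⌈t⌉_m`, the minimum of `((t,∞) ∪ {T}) ∩ {0, T/m, 2T/m, …}`; for `0 ≤ t ≤ T`, `0 < T` and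
`1 ≤ m` this set is nonempty and its infimum is attained. -/
def gridCeil (T : ℝ) (m : ℕ) (t : ℝ) : ℝ := sInf ((Ioi t ∪ {T}) ∩ grid T m)

/-- Piecewise linear interpolation of `Z` at time `t` on the grid of mesh `T / k`. -/
def interp (T : ℝ) (k : ℕ) (Z : ℝ → ℝ) (t : ℝ) : ℝ :=
  (gridCeil T k t - t) / (T / k) * Z (gridFloor T k t)
    + (t - gridFloor T k t) / (T / k) * Z (gridCeil T k t)

/-- The multigrid approximation `𝒴^{n,m}_t` with indices `θ̄_0, θ̄_1, … ∈ Θ`. -/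
def multigrid (T : ℝ) (f : ℝ → ℝ) (g : E → ℝ) (τ : Idx → Ω → ℝ)
    (Y : ℕ → Idx → ℝ → ℝ → E → Ω → E) (θbar : ℕ → Idx) (n m : ℕ) (t : ℝ) (ω : Ω) : ℝ :=
  ∑ ℓ ∈ Finset.range n,
    (interp T (m ^ (ℓ + 1))
        (fun s => mlp T f g τ Y m (n - ℓ) (θbar ℓ) s (Y (m ^ n) Idx.zero 0 s 0 ω) ω) t
      - (if 1 ≤ ℓ then
          interp T (m ^ ℓ)
            (fun s => mlp T f g τ Y m (n - ℓ) (θbar ℓ) s (Y (m ^ n) Idx.zero 0 s 0 ω) ω) t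
        else 0))

/-- `u` is (on `[0,T] × E`) a measurable function that satisfies the integrability and growth
condition and the stochastic fixed-point equation
`u(t,x) = E[g(X^x_{t,T})] + ∫_t^T E[f(u(r, X^x_{t,r}))] dr`. -/
structure IsFixedPoint (P : Measure Ω) (T : ℝ) (f : ℝ → ℝ) (g : E → ℝ) (V : ℝ → E → ℝ)
    (X : ℝ → ℝ → E → Ω → E) (u : ℝ → E → ℝ) : Prop where
  meas : Measurable fun z : Icc 0 T × E => u z.1 z.2
  finite : ∀ t ∈ Icc 0 T, ∀ x,
    (∫⁻ ω, ENNReal.ofReal |g (X t T x ω)| ∂P)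
      + (∫⁻ r in Icc t T, ∫⁻ ω, ENNReal.ofReal |f (u r (X t r x ω))| ∂P)
      + (⨆ r ∈ Icc 0 T, ⨆ ξ : E, ENNReal.ofReal (|u r ξ| / V r ξ)) < ∞
  eq : ∀ t ∈ Icc 0 T, ∀ x,
    u t x = ∫ ω, g (X t T x ω) ∂P + ∫ r in t..T, ∫ ω, f (u r (X t r x ω)) ∂P

end Main

end

end MultigridFBSDE

/-! Write K = e^{cT} and measure distances in units of √T. The fixed-point map contracts by 1/2 in
the supremum norm with weight e^{2c(T-t)}V(t,x), because E[V(r,X^x_{t,r})] ≤ V(t,x)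
(`Flow.picardStep_contract`); this yields u and its uniqueness. Linear combinations of values of u
at finitely many points, transported by the same flow, satisfy an integral inequality. Gronwall's
lemma and the Markov property (`Flow.abs_comb_le`) then bound u, its differences and its second
differences, using one, two and four points. Restarting the equation at a later time
(`Flow.solution_flow`) adds Hölder-1/2 regularity in time (`Flow.solution_time`,
`Flow.solution_diff_time`). This gives (i) and (ii).

For (iii), the error of U_{n,m} is tracked through two families of moments at once (`Err`): those of
U - u at a point, and those of its increments between two space-time points. The increments cannot
be avoided, since they are what interpolation in time sees. A summand of level ℓ splits into a drift
part, where f is evaluated at U instead of u, and a path part, where u is kept and only the forward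
paths change. The path part has size m^{-ℓ/2} up to a factor √m; for its increments this is a
second-difference estimate for g, f and u (`Flow.pathDiff_sub_le`). In the drift part the error is
weighted by exp(a(T-t)/(Tp)) with a = m^{p/2}; integrating this weight over the uniform random time
gains a^{-1/p} = m^{-1/2} (`LB.exp_weight`, `Flow.drift_err`).

The average of m^{n-ℓ} independent summands deviates from its mean by a factor m^{-(n-ℓ)/2}, by a
Marcinkiewicz–Zygmund inequality (`LB.sum_indep`), and the means telescope, so that only the bias of
the last level survives (`Approx.integral_mlp`). Hence every contribution is of order m^{-n/2}, and
a geometric series with ratio 74 K⁴ √(p-1) closes the induction (`Flow.mlp_err`).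

In the multigrid sum, subtracting u inside each level leaves only the interpolation error of u
itself on the finest grid (`multigrid_sub`). For ℓ ≥ 1, passing between two consecutive grids costs
m^{-ℓ/2} times the Hölder constant of U_{n-ℓ} - u along the path, which is of order m^{-(n-ℓ)/2}.
The product is again m^{-n/2}, and the sum over ℓ is geometric (`Flow.multigrid_err`).

Two devices run through the proof. Moment bounds are indexed by the reciprocal of the exponent, so
that Hölder's inequality adds indices; the total budget is 10/p₁ + 2/p₂ ≤ 1/p. Independence enters
by freezing: each quantity is measurable with respect to the times and paths whose indices lie in an
explicit set, disjoint sets give independent information, and an independent argument may be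
replaced by a constant before integrating. -/

namespace MultigridFBSDE

set_option linter.unusedSectionVars false

universe u v

/-! ### Calculus of moment bounds indexed by reciprocal exponents. -/

section LpCalculus

variable {Ω : Type*} [MeasurableSpace Ω] {P : Measure Ω}

/-- `LB P s Z b` says that the real random variable `Z` has `L^{1/s}`-norm at most `b`. -/
structure LB (P : Measure Ω) (s : ℝ) (Z : Ω → ℝ) (b : ℝ) : Prop where
  pos : 0 < s
  le_one : s ≤ 1
  meas : AEStronglyMeasurable Z P
  nonneg : 0 ≤ b
  norm_le : eLpNorm Z (ENNReal.ofReal s⁻¹) P ≤ ENNReal.ofReal b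

namespace LB

variable {s s' r b b' : ℝ} {Z Z' : Ω → ℝ}

theorem one_le_exponent (h0 : 0 < s) (h1 : s ≤ 1) : 1 ≤ ENNReal.ofReal s⁻¹ := by
  rw [ENNReal.one_le_ofReal]
  exact (one_le_inv₀ h0).2 h1

theorem mono_bound (h : LB P s Z b) (hb : b ≤ b') : LB P s Z b' :=
  ⟨h.pos, h.le_one, h.meas, h.nonneg.trans hb, h.norm_le.trans (ENNReal.ofReal_le_ofReal hb)⟩

/-- On a probability space Lᵖ norms increase with p, so a larger reciprocal exponent is a weaker
statement. -/
theorem mono_exponent [IsProbabilityMeasure P] (h : LB P s Z b) (hs : s ≤ r) (hr : r ≤ 1) :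
    LB P r Z b := by
  have hr0 : 0 < r := h.pos.trans_le hs
  refine ⟨hr0, hr, h.meas, h.nonneg, le_trans ?_ h.norm_le⟩
  refine eLpNorm_le_eLpNorm_of_exponent_le ?_ h.meas
  exact ENNReal.ofReal_le_ofReal (inv_anti₀ h.pos hs)

theorem of_abs_le (h : LB P s Z b) (hm : AEStronglyMeasurable Z' P)
    (hle : ∀ᵐ ω ∂P, |Z' ω| ≤ |Z ω|) : LB P s Z' b :=
  ⟨h.pos, h.le_one, hm, h.nonneg, (eLpNorm_mono_ae (by simpa using hle)).trans h.norm_le⟩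

theorem of_le (h : LB P s Z b) (hm : AEStronglyMeasurable Z' P)
    (hle : ∀ᵐ ω ∂P, |Z' ω| ≤ Z ω) : LB P s Z' b :=
  h.of_abs_le hm (hle.mono fun _ hω => hω.trans (le_abs_self _))

theorem congr (h : LB P s Z b) (hle : Z' =ᵐ[P] Z) : LB P s Z' b :=
  ⟨h.pos, h.le_one, h.meas.congr hle.symm, h.nonneg, (eLpNorm_congr_ae hle).le.trans h.norm_le⟩

theorem abs (h : LB P s Z b) : LB P s (fun ω => |Z ω|) b :=
  h.of_abs_le h.meas.norm (by simp)

theorem neg (h : LB P s Z b) : LB P s (fun ω => -Z ω) b :=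
  h.of_abs_le h.meas.neg (by simp)

theorem const [IsProbabilityMeasure P] (h0 : 0 < s) (h1 : s ≤ 1) {a : ℝ} (ha : 0 ≤ a) :
    LB P s (fun _ => a) a := by
  refine ⟨h0, h1, aestronglyMeasurable_const, ha, ?_⟩
  rw [eLpNorm_const _ (by simpa using h0) (IsProbabilityMeasure.ne_zero P)]
  simp [Real.enorm_eq_ofReal ha]

theorem add' (h : LB P s Z b) (h' : LB P s Z' b') : LB P s (fun ω => Z ω + Z' ω) (b + b') := by
  refine ⟨h.pos, h.le_one, h.meas.add h'.meas, add_nonneg h.nonneg h'.nonneg, ?_⟩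
  rw [ENNReal.ofReal_add h.nonneg h'.nonneg]
  exact (eLpNorm_add_le h.meas h'.meas (one_le_exponent h.pos h.le_one)).trans
    (add_le_add h.norm_le h'.norm_le)

theorem add [IsProbabilityMeasure P] (h : LB P s Z b) (h' : LB P s' Z' b') (hs : s ≤ r)
    (hs' : s' ≤ r) (hr : r ≤ 1) : LB P r (fun ω => Z ω + Z' ω) (b + b') :=
  (h.mono_exponent hs hr).add' (h'.mono_exponent hs' hr)

theorem sub' (h : LB P s Z b) (h' : LB P s Z' b') : LB P s (fun ω => Z ω - Z' ω) (b + b') := by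
  simpa [sub_eq_add_neg] using h.add' h'.neg

theorem const_mul (h : LB P s Z b) {a : ℝ} (ha : 0 ≤ a) : LB P s (fun ω => a * Z ω) (a * b) := by
  refine ⟨h.pos, h.le_one, h.meas.const_mul a, mul_nonneg ha h.nonneg, ?_⟩
  have := eLpNorm_const_smul a Z (ENNReal.ofReal s⁻¹) P
  have e : (a • Z) = fun ω => a * Z ω := by ext; simp
  rw [e] at this
  rw [this, Real.enorm_eq_ofReal ha, ENNReal.ofReal_mul ha]
  gcongr
  exact h.norm_le

/-- Hölder's inequality: the reciprocal exponents s and s' add up, and the room left below r is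
filled by monotonicity of the norms. -/
theorem mul [IsProbabilityMeasure P] (h : LB P s Z b) (h' : LB P s' Z' b') (hs : s + s' ≤ r)
    (hr : r ≤ 1) : LB P r (fun ω => Z ω * Z' ω) (b * b') := by
  have hp := h.pos
  have hp' := h'.pos
  have key : LB P (s + s') (fun ω => Z ω * Z' ω) (b * b') := by
    refine ⟨by linarith, by linarith, h.meas.mul h'.meas, mul_nonneg h.nonneg h'.nonneg, ?_⟩
    have : ENNReal.HolderTriple (ENNReal.ofReal s⁻¹) (ENNReal.ofReal s'⁻¹)
        (ENNReal.ofReal (s + s')⁻¹) := by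
      constructor
      rw [← ENNReal.ofReal_inv_of_pos (by positivity), ← ENNReal.ofReal_inv_of_pos (by positivity),
        ← ENNReal.ofReal_inv_of_pos (by positivity), inv_inv, inv_inv, inv_inv,
        ENNReal.ofReal_add hp.le hp'.le]
    have := eLpNorm_smul_le_mul_eLpNorm (p := ENNReal.ofReal s⁻¹) (q := ENNReal.ofReal s'⁻¹)
      (r := ENNReal.ofReal (s + s')⁻¹) h'.meas h.meas
    refine (this.trans ?_)
    rw [ENNReal.ofReal_mul h.nonneg]
    exact mul_le_mul' h.norm_le h'.norm_le
  exact key.mono_exponent hs hr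

/-- The argument k stands for the power k + 1; later uses such as `pow 8` mean a ninth power. -/
theorem pow [IsProbabilityMeasure P] (h : LB P s Z b) (k : ℕ) (hk : (k + 1 : ℝ) * s ≤ r)
    (hr : r ≤ 1) : LB P r (fun ω => Z ω ^ (k + 1)) (b ^ (k + 1)) := by
  induction k generalizing r with
  | zero => simpa using h.mono_exponent (by simpa using hk) hr
  | succ k ih =>
    have hp := h.pos
    push_cast at hk
    have := (ih (r := (k + 1 : ℝ) * s) le_rfl (by nlinarith)).mul h (r := r) (by linarith) hr
    simpa [pow_succ] using this

theorem memLp (h : LB P s Z b) : MemLp Z (ENNReal.ofReal s⁻¹) P :=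
  ⟨h.meas, h.norm_le.trans_lt ENNReal.ofReal_lt_top⟩

theorem integrable [IsProbabilityMeasure P] (h : LB P s Z b) : Integrable Z P :=
  h.memLp.integrable (one_le_exponent h.pos h.le_one)

theorem lintegral_le [IsProbabilityMeasure P] (h : LB P s Z b) :
    ∫⁻ ω, ENNReal.ofReal |Z ω| ∂P ≤ ENNReal.ofReal b := by
  have := (h.mono_exponent h.le_one le_rfl).norm_le
  simpa [eLpNorm_one_eq_lintegral_enorm, Real.enorm_eq_ofReal_abs] using this

theorem integral_abs_le [IsProbabilityMeasure P] (h : LB P s Z b) : ∫ ω, |Z ω| ∂P ≤ b := by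
  rw [integral_eq_lintegral_of_nonneg_ae (Filter.Eventually.of_forall fun _ => abs_nonneg _)
    h.meas.norm]
  exact ENNReal.toReal_le_of_le_ofReal h.nonneg h.lintegral_le

theorem abs_integral_le [IsProbabilityMeasure P] (h : LB P s Z b) : |∫ ω, Z ω ∂P| ≤ b :=
  (abs_integral_le_integral_abs).trans h.integral_abs_le

theorem sum {ι : Type*} (S : Finset ι) {Z : ι → Ω → ℝ} {b : ι → ℝ} (h0 : 0 < s) (h1 : s ≤ 1)
    (h : ∀ i ∈ S, LB P s (Z i) (b i)) : LB P s (fun ω => ∑ i ∈ S, Z i ω) (∑ i ∈ S, b i) := by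
  classical
  induction S using Finset.induction_on with
  | empty => exact ⟨h0, h1, by simpa using aestronglyMeasurable_const, by simp, by simp⟩
  | insert i S hi ih =>
    simp only [Finset.sum_insert hi]
    exact (h i (by simp)).add' (ih fun j hj => h j (by simp [hj]))

theorem sub_integral [IsProbabilityMeasure P] (h : LB P s Z b) :
    LB P s (fun ω => Z ω - ∫ ω, Z ω ∂P) (2 * b) := by
  have := h.sub' ((LB.const (P := P) h.pos h.le_one (a := |∫ ω, Z ω ∂P|) (abs_nonneg _)).mono_bound
    h.abs_integral_le |>.of_abs_le (Z' := fun _ => ∫ ω, Z ω ∂P) aestronglyMeasurable_const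
      (by simp))
  simpa [two_mul] using this

/-- Serves to let the approximating paths tend to the forward process, and to pass from strictly
positive bounds to nonnegative ones. -/
theorem of_tendsto {ε : ℕ → ℝ} (hε : Filter.Tendsto ε Filter.atTop (nhds 0))
    (h : ∀ n, LB P s Z (b + ε n)) : LB P s Z b := by
  have hb : Filter.Tendsto (fun n => b + ε n) Filter.atTop (nhds b) := by
    simpa using hε.const_add b
  refine ⟨(h 0).pos, (h 0).le_one, (h 0).meas,
    ge_of_tendsto' hb fun n => (h n).nonneg, ?_⟩
  exact ge_of_tendsto' ((ENNReal.continuous_ofReal.tendsto _).comp hb) fun n => (h n).norm_le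

end LB

end LpCalculus

/-! ### Freezing an independent argument. -/

section Freezing

variable {Ω S Ω' : Type*} {mΩ : MeasurableSpace Ω} {mS : MeasurableSpace S}
  {mΩ' : MeasurableSpace Ω'} {P : Measure Ω} [IsProbabilityMeasure P]

/-- Independence makes the joint law a product measure, so Tonelli's theorem integrates over W with
the value of Z held fixed. -/
theorem IndepFun.lintegral_eq {Z : Ω → S} {W : Ω → Ω'} (hZ : Measurable Z) (hW : Measurable W)
    (hind : IndepFun Z W P) {F : S → Ω' → ℝ≥0∞} (hF : Measurable (fun z : S × Ω' => F z.1 z.2)) :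
    ∫⁻ ω, F (Z ω) (W ω) ∂P = ∫⁻ ω', ∫⁻ ω, F (Z ω') (W ω) ∂P ∂P := by
  have hmap := (indepFun_iff_map_prod_eq_prod_map_map hZ.aemeasurable hW.aemeasurable).1 hind
  have h1 := lintegral_map (μ := P) hF (hZ.prodMk hW)
  rw [hmap, lintegral_prod _ hF.aemeasurable, lintegral_map hF.lintegral_prod_right' hZ] at h1
  rw [← h1]
  exact lintegral_congr fun ω' => lintegral_map (hF.comp measurable_prodMk_left) hW

theorem IndepFun.integral_eq {Z : Ω → S} {W : Ω → Ω'} (hZ : Measurable Z) (hW : Measurable W)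
    (hind : IndepFun Z W P) {F : S → Ω' → ℝ} (hF : Measurable (fun z : S × Ω' => F z.1 z.2))
    (hint : Integrable (fun ω => F (Z ω) (W ω)) P) :
    ∫ ω, F (Z ω) (W ω) ∂P = ∫ ω', ∫ ω, F (Z ω') (W ω) ∂P ∂P := by
  have hmap := (indepFun_iff_map_prod_eq_prod_map_map hZ.aemeasurable hW.aemeasurable).1 hind
  have hZW := hZ.prodMk hW
  have h1 := integral_map (μ := P) hZW.aemeasurable (f := fun z : S × Ω' => F z.1 z.2)
    hF.aestronglyMeasurable
  have h2 : Integrable (fun z : S × Ω' => F z.1 z.2) (P.map fun ω => (Z ω, W ω)) :=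
    (integrable_map_measure hF.aestronglyMeasurable hZW.aemeasurable).2 hint
  rw [hmap] at h1 h2
  rw [integral_prod _ h2, integral_map hZ.aemeasurable
    hF.stronglyMeasurable.integral_prod_right'.aestronglyMeasurable] at h1
  rw [← h1]
  exact integral_congr_ae (Filter.Eventually.of_forall fun ω' => integral_map hW.aemeasurable
    (hF.comp measurable_prodMk_left).aestronglyMeasurable)

/-- Two random elements have the same law if they are obtained from random functions with the
same one-dimensional laws, evaluated at independent random points with the same law. -/
theorem IndepFun.identDistrib_prodMk {Ω₂' R : Type*} {mΩ₂' : MeasurableSpace Ω₂'}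
    {mR : MeasurableSpace R} {Z Z₂ : Ω → S} {W : Ω → Ω'} {W₂ : Ω → Ω₂'} (hZ : Measurable Z)
    (hZ₂ : Measurable Z₂) (hW : Measurable W) (hW₂ : Measurable W₂) (hind : IndepFun Z W P)
    (hind₂ : IndepFun Z₂ W₂ P) {F : S → Ω' → R} {F₂ : S → Ω₂' → R}
    (hF : Measurable (fun z : S × Ω' => F z.1 z.2))
    (hF₂ : Measurable (fun z : S × Ω₂' => F₂ z.1 z.2)) (hZZ : IdentDistrib Z Z₂ P P)
    (hFF : ∀ z ∈ range Z ∪ range Z₂,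
      IdentDistrib (fun ω => F z (W ω)) (fun ω => F₂ z (W₂ ω)) P P) :
    IdentDistrib (fun ω => (Z ω, F (Z ω) (W ω))) (fun ω => (Z₂ ω, F₂ (Z₂ ω) (W₂ ω))) P P := by
  have hm1 : Measurable fun ω => (Z ω, F (Z ω) (W ω)) := hZ.prodMk (hF.comp (hZ.prodMk hW))
  have hm2 : Measurable fun ω => (Z₂ ω, F₂ (Z₂ ω) (W₂ ω)) :=
    hZ₂.prodMk (hF₂.comp (hZ₂.prodMk hW₂))
  refine ⟨hm1.aemeasurable, hm2.aemeasurable, ?_⟩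
  ext B hB
  have hind1 : Measurable (B.indicator (1 : S × R → ℝ≥0∞)) := measurable_one.indicator hB
  have e1 : (P.map fun ω => (Z ω, F (Z ω) (W ω))) B
      = ∫⁻ ω, B.indicator 1 (Z ω, F (Z ω) (W ω)) ∂P := by
    rw [← lintegral_indicator_one hB, lintegral_map hind1 hm1]
  have e2 : (P.map fun ω => (Z₂ ω, F₂ (Z₂ ω) (W₂ ω))) B
      = ∫⁻ ω, B.indicator 1 (Z₂ ω, F₂ (Z₂ ω) (W₂ ω)) ∂P := by
    rw [← lintegral_indicator_one hB, lintegral_map hind1 hm2]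
  have hG : Measurable fun z : S × Ω' => B.indicator (1 : S × R → ℝ≥0∞) (z.1, F z.1 z.2) :=
    hind1.comp (measurable_fst.prodMk hF)
  have hG₂ : Measurable fun z : S × Ω₂' => B.indicator (1 : S × R → ℝ≥0∞) (z.1, F₂ z.1 z.2) :=
    hind1.comp (measurable_fst.prodMk hF₂)
  rw [e1, e2, IndepFun.lintegral_eq hZ hW hind (F := fun z w => B.indicator 1 (z, F z w)) hG,
    IndepFun.lintegral_eq hZ₂ hW₂ hind₂ (F := fun z w => B.indicator 1 (z, F₂ z w)) hG₂]
  -- Once z is frozen the indicator depends only on the law of F z. Only attained values of z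
  -- matter, which is what allows random times known to lie in [0,1].
  have h3 : ∀ z ∈ range Z ∪ range Z₂, ∫⁻ ω, B.indicator (1 : S × R → ℝ≥0∞) (z, F z (W ω)) ∂P
      = ∫⁻ ω, B.indicator (1 : S × R → ℝ≥0∞) (z, F₂ z (W₂ ω)) ∂P := fun z hz =>
    ((hFF z hz).comp (u := fun r => B.indicator (1 : S × R → ℝ≥0∞) (z, r))
      (hind1.comp measurable_prodMk_left)).lintegral_eq
  have hG₂' : Measurable fun z : S => ∫⁻ ω, B.indicator (1 : S × R → ℝ≥0∞) (z, F₂ z (W₂ ω)) ∂P :=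
    Measurable.lintegral_prod_right' (f := fun q : S × Ω =>
      B.indicator (1 : S × R → ℝ≥0∞) (q.1, F₂ q.1 (W₂ q.2)))
      (hG₂.comp (measurable_fst.prodMk (hW₂.comp measurable_snd)))
  rw [lintegral_congr fun ω' => h3 (Z ω') (Or.inl (mem_range_self _))]
  exact (hZZ.comp hG₂').lintegral_eq

/-- A random field evaluated at an independent random point: bounds on the `L^p`-norms at fixed
points integrate. -/
theorem eLpNorm_freeze_le {p : ℝ} (hp : 0 < p) {Z : Ω → S} {W : Ω → Ω'} (hZ : Measurable Z)
    (hW : Measurable W) (hind : IndepFun Z W P) {F : S → Ω' → ℝ}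
    (hF : Measurable (fun z : S × Ω' => F z.1 z.2)) {b : Ω → ℝ}
    (hb : ∀ ω', eLpNorm (fun ω => F (Z ω') (W ω)) (ENNReal.ofReal p) P ≤ ENNReal.ofReal (b ω')) :
    eLpNorm (fun ω => F (Z ω) (W ω)) (ENNReal.ofReal p) P ≤ eLpNorm b (ENNReal.ofReal p) P := by
  have h0 : ENNReal.ofReal p ≠ 0 := by simpa using hp
  rw [eLpNorm_eq_lintegral_rpow_enorm_toReal h0 ENNReal.ofReal_ne_top,
    eLpNorm_eq_lintegral_rpow_enorm_toReal h0 ENNReal.ofReal_ne_top, ENNReal.toReal_ofReal hp.le]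
  refine ENNReal.rpow_le_rpow ?_ (by positivity)
  rw [IndepFun.lintegral_eq hZ hW hind (F := fun z w => ‖F z w‖ₑ ^ p) (by fun_prop)]
  refine lintegral_mono fun ω' => ?_
  have := hb ω'
  rw [eLpNorm_eq_lintegral_rpow_enorm_toReal h0 ENNReal.ofReal_ne_top,
    ENNReal.toReal_ofReal hp.le, one_div, ENNReal.rpow_inv_le_iff hp] at this
  refine this.trans (ENNReal.rpow_le_rpow ?_ hp.le)
  exact Real.ofReal_le_enorm _

end Freezing

/-! ### Independence of σ-algebras. -/

section SigmaAlgebras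

variable {Ω : Type*} {m m' a a' b b' : MeasurableSpace Ω} {mΩ : MeasurableSpace Ω} {P : Measure Ω}

/-- Measurability of the null events in `augment` refers to the innermost instance in scope, namely
`m` itself; these events already belong to `m`, so the join adds nothing. -/
theorem augment_eq : augment P m = m :=
  sup_eq_left.2 (MeasurableSpace.generateFrom_le fun _ h => h.1)

/-- The space Ω with the smaller σ-algebra m is taken as the state space of the identity.
Information thereby becomes a random element to which the freezing lemmas apply directly. -/
theorem indepFun_id_of_indep {S : Type*} {mS : MeasurableSpace S} {Z : Ω → S}
    (hind : @Indep Ω (MeasurableSpace.comap Z mS) m mΩ P) :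
    @IndepFun Ω S Ω mΩ mS m Z id P := by
  refine (@IndepFun_iff_Indep Ω S Ω mΩ mS m Z id P).2 ?_
  rwa [MeasurableSpace.comap_id]

/-- If `a, a'`, `b, b'` and `a ⊔ a', b ⊔ b'` are independent pairs, then so are `a ⊔ b`
and `a' ⊔ b'`. -/
theorem Indep.sup_sup [IsProbabilityMeasure P] (ha : a ≤ mΩ)
    (ha' : a' ≤ mΩ) (hb : b ≤ mΩ) (hb' : b' ≤ mΩ) (haa : Indep a a' P) (hbb : Indep b b' P)
    (hab : Indep (a ⊔ a') (b ⊔ b') P) : Indep (a ⊔ b) (a' ⊔ b') P := by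
  have hpi : ∀ c d : MeasurableSpace Ω,
      IsPiSystem {s | ∃ t u, MeasurableSet[c] t ∧ MeasurableSet[d] u ∧ s = t ∩ u} ∧
      c ⊔ d = MeasurableSpace.generateFrom
        {s | ∃ t u, MeasurableSet[c] t ∧ MeasurableSet[d] u ∧ s = t ∩ u} := by
    intro c d
    constructor
    · rintro _ ⟨t, u, ht, hu, rfl⟩ _ ⟨t', u', ht', hu', rfl⟩ -
      exact ⟨t ∩ t', u ∩ u', ht.inter ht', hu.inter hu', by ext; simp; tauto⟩
    · refine le_antisymm (sup_le ?_ ?_) (MeasurableSpace.generateFrom_le ?_)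
      · exact fun s hs => MeasurableSpace.measurableSet_generateFrom
          ⟨s, univ, hs, MeasurableSet.univ, by simp⟩
      · exact fun s hs => MeasurableSpace.measurableSet_generateFrom
          ⟨univ, s, MeasurableSet.univ, hs, by simp⟩
      · rintro _ ⟨t, u, ht, hu, rfl⟩
        exact MeasurableSet.inter (m := c ⊔ d) ((le_sup_left : c ≤ c ⊔ d) _ ht)
          ((le_sup_right : d ≤ c ⊔ d) _ hu)
  refine IndepSets.indep (sup_le ha hb) (sup_le ha' hb') (hpi a b).1 (hpi a' b').1 (hpi a b).2
    (hpi a' b').2 ?_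
  rw [IndepSets_iff]
  rintro _ _ ⟨t, u, ht, hu, rfl⟩ ⟨t', u', ht', hu', rfl⟩
  rw [Indep_iff] at haa hbb hab
  have l1 : ∀ s, MeasurableSet[a] s → MeasurableSet[a ⊔ a'] s := (le_sup_left : a ≤ a ⊔ a')
  have l2 : ∀ s, MeasurableSet[a'] s → MeasurableSet[a ⊔ a'] s := (le_sup_right : a' ≤ a ⊔ a')
  have l3 : ∀ s, MeasurableSet[b] s → MeasurableSet[b ⊔ b'] s := (le_sup_left : b ≤ b ⊔ b')
  have l4 : ∀ s, MeasurableSet[b'] s → MeasurableSet[b ⊔ b'] s := (le_sup_right : b' ≤ b ⊔ b')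
  -- Regrouping puts the events of a, a' in one block and those of b, b' in the other: `hab`
  -- separates the blocks, `haa` and `hbb` split each of them, and `hab` used again reassembles the
  -- factors.
  have e : t ∩ u ∩ (t' ∩ u') = (t ∩ t') ∩ (u ∩ u') := by ext; simp; tauto
  rw [e, hab _ _ ((l1 _ ht).inter (l2 _ ht')) ((l3 _ hu).inter (l4 _ hu')), haa _ _ ht ht',
    hbb _ _ hu hu', hab _ _ (l1 _ ht) (l3 _ hu), hab _ _ (l2 _ ht') (l4 _ hu')]
  ring

end SigmaAlgebras

/-! ### A Gronwall lemma for functions that need not be measurable. -/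

section Gronwall

/-- The integral inequality is iterated: after k steps the a priori bound M carries the factor
(c(T-r))^k/k!, which tends to zero. Each iterate is an explicit continuous majorant, so only that
majorant is ever integrated exactly. -/
theorem lintegral_gronwall {φ : ℝ → ℝ≥0∞} {t T c A M : ℝ} (hc : 0 ≤ c) (hA : 0 ≤ A) (hM0 : 0 ≤ M)
    (h : ∀ r ∈ Icc t T, φ r ≤ ENNReal.ofReal A + ENNReal.ofReal c * ∫⁻ s in Icc r T, φ s)
    (hM : ∀ r ∈ Icc t T, φ r ≤ ENNReal.ofReal M) {r : ℝ} (hr : r ∈ Icc t T) :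
    φ r ≤ ENNReal.ofReal (A * Real.exp (c * (T - r))) := by
  have key : ∀ k : ℕ, ∀ r ∈ Icc t T, φ r ≤ ENNReal.ofReal
      (A * Real.exp (c * (T - r)) + M * ((c * (T - r)) ^ k / k.factorial)) := by
    intro k
    induction k with
    | zero =>
      intro r hr
      refine (hM r hr).trans (ENNReal.ofReal_le_ofReal ?_)
      have : 0 ≤ A * Real.exp (c * (T - r)) := by positivity
      simpa using this
    | succ k ih =>
      intro r hr
      have hcont : Continuous fun s => A * Real.exp (c * (T - s))
          + M * ((c * (T - s)) ^ k / k.factorial) := by fun_prop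
      have h1 : ∫⁻ s in Icc r T, φ s ≤ ENNReal.ofReal (∫ s in r..T,
          (A * Real.exp (c * (T - s)) + M * ((c * (T - s)) ^ k / k.factorial))) := by
        rw [intervalIntegral.integral_of_le hr.2, ← integral_Icc_eq_integral_Ioc,
          ofReal_integral_eq_lintegral_ofReal (hcont.continuousOn.integrableOn_Icc)]
        · refine setLIntegral_mono' measurableSet_Icc fun s hs => ih s ⟨hr.1.trans hs.1, hs.2⟩
        · refine (ae_restrict_iff' measurableSet_Icc).2 (Filter.Eventually.of_forall fun s hs => ?_)
          have : 0 ≤ T - s := sub_nonneg.2 hs.2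
          simp only [Pi.zero_apply]
          positivity
      -- The exponential reproduces itself up to the constant A, which the inhomogeneity restores,
      -- and the remainder moves on to the next term of the exponential series.
      have h2 : c * ∫ s in r..T,
          (A * Real.exp (c * (T - s)) + M * ((c * (T - s)) ^ k / k.factorial)) =
          A * Real.exp (c * (T - r)) - A
            + M * ((c * (T - r)) ^ (k + 1) / (k + 1).factorial) := by
        rw [← intervalIntegral.integral_const_mul,
          intervalIntegral.integral_eq_sub_of_hasDerivAt (f := fun s =>
          -(A * Real.exp (c * (T - s))) - M * ((c * (T - s)) ^ (k + 1) / (k + 1).factorial))]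
        · simp; ring
        · intro s _
          have d1 : HasDerivAt (fun s => c * (T - s)) (-c) s := by
            simpa using ((hasDerivAt_id s).const_sub T).const_mul c
          have d2 := ((d1.exp.const_mul A).neg).sub
            (((d1.pow (k + 1)).div_const ((k + 1).factorial : ℝ)).const_mul M)
          refine d2.congr_deriv ?_
          have : ((k + 1).factorial : ℝ) = (k + 1) * k.factorial := by
            push_cast [Nat.factorial_succ]; ring
          have hk : (k.factorial : ℝ) ≠ 0 := by positivity
          have hk' : (k + 1 : ℝ) ≠ 0 := by positivity
          rw [this]
          push_cast
          field_simp
          ring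
        · exact (hcont.const_mul c).intervalIntegrable _ _ 
      have h3 : 0 ≤ T - r := sub_nonneg.2 hr.2
      calc φ r ≤ ENNReal.ofReal A + ENNReal.ofReal c * ENNReal.ofReal (∫ s in r..T,
          (A * Real.exp (c * (T - s)) + M * ((c * (T - s)) ^ k / k.factorial))) :=
            (h r hr).trans (by gcongr)
        _ = ENNReal.ofReal (A + (A * Real.exp (c * (T - r)) - A
            + M * ((c * (T - r)) ^ (k + 1) / (k + 1).factorial))) := by
          rw [← ENNReal.ofReal_mul hc, h2, ENNReal.ofReal_add hA]
          have : A ≤ A * Real.exp (c * (T - r)) :=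
            le_mul_of_one_le_right hA (Real.one_le_exp (by positivity))
          have : 0 ≤ M * ((c * (T - r)) ^ (k + 1) / (k + 1).factorial) := by positivity
          linarith
        _ = _ := by congr 1; ring
  have hlim : Filter.Tendsto (fun k : ℕ => ENNReal.ofReal
      (A * Real.exp (c * (T - r)) + M * ((c * (T - r)) ^ k / k.factorial))) Filter.atTop
      (nhds (ENNReal.ofReal (A * Real.exp (c * (T - r)) + M * 0))) := by
    refine (ENNReal.continuous_ofReal.tendsto _).comp ?_
    exact ((FloorSemiring.tendsto_pow_div_factorial_atTop _).const_mul M).const_add _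
  have := ge_of_tendsto' hlim fun k => key k r hr
  simpa using this

end Gronwall

/-! ### Second-order Taylor estimate for powers of the absolute value. -/

section Rpow

/-- The odd power z ↦ |z|^{q-1}z has derivative q|z|^{q-1}. For equal signs the mean value theorem
applies; for opposite signs both summands are bounded separately by M^{q-1} times their base. -/
theorem abs_rpow_mul_sub_le {q M a b : ℝ} (hq : 1 ≤ q) (ha : |a| ≤ M) (hb : |b| ≤ M) :
    |(|a| ^ (q - 1) * a - |b| ^ (q - 1) * b)| ≤ q * M ^ (q - 1) * |a - b| := by
  have hM : 0 ≤ M := (abs_nonneg a).trans ha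
  have hpow : ∀ x : ℝ, 0 ≤ x → x ^ (q - 1) * x = x ^ q := by
    intro x hx
    rcases hx.eq_or_lt with rfl | hx
    · simp [show q ≠ 0 by linarith]
    · rw [← Real.rpow_add_one hx.ne']; simp
  have hpos : ∀ a b : ℝ, 0 ≤ a → 0 ≤ b → a ≤ M → b ≤ M →
      |a ^ q - b ^ q| ≤ q * M ^ (q - 1) * |a - b| := by
    intro a b ha hb haM hbM
    have := Convex.norm_image_sub_le_of_norm_hasDerivWithin_le (𝕜 := ℝ) (f := fun x : ℝ => x ^ q)
      (f' := fun x => q * x ^ (q - 1)) (C := q * M ^ (q - 1)) (s := Icc 0 M) (x := b) (y := a)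
      (fun x _ => (Real.hasDerivAt_rpow_const (Or.inr hq)).hasDerivWithinAt)
      (fun x hx => by
        rw [Real.norm_of_nonneg (mul_nonneg (by linarith) (Real.rpow_nonneg hx.1 _))]
        exact mul_le_mul_of_nonneg_left (Real.rpow_le_rpow hx.1 hx.2 (by linarith)) (by linarith))
      (convex_Icc 0 M) ⟨hb, hbM⟩ ⟨ha, haM⟩
    simpa using this
  have hmix : ∀ a b : ℝ, 0 ≤ a → 0 ≤ b → a ≤ M → b ≤ M →
      a ^ q + b ^ q ≤ q * M ^ (q - 1) * (a + b) := by
    intro a b ha hb haM hbM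
    have h1 : ∀ x : ℝ, 0 ≤ x → x ≤ M → x ^ q ≤ M ^ (q - 1) * x := fun x hx hxM => by
      rw [← hpow x hx]
      exact mul_le_mul_of_nonneg_right (Real.rpow_le_rpow hx hxM (by linarith)) hx
    have h2 : 0 ≤ M ^ (q - 1) * (a + b) := mul_nonneg (Real.rpow_nonneg hM _) (by linarith)
    nlinarith [h1 a ha haM, h1 b hb hbM]
  rcases le_total 0 a with ha0 | ha0 <;> rcases le_total 0 b with hb0 | hb0
  · rw [abs_of_nonneg ha0] at *; rw [abs_of_nonneg hb0] at *
    rw [hpow a ha0, hpow b hb0]; exact hpos a b ha0 hb0 ha hb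
  · rw [abs_of_nonneg ha0] at *; rw [abs_of_nonpos hb0] at *
    have h1 := hpow (-b) (by linarith)
    have h2 : a ^ (q - 1) * a - (-b) ^ (q - 1) * b = a ^ q + (-b) ^ q := by
      rw [← h1, hpow a ha0]; ring
    have h3 := Real.rpow_nonneg ha0 q
    have h4 := Real.rpow_nonneg (show 0 ≤ -b by linarith) q
    rw [h2, abs_of_nonneg (add_nonneg h3 h4), abs_of_nonneg (show 0 ≤ a - b by linarith)]
    simpa [sub_eq_add_neg] using hmix a (-b) ha0 (by linarith) ha hb
  · rw [abs_of_nonpos ha0] at *; rw [abs_of_nonneg hb0] at *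
    have h1 := hpow (-a) (by linarith)
    have h2 : (-a) ^ (q - 1) * a - b ^ (q - 1) * b = -((-a) ^ q + b ^ q) := by
      rw [← h1, hpow b hb0]; ring
    have h4 := Real.rpow_nonneg hb0 q
    have h3 := Real.rpow_nonneg (show 0 ≤ -a by linarith) q
    rw [h2, abs_neg, abs_of_nonneg (add_nonneg h3 h4), abs_of_nonpos (show a - b ≤ 0 by linarith)]
    have := hmix (-a) b (by linarith) hb0 ha hb
    rwa [show -(a - b) = -a + b by ring]
  · rw [abs_of_nonpos ha0] at *; rw [abs_of_nonpos hb0] at *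
    have h1 := hpow (-a) (by linarith)
    have h1' := hpow (-b) (by linarith)
    have h2 : (-a) ^ (q - 1) * a - (-b) ^ (q - 1) * b = -((-a) ^ q - (-b) ^ q) := by
      rw [← h1, ← h1']; ring
    rw [h2, abs_neg]
    have := hpos (-a) (-b) (by linarith) (by linarith) ha hb
    rwa [show -a - -b = -(a - b) by ring, abs_neg] at this

/-- Second-order Taylor bound for `z ↦ |z|^p`, `p ≥ 2`. -/
theorem abs_add_rpow_le {p : ℝ} (hp : 2 ≤ p) (x y : ℝ) :
    |x + y| ^ p ≤ |x| ^ p + p * (|x| ^ (p - 2) * x) * y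
      + p * (p - 1) / 2 * (y ^ 2 * (|x| + |y|) ^ (p - 2)) := by
  set M := |x| + |y| with hM
  have hM0 : 0 ≤ M := by positivity
  -- G is the right side minus the left side along the segment x + ty. It vanishes at t = 0, so
  -- monotonicity on [0,1] is all that is needed.
  let G : ℝ → ℝ := fun t => |x| ^ p + p * (|x| ^ (p - 2) * x) * (t * y)
      + p * (p - 1) / 2 * ((t * y) ^ 2 * M ^ (p - 2)) - |x + t * y| ^ p
  have hder : ∀ t, HasDerivAt G (p * (|x| ^ (p - 2) * x) * y
      + p * (p - 1) / 2 * ((2 * (t * y) * y) * M ^ (p - 2))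
      - p * |x + t * y| ^ (p - 2) * (x + t * y) * y) t := by
    intro t
    have d0 : HasDerivAt (fun t : ℝ => t * y) y t := by simpa using (hasDerivAt_id t).mul_const y
    have d1 : HasDerivAt (fun t : ℝ => x + t * y) y t := d0.const_add x
    have d2 := (hasDerivAt_abs_rpow (x + t * y) (p := p) (by linarith)).comp t d1
    have d3 := (d0.pow 2).mul_const (M ^ (p - 2))
    have := ((d0.const_mul (p * (|x| ^ (p - 2) * x))).const_add (|x| ^ p)).add
      (d3.const_mul (p * (p - 1) / 2)) |>.sub d2
    refine this.congr_deriv ?_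
    simp
  have hmono : MonotoneOn G (Icc 0 1) := by
    refine monotoneOn_of_deriv_nonneg (convex_Icc 0 1)
      (fun t _ => (hder t).continuousAt.continuousWithinAt)
      (fun t _ => (hder t).differentiableAt.differentiableWithinAt) fun t ht => ?_
    rw [interior_Icc] at ht
    rw [(hder t).deriv]
    -- The sign of G' comes from the Lipschitz constant of z ↦ |z|^{p-2}z on [-M,M], an interval
    -- that contains x and x + ty.
    have h1 := abs_rpow_mul_sub_le (q := p - 1) (M := M) (a := x + t * y) (b := x) (by linarith)
      ((abs_add_le _ _).trans (by
        rw [abs_mul, abs_of_pos ht.1, hM]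
        nlinarith [ht.2, abs_nonneg y])) (by rw [hM]; linarith [abs_nonneg y])
    rw [show p - 1 - 1 = p - 2 by ring, show x + t * y - x = t * y by ring, abs_mul,
      abs_of_pos ht.1] at h1
    have h2 := mul_le_mul_of_nonneg_right h1 (abs_nonneg y)
    rw [← abs_mul] at h2
    have h3 := (le_abs_self _).trans h2
    have h4 : (p - 1) * M ^ (p - 2) * (t * |y|) * |y| = (p - 1) * M ^ (p - 2) * t * y ^ 2 := by
      rw [← sq_abs y]; ring
    rw [h4] at h3
    nlinarith
  have h01 := hmono (left_mem_Icc.2 zero_le_one) (right_mem_Icc.2 zero_le_one) zero_le_one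
  simp only [G] at h01
  simp only [zero_mul, mul_zero, add_zero, one_mul] at h01
  norm_num at h01
  linarith

end Rpow

/-- Induction step of the Marcinkiewicz–Zygmund bound, with A = √(2(p-1)k). For k this large, A + 1
may be replaced by A in the second-order term at the price of a factor 2, and Bernoulli's inequality
shows that (A² + 2(p-1))^{p/2} grows fast enough to absorb the result. -/
theorem rpow_step_le {p b : ℝ} {k : ℕ} (hp : 2 ≤ p) (hb : 0 < b) (hk : 2 * (p - 1) < k + 1) :
    (√(2 * (p - 1) * k) * b) ^ p
      + p * (p - 1) / 2 * (b ^ 2 * (√(2 * (p - 1) * k) * b + b) ^ (p - 2)) ≤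
      (√(2 * (p - 1) * (k + 1 : ℕ)) * b) ^ p := by
  have hk1 : (1 : ℝ) < k := by linarith
  set A := √(2 * (p - 1) * k) with hAdef
  have hpos : 0 < 2 * (p - 1) * k := mul_pos (by linarith) (by linarith)
  have hA2 : A ^ 2 = 2 * (p - 1) * k := Real.sq_sqrt hpos.le
  have hA : 0 < A := Real.sqrt_pos.2 hpos
  have hp1 : (0 : ℝ) < p - 1 := by linarith
  -- Since k > 2p - 3, one has (p-2)/A ≤ 1/2, and the power is at most e^{1/2} < 2.
  have e1 : (1 + A⁻¹) ^ (p - 2) ≤ 2 := by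
    have h1 : (p - 2) * A⁻¹ ≤ 1 / 2 := by
      rw [← div_eq_mul_inv, div_le_iff₀ hA]
      refine (sq_le_sq₀ (by linarith) (by positivity)).1 ?_
      nlinarith
    calc (1 + A⁻¹) ^ (p - 2) ≤ (Real.exp A⁻¹) ^ (p - 2) := by
          refine Real.rpow_le_rpow (by positivity) ?_ (by linarith)
          linarith [Real.add_one_le_exp A⁻¹]
      _ = Real.exp ((p - 2) * A⁻¹) := by rw [← Real.exp_mul, mul_comm]
      _ ≤ Real.exp (1 / 2) := Real.exp_le_exp.2 h1
      _ ≤ 2 := by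
          have h2 := Real.exp_one_lt_d9
          have h3 : Real.exp (1 / 2) ^ 2 = Real.exp 1 := by rw [← Real.exp_nat_mul]; norm_num
          nlinarith [Real.exp_pos (1 / 2)]
  have e2 : (A + 1) ^ (p - 2) ≤ 2 * A ^ (p - 2) := by
    have : A + 1 = (1 + A⁻¹) * A := by field_simp
    rw [this, Real.mul_rpow (by positivity) hA.le]
    exact mul_le_mul_of_nonneg_right e1 (by positivity)
  have e3 : A ^ p + p * (p - 1) * A ^ (p - 2) ≤ √(2 * (p - 1) * (k + 1 : ℕ)) ^ p := by
    have h1 : 2 * (p - 1) * ((k + 1 : ℕ) : ℝ) = A ^ 2 * (1 + 2 * (p - 1) / A ^ 2) := by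
      push_cast; field_simp; rw [hA2]; ring
    -- Bernoulli's inequality with exponent p/2 ≥ 1.
    have h2 := one_add_mul_self_le_rpow_one_add (s := 2 * (p - 1) / A ^ 2) (p := p / 2)
      (by have : 0 ≤ 2 * (p - 1) / A ^ 2 := by positivity
          linarith) (by linarith)
    have h3 : A ^ (p - 2) = A ^ p / A ^ 2 := by
      rw [Real.rpow_sub hA]; norm_num
    rw [h1, Real.sqrt_mul (by positivity), Real.sqrt_sq hA.le, Real.mul_rpow hA.le (by positivity),
      Real.sqrt_eq_rpow, ← Real.rpow_mul (by positivity), one_div_mul_eq_div, h3]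
    have h4 : A ^ p + p * (p - 1) * (A ^ p / A ^ 2) = A ^ p * (1 + p / 2 * (2 * (p - 1) / A ^ 2)) := by
      field_simp
    rw [h4]
    exact mul_le_mul_of_nonneg_left h2 (by positivity)
  have e4 : b ^ 2 * (A * b + b) ^ (p - 2) = b ^ p * (A + 1) ^ (p - 2) := by
    rw [show A * b + b = b * (A + 1) by ring, Real.mul_rpow hb.le (by positivity), ← mul_assoc,
      Real.rpow_sub hb]
    rw [Real.rpow_two]
    field_simp
  rw [e4, Real.mul_rpow hA.le hb.le, Real.mul_rpow (by positivity) hb.le]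
  have hbp : 0 < b ^ p := by positivity
  have h5 : p * (p - 1) / 2 * (A + 1) ^ (p - 2) ≤ p * (p - 1) / 2 * (2 * A ^ (p - 2)) :=
    mul_le_mul_of_nonneg_left e2 (by positivity)
  nlinarith

/-! ### Moments of sums of independent centred variables, and the exponential time weight. -/

section MarcinkiewiczZygmund

variable {Ω : Type*} [MeasurableSpace Ω] {P : Measure Ω}

theorem eLpNorm_ofReal_le_iff {p b : ℝ} (hp : 0 < p) (hb : 0 ≤ b) {Z : Ω → ℝ} :
    eLpNorm Z (ENNReal.ofReal p) P ≤ ENNReal.ofReal b ↔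
      ∫⁻ ω, ENNReal.ofReal (|Z ω| ^ p) ∂P ≤ ENNReal.ofReal (b ^ p) := by
  have h0 : ENNReal.ofReal p ≠ 0 := by simpa using hp
  rw [eLpNorm_eq_lintegral_rpow_enorm_toReal h0 ENNReal.ofReal_ne_top,
    ENNReal.toReal_ofReal hp.le, one_div, ENNReal.rpow_inv_le_iff hp,
    ENNReal.ofReal_rpow_of_nonneg hb hp.le]
  simp only [Real.enorm_eq_ofReal_abs, ENNReal.ofReal_rpow_of_nonneg (abs_nonneg _) hp.le]

namespace LB

variable {p x y b : ℝ} {X Y Z : Ω → ℝ}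

theorem lintegral_rpow_le (hp : 0 < p) (h : LB P p⁻¹ Z b) :
    ∫⁻ ω, ENNReal.ofReal (|Z ω| ^ p) ∂P ≤ ENNReal.ofReal (b ^ p) := by
  have := h.norm_le
  rw [inv_inv] at this
  exact (eLpNorm_ofReal_le_iff hp h.nonneg).1 this

theorem integrable_rpow (hp : 0 < p) (h : LB P p⁻¹ Z b) : Integrable (fun ω => |Z ω| ^ p) P := by
  have h1 := h.lintegral_rpow_le hp
  refine ⟨(h.meas.norm.aemeasurable.pow_const p).aestronglyMeasurable, ?_⟩
  rw [hasFiniteIntegral_iff_ofReal (Filter.Eventually.of_forall fun _ => by positivity)]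
  exact h1.trans_lt ENNReal.ofReal_lt_top

theorem integral_rpow_le (hp : 0 < p) (h : LB P p⁻¹ Z b) : ∫ ω, |Z ω| ^ p ∂P ≤ b ^ p := by
  rw [integral_eq_lintegral_of_nonneg_ae (Filter.Eventually.of_forall fun _ => by positivity)
    (h.integrable_rpow hp).1]
  exact ENNReal.toReal_le_of_le_ofReal (Real.rpow_nonneg h.nonneg _) (h.lintegral_rpow_le hp)

theorem of_integral_rpow_le (hp : 1 ≤ p) (hb : 0 ≤ b) (hm : AEStronglyMeasurable Z P)
    (hint : Integrable (fun ω => |Z ω| ^ p) P) (h : ∫ ω, |Z ω| ^ p ∂P ≤ b ^ p) :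
    LB P p⁻¹ Z b := by
  have hp0 : 0 < p := by linarith
  refine ⟨by positivity, inv_le_one_of_one_le₀ hp, hm, hb, ?_⟩
  rw [inv_inv, eLpNorm_ofReal_le_iff hp0 hb, ← ofReal_integral_eq_lintegral_ofReal hint
    (Filter.Eventually.of_forall fun _ => by positivity)]
  exact ENNReal.ofReal_le_ofReal h

/-- In the Taylor expansion of |X + Y|^p around X the first-order term has mean zero by independence
and centring. The second-order term is handled by Hölder's inequality with exponents p/2 and
p/(p-2). -/
theorem add_indep [IsProbabilityMeasure P] (hp : 2 ≤ p) (hX : LB P p⁻¹ X x) (hY : LB P p⁻¹ Y y)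
    (hind : IndepFun X Y P) (hY0 : ∫ ω, Y ω ∂P = 0) :
    ∫ ω, |X ω + Y ω| ^ p ∂P ≤
      x ^ p + p * (p - 1) / 2 * (y ^ 2 * (x + y) ^ (p - 2)) := by
  have hp0 : 0 < p := by linarith
  have hx := hX.nonneg
  have hy := hY.nonneg
  have hXm := hX.meas.aemeasurable
  have hYm := hY.meas.aemeasurable
  have hA : LB P p⁻¹ (fun ω => |X ω| + |Y ω|) (x + y) := hX.abs.add' hY.abs
  have hq : ∫⁻ ω, ENNReal.ofReal (Y ω ^ 2 * (|X ω| + |Y ω|) ^ (p - 2)) ∂P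
      ≤ ENNReal.ofReal (y ^ 2 * (x + y) ^ (p - 2)) := by
    have h1 := ENNReal.lintegral_mul_norm_pow_le (μ := P)
      (f := fun ω => ENNReal.ofReal (|Y ω| ^ p))
      (g := fun ω => ENNReal.ofReal (|(|X ω| + |Y ω|)| ^ p))
      (by fun_prop) (by fun_prop) (p := 2 / p) (q := (p - 2) / p) (by positivity)
      (div_nonneg (by linarith) hp0.le) (by field_simp; ring)
    have h2 : ∀ a b : ℝ, 0 ≤ b → ENNReal.ofReal (|a| ^ p) ^ (2 / p) *
        ENNReal.ofReal (|b| ^ p) ^ ((p - 2) / p) = ENNReal.ofReal (a ^ 2 * b ^ (p - 2)) := by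
      intro a b hb
      rw [ENNReal.ofReal_rpow_of_nonneg (by positivity) (by positivity),
        ENNReal.ofReal_rpow_of_nonneg (by positivity) (div_nonneg (by linarith) hp0.le),
        ← Real.rpow_mul (abs_nonneg _), ← Real.rpow_mul (abs_nonneg _),
        ← ENNReal.ofReal_mul (by positivity), mul_div_cancel₀ _ hp0.ne',
        mul_div_cancel₀ _ hp0.ne', abs_of_nonneg hb]
      congr 2
      rw [← sq_abs a]; norm_cast
    simp only [h2 _ _ (add_nonneg (abs_nonneg _) (abs_nonneg _))] at h1
    refine h1.trans ?_
    rw [← h2 y (x + y) (by linarith)]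
    rw [abs_of_nonneg hy, abs_of_nonneg (show 0 ≤ x + y by linarith)]
    exact mul_le_mul' (ENNReal.rpow_le_rpow (hY.lintegral_rpow_le hp0) (by positivity))
      (ENNReal.rpow_le_rpow (hA.lintegral_rpow_le hp0) (div_nonneg (by linarith) hp0.le))
  have hqnn : 0 ≤ᵐ[P] fun ω => Y ω ^ 2 * (|X ω| + |Y ω|) ^ (p - 2) :=
    Filter.Eventually.of_forall fun ω => by simp only [Pi.zero_apply]; positivity
  have hqint : Integrable (fun ω => Y ω ^ 2 * (|X ω| + |Y ω|) ^ (p - 2)) P := by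
    refine ⟨AEMeasurable.aestronglyMeasurable (by fun_prop), ?_⟩
    rw [hasFiniteIntegral_iff_ofReal hqnn]
    exact hq.trans_lt ENNReal.ofReal_lt_top
  have hqle : ∫ ω, Y ω ^ 2 * (|X ω| + |Y ω|) ^ (p - 2) ∂P ≤ y ^ 2 * (x + y) ^ (p - 2) := by
    rw [integral_eq_lintegral_of_nonneg_ae hqnn hqint.1]
    exact ENNReal.toReal_le_of_le_ofReal (by positivity) hq
  have hφ : Measurable fun z : ℝ => |z| ^ (p - 2) * z := by fun_prop
  have hφX : Integrable (fun ω => |X ω| ^ (p - 2) * X ω) P := by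
    refine Integrable.mono' ((integrable_const (1 : ℝ)).add (hX.integrable_rpow hp0))
      (hφ.comp_aemeasurable hXm).aestronglyMeasurable (Filter.Eventually.of_forall fun ω => ?_)
    rw [Real.norm_eq_abs, abs_mul, abs_of_nonneg (Real.rpow_nonneg (abs_nonneg _) _)]
    simp only [Pi.add_apply]
    rcases (abs_nonneg (X ω)).eq_or_lt with h | h
    · rw [← h]; simp [hp0.ne']
    · rw [← Real.rpow_add_one h.ne']
      rcases le_total (|X ω|) 1 with h1 | h1
      · have h2 := Real.rpow_le_one h.le h1 (show 0 ≤ p - 2 + 1 by linarith)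
        have h3 := Real.rpow_nonneg h.le p
        linarith
      · have h2 := Real.rpow_le_rpow_of_exponent_le h1 (show p - 2 + 1 ≤ p by linarith)
        linarith
  have hind2 : IndepFun (fun ω => |X ω| ^ (p - 2) * X ω) Y P := hind.comp hφ measurable_id
  have hcross : ∫ ω, (|X ω| ^ (p - 2) * X ω) * Y ω ∂P = 0 := by
    have := hind2.integral_mul_eq_mul_integral hφX.1 hY.meas
    simp only [Pi.mul_apply] at this
    rw [this, hY0, mul_zero]
  have hcint : Integrable (fun ω => (|X ω| ^ (p - 2) * X ω) * Y ω) P :=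
    hind2.integrable_mul hφX hY.integrable
  calc ∫ ω, |X ω + Y ω| ^ p ∂P
      ≤ ∫ ω, (|X ω| ^ p + p * ((|X ω| ^ (p - 2) * X ω) * Y ω)
        + p * (p - 1) / 2 * (Y ω ^ 2 * (|X ω| + |Y ω|) ^ (p - 2))) ∂P := by
        refine integral_mono ((hX.add' hY).integrable_rpow hp0)
          (((hX.integrable_rpow hp0).add (hcint.const_mul p)).add (hqint.const_mul _)) fun ω => ?_
        have := abs_add_rpow_le hp (X ω) (Y ω)
        simp only
        linarith
    _ = ∫ ω, |X ω| ^ p ∂P + p * ∫ ω, (|X ω| ^ (p - 2) * X ω) * Y ω ∂P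
        + p * (p - 1) / 2 * ∫ ω, Y ω ^ 2 * (|X ω| + |Y ω|) ^ (p - 2) ∂P := by
        have i1 : Integrable (fun ω => |X ω| ^ p + p * ((|X ω| ^ (p - 2) * X ω) * Y ω)) P :=
          (hX.integrable_rpow hp0).add (hcint.const_mul p)
        rw [integral_add i1 (hqint.const_mul _),
          integral_add (hX.integrable_rpow hp0) (hcint.const_mul p), integral_const_mul,
          integral_const_mul]
    _ ≤ _ := by
        rw [hcross, mul_zero, add_zero]
        exact add_le_add (hX.integral_rpow_le hp0)
          (mul_le_mul_of_nonneg_left hqle (by nlinarith))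

/-- Marcinkiewicz–Zygmund type inequality for centred, successively independent summands. -/
theorem sum_indep [IsProbabilityMeasure P] (hp : 2 ≤ p) (hb : 0 < b) {Z : ℕ → Ω → ℝ} (n : ℕ)
    (hZ : ∀ i < n, LB P p⁻¹ (Z i) b) (h0 : ∀ i < n, ∫ ω, Z i ω ∂P = 0)
    (hind : ∀ k < n, IndepFun (fun ω => ∑ i ∈ Finset.range k, Z i ω) (Z k) P) :
    LB P p⁻¹ (fun ω => ∑ i ∈ Finset.range n, Z i ω) (√(2 * (p - 1) * n) * b) := by
  have hp0 : 0 < p := by linarith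
  have hpi0 : 0 < p⁻¹ := by positivity
  have hpi1 : p⁻¹ ≤ 1 := inv_le_one_of_one_le₀ (by linarith)
  -- For few summands the triangle inequality suffices, because k ≤ √(2(p-1)k) whenever k ≤ 2(p-1).
  -- Beyond that range the Taylor step takes over.
  have htriv : ∀ k : ℕ, k ≤ n → (k : ℝ) ≤ 2 * (p - 1) →
      LB P p⁻¹ (fun ω => ∑ i ∈ Finset.range k, Z i ω) (√(2 * (p - 1) * k) * b) := by
    intro k hk hkp
    have := LB.sum (P := P) (Finset.range k) (Z := Z) (b := fun _ => b) hpi0 hpi1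
      (fun i hi => hZ i ((Finset.mem_range.1 hi).trans_le hk))
    refine this.mono_bound ?_
    simp only [Finset.sum_const, Finset.card_range, nsmul_eq_mul]
    refine mul_le_mul_of_nonneg_right (Real.le_sqrt_of_sq_le ?_) hb.le
    nlinarith [(Nat.cast_nonneg k : (0 : ℝ) ≤ k)]
  suffices H : ∀ k : ℕ, k ≤ n →
      LB P p⁻¹ (fun ω => ∑ i ∈ Finset.range k, Z i ω) (√(2 * (p - 1) * k) * b) from H n le_rfl
  intro k
  induction k with
  | zero => intro h; exact htriv 0 h (by simp; linarith)
  | succ k ih =>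
    intro hk
    by_cases hkp : ((k + 1 : ℕ) : ℝ) ≤ 2 * (p - 1)
    · exact htriv _ hk hkp
    push Not at hkp
    push_cast at hkp
    have hS := ih (by omega)
    have h1 := hS.add_indep hp (hZ k (by omega)) (hind k (by omega)) (h0 k (by omega))
    have hadd := hS.add' (hZ k (by omega))
    simp only [Finset.sum_range_succ]
    refine LB.of_integral_rpow_le (by linarith) (by positivity) hadd.meas
      (hadd.integrable_rpow hp0) (h1.trans ?_)
    exact rpow_step_le hp hb hkp

end LB

/-- The exponential weight compensates the factor `√m` in the recursion for the
multilevel Picard approximations. -/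
theorem LB.exp_weight {p a l : ℝ} (hp : 2 ≤ p) (ha : 0 < a) (hl0 : 0 ≤ l) (hl1 : l ≤ 1) {τ : Ω → ℝ}
    (hτ : Measurable τ) (hlaw : P.map τ = volume.restrict (Icc 0 1)) :
    LB P p⁻¹ (fun ω => √l * Real.exp (a * (l * (1 - τ ω)) / p))
      (a ^ (-p⁻¹) * Real.exp (a * l / p)) := by
  have hp0 : 0 < p := by linarith
  have hprob : IsProbabilityMeasure P := by
    constructor
    have := congrArg (fun μ => μ univ) hlaw
    simpa [Measure.map_apply hτ] using this
  have hpow : ∀ r : ℝ, |√l * Real.exp (a * (l * (1 - r)) / p)| ^ p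
      = √l ^ p * Real.exp (a * (l * (1 - r))) := by
    intro r
    rw [abs_of_nonneg (by positivity), Real.mul_rpow (by positivity) (by positivity),
      ← Real.exp_mul, div_mul_cancel₀ _ hp0.ne']
  have hcont : Continuous fun r : ℝ => √l ^ p * Real.exp (a * (l * (1 - r))) := by fun_prop
  refine LB.of_integral_rpow_le (by linarith) (by positivity)
    (Measurable.aestronglyMeasurable (by fun_prop)) ?_ ?_
  · simp only [hpow]
    refine (integrable_map_measure (f := τ) (g := fun r => √l ^ p * Real.exp (a * (l * (1 - r))))
      hcont.aestronglyMeasurable hτ.aemeasurable).1 ?_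
    rw [hlaw]
    exact hcont.continuousOn.integrableOn_Icc
  · simp only [hpow]
    rw [← integral_map hτ.aemeasurable (f := fun r => √l ^ p * Real.exp (a * (l * (1 - r))))
      hcont.aestronglyMeasurable, hlaw, integral_Icc_eq_integral_Ioc,
      ← intervalIntegral.integral_of_le zero_le_one, intervalIntegral.integral_const_mul]
    rw [Real.mul_rpow (by positivity) (by positivity), ← Real.rpow_mul ha.le, ← Real.exp_mul,
      div_mul_cancel₀ _ hp0.ne', neg_mul, inv_mul_cancel₀ hp0.ne', Real.rpow_neg_one]
    -- Uses p ≥ 2 and l ≤ 1. The factor l left over cancels the l in the denominator of ∫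
    -- exp(al(1-r)) dr = (e^{al} - 1)/(al).
    have hlp : √l ^ p ≤ l := by
      calc √l ^ p ≤ √l ^ (2 : ℝ) :=
            Real.rpow_le_rpow_of_exponent_ge' (by positivity) (Real.sqrt_le_one.2 hl1)
              (by norm_num) hp
        _ = l := by rw [Real.rpow_two, Real.sq_sqrt hl0]
    have hI : a * l * ∫ r in (0 : ℝ)..1, Real.exp (a * (l * (1 - r))) = Real.exp (a * l) - 1 := by
      rw [← intervalIntegral.integral_const_mul,
        intervalIntegral.integral_eq_sub_of_hasDerivAt
          (f := fun r => -Real.exp (a * (l * (1 - r))))]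
      · simp; ring
      · intro r _
        have d1 : HasDerivAt (fun r : ℝ => a * (l * (1 - r))) (-(a * l)) r := by
          simpa using ((((hasDerivAt_id r).const_sub 1).const_mul l).const_mul a)
        refine d1.exp.neg.congr_deriv (by ring)
      · exact Continuous.intervalIntegrable (by fun_prop) _ _
    have hI0 : 0 ≤ ∫ r in (0 : ℝ)..1, Real.exp (a * (l * (1 - r))) :=
      intervalIntegral.integral_nonneg zero_le_one fun r _ => (Real.exp_pos _).le
    rw [← div_eq_inv_mul, le_div_iff₀ ha]
    nlinarith [mul_le_mul_of_nonneg_right hlp hI0]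

end MarcinkiewiczZygmund

/-! ### Normalized form of the data, with distances in units of √T. -/

section Structures

variable {E : Type u} {Ω : Type v} [NormedAddCommGroup E] [MeasurableSpace E] [MeasurableSpace Ω]

/-- The norm of `E` rescaled by `√T`. -/
noncomputable def nd (T : ℝ) (x : E) : ℝ := ‖x‖ / √T

/-- The parabolic distance of two times rescaled by `√T`. -/
noncomputable def td (T t s : ℝ) : ℝ := √|t - s| / √T

/-- A random field of positions whose moments are controlled by `V`. -/
structure Proc (P : Measure Ω) (s₁ s₂ c T : ℝ) (V : ℝ → E → ℝ) (Z : ℝ → ℝ → E → Ω → E) :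
    Prop where
  meas : Measurable fun z : ℝ × ℝ × E × Ω => Z z.1 z.2.1 z.2.2.1 z.2.2.2
  V_le : ∀ s t, 0 ≤ s → s ≤ t → t ≤ T → ∀ x, LB P s₁ (fun ω => V t (Z s t x ω)) (V s x)
  two : ∀ s t s' t', 0 ≤ s → s ≤ t → t ≤ T → s ≤ s' → s' ≤ t' → t' ≤ T → ∀ x x',
    LB P s₂ (fun ω => nd T (Z s t x ω - Z s' t' x' ω))
      ((V s x + V s' x') / 2 * ((td T s s' + td T t t') / 2) + Real.exp (c * T) * nd T (x - x'))

/-- Two random fields of positions which are close to each other, also after taking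
increments. -/
structure Close (P : Measure Ω) (s₂ T : ℝ) (V : ℝ → E → ℝ) (Z Z' : ℝ → ℝ → E → Ω → E) (δ : ℝ) :
    Prop where
  four : ∀ s t s' t', 0 ≤ s → s ≤ t → t ≤ T → s ≤ s' → s' ≤ t' → t' ≤ T → ∀ x x',
    LB P s₂ (fun ω => nd T ((Z s t x ω - Z' s t x ω) - (Z s' t' x' ω - Z' s' t' x' ω)))
      ((V s x + V s' x') / 2 * ((td T s s' + td T t t') / 2 + nd T (x - x')) * δ)
  two : ∀ s t, 0 ≤ s → s ≤ t → t ≤ T → ∀ x,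
    LB P s₂ (fun ω => nd T (Z s t x ω - Z' s t x ω)) (V s x / 2 * δ)

/-- The data of the stochastic fixed-point equation, in normalized form. -/
structure Flow (P : Measure Ω) (s₁ s₂ c T : ℝ) (f : ℝ → ℝ) (g : E → ℝ) (V : ℝ → E → ℝ)
    (X : ℝ → ℝ → E → Ω → E) : Prop where
  s₁_pos : 0 < s₁
  s₂_pos : 0 < s₂
  exponents : 10 * s₁ + 2 * s₂ ≤ 1 / 2
  c_pos : 0 < c
  T_pos : 0 < T
  g_meas : Measurable g
  V_meas : Measurable fun z : ℝ × E => V z.1 z.2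
  exp_le_V : ∀ t x, Real.exp (c * T) ≤ V t x
  f_lip : ∀ v w, |f v - f w| ≤ c * |v - w|
  f_diff : ∀ v w v' w' : ℝ,
    |(f v - f w) - (f v' - f w')| ≤ c * |(v - w) - (v' - w')|
      + c * (|v - w| + |v' - w'|) * |v - v'| / 2
  f_zero : ∀ s x, T * |f 0| ≤ V s x
  g_le : ∀ x, |g x| ≤ V T x
  g_lip : ∀ x y, |g x - g y| ≤ (V T x + V T y) / 2 * nd T (x - y)
  g_diff : ∀ x y x' y' : E,
    |(g x - g y) - (g x' - g y')| ≤ (V T x + V T y + V T x' + V T y') / 4 *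
      (nd T ((x - y) - (x' - y')) + (nd T (x - y) + nd T (x' - y')) * nd T (x - x') / 2)
  proc : Proc P s₁ s₂ c T V X
  start : ∀ s ∈ Icc 0 T, ∀ x, ∀ᵐ ω ∂P, X s s x ω = x
  flow : ∀ s t r, 0 ≤ s → s ≤ t → t ≤ r → r ≤ T → ∀ x,
    ∀ᵐ ω ∂P, X t r (X s t x ω) ω = X s r x ω
  indep : ∀ t ∈ Icc 0 T, ∃ (Ξ : Type v) (_ : MeasurableSpace Ξ) (W : Ω → Ξ)
    (F : ℝ → E → Ξ → E), Measurable W ∧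
    (Measurable fun z : ℝ × E × Ξ => F z.1 z.2.1 z.2.2) ∧
    (∀ r x ω, X t r x ω = F r x (W ω)) ∧
    ∀ s, 0 ≤ s → s ≤ t → IndepFun (fun ω (x : E) => X s t x ω) W P
  X_diff : ∀ s t, 0 ≤ s → s ≤ t → t ≤ T → ∀ x y x' y',
    LB P s₂ (fun ω => nd T ((X s t x ω - X s t y ω) - (X s t x' ω - X s t y' ω)))
      ((V s x + V s y + V s x' + V s y') / 4 * (nd T ((x - y) - (x' - y'))
        + (nd T (x - y) + nd T (x' - y')) * nd T (x - x') / 2))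
  X_incr : ∀ s t, 0 ≤ s → s ≤ t → t ≤ T → ∀ x y,
    LB P s₂ (fun ω => nd T ((X s t x ω - X s t y ω) - (x - y)))
      ((V s x + V s y) / 2 * nd T (x - y) * td T t s)

theorem nd_nonneg (T : ℝ) (x : E) : 0 ≤ nd T x := by unfold nd; positivity
theorem td_nonneg (T t s : ℝ) : 0 ≤ td T t s := by unfold td; positivity
theorem nd_zero (T : ℝ) : nd T (0 : E) = 0 := by simp [nd]
theorem td_self (T t : ℝ) : td T t t = 0 := by simp [td]
theorem td_comm (T t s : ℝ) : td T t s = td T s t := by simp [td, abs_sub_comm]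
theorem nd_add_le (T : ℝ) (x y : E) : nd T (x + y) ≤ nd T x + nd T y := by
  unfold nd; rw [← add_div]; gcongr; exact norm_add_le x y
theorem nd_sub_comm (T : ℝ) (x y : E) : nd T (x - y) = nd T (y - x) := by
  simp [nd, norm_sub_rev]
theorem nd_sub_le (T : ℝ) (x y : E) : nd T (x - y) ≤ nd T x + nd T y := by
  unfold nd; rw [← add_div]; gcongr; exact norm_sub_le x y
theorem td_le_one {T t s : ℝ} (hT : 0 < T) (ht : t ∈ Icc 0 T) (hs : s ∈ Icc 0 T) :
    td T t s ≤ 1 := by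
  unfold td
  rw [div_le_one (by positivity)]
  refine Real.sqrt_le_sqrt (abs_le.2 ⟨by linarith [ht.1, hs.2], by linarith [ht.2, hs.1]⟩)
theorem td_sq {T : ℝ} (hT : 0 < T) (t s : ℝ) : td T t s ^ 2 = |t - s| / T := by
  unfold td; rw [div_pow, Real.sq_sqrt (abs_nonneg _), Real.sq_sqrt hT.le]
theorem measurable_nd [BorelSpace E] (T : ℝ) : Measurable (nd T : E → ℝ) := by
  unfold nd; fun_prop
theorem td_mono {T a b a' b' : ℝ} (h : |a - b| ≤ |a' - b'|) : td T a b ≤ td T a' b' := by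
  unfold td; gcongr

end Structures

/-! ### Extension of the random fields to all real times. -/

section Clamp

variable {E Ω : Type*}

/-- Projection of a time to `[0, T]`. -/
def clampTime (T t : ℝ) : ℝ := max 0 (min t T)

/-- Extension of a two-parameter field from `0 ≤ s ≤ t ≤ T` to all real times. -/
def clampField (T : ℝ) (X : ℝ → ℝ → E → Ω → E) (s t : ℝ) : E → Ω → E :=
  X (clampTime T s) (max (clampTime T s) (clampTime T t))

theorem clampTime_mem {T : ℝ} (hT : 0 ≤ T) (t : ℝ) : clampTime T t ∈ Icc 0 T :=
  ⟨le_max_left _ _, max_le hT (min_le_right _ _)⟩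

theorem clampTime_of_mem {T t : ℝ} (ht : t ∈ Icc 0 T) : clampTime T t = t := by
  simp [clampTime, ht.1, ht.2]

theorem measurable_clampTime (T : ℝ) : Measurable (clampTime T) := by unfold clampTime; fun_prop

theorem clampField_of_le {T s t : ℝ} (X : ℝ → ℝ → E → Ω → E) (h0 : 0 ≤ s) (hst : s ≤ t)
    (ht : t ≤ T) : clampField T X s t = X s t := by
  rw [clampField, clampTime_of_mem ⟨h0, hst.trans ht⟩, clampTime_of_mem ⟨h0.trans hst, ht⟩,
    max_eq_right hst]

theorem measurable_clampField [MeasurableSpace E] {m : MeasurableSpace Ω} {T : ℝ} (hT : 0 ≤ T)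
    {X : ℝ → ℝ → E → Ω → E}
    (h : JointlyMeasurable m (fun (q : TimePair T) x ω => X q.1.1 q.1.2 x ω)) :
    Measurable fun z : ℝ × ℝ × E × Ω => clampField T X z.1 z.2.1 z.2.2.1 z.2.2.2 := by
  have h1 : Measurable fun z : ℝ × ℝ × E × Ω =>
      ((⟨(clampTime T z.1, max (clampTime T z.1) (clampTime T z.2.1)),
        (clampTime_mem hT _).1, le_max_left _ _, max_le (clampTime_mem hT _).2
          (clampTime_mem hT _).2⟩, z.2.2.1, z.2.2.2) : TimePair T × E × Ω) := by
    have := measurable_clampTime T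
    refine Measurable.prodMk (Measurable.subtype_mk (by fun_prop)) (by fun_prop)
  exact Measurable.comp (g := fun z : TimePair T × E × Ω => X z.1.1.1 z.1.1.2 z.2.1 z.2.2) h h1

theorem measurable_clampField_left [MeasurableSpace E] {m : MeasurableSpace Ω} {T t : ℝ}
    (ht : t ∈ Icc 0 T) {X : ℝ → ℝ → E → Ω → E}
    (h : JointlyMeasurable m (fun (r : Icc t T) x ω => X t r x ω)) :
    Measurable fun z : ℝ × E × Ω => clampField T X t z.1 z.2.1 z.2.2 := by
  have hT : 0 ≤ T := ht.1.trans ht.2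
  have h1 : Measurable fun z : ℝ × E × Ω =>
      ((⟨max t (clampTime T z.1), le_max_left _ _, max_le ht.2 (clampTime_mem hT _).2⟩,
        z.2.1, z.2.2) : Icc t T × E × Ω) := by
    have := measurable_clampTime T
    refine Measurable.prodMk (Measurable.subtype_mk (by fun_prop)) (by fun_prop)
  have h2 := Measurable.comp (g := fun z : Icc t T × E × Ω => X t z.1 z.2.1 z.2.2) h h1
  have e : ∀ r, clampField T X t r = X t (max t (clampTime T r)) := fun r => by
    rw [clampField, clampTime_of_mem ht]
  simp only [e]
  exact h2

end Clamp

/-! ### Moment bounds for the approximating paths and for the forward process. -/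

section Normalize

variable {E : Type u} {Ω : Type v} [NormedAddCommGroup E] [MeasurableSpace E] [BorelSpace E]
  [SecondCountableTopology E] [MeasurableSpace Ω] {P : Measure Ω} [IsProbabilityMeasure P]

theorem LB.of_rNorm {p B T : ℝ} (hp : 1 ≤ p) {Z : Ω → E} (hZ : Measurable Z)
    (hB : 0 ≤ B) (h : rNorm P p Z ≤ ENNReal.ofReal B) :
    LB P p⁻¹ (fun ω => nd T (Z ω)) (B / √T) := by
  have h1 : LB P p⁻¹ (fun ω => ‖Z ω‖) B :=
    ⟨by positivity, inv_le_one_of_one_le₀ hp, hZ.norm.aestronglyMeasurable, hB, by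
      rw [inv_inv, eLpNorm_norm]; exact h⟩
  have h2 := h1.const_mul (a := (√T)⁻¹) (by positivity)
  simpa [nd, div_eq_inv_mul] using h2

theorem LB.of_identDistrib {s b : ℝ} {Z Z' : Ω → ℝ} (h : LB P s Z' b)
    (hid : IdentDistrib Z Z' P P) : LB P s Z b :=
  ⟨h.pos, h.le_one, hid.aemeasurable_fst.aestronglyMeasurable, h.nonneg, by
    rw [hid.eLpNorm_eq]; exact h.norm_le⟩

theorem eLpNorm_le_of_ae_tendsto {p : ℝ≥0∞} {Z : ℕ → Ω → ℝ} {Z' : Ω → ℝ} {b : ℝ≥0∞}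
    (hm : ∀ n, AEStronglyMeasurable (Z n) P) (hb : ∀ n, eLpNorm (Z n) p P ≤ b)
    (hlim : ∀ᵐ ω ∂P, Filter.Tendsto (fun n => Z n ω) Filter.atTop (nhds (Z' ω))) :
    eLpNorm Z' p P ≤ b := by
  refine (Lp.eLpNorm_lim_le_liminf_eLpNorm hm Z' hlim).trans ?_
  refine Filter.liminf_le_of_le (by isBoundedDefault) fun c hc => ?_
  obtain ⟨n, hn⟩ := hc.exists
  exact hn.trans (hb n)

variable {p₁ p₂ c T : ℝ} {f : ℝ → ℝ} {g : E → ℝ} {V : ℝ → E → ℝ} {X : ℝ → ℝ → E → Ω → E}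
  {τ : Idx → Ω → ℝ} {Y : ℕ → Idx → ℝ → ℝ → E → Ω → E}

section

variable (hX : ForwardSetting P p₁ p₂ c T f g V X) (hY : ApproxSetting P p₁ p₂ c T V X τ Y)
include hX

theorem ForwardSetting.measurable_clamp : Measurable fun z : ℝ × ℝ × E × Ω =>
    clampField T X z.1 z.2.1 z.2.2.1 z.2.2.2 := measurable_clampField hX.T_pos.le hX.X_meas

theorem ForwardSetting.measurable_X {s t : ℝ} (h0 : 0 ≤ s) (hst : s ≤ t) (ht : t ≤ T) (x : E) :
    Measurable (X s t x) := by
  rw [← clampField_of_le X h0 hst ht]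
  exact hX.measurable_clamp.comp (g := fun z : ℝ × ℝ × E × Ω =>
    clampField T X z.1 z.2.1 z.2.2.1 z.2.2.2) (f := fun ω => (s, t, x, ω)) (by fun_prop)

theorem ForwardSetting.V_nonneg {t : ℝ} (ht : t ∈ Icc 0 T) (x : E) : 0 ≤ V t x :=
  zero_le_one.trans (hX.one_le_V t ht x)

theorem ForwardSetting.continuous_V {t : ℝ} (ht : t ∈ Icc 0 T) : Continuous (V t) := by
  have := hX.V_cont.comp_continuous (f := fun x : E => (t, x)) (by fun_prop) (by simp [ht.1, ht.2])
  exact this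

include hY

theorem ApproxSetting.measurable_clamp {n : ℕ} (hn : 1 ≤ n) (θ : Idx) :
    Measurable fun z : ℝ × ℝ × E × Ω => clampField T (Y n θ) z.1 z.2.1 z.2.2.1 z.2.2.2 :=
  measurable_clampField hX.T_pos.le (hY.Y_meas n hn θ)

theorem ApproxSetting.measurable_Y {n : ℕ} (hn : 1 ≤ n) (θ : Idx) {s t : ℝ} (h0 : 0 ≤ s)
    (hst : s ≤ t) (ht : t ≤ T) (x : E) : Measurable (Y n θ s t x) := by
  rw [← clampField_of_le (Y n θ) h0 hst ht]
  exact (hY.measurable_clamp hX hn θ).comp (g := fun z : ℝ × ℝ × E × Ω =>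
    clampField T (Y n θ) z.1 z.2.1 z.2.2.1 z.2.2.2) (f := fun ω => (s, t, x, ω)) (by fun_prop)

/-- The moment hypotheses are given for the index 0 only. Each involves finitely many coordinates of
the field, so equality of laws carries it to every index. -/
theorem ApproxSetting.identDistrib (θ : Idx) {ι : Type*} [Countable ι]
    {q : ι → ℕ × ℝ × ℝ × E} (hq : ∀ i, 1 ≤ (q i).1 ∧ 0 ≤ (q i).2.1 ∧ (q i).2.1 ≤ (q i).2.2.1 ∧
      (q i).2.2.1 ≤ T) {R : Type*} [MeasurableSpace R] {Ψ : (ι → E) → R} (hΨ : Measurable Ψ) :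
    IdentDistrib (fun ω => Ψ fun i => Y (q i).1 θ (q i).2.1 (q i).2.2.1 (q i).2.2.2 ω)
      (fun ω => Ψ fun i => Y (q i).1 Idx.zero (q i).2.1 (q i).2.2.1 (q i).2.2.2 ω) P P := by
  have hm : Measurable fun φ : ℕ+ × TimePair T × E → E =>
      Ψ fun i => φ (⟨(q i).1, (hq i).1⟩, ⟨((q i).2.1, (q i).2.2.1), (hq i).2⟩, (q i).2.2.2) :=
    hΨ.comp (measurable_pi_lambda _ fun i => measurable_pi_apply _)
  exact (hY.Y_ident θ).comp hm

theorem ApproxSetting.V_le_zero {n : ℕ} (hn : 1 ≤ n) (s t : ℝ) (h0 : 0 ≤ s) (hst : s ≤ t)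
    (ht : t ≤ T) (x : E) : LB P p₁⁻¹ (fun ω => V t (Y n Idx.zero s t x ω)) (V s x) := by
  have hp := hX.one_le_p₁
  refine ⟨by positivity, inv_le_one_of_one_le₀ hp, ?_, hX.V_nonneg ⟨h0, hst.trans ht⟩ x, ?_⟩
  · exact ((hX.continuous_V ⟨h0.trans hst, ht⟩).measurable.comp
      (hY.measurable_Y hX hn _ h0 hst ht x)).aestronglyMeasurable
  · rw [inv_inv]; exact hY.V_Y_le n hn s t h0 hst ht x

theorem ApproxSetting.two_zero {n : ℕ} (hn : 1 ≤ n) (s t s' t' : ℝ) (h0 : 0 ≤ s) (hst : s ≤ t)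
    (ht : t ≤ T) (hss : s ≤ s') (hst' : s' ≤ t') (ht' : t' ≤ T) (x x' : E) :
    LB P p₂⁻¹ (fun ω => nd T (Y n Idx.zero s t x ω - Y n Idx.zero s' t' x' ω))
      ((V s x + V s' x') / 2 * ((td T s s' + td T t t') / 2) + Real.exp (c * T) * nd T (x - x')) := by
  have v1 := hX.V_nonneg ⟨h0, hst.trans ht⟩ x
  have v2 := hX.V_nonneg ⟨h0.trans hss, hst'.trans ht'⟩ x'
  have := LB.of_rNorm (T := T) hX.one_le_p₂ ((hY.measurable_Y hX hn _ h0 hst ht x).sub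
    (hY.measurable_Y hX hn _ (h0.trans hss) hst' ht' x')) (by positivity)
    (hY.Y_diff n hn s t s' t' h0 hst ht hss hst' ht' x x')
  refine this.mono_bound (le_of_eq ?_)
  unfold td nd; ring

theorem ApproxSetting.close_X {n : ℕ} (hn : 1 ≤ n) :
    Close P p₂⁻¹ T V (Y n Idx.zero) X (1 / √(n : ℝ)) := by
  have h4 : ∀ s t s' t', 0 ≤ s → s ≤ t → t ≤ T → s ≤ s' → s' ≤ t' → t' ≤ T → ∀ x x',
    LB P p₂⁻¹ (fun ω => nd T ((Y n Idx.zero s t x ω - X s t x ω)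
      - (Y n Idx.zero s' t' x' ω - X s' t' x' ω)))
      ((V s x + V s' x') / 2 * ((td T s s' + td T t t') / 2 + nd T (x - x')) * (1 / √(n : ℝ))) := by
    intro s t s' t' h0 hst ht hss hst' ht' x x'
    have v1 := hX.V_nonneg ⟨h0, hst.trans ht⟩ x
    have v2 := hX.V_nonneg ⟨h0.trans hss, hst'.trans ht'⟩ x'
    have := LB.of_rNorm (T := T) hX.one_le_p₂ (((hY.measurable_Y hX hn _ h0 hst ht x).sub
      (hX.measurable_X h0 hst ht x)).sub ((hY.measurable_Y hX hn _ (h0.trans hss) hst' ht' x').sub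
      (hX.measurable_X (h0.trans hss) hst' ht' x'))) (by positivity)
      (hY.YX_diff n hn s t s' t' h0 hst ht hss hst' ht' x x')
    refine this.mono_bound (le_of_eq ?_)
    unfold td nd; ring
  refine ⟨h4, fun s t h0 hst ht x => ?_⟩
  have hs : s ∈ Icc 0 T := ⟨h0, hst.trans ht⟩
  have v1 := hX.V_nonneg hs x
  -- With s' = t' = s both processes sit at x at the second time, so the four-point bound reduces to
  -- the distance of the two paths at time t.
  have h1 := h4 s t s s h0 hst ht le_rfl le_rfl (hst.trans ht) x x
  refine (h1.congr ?_).mono_bound ?_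
  · filter_upwards [hY.X_start s hs x, hY.Y_start n hn s hs x] with ω h2 h3
    simp [h2, h3]
  · have := td_le_one hX.T_pos ⟨h0.trans hst, ht⟩ hs
    rw [td_self, sub_self, nd_zero]
    have h3 : V s x * (td T t s) * (1 / √(n : ℝ)) ≤ V s x * 1 * (1 / √(n : ℝ)) := by gcongr
    linarith

theorem ApproxSetting.close_zero {n k : ℕ} (hn : 1 ≤ n) (hk : 1 ≤ k) :
    Close P p₂⁻¹ T V (Y n Idx.zero) (Y k Idx.zero) (1 / √(n : ℝ) + 1 / √(k : ℝ)) := by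
  have hN := hY.close_X hX hn
  have hK := hY.close_X hX hk
  refine ⟨fun s t s' t' h0 hst ht hss hst' ht' x x' => ?_, fun s t h0 hst ht x => ?_⟩
  · have h1 := (hN.four s t s' t' h0 hst ht hss hst' ht' x x').add'
      (hK.four s t s' t' h0 hst ht hss hst' ht' x x')
    refine (h1.of_le ?_ (Filter.Eventually.of_forall fun ω => ?_)).mono_bound (le_of_eq (by ring))
    · exact ((measurable_nd T).comp (((hY.measurable_Y hX hn _ h0 hst ht x).sub
        (hY.measurable_Y hX hk _ h0 hst ht x)).sub
        ((hY.measurable_Y hX hn _ (h0.trans hss) hst' ht' x').sub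
        (hY.measurable_Y hX hk _ (h0.trans hss) hst' ht' x')))).aestronglyMeasurable
    · rw [abs_of_nonneg (nd_nonneg _ _)]
      refine le_trans (le_of_eq ?_) (nd_sub_le T _ _)
      congr 1; abel
  · have h1 := (hN.two s t h0 hst ht x).add' (hK.two s t h0 hst ht x)
    refine (h1.of_le ?_ (Filter.Eventually.of_forall fun ω => ?_)).mono_bound (le_of_eq (by ring))
    · exact ((measurable_nd T).comp ((hY.measurable_Y hX hn _ h0 hst ht x).sub
        (hY.measurable_Y hX hk _ h0 hst ht x))).aestronglyMeasurable
    · rw [abs_of_nonneg (nd_nonneg _ _)]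
      refine le_trans (le_of_eq ?_) (nd_sub_le T _ _)
      congr 1; abel

theorem tendsto_const_div_sqrt (a : ℝ) :
    Filter.Tendsto (fun n : ℕ => a * (1 / √((n + 1 : ℕ) : ℝ))) Filter.atTop (nhds 0) := by
  have h1 : Filter.Tendsto (fun n : ℕ => √((n + 1 : ℕ) : ℝ)) Filter.atTop Filter.atTop :=
    Real.tendsto_sqrt_atTop.comp (tendsto_natCast_atTop_atTop.comp (Filter.tendsto_add_atTop_nat 1))
  simpa using (h1.inv_tendsto_atTop).const_mul a

/-- The Lyapunov bound is assumed for the approximating paths only. These converge to X in L^{p₂},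
hence almost surely along a subsequence; continuity of V and Fatou's lemma transfer the bound. -/
theorem ApproxSetting.V_le_X (s t : ℝ) (h0 : 0 ≤ s) (hst : s ≤ t)
    (ht : t ≤ T) (x : E) : LB P p₁⁻¹ (fun ω => V t (X s t x ω)) (V s x) := by
  have hp := hX.one_le_p₁
  have hVc := hX.continuous_V ⟨h0.trans hst, ht⟩
  refine ⟨by positivity, inv_le_one_of_one_le₀ hp, ?_, hX.V_nonneg ⟨h0, hst.trans ht⟩ x, ?_⟩
  · exact (hVc.measurable.comp (hX.measurable_X h0 hst ht x)).aestronglyMeasurable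
  rw [inv_inv]
  let D : ℕ → Ω → ℝ := fun n ω => nd T (Y (n + 1) Idx.zero s t x ω - X s t x ω)
  have hD : ∀ n, LB P p₂⁻¹ (D n) (V s x / 2 * (1 / √((n + 1 : ℕ) : ℝ))) := fun n =>
    (hY.close_X hX (Nat.le_add_left 1 n)).two s t h0 hst ht x
  have hlim : Filter.Tendsto (fun n => eLpNorm (D n - 0) (ENNReal.ofReal (p₂⁻¹)⁻¹) P) Filter.atTop
      (nhds 0) := by
    have h1 := (ENNReal.continuous_ofReal.tendsto _).comp
      (tendsto_const_div_sqrt hX hY (V s x / 2))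
    rw [ENNReal.ofReal_zero] at h1
    refine tendsto_of_tendsto_of_tendsto_of_le_of_le tendsto_const_nhds h1 (fun n => zero_le)
      fun n => ?_
    simp only [sub_zero]
    exact (hD n).norm_le
  have hne : ENNReal.ofReal (p₂⁻¹)⁻¹ ≠ 0 := by
    have := hX.one_le_p₂
    rw [inv_inv]; simp; linarith
  have hmeas := tendstoInMeasure_of_tendsto_eLpNorm hne (fun n => (hD n).meas)
    (aestronglyMeasurable_const (b := (0 : ℝ))) hlim
  obtain ⟨ns, -, hns⟩ := hmeas.exists_seq_tendsto_ae
  refine eLpNorm_le_of_ae_tendsto (Z := fun i ω => V t (Y (ns i + 1) Idx.zero s t x ω)) (fun i => ?_)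
    (fun i => hY.V_Y_le _ (Nat.le_add_left 1 _) s t h0 hst ht x) ?_
  · exact (hVc.measurable.comp
      (hY.measurable_Y hX (Nat.le_add_left 1 _) _ h0 hst ht x)).aestronglyMeasurable
  · filter_upwards [hns] with ω hω
    refine (hVc.tendsto _).comp ?_
    rw [tendsto_iff_norm_sub_tendsto_zero]
    have h2 := hω.mul_const (√T)
    have h3 : √T ≠ 0 := (Real.sqrt_pos.2 hX.T_pos).ne'
    simpa [D, nd, h3] using h2

/-- The same passage to the limit, by the triangle inequality with an error proportional to 1/√n. -/
theorem ApproxSetting.two_X (s t s' t' : ℝ) (h0 : 0 ≤ s) (hst : s ≤ t)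
    (ht : t ≤ T) (hss : s ≤ s') (hst' : s' ≤ t') (ht' : t' ≤ T) (x x' : E) :
    LB P p₂⁻¹ (fun ω => nd T (X s t x ω - X s' t' x' ω))
      ((V s x + V s' x') / 2 * ((td T s s' + td T t t') / 2) + Real.exp (c * T) * nd T (x - x')) := by
  refine LB.of_tendsto (tendsto_const_div_sqrt hX hY
    ((V s x + V s' x') / 2 * ((td T s s' + td T t t') / 2 + nd T (x - x')))) fun n => ?_
  have hn : 1 ≤ n + 1 := Nat.le_add_left 1 n
  refine ((hY.two_zero hX hn s t s' t' h0 hst ht hss hst' ht' x x').add'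
    ((hY.close_X hX hn).four s t s' t' h0 hst ht hss hst' ht' x x')).of_le ?_
    (Filter.Eventually.of_forall fun ω => ?_)
  · exact ((measurable_nd T).comp ((hX.measurable_X h0 hst ht x).sub
      (hX.measurable_X (h0.trans hss) hst' ht' x'))).aestronglyMeasurable
  · rw [abs_of_nonneg (nd_nonneg _ _)]
    refine le_trans (le_of_eq ?_) (nd_sub_le T _ _)
    congr 1; abel

/-- At s = t the approximating path is still at x, so the lower moment bound becomes pointwise. It
is what later permits powers of e^{cT} to be traded for powers of V. -/
theorem ApproxSetting.exp_le_V {t : ℝ} (ht : t ∈ Icc 0 T) (x : E) :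
    Real.exp (c * T) ≤ V t x := by
  have hp := hX.one_le_p₁
  have h1 := hY.le_V_Y 1 le_rfl t t ht.1 le_rfl ht.2 x
  have h2 : (fun ω => V t (Y 1 Idx.zero t t x ω)) =ᵐ[P] fun _ => V t x := by
    filter_upwards [hY.Y_start 1 le_rfl t ht x] with ω h
    rw [h]
  rw [rNorm, eLpNorm_congr_ae h2, eLpNorm_const _ (by simp; linarith)
    (IsProbabilityMeasure.ne_zero P)] at h1
  simp only [measure_univ, ENNReal.one_rpow, mul_one] at h1
  rwa [Real.enorm_eq_ofReal (hX.V_nonneg ht x),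
    ENNReal.ofReal_le_ofReal_iff (hX.V_nonneg ht x)] at h1

end

end Normalize

/-! ### Verification of the normalized hypotheses. -/

section Clamped

variable {E : Type u} {Ω : Type v} [NormedAddCommGroup E] [MeasurableSpace E] [BorelSpace E]
  [SecondCountableTopology E] [MeasurableSpace Ω] {P : Measure Ω} [IsProbabilityMeasure P]
  {p₁ p₂ c T : ℝ} {f : ℝ → ℝ} {g : E → ℝ} {V : ℝ → E → ℝ} {X : ℝ → ℝ → E → Ω → E}
  {τ : Idx → Ω → ℝ} {Y : ℕ → Idx → ℝ → ℝ → E → Ω → E}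

theorem Close.clamp {s₂ δ : ℝ} {Z Z' : ℝ → ℝ → E → Ω → E} (h : Close P s₂ T V Z Z' δ) :
    Close P s₂ T (fun t => V (clampTime T t)) (clampField T Z) (clampField T Z') δ := by
  refine ⟨fun s t s' t' h0 hst ht hss hst' ht' x x' => ?_, fun s t h0 hst ht x => ?_⟩
  · rw [clampField_of_le _ h0 hst ht, clampField_of_le _ h0 hst ht,
      clampField_of_le _ (h0.trans hss) hst' ht', clampField_of_le _ (h0.trans hss) hst' ht',
      clampTime_of_mem ⟨h0, hst.trans ht⟩, clampTime_of_mem ⟨h0.trans hss, hst'.trans ht'⟩]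
    exact h.four s t s' t' h0 hst ht hss hst' ht' x x'
  · rw [clampField_of_le _ h0 hst ht, clampField_of_le _ h0 hst ht,
      clampTime_of_mem ⟨h0, hst.trans ht⟩]
    exact h.two s t h0 hst ht x

theorem Proc.of_clamp {s₁ s₂ : ℝ} {Z : ℝ → ℝ → E → Ω → E}
    (meas : Measurable fun z : ℝ × ℝ × E × Ω => clampField T Z z.1 z.2.1 z.2.2.1 z.2.2.2)
    (V_le : ∀ s t, 0 ≤ s → s ≤ t → t ≤ T → ∀ x, LB P s₁ (fun ω => V t (Z s t x ω)) (V s x))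
    (two : ∀ s t s' t', 0 ≤ s → s ≤ t → t ≤ T → s ≤ s' → s' ≤ t' → t' ≤ T → ∀ x x',
      LB P s₂ (fun ω => nd T (Z s t x ω - Z s' t' x' ω))
      ((V s x + V s' x') / 2 * ((td T s s' + td T t t') / 2) + Real.exp (c * T) * nd T (x - x'))) :
    Proc P s₁ s₂ c T (fun t => V (clampTime T t)) (clampField T Z) := by
  refine ⟨meas, fun s t h0 hst ht x => ?_, fun s t s' t' h0 hst ht hss hst' ht' x x' => ?_⟩
  · rw [clampField_of_le _ h0 hst ht, clampTime_of_mem ⟨h0, hst.trans ht⟩,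
      clampTime_of_mem ⟨h0.trans hst, ht⟩]
    exact V_le s t h0 hst ht x
  · rw [clampField_of_le _ h0 hst ht, clampField_of_le _ (h0.trans hss) hst' ht',
      clampTime_of_mem ⟨h0, hst.trans ht⟩, clampTime_of_mem ⟨h0.trans hss, hst'.trans ht'⟩]
    exact two s t s' t' h0 hst ht hss hst' ht' x x'

variable (hX : ForwardSetting P p₁ p₂ c T f g V X) (hY : ApproxSetting P p₁ p₂ c T V X τ Y)
include hX hY

theorem ApproxSetting.proc_X :
    Proc P p₁⁻¹ p₂⁻¹ c T (fun t => V (clampTime T t)) (clampField T X) :=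
  Proc.of_clamp hX.measurable_clamp (hY.V_le_X hX) (hY.two_X hX)

theorem ApproxSetting.proc_Y {n : ℕ} (hn : 1 ≤ n) (θ : Idx) :
    Proc P p₁⁻¹ p₂⁻¹ c T (fun t => V (clampTime T t)) (clampField T (Y n θ)) := by
  refine Proc.of_clamp (hY.measurable_clamp hX hn θ) (fun s t h0 hst ht x => ?_)
    fun s t s' t' h0 hst ht hss hst' ht' x x' => ?_
  · exact (hY.V_le_zero hX hn s t h0 hst ht x).of_identDistrib
      (hY.identDistrib hX θ (ι := Fin 1) (q := fun _ => (n, s, t, x)) (fun _ => ⟨hn, h0, hst, ht⟩)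
      (Ψ := fun y => V t (y 0))
      ((hX.continuous_V ⟨h0.trans hst, ht⟩).measurable.comp (measurable_pi_apply 0)))
  · refine (hY.two_zero hX hn s t s' t' h0 hst ht hss hst' ht' x x').of_identDistrib
      (hY.identDistrib hX θ (ι := Fin 2) (q := ![(n, s, t, x), (n, s', t', x')]) (fun i => ?_)
      (Ψ := fun y => nd T (y 0 - y 1))
      ((measurable_nd T).comp ((measurable_pi_apply 0).sub (measurable_pi_apply 1))))
    fin_cases i
    · exact ⟨hn, h0, hst, ht⟩
    · exact ⟨hn, h0.trans hss, hst', ht'⟩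

theorem ApproxSetting.close_Y {n k : ℕ} (hn : 1 ≤ n) (hk : 1 ≤ k) (θ : Idx) :
    Close P p₂⁻¹ T (fun t => V (clampTime T t)) (clampField T (Y n θ)) (clampField T (Y k θ))
      (1 / √(n : ℝ) + 1 / √(k : ℝ)) := by
  have h := hY.close_zero hX hn hk
  refine Close.clamp ⟨fun s t s' t' h0 hst ht hss hst' ht' x x' => ?_, fun s t h0 hst ht x => ?_⟩
  · refine (h.four s t s' t' h0 hst ht hss hst' ht' x x').of_identDistrib
      (hY.identDistrib hX θ (ι := Fin 4)
      (q := ![(n, s, t, x), (k, s, t, x), (n, s', t', x'), (k, s', t', x')]) (fun i => ?_)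
      (Ψ := fun y => nd T ((y 0 - y 1) - (y 2 - y 3)))
      ((measurable_nd T).comp (((measurable_pi_apply 0).sub (measurable_pi_apply 1)).sub
        ((measurable_pi_apply 2).sub (measurable_pi_apply 3)))))
    fin_cases i
    · exact ⟨hn, h0, hst, ht⟩
    · exact ⟨hk, h0, hst, ht⟩
    · exact ⟨hn, h0.trans hss, hst', ht'⟩
    · exact ⟨hk, h0.trans hss, hst', ht'⟩
  · refine (h.two s t h0 hst ht x).of_identDistrib
      (hY.identDistrib hX θ (ι := Fin 2)
      (q := ![(n, s, t, x), (k, s, t, x)]) (fun i => ?_)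
      (Ψ := fun y => nd T (y 0 - y 1))
      ((measurable_nd T).comp ((measurable_pi_apply 0).sub (measurable_pi_apply 1))))
    fin_cases i
    · exact ⟨hn, h0, hst, ht⟩
    · exact ⟨hk, h0, hst, ht⟩

theorem ApproxSetting.flow (he : 10 * p₁⁻¹ + 2 * p₂⁻¹ ≤ 1 / 2) :
    Flow P p₁⁻¹ p₂⁻¹ c T f g (fun t => V (clampTime T t)) (clampField T X) := by
  have hp₁ := hX.one_le_p₁
  have hp₂ := hX.one_le_p₂
  have hT := hX.T_pos
  have hTT : T ∈ Icc 0 T := ⟨hT.le, le_rfl⟩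
  have hclT : clampTime T T = T := clampTime_of_mem hTT
  have e2 : ∀ a b : ℝ, a * b / (2 * T) = a / √T * (b / √T) / 2 := fun a b => by
    rw [div_mul_div_comm, Real.mul_self_sqrt hT.le]; ring
  have hg : ∀ x y x' y' : E,
    |(g x - g y) - (g x' - g y')| ≤ (V T x + V T y + V T x' + V T y') / 4 *
      (nd T ((x - y) - (x' - y')) + (nd T (x - y) + nd T (x' - y')) * nd T (x - x') / 2) := by
    intro x y x' y'
    refine (hX.g_diff x y x' y').trans (le_of_eq ?_)
    rw [e2]; unfold nd; ring
  refine
    { s₁_pos := by positivity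
      s₂_pos := by positivity
      exponents := he
      c_pos := hX.c_pos
      T_pos := hT
      g_meas := hX.g_cont.measurable
      V_meas := ?_
      exp_le_V := fun t x => hY.exp_le_V hX (clampTime_mem hT.le t) x
      f_lip := fun v w => by simpa using hX.f_diff v w v v |>.trans (by simp)
      f_diff := hX.f_diff
      f_zero := fun s x => by
        have := hX.f_zero_le _ (clampTime_mem hT.le s) x
        rwa [abs_mul, abs_of_pos hT] at this
      g_le := by simpa only [hclT] using hX.g_le
      g_lip := ?_
      g_diff := by simpa only [hclT] using hg
      proc := hY.proc_X hX
      start := fun s hs x => by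
        rw [clampField_of_le _ hs.1 le_rfl hs.2]; exact hY.X_start s hs x
      flow := fun s t r h0 hst htr hr x => by
        rw [clampField_of_le _ (h0.trans hst) htr hr, clampField_of_le _ h0 hst (htr.trans hr),
          clampField_of_le _ h0 (hst.trans htr) hr]
        exact hX.flow s t r h0 hst htr hr x
      indep := ?_
      X_diff := ?_
      X_incr := ?_ }
  · have h1 : Continuous fun z : ℝ × E => V (clampTime T z.1) z.2 := by
      refine hX.V_cont.comp_continuous (f := fun z : ℝ × E => (clampTime T z.1, z.2)) ?_ ?_
      · unfold clampTime; fun_prop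
      · intro z; exact ⟨clampTime_mem hT.le _, mem_univ _⟩
    exact h1.measurable
  · intro x y
    simp only [hclT]
    -- The quadruples (x,y,x,x) and (y,x,y,y) give Lipschitz bounds with weights (3V(x) + V(y))/4
    -- and (V(x) + 3V(y))/4; their average is the symmetric weight.
    have h1 := hg x y x x
    have h2 := hg y x y y
    simp only [sub_self, nd_zero, sub_zero, mul_zero, zero_div, add_zero] at h1 h2
    rw [nd_sub_comm T y x, abs_sub_comm] at h2
    linarith
  · intro t ht
    -- The noise space is Ω itself, carrying the σ-algebra of the future field. Independence holds
    -- for this σ-algebra, and `X_meas_self` supplies the joint measurability of the flow with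
    -- respect to it.
    refine ⟨Ω, MeasurableSpace.comap (futureField T t X) inferInstance, id,
      fun r x ω => clampField T X t r x ω, ?_, ?_, fun _ _ _ => rfl, ?_⟩
    · refine measurable_id'' ?_
      refine Measurable.comap_le (measurable_pi_lambda _ fun z => ?_)
      exact hX.measurable_X ht.1 z.1.2.1 z.1.2.2 z.2
    · have := hX.X_meas_self t ht
      rw [augment_eq] at this
      exact measurable_clampField_left ht this
    · intro s h0 hst
      have := hX.flow_indep s t h0 hst ht.2
      rw [clampField_of_le _ h0 hst ht.2]
      rw [IndepFun_iff_Indep] at this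
      exact indepFun_id_of_indep this
  · intro s t h0 hst ht x y x' y'
    have hs : s ∈ Icc 0 T := ⟨h0, hst.trans ht⟩
    have v1 := hX.V_nonneg hs x
    have v2 := hX.V_nonneg hs y
    have v3 := hX.V_nonneg hs x'
    have v4 := hX.V_nonneg hs y'
    rw [clampField_of_le _ h0 hst ht]
    simp only [clampTime_of_mem hs]
    have := LB.of_rNorm (T := T) hp₂ (((hX.measurable_X h0 hst ht x).sub
      (hX.measurable_X h0 hst ht y)).sub ((hX.measurable_X h0 hst ht x').sub
      (hX.measurable_X h0 hst ht y'))) (by positivity) (hX.X_diff s t h0 hst ht x y x' y')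
    refine this.mono_bound (le_of_eq ?_)
    have hT' : √T ≠ 0 := (Real.sqrt_pos.2 hT).ne'
    unfold nd
    field_simp
  · intro s t h0 hst ht x y
    have hs : s ∈ Icc 0 T := ⟨h0, hst.trans ht⟩
    have v1 := hX.V_nonneg hs x
    have v2 := hX.V_nonneg hs y
    rw [clampField_of_le _ h0 hst ht]
    simp only [clampTime_of_mem hs]
    have := LB.of_rNorm (T := T) hp₂ (((hX.measurable_X h0 hst ht x).sub
      (hX.measurable_X h0 hst ht y)).sub_const _) (by positivity) (hX.X_incr s t h0 hst ht x y)
    refine this.mono_bound (le_of_eq ?_)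
    unfold nd td; ring

end Clamped

/-! ### Existence and uniqueness for the stochastic fixed-point equation. -/

section FixedPoint

variable {E : Type u} {Ω : Type v} [NormedAddCommGroup E] [MeasurableSpace E] [BorelSpace E]
  [SecondCountableTopology E] [MeasurableSpace Ω] {P : Measure Ω} [IsProbabilityMeasure P]
  {s₁ s₂ c T : ℝ} {f : ℝ → ℝ} {g : E → ℝ} {V : ℝ → E → ℝ} {X : ℝ → ℝ → E → Ω → E}

/-- Candidate functions for the stochastic fixed-point equation: measurable functions which grow
at most like `V`. -/
structure Growth (T : ℝ) (V : ℝ → E → ℝ) (C : ℝ) (u : ℝ → E → ℝ) : Prop where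
  meas : Measurable fun z : ℝ × E => u z.1 z.2
  nonneg : 0 ≤ C
  le : ∀ t ∈ Icc 0 T, ∀ x, |u t x| ≤ C * V t x

/-- The right-hand side of the stochastic fixed-point equation. -/
noncomputable def picardStep (P : Measure Ω) (T : ℝ) (f : ℝ → ℝ) (g : E → ℝ)
    (X : ℝ → ℝ → E → Ω → E) (u : ℝ → E → ℝ) (t : ℝ) (x : E) : ℝ :=
  ∫ ω, g (X t T x ω) ∂P + ∫ r in t..T, ∫ ω, f (u r (X t r x ω)) ∂P

/-- Solutions of the stochastic fixed-point equation. -/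
structure Solution (P : Measure Ω) (T : ℝ) (f : ℝ → ℝ) (g : E → ℝ) (V : ℝ → E → ℝ)
    (X : ℝ → ℝ → E → Ω → E) (u : ℝ → E → ℝ) : Prop where
  growth : ∃ C, Growth T V C u
  eq : ∀ t ∈ Icc 0 T, ∀ x, u t x = picardStep P T f g X u t x

variable (hF : Flow P s₁ s₂ c T f g V X)
include hF

theorem Flow.one_le_exp : 1 ≤ Real.exp (c * T) :=
  Real.one_le_exp (mul_nonneg hF.c_pos.le hF.T_pos.le)

theorem Flow.one_le_V (t : ℝ) (x : E) : 1 ≤ V t x := hF.one_le_exp.trans (hF.exp_le_V t x)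

theorem Flow.V_pos (t : ℝ) (x : E) : 0 < V t x := zero_lt_one.trans_le (hF.one_le_V t x)

theorem Flow.f_meas : Measurable f := by
  have : LipschitzWith c.toNNReal f := LipschitzWith.of_dist_le_mul fun v w => by
    simpa [Real.dist_eq, Real.coe_toNNReal _ hF.c_pos.le] using hF.f_lip v w
  exact this.continuous.measurable

theorem Flow.measurable_X (s t : ℝ) (x : E) : Measurable (X s t x) :=
  hF.proc.meas.comp (f := fun ω : Ω => (s, t, x, ω)) (by fun_prop)

theorem Flow.abs_f_le (v : ℝ) : |f v| ≤ |f 0| + c * |v| := by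
  have h1 := hF.f_lip v 0
  have h2 := abs_sub_abs_le_abs_sub (f v) (f 0)
  rw [sub_zero] at h1; linarith

theorem Flow.lb_comp {u : ℝ → E → ℝ} {C : ℝ} (hu : Growth T V C u) {t r : ℝ} (ht : 0 ≤ t)
    (htr : t ≤ r) (hr : r ≤ T) (x : E) :
    LB P s₁ (fun ω => u r (X t r x ω)) (C * V t x) := by
  refine ((hF.proc.V_le t r ht htr hr x).const_mul hu.nonneg).of_le ?_
    (Filter.Eventually.of_forall fun ω => hu.le r ⟨ht.trans htr, hr⟩ _)
  exact (hu.meas.comp (measurable_const.prodMk (hF.measurable_X t r x))).aestronglyMeasurable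

theorem Flow.s₁_le_one : s₁ ≤ 1 := by
  have := hF.exponents
  have := hF.s₂_pos
  have := hF.s₁_pos
  linarith

theorem Flow.lb_f_comp {u : ℝ → E → ℝ} {C : ℝ} (hu : Growth T V C u) {t r : ℝ} (ht : 0 ≤ t)
    (htr : t ≤ r) (hr : r ≤ T) (x : E) :
    LB P s₁ (fun ω => f (u r (X t r x ω))) (|f 0| + c * (C * V t x)) := by
  have h := hF.lb_comp hu ht htr hr x
  refine ((LB.const hF.s₁_pos hF.s₁_le_one (abs_nonneg (f 0))).add'
    (h.abs.const_mul hF.c_pos.le)).of_le ?_ (Filter.Eventually.of_forall fun ω => hF.abs_f_le _)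
  exact (hF.f_meas.comp_aemeasurable h.meas.aemeasurable).aestronglyMeasurable

theorem Flow.lb_g {t : ℝ} (ht : t ∈ Icc 0 T) (x : E) :
    LB P s₁ (fun ω => g (X t T x ω)) (V t x) :=
  (hF.proc.V_le t T ht.1 ht.2 le_rfl x).of_le
    (hF.g_meas.comp (hF.measurable_X t T x)).aestronglyMeasurable
    (Filter.Eventually.of_forall fun _ => hF.g_le _)

theorem Flow.measurable_integral_f {u : ℝ → E → ℝ} (hu : Measurable fun z : ℝ × E => u z.1 z.2) :
    Measurable fun z : ℝ × E × ℝ => ∫ ω, f (u z.2.2 (X z.1 z.2.2 z.2.1 ω)) ∂P := by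
  have h1 : Measurable fun q : (ℝ × E × ℝ) × Ω => X q.1.1 q.1.2.2 q.1.2.1 q.2 :=
    hF.proc.meas.comp (f := fun q : (ℝ × E × ℝ) × Ω => (q.1.1, q.1.2.2, q.1.2.1, q.2)) (by fun_prop)
  have h2 : Measurable fun q : (ℝ × E × ℝ) × Ω => f (u q.1.2.2 (X q.1.1 q.1.2.2 q.1.2.1 q.2)) :=
    hF.f_meas.comp (hu.comp ((by fun_prop : Measurable fun q : (ℝ × E × ℝ) × Ω => q.1.2.2).prodMk h1))
  exact h2.stronglyMeasurable.integral_prod_right'.measurable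

theorem Flow.intervalIntegrable_f {u : ℝ → E → ℝ} {C : ℝ} (hu : Growth T V C u) {t a b : ℝ}
    (ht : 0 ≤ t) (hta : t ≤ a) (hab : a ≤ b) (hb : b ≤ T) (x : E) :
    IntervalIntegrable (fun r => ∫ ω, f (u r (X t r x ω)) ∂P) volume a b := by
  rw [intervalIntegrable_iff_integrableOn_Ioc_of_le hab]
  refine Integrable.mono' (g := fun _ => |f 0| + c * (C * V t x)) (integrable_const _) ?_ ?_
  · exact ((hF.measurable_integral_f hu.meas).comp (f := fun r : ℝ => (t, x, r))
      (by fun_prop)).aestronglyMeasurable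
  · refine (ae_restrict_iff' measurableSet_Ioc).2 (Filter.Eventually.of_forall fun r hr => ?_)
    exact (hF.lb_f_comp hu ht (hta.trans hr.1.le) (hr.2.trans hb) x).abs_integral_le

/-- Clamping keeps the lower limit below T, so the time integral can be written over the whole line
with an indicator that is jointly measurable in the parameters. -/
theorem Flow.measurable_picardStep {u : ℝ → E → ℝ} (hu : Measurable fun z : ℝ × E => u z.1 z.2) :
    Measurable fun z : ℝ × E => picardStep P T f g X u (clampTime T z.1) z.2 := by
  have hcl := measurable_clampTime T
  have h1 : Measurable fun q : (ℝ × E) × Ω => X (clampTime T q.1.1) T q.1.2 q.2 :=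
    hF.proc.meas.comp (f := fun q : (ℝ × E) × Ω => (clampTime T q.1.1, T, q.1.2, q.2))
      (by fun_prop)
  have h2 : Measurable fun z : ℝ × E => ∫ ω, g (X (clampTime T z.1) T z.2 ω) ∂P :=
    (hF.g_meas.comp h1).stronglyMeasurable.integral_prod_right'.measurable
  have h3 : Measurable fun q : (ℝ × E) × ℝ => (Ioc (clampTime T q.1.1) T).indicator
      (fun r => ∫ ω, f (u r (X (clampTime T q.1.1) r q.1.2 ω)) ∂P) q.2 := by
    have h4 : Measurable fun q : (ℝ × E) × ℝ =>
        ∫ ω, f (u q.2 (X (clampTime T q.1.1) q.2 q.1.2 ω)) ∂P :=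
      (hF.measurable_integral_f hu).comp
        (f := fun q : (ℝ × E) × ℝ => (clampTime T q.1.1, q.1.2, q.2)) (by fun_prop)
    have h5 : MeasurableSet {q : (ℝ × E) × ℝ | clampTime T q.1.1 < q.2} :=
      measurableSet_lt (by fun_prop) (by fun_prop)
    have h5' : MeasurableSet {q : (ℝ × E) × ℝ | q.2 ≤ T} :=
      measurableSet_le (by fun_prop) (by fun_prop)
    have e : (fun q : (ℝ × E) × ℝ => (Ioc (clampTime T q.1.1) T).indicator
        (fun r => ∫ ω, f (u r (X (clampTime T q.1.1) r q.1.2 ω)) ∂P) q.2) =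
        ({q : (ℝ × E) × ℝ | clampTime T q.1.1 < q.2} ∩ {q | q.2 ≤ T}).indicator
          (fun q => ∫ ω, f (u q.2 (X (clampTime T q.1.1) q.2 q.1.2 ω)) ∂P) := by
      ext q
      by_cases hq : clampTime T q.1.1 < q.2 ∧ q.2 ≤ T
      · rw [indicator_of_mem (show q.2 ∈ Ioc (clampTime T q.1.1) T from hq),
          indicator_of_mem (show q ∈ _ ∩ _ from hq)]
      · rw [indicator_of_notMem (show q.2 ∉ Ioc (clampTime T q.1.1) T from hq),
          indicator_of_notMem (show q ∉ _ ∩ _ from hq)]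
    rw [e]
    exact h4.indicator (h5.inter h5')
  have h6 := (h3.stronglyMeasurable.integral_prod_right' (ν := (volume : Measure ℝ))).measurable
  have h7 : ∀ z : ℝ × E, picardStep P T f g X u (clampTime T z.1) z.2
      = ∫ ω, g (X (clampTime T z.1) T z.2 ω) ∂P + ∫ r, (Ioc (clampTime T z.1) T).indicator
      (fun r => ∫ ω, f (u r (X (clampTime T z.1) r z.2 ω)) ∂P) r := fun z => by
    rw [picardStep, intervalIntegral.integral_of_le (clampTime_mem hF.T_pos.le z.1).2,
      integral_indicator measurableSet_Ioc]
  simp only [h7]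
  exact h2.add h6

/-- Since E[V(r,X^x_{t,r})] ≤ V(t,x), the difference is at most V(t,x) c D ∫_t^T e^{2c(T-r)} dr. The
rate 2c, twice the Lipschitz constant of f, makes this at most half of the weight at t. -/
theorem Flow.picardStep_contract {v w : ℝ → E → ℝ} {C C' D : ℝ} (hv : Growth T V C v)
    (hw : Growth T V C' w) (hD : 0 ≤ D)
    (h : ∀ t ∈ Icc 0 T, ∀ x, |v t x - w t x| ≤ D * Real.exp (2 * c * (T - t)) * V t x) :
    ∀ t ∈ Icc 0 T, ∀ x, |picardStep P T f g X v t x - picardStep P T f g X w t x| ≤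
      D / 2 * Real.exp (2 * c * (T - t)) * V t x := by
  intro t ht x
  have hc := hF.c_pos
  have hVp := hF.V_pos t x
  have i1 := hF.intervalIntegrable_f hv ht.1 le_rfl ht.2 le_rfl x
  have i2 := hF.intervalIntegrable_f hw ht.1 le_rfl ht.2 le_rfl x
  rw [picardStep, picardStep, add_sub_add_left_eq_sub, ← intervalIntegral.integral_sub i1 i2]
  have hb : ∀ r ∈ Icc t T, |∫ ω, f (v r (X t r x ω)) ∂P - ∫ ω, f (w r (X t r x ω)) ∂P| ≤
      c * (D * Real.exp (2 * c * (T - r)) * V t x) := by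
    intro r hr
    have l1 := hF.lb_f_comp hv ht.1 hr.1 hr.2 x
    have l2 := hF.lb_f_comp hw ht.1 hr.1 hr.2 x
    rw [← integral_sub l1.integrable l2.integrable]
    have l3 := ((hF.proc.V_le t r ht.1 hr.1 hr.2 x).const_mul
      (a := c * (D * Real.exp (2 * c * (T - r)))) (by positivity))
    have l4 := l3.of_le (Z' := fun ω => f (v r (X t r x ω)) - f (w r (X t r x ω)))
      (l1.meas.sub l2.meas) (Filter.Eventually.of_forall fun ω => by
        refine (hF.f_lip _ _).trans ?_
        rw [mul_assoc]
        exact mul_le_mul_of_nonneg_left (h r ⟨ht.1.trans hr.1, hr.2⟩ _) hc.le)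
    exact l4.abs_integral_le.trans (le_of_eq (by ring))
  have hcont : Continuous fun r => c * (D * Real.exp (2 * c * (T - r)) * V t x) := by fun_prop
  have h1 := intervalIntegral.norm_integral_le_of_norm_le ht.2
    (μ := volume) (f := fun r => ∫ ω, f (v r (X t r x ω)) ∂P - ∫ ω, f (w r (X t r x ω)) ∂P)
    (g := fun r => c * (D * Real.exp (2 * c * (T - r)) * V t x))
    (Filter.Eventually.of_forall fun r hr => hb r ⟨hr.1.le, hr.2⟩)
    (hcont.intervalIntegrable _ _)
  have h2 : ∫ r in t..T, c * (D * Real.exp (2 * c * (T - r)) * V t x) =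
      D / 2 * V t x * Real.exp (2 * c * (T - t)) - D / 2 * V t x := by
    rw [intervalIntegral.integral_eq_sub_of_hasDerivAt
      (f := fun r => -(D / 2 * V t x * Real.exp (2 * c * (T - r))))]
    · simp; ring
    · intro r _
      have d1 : HasDerivAt (fun r : ℝ => 2 * c * (T - r)) (-(2 * c)) r := by
        simpa using ((hasDerivAt_id r).const_sub T).const_mul (2 * c)
      refine (d1.exp.const_mul (D / 2 * V t x)).neg.congr_deriv (by ring)
    · exact hcont.intervalIntegrable _ _
  rw [h2, Real.norm_eq_abs] at h1
  have : 0 ≤ D / 2 * V t x := by positivity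
  refine h1.trans (le_of_sub_nonneg ?_)
  ring_nf
  nlinarith

/-- Two solutions differ by a multiple of V, and applying the contraction repeatedly halves that
multiple each time. -/
theorem Solution.unique {u v : ℝ → E → ℝ} (hu : Solution P T f g V X u)
    (hv : Solution P T f g V X v) : ∀ t ∈ Icc 0 T, ∀ x, u t x = v t x := by
  obtain ⟨C, hC⟩ := hu.growth
  obtain ⟨C', hC'⟩ := hv.growth
  have hc := hF.c_pos
  have key : ∀ k : ℕ, ∀ t ∈ Icc 0 T, ∀ x, |u t x - v t x| ≤
      (C + C') * (1 / 2) ^ k * Real.exp (2 * c * (T - t)) * V t x := by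
    intro k
    induction k with
    | zero =>
      intro t ht x
      have h1 := hC.le t ht x
      have h2 := hC'.le t ht x
      have h3 : 1 ≤ Real.exp (2 * c * (T - t)) :=
        Real.one_le_exp (mul_nonneg (by positivity) (by linarith [ht.2]))
      have h4 := abs_sub (u t x) (v t x)
      have h5 : 0 ≤ (C + C') * V t x :=
        mul_nonneg (add_nonneg hC.nonneg hC'.nonneg) (hF.V_pos t x).le
      nlinarith
    | succ k ih =>
      intro t ht x
      rw [hu.eq t ht x, hv.eq t ht x]
      refine (hF.picardStep_contract hC hC' ?_ ih t ht x).trans (le_of_eq (by ring))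
      exact mul_nonneg (add_nonneg hC.nonneg hC'.nonneg) (by positivity)
  intro t ht x
  have hlim : Filter.Tendsto (fun k : ℕ => (C + C') * (1 / 2) ^ k * Real.exp (2 * c * (T - t))
      * V t x) Filter.atTop (nhds ((C + C') * 0 * Real.exp (2 * c * (T - t)) * V t x)) :=
    (((tendsto_pow_atTop_nhds_zero_of_lt_one (by norm_num) (by norm_num)).const_mul _).mul_const
      _).mul_const _
  have h := ge_of_tendsto' hlim fun k => key k t ht x
  simp only [mul_zero, zero_mul] at h
  exact sub_eq_zero.1 (abs_nonpos_iff.1 h)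

/-- Picard iterates. -/
noncomputable def picardIter (P : Measure Ω) (T : ℝ) (f : ℝ → ℝ) (g : E → ℝ)
    (X : ℝ → ℝ → E → Ω → E) : ℕ → ℝ → E → ℝ
  | 0 => fun _ _ => 0
  | k + 1 => fun t x => picardStep P T f g X (picardIter P T f g X k) (clampTime T t) x

theorem Flow.exists_solution : ∃ u, Solution P T f g V X u := by
  have hc := hF.c_pos
  have hT := hF.T_pos
  set U := picardIter P T f g X with hU
  have hexp : ∀ t ∈ Icc 0 T, 1 ≤ Real.exp (2 * c * (T - t)) := fun t ht =>
    Real.one_le_exp (mul_nonneg (by positivity) (by linarith [ht.2]))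
  have hexp' : ∀ t ∈ Icc 0 T, Real.exp (2 * c * (T - t)) ≤ Real.exp (2 * c * T) := fun t ht =>
    Real.exp_le_exp.2 (mul_le_mul_of_nonneg_left (by linarith [ht.1]) (by positivity))
  have hmeas : ∀ k, Measurable fun z : ℝ × E => U k z.1 z.2 := by
    intro k
    induction k with
    | zero => exact measurable_const
    | succ k ih => exact hF.measurable_picardStep ih
  have hstep : ∀ k, ∀ t ∈ Icc 0 T, ∀ x, U (k + 1) t x = picardStep P T f g X (U k) t x := by
    intro k t ht x
    show picardStep P T f g X (U k) (clampTime T t) x = _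
    rw [clampTime_of_mem ht]
  have h0 : Growth T V 0 (U 0) := ⟨hmeas 0, le_rfl, fun t _ x => by simp [hU, picardIter]⟩
  have hdiff0 : ∀ t ∈ Icc 0 T, ∀ x,
      |U 1 t x - U 0 t x| ≤ 2 * Real.exp (2 * c * (T - t)) * V t x := by
    intro t ht x
    have hV := hF.V_pos t x
    have e : U 1 t x - U 0 t x = ∫ ω, g (X t T x ω) ∂P + ∫ r in t..T, f 0 := by
      rw [hstep 0 t ht x]; simp [hU, picardIter, picardStep]
    have h1 := (hF.lb_g ht x).abs_integral_le
    have h2 := hF.f_zero t x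
    have h3 : |∫ r in t..T, f 0| ≤ V t x := by
      rw [intervalIntegral.integral_const, smul_eq_mul, abs_mul, abs_of_nonneg (by linarith [ht.2])]
      exact le_trans (mul_le_mul_of_nonneg_right (by linarith [ht.1]) (abs_nonneg _)) h2
    rw [e]
    have := abs_add_le (∫ ω, g (X t T x ω) ∂P) (∫ r in t..T, f 0)
    have := hexp t ht
    nlinarith
  have hboth : ∀ k, (∃ C, Growth T V C (U k)) ∧ (∃ C, Growth T V C (U (k + 1))) ∧
      ∀ t ∈ Icc 0 T, ∀ x, |U (k + 1) t x - U k t x| ≤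
        2 * (1 / 2) ^ k * Real.exp (2 * c * (T - t)) * V t x := by
    have hgr : ∀ k C D, 0 ≤ D → Growth T V C (U k) → (∀ t ∈ Icc 0 T, ∀ x,
        |U (k + 1) t x - U k t x| ≤ D * Real.exp (2 * c * (T - t)) * V t x) →
        ∃ C, Growth T V C (U (k + 1)) := by
      intro k C D hD hC h
      refine ⟨C + D * Real.exp (2 * c * T), hmeas _, add_nonneg hC.nonneg (by positivity),
        fun t ht x => ?_⟩
      have h1 := h t ht x
      have h2 := hC.le t ht x
      have h3 := abs_sub_abs_le_abs_sub (U (k + 1) t x) (U k t x)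
      have h4 : D * Real.exp (2 * c * (T - t)) * V t x ≤ D * Real.exp (2 * c * T) * V t x :=
        mul_le_mul_of_nonneg_right (mul_le_mul_of_nonneg_left (hexp' t ht) hD) (hF.V_pos t x).le
      linarith
    intro k
    induction k with
    | zero => exact ⟨⟨0, h0⟩, hgr 0 0 2 (by norm_num) h0 hdiff0, by simpa using hdiff0⟩
    | succ k ih =>
      obtain ⟨⟨C, hC⟩, ⟨C', hC'⟩, hd⟩ := ih
      have hd' : ∀ t ∈ Icc 0 T, ∀ x, |U (k + 2) t x - U (k + 1) t x| ≤
          2 * (1 / 2) ^ (k + 1) * Real.exp (2 * c * (T - t)) * V t x := by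
        intro t ht x
        rw [hstep (k + 1) t ht x, hstep k t ht x]
        exact (hF.picardStep_contract hC' hC (by positivity) hd t ht x).trans
          (le_of_eq (by ring))
      exact ⟨⟨C', hC'⟩, hgr (k + 1) C' _ (by positivity) hC' hd', hd'⟩
  -- The iterates depend on time only through its projection to [0,T], so they converge for every
  -- real time and the limit is measurable on all of ℝ × E.
  have hclamp : ∀ k t x, U k (clampTime T t) x = U k t x := by
    intro k t x
    cases k with
    | zero => rfl
    | succ k =>
      show picardStep P T f g X (U k) _ x = picardStep P T f g X (U k) _ x
      rw [clampTime_of_mem (clampTime_mem hT.le t)]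
  have hgeo : ∀ t x k, dist (U k t x) (U (k + 1) t x) ≤
      (2 * Real.exp (2 * c * (T - clampTime T t)) * V (clampTime T t) x) * (1 / 2) ^ k := by
    intro t x k
    have := (hboth k).2.2 _ (clampTime_mem hT.le t) x
    rw [hclamp, hclamp] at this
    rw [dist_comm, Real.dist_eq]
    exact this.trans (le_of_eq (by ring))
  have hconv : ∀ t x, ∃ a, Filter.Tendsto (fun k => U k t x) Filter.atTop (nhds a) := fun t x =>
    cauchySeq_tendsto_of_complete (cauchySeq_of_le_geometric _ _ (by norm_num) (hgeo t x))
  choose u hu using hconv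
  have humeas : Measurable fun z : ℝ × E => u z.1 z.2 :=
    measurable_of_tendsto_metrizable hmeas (tendsto_pi_nhds.2 fun z => hu z.1 z.2)
  have herr : ∀ k, ∀ t ∈ Icc 0 T, ∀ x, |U k t x - u t x| ≤
      4 * (1 / 2) ^ k * Real.exp (2 * c * (T - t)) * V t x := by
    intro k t ht x
    have := dist_le_of_le_geometric_of_tendsto _ _ (by norm_num) (hgeo t x) (hu t x) k
    rw [Real.dist_eq, clampTime_of_mem ht] at this
    exact this.trans (le_of_eq (by ring))
  have hugr : Growth T V (4 * Real.exp (2 * c * T)) u := by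
    refine ⟨humeas, by positivity, fun t ht x => ?_⟩
    have h1 := herr 0 t ht x
    simp only [hU, picardIter, zero_sub, abs_neg, pow_zero, mul_one] at h1
    exact h1.trans (mul_le_mul_of_nonneg_right (mul_le_mul_of_nonneg_left (hexp' t ht)
      (by norm_num)) (hF.V_pos t x).le)
  refine ⟨u, ⟨_, hugr⟩, fun t ht x => ?_⟩
  have hle : ∀ k : ℕ, |u t x - picardStep P T f g X u t x| ≤
      4 * Real.exp (2 * c * (T - t)) * V t x * (1 / 2) ^ k := by
    intro k
    obtain ⟨C, hC⟩ := (hboth k).1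
    have h1 := herr (k + 1) t ht x
    have h2 := hF.picardStep_contract hC hugr (by positivity) (herr k) t ht x
    rw [hstep k t ht x] at h1
    have h3 := abs_sub_le (u t x) (picardStep P T f g X (U k) t x) (picardStep P T f g X u t x)
    rw [abs_sub_comm (u t x) (picardStep P T f g X (U k) t x)] at h3
    refine h3.trans ((add_le_add h1 h2).trans (le_of_eq ?_))
    rw [pow_succ]; ring
  have hlim : Filter.Tendsto (fun k : ℕ => 4 * Real.exp (2 * c * (T - t)) * V t x * (1 / 2) ^ k)
      Filter.atTop (nhds (4 * Real.exp (2 * c * (T - t)) * V t x * 0)) :=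
    (tendsto_pow_atTop_nhds_zero_of_lt_one (by norm_num) (by norm_num)).const_mul _
  have h := ge_of_tendsto' hlim hle
  rw [mul_zero] at h
  exact sub_eq_zero.1 (abs_nonpos_iff.1 h)

end FixedPoint

/-! ### Markov property and Gronwall estimates along the flow. -/

section Regularity

variable {E : Type u} {Ω : Type v} [NormedAddCommGroup E] [MeasurableSpace E] [BorelSpace E]
  [SecondCountableTopology E] [MeasurableSpace Ω] {P : Measure Ω} [IsProbabilityMeasure P]
  {s₁ s₂ c T : ℝ} {f : ℝ → ℝ} {g : E → ℝ} {V : ℝ → E → ℝ} {X : ℝ → ℝ → E → Ω → E}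

theorem enorm_interval_integral_le {a b : ℝ} (hab : a ≤ b) (h : ℝ → Ω → ℝ) :
    ‖∫ r in a..b, ∫ ω, h r ω ∂P‖ₑ ≤ ∫⁻ r in Icc a b, ∫⁻ ω, ‖h r ω‖ₑ ∂P := by
  rw [intervalIntegral.integral_of_le hab, ← integral_Icc_eq_integral_Ioc]
  exact (enorm_integral_le_lintegral_enorm _).trans
    (lintegral_mono fun r => enorm_integral_le_lintegral_enorm _)

variable (hF : Flow P s₁ s₂ c T f g V X)
include hF

/-- The positions at time r are frozen against the independent noise that drives the flow after r,
and the flow property identifies the composition. A whole family of points is moved by the same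
noise, as needed for differences of u. -/
theorem Flow.markov_lintegral {ι : Type*} [Countable ι] {t r s : ℝ} (ht : 0 ≤ t) (htr : t ≤ r)
    (hrs : r ≤ s) (hs : s ≤ T) (x : ι → E) {G : (ι → E) → ℝ≥0∞} (hG : Measurable G) :
    ∫⁻ ω', ∫⁻ ω, G (fun i => X r s (X t r (x i) ω') ω) ∂P ∂P
      = ∫⁻ ω, G (fun i => X t s (x i) ω) ∂P := by
  obtain ⟨Ξ, mΞ, W, F, hW, hFm, hXF, hind⟩ := hF.indep r ⟨ht.trans htr, hrs.trans hs⟩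
  have hZ : Measurable fun ω i => X t r (x i) ω :=
    measurable_pi_lambda _ fun i => hF.measurable_X t r (x i)
  have hind' : IndepFun (fun ω i => X t r (x i) ω) W P :=
    (hind t ht htr).comp (φ := fun (y : E → E) (i : ι) => y (x i))
      (measurable_pi_lambda _ fun i => measurable_pi_apply _) measurable_id
  have hGm : Measurable fun q : (ι → E) × Ξ => G (fun i => F s (q.1 i) q.2) :=
    hG.comp (measurable_pi_lambda _ fun i => hFm.comp
      (f := fun q : (ι → E) × Ξ => (s, q.1 i, q.2)) (by fun_prop))
  have h1 := IndepFun.lintegral_eq hZ hW hind' (F := fun z ξ => G (fun i => F s (z i) ξ)) hGm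
  simp only [← hXF] at h1
  rw [← h1]
  refine lintegral_congr_ae ?_
  have h2 : ∀ᵐ ω ∂P, ∀ i, X r s (X t r (x i) ω) ω = X t s (x i) ω :=
    ae_all_iff.2 fun i => hF.flow t r s ht htr hrs hs (x i)
  filter_upwards [h2] with ω hω
  simp only [hω]

theorem Flow.markov_integral {t r s : ℝ} (ht : 0 ≤ t) (htr : t ≤ r)
    (hrs : r ≤ s) (hs : s ≤ T) (x : E) {G : E → ℝ} (hG : Measurable G)
    (hint : Integrable (fun ω => G (X t s x ω)) P) :
    ∫ ω', ∫ ω, G (X r s (X t r x ω') ω) ∂P ∂P = ∫ ω, G (X t s x ω) ∂P := by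
  obtain ⟨Ξ, mΞ, W, F, hW, hFm, hXF, hind⟩ := hF.indep r ⟨ht.trans htr, hrs.trans hs⟩
  have hind' : IndepFun (X t r x) W P :=
    (hind t ht htr).comp (φ := fun (y : E → E) => y x) (measurable_pi_apply _) measurable_id
  have hGm : Measurable fun q : E × Ξ => G (F s q.1 q.2) :=
    hG.comp (hFm.comp (f := fun q : E × Ξ => (s, q.1, q.2)) (by fun_prop))
  have h2 := hF.flow t r s ht htr hrs hs x
  have h3 : (fun ω => G (F s (X t r x ω) (W ω))) =ᵐ[P] fun ω => G (X t s x ω) := by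
    filter_upwards [h2] with ω hω
    rw [← hXF, hω]
  have h1 := IndepFun.integral_eq (hF.measurable_X t r x) hW hind'
    (F := fun z ξ => G (F s z ξ)) hGm (hint.congr h3.symm)
  rw [integral_congr_ae h3] at h1
  simp only [← hXF] at h1
  exact h1.symm

theorem Flow.measurable_Xv {ι : Type*} [Countable ι] :
    Measurable fun q : ℝ × ℝ × (ι → E) × Ω => fun i => X q.1 q.2.1 (q.2.2.1 i) q.2.2.2 :=
  measurable_pi_lambda _ fun i => hF.proc.meas.comp
    (f := fun q : ℝ × ℝ × (ι → E) × Ω => (q.1, q.2.1, q.2.2.1 i, q.2.2.2)) (by fun_prop)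

/-- Gronwall estimate along the flow. -/
theorem Flow.gronwall {ι : Type*} [Countable ι] {ψ χ : ℝ → (ι → E) → ℝ≥0∞} {γ : (ι → E) → ℝ≥0∞}
    (hψ : Measurable fun q : ℝ × (ι → E) => ψ q.1 q.2)
    (hχ : Measurable fun q : ℝ × (ι → E) => χ q.1 q.2) (hγ : Measurable γ)
    (hrec : ∀ r ∈ Icc 0 T, ∀ z : ι → E, ψ r z ≤ ∫⁻ ω, γ (fun i => X r T (z i) ω) ∂P
      + ∫⁻ s in Icc r T, ∫⁻ ω, (ENNReal.ofReal c * ψ s (fun i => X r s (z i) ω)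
        + χ s (fun i => X r s (z i) ω)) ∂P)
    {t : ℝ} (ht : t ∈ Icc 0 T) (x : ι → E) {A M : ℝ} (hA0 : 0 ≤ A) (hM0 : 0 ≤ M)
    (hA : ∫⁻ ω, γ (fun i => X t T (x i) ω) ∂P
      + ∫⁻ s in Icc t T, ∫⁻ ω, χ s (fun i => X t s (x i) ω) ∂P ≤ ENNReal.ofReal A)
    (hM : ∀ r ∈ Icc t T, ∫⁻ ω, ψ r (fun i => X t r (x i) ω) ∂P ≤ ENNReal.ofReal M) :
    ψ t x ≤ ENNReal.ofReal (A * Real.exp (c * (T - t))) := by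
  have hXm := hF.measurable_Xv (ι := ι)
  obtain ⟨H, hH⟩ : ∃ H : ℝ → (ι → E) → ℝ≥0∞, H = fun s z => ENNReal.ofReal c * ψ s z + χ s z :=
    ⟨_, rfl⟩
  have hHm : Measurable fun q : ℝ × (ι → E) => H q.1 q.2 := by
    rw [hH]; exact (hψ.const_mul _).add hχ
  have hH' : ∀ s z, ENNReal.ofReal c * ψ s z + χ s z = H s z := fun s z => by rw [hH]
  simp only [hH'] at hrec
  have hXt : Measurable fun q : ℝ × Ω => fun i => X t q.1 (x i) q.2 :=
    hXm.comp (f := fun q : ℝ × Ω => (t, q.1, x, q.2)) (by fun_prop)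
  have hφ0 : ∫⁻ ω, ψ t (fun i => X t t (x i) ω) ∂P = ψ t x := by
    have : (fun ω => ψ t (fun i => X t t (x i) ω)) =ᵐ[P] fun _ => ψ t x := by
      filter_upwards [ae_all_iff.2 fun i => hF.start t ht (x i)] with ω hω
      simp only [hω]
    rw [lintegral_congr_ae this]; simp
  -- The recursion is integrated along the flow started at (t,x). The Markov property merges the two
  -- successive motions, leaving a scalar Gronwall inequality for r ↦ E[ψ(r,X_{t,r})].
  have hgron : ∀ r ∈ Icc t T, ∫⁻ ω, ψ r (fun i => X t r (x i) ω) ∂P ≤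
      ENNReal.ofReal A + ENNReal.ofReal c *
        ∫⁻ s in Icc r T, ∫⁻ ω, ψ s (fun i => X t s (x i) ω) ∂P := by
    intro r hr
    have hZ : Measurable fun ω i => X t r (x i) ω :=
      measurable_pi_lambda _ fun i => hF.measurable_X t r (x i)
    have m1 : Measurable fun ω' => ∫⁻ ω, γ (fun i => X r T (X t r (x i) ω') ω) ∂P :=
      Measurable.lintegral_prod_right' (f := fun q : Ω × Ω =>
        γ (fun i => X r T (X t r (x i) q.1) q.2)) (hγ.comp (hXm.comp
          (f := fun q : Ω × Ω => (r, T, fun i => X t r (x i) q.1, q.2))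
          (measurable_const.prodMk (measurable_const.prodMk
            ((hZ.comp measurable_fst).prodMk measurable_snd)))))
    have m2 : Measurable fun q : Ω × ℝ => ∫⁻ ω, H q.2 (fun i => X r q.2 (X t r (x i) q.1) ω) ∂P := by
      refine Measurable.lintegral_prod_right' (f := fun q : (Ω × ℝ) × Ω =>
        H q.1.2 (fun i => X r q.1.2 (X t r (x i) q.1.1) q.2)) (hHm.comp
        (f := fun q : (Ω × ℝ) × Ω => (q.1.2, fun i => X r q.1.2 (X t r (x i) q.1.1) q.2)) ?_)
      refine Measurable.prodMk (by fun_prop) (hXm.comp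
        (f := fun q : (Ω × ℝ) × Ω => (r, q.1.2, fun i => X t r (x i) q.1.1, q.2)) ?_)
      exact measurable_const.prodMk (Measurable.prodMk (by fun_prop)
        ((hZ.comp (measurable_fst.comp measurable_fst)).prodMk measurable_snd))
    have hsw := lintegral_lintegral_swap (μ := P) (ν := volume.restrict (Icc r T))
      (f := fun ω' s => ∫⁻ ω, H s (fun i => X r s (X t r (x i) ω') ω) ∂P) m2.aemeasurable
    have e1 : ∫⁻ ω', (∫⁻ ω, γ (fun i => X r T (X t r (x i) ω') ω) ∂P
          + ∫⁻ s in Icc r T, ∫⁻ ω, H s (fun i => X r s (X t r (x i) ω') ω) ∂P) ∂P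
        = ∫⁻ ω, γ (fun i => X t T (x i) ω) ∂P
          + ∫⁻ s in Icc r T, ∫⁻ ω, H s (fun i => X t s (x i) ω) ∂P := by
      rw [lintegral_add_left m1, hsw, hF.markov_lintegral ht.1 hr.1 hr.2 le_rfl x hγ]
      congr 1
      refine setLIntegral_congr_fun measurableSet_Icc fun s hs => ?_
      exact hF.markov_lintegral ht.1 hr.1 hs.1 hs.2 x (G := H s)
        (hHm.comp measurable_prodMk_left)
    have e2 : ∫⁻ s in Icc r T, ∫⁻ ω, H s (fun i => X t s (x i) ω) ∂P
        = ENNReal.ofReal c * (∫⁻ s in Icc r T, ∫⁻ ω, ψ s (fun i => X t s (x i) ω) ∂P)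
          + ∫⁻ s in Icc r T, ∫⁻ ω, χ s (fun i => X t s (x i) ω) ∂P := by
      have m4 : Measurable fun q : ℝ × Ω => ψ q.1 (fun i => X t q.1 (x i) q.2) :=
        hψ.comp (measurable_fst.prodMk hXt)
      rw [← lintegral_const_mul' _ _ ENNReal.ofReal_ne_top,
        ← lintegral_add_left ((Measurable.lintegral_prod_right' m4).const_mul (ENNReal.ofReal c))]
      refine lintegral_congr fun s => ?_
      have m5 : Measurable fun ω => ψ s (fun i => X t s (x i) ω) := m4.comp measurable_prodMk_left
      rw [← lintegral_const_mul _ m5, ← lintegral_add_left (m5.const_mul _), hH]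
    have e3 : ∫⁻ s in Icc r T, ∫⁻ ω, χ s (fun i => X t s (x i) ω) ∂P ≤
        ∫⁻ s in Icc t T, ∫⁻ ω, χ s (fun i => X t s (x i) ω) ∂P :=
      lintegral_mono_set (Icc_subset_Icc_left hr.1)
    have e4 := lintegral_mono (μ := P) fun ω' => hrec r ⟨ht.1.trans hr.1, hr.2⟩
      fun i => X t r (x i) ω'
    rw [e1, e2] at e4
    refine e4.trans ?_
    rw [add_comm (ENNReal.ofReal c * _), ← add_assoc]
    exact add_le_add_left ((add_le_add_right e3 _).trans hA) _
  rw [← hφ0]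
  exact lintegral_gronwall (φ := fun r => ∫⁻ ω, ψ r (fun i => X t r (x i) ω) ∂P)
    hF.c_pos.le hA0 hM0 hgron hM (left_mem_Icc.2 ht.2)

/-- Gronwall estimate along the flow for linear combinations of values of a solution. -/
theorem Flow.abs_comb_le {u : ℝ → E → ℝ} (hu : Solution P T f g V X u) {ι : Type*} [Fintype ι]
    (a : ι → ℝ) {χ : ℝ → (ι → E) → ℝ≥0∞} (hχ : Measurable fun q : ℝ × (ι → E) => χ q.1 q.2)
    (hf : ∀ s ∈ Icc 0 T, ∀ z : ι → E, ‖∑ i, a i * f (u s (z i))‖ₑ ≤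
      ENNReal.ofReal c * ‖∑ i, a i * u s (z i)‖ₑ + χ s z)
    {t : ℝ} (ht : t ∈ Icc 0 T) (x : ι → E) {A : ℝ} (hA0 : 0 ≤ A)
    (hA : ∫⁻ ω, ‖∑ i, a i * g (X t T (x i) ω)‖ₑ ∂P
      + ∫⁻ s in Icc t T, ∫⁻ ω, χ s (fun i => X t s (x i) ω) ∂P ≤ ENNReal.ofReal A) :
    |∑ i, a i * u t (x i)| ≤ A * Real.exp (c * (T - t)) := by
  obtain ⟨C, hC⟩ := hu.growth
  have hum := hC.meas
  have hψm : Measurable fun q : ℝ × (ι → E) => ‖∑ i, a i * u q.1 (q.2 i)‖ₑ := by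
    refine Measurable.enorm (Finset.measurable_fun_sum _ fun i _ => Measurable.const_mul ?_ _)
    exact hum.comp (f := fun q : ℝ × (ι → E) => (q.1, q.2 i)) (by fun_prop)
  have hgm : Measurable fun z : ι → E => ‖∑ i, a i * g (z i)‖ₑ :=
    Measurable.enorm (Finset.measurable_fun_sum _ fun i _ =>
      (hF.g_meas.comp (measurable_pi_apply i)).const_mul _)
  have key := hF.gronwall (ψ := fun r z => ‖∑ i, a i * u r (z i)‖ₑ) (χ := χ)
    (γ := fun z => ‖∑ i, a i * g (z i)‖ₑ) hψm hχ hgm ?_ ht x hA0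
    (M := ∑ i, |a i| * (C * V t (x i))) (Finset.sum_nonneg fun i _ => mul_nonneg (abs_nonneg _)
      (mul_nonneg hC.nonneg (hF.V_pos t _).le)) hA ?_
  · rw [Real.enorm_eq_ofReal_abs] at key
    exact (ENNReal.ofReal_le_ofReal_iff (by positivity)).1 key
  · intro r hr z
    -- The equation for u is linear in the pair (g, f∘u), so a combination of its values obeys the
    -- equation with the combined data.
    have e : ∑ i, a i * u r (z i) = ∫ ω, ∑ i, a i * g (X r T (z i) ω) ∂P
        + ∫ s in r..T, ∫ ω, ∑ i, a i * f (u s (X r s (z i) ω)) ∂P := by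
      have e1 : ∫ ω, ∑ i, a i * g (X r T (z i) ω) ∂P
          = ∑ i, a i * ∫ ω, g (X r T (z i) ω) ∂P := by
        rw [integral_finsetSum _ fun i _ => ((hF.lb_g hr (z i)).integrable.const_mul _)]
        simp only [integral_const_mul]
      have e2 : ∫ s in r..T, ∫ ω, ∑ i, a i * f (u s (X r s (z i) ω)) ∂P
          = ∑ i, a i * ∫ s in r..T, ∫ ω, f (u s (X r s (z i) ω)) ∂P := by
        simp only [← intervalIntegral.integral_const_mul]
        rw [← intervalIntegral.integral_finsetSum fun i _ =>
          (hF.intervalIntegrable_f hC hr.1 le_rfl hr.2 le_rfl (z i)).const_mul _]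
        refine intervalIntegral.integral_congr fun s hs => ?_
        rw [uIcc_of_le hr.2] at hs
        rw [integral_finsetSum _ fun i _ =>
          ((hF.lb_f_comp hC hr.1 hs.1 hs.2 (z i)).integrable.const_mul _)]
        simp only [integral_const_mul]
      rw [e1, e2, ← Finset.sum_add_distrib]
      refine Finset.sum_congr rfl fun i _ => ?_
      rw [hu.eq r hr (z i), picardStep, mul_add]
    rw [e]
    refine (enorm_add_le _ _).trans (add_le_add (enorm_integral_le_lintegral_enorm _) ?_)
    refine (enorm_interval_integral_le hr.2 _).trans ?_
    refine setLIntegral_mono' measurableSet_Icc fun s hs => lintegral_mono fun ω => ?_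
    exact hf s ⟨hr.1.trans hs.1, hs.2⟩ fun i => X r s (z i) ω
  -- Gronwall's lemma needs some finite a priori bound; the growth of u provides one, whose size
  -- does not enter the conclusion.
  · intro r hr
    have h1 := LB.sum (P := P) (s := s₁) (Finset.univ : Finset ι)
      (Z := fun i ω => a i * u r (X t r (x i) ω)) (b := fun i => |a i| * (C * V t (x i)))
      hF.s₁_pos hF.s₁_le_one fun i _ => by
        have := (hF.lb_comp hC ht.1 hr.1 hr.2 (x i))
        exact (this.const_mul (abs_nonneg (a i))).of_abs_le (this.meas.const_mul _)
          (Filter.Eventually.of_forall fun ω => by simp [abs_mul])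
    have := h1.lintegral_le
    simpa only [Real.enorm_eq_ofReal_abs] using this

end Regularity

/-! ### Growth, Lipschitz and second-difference bounds for the solution. -/

section Estimates

variable {E : Type u} {Ω : Type v} [NormedAddCommGroup E] [MeasurableSpace E] [BorelSpace E]
  [SecondCountableTopology E] [MeasurableSpace Ω] {P : Measure Ω} [IsProbabilityMeasure P]
  {s₁ s₂ c T : ℝ} {f : ℝ → ℝ} {g : E → ℝ} {V : ℝ → E → ℝ} {X : ℝ → ℝ → E → Ω → E}

theorem lintegral_Icc_le {a b M : ℝ} {φ : ℝ → ℝ≥0∞} (hM : 0 ≤ M)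
    (h : ∀ s ∈ Icc a b, φ s ≤ ENNReal.ofReal M) :
    ∫⁻ s in Icc a b, φ s ≤ ENNReal.ofReal (M * (b - a)) := by
  refine (setLIntegral_mono' measurableSet_Icc h).trans ?_
  rw [lintegral_const, Measure.restrict_apply MeasurableSet.univ, univ_inter, Real.volume_Icc,
    ENNReal.ofReal_mul hM]

/-- Lets every factor cT be absorbed into K/2, so that the constants depend on c and T only through
K = e^{cT}. -/
theorem two_mul_le_exp (y : ℝ) : 2 * y ≤ Real.exp y := by
  have h1 := Real.exp_one_mul_le_exp (x := y)
  rcases le_total y 0 with h | h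
  · have := Real.exp_pos y; linarith
  · have h2 := Real.add_one_le_exp (1 : ℝ)
    nlinarith

/-- With W the mean of the four weights and K ≤ W, each term is at most a multiple of K⁷W² times N
or (m + m')M. The final factor K is the Gronwall exponential. -/
theorem second_diff_bound {a b a' b' K N m m' M c T : ℝ} (ha : K ≤ a) (hb : K ≤ b) (ha' : K ≤ a')
    (hb' : K ≤ b') (hK : 1 ≤ K) (hyK : 2 * (c * T) ≤ K) (hN : 0 ≤ N) (hm : 0 ≤ m)
    (hm' : 0 ≤ m') (hM : 0 ≤ M) :
    ((a + b + a' + b') / 4 * ((a + b + a' + b') / 4 * (N + (m + m') * M / 2)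
        + (K * m + K * m') * (K * M) / 2)
      + c * K ^ 4 / 2 * (((a + b) / 2 * (K * m) + (a' + b') / 2 * (K * m')) * ((a + a') / 2
        * (K * M))) * T) * K ≤
    2 * K ^ 8 * ((a + b + a' + b') / 4) ^ 2 * (N + (m + m') * M) := by
  obtain ⟨W, hW⟩ : ∃ W, W = (a + b + a' + b') / 4 := ⟨_, rfl⟩
  obtain ⟨S, hS⟩ : ∃ S, S = m + m' := ⟨_, rfl⟩
  have hKW : K ≤ W := by rw [hW]; linarith
  have hS0 : 0 ≤ S := by rw [hS]; positivity
  have hK0 : 0 < K := by linarith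
  have hW0 : 0 < W := by linarith
  have hSM : 0 ≤ S * M := by positivity
  have b1 : ((a + b) / 2 * (K * m) + (a' + b') / 2 * (K * m')) * ((a + a') / 2 * (K * M)) ≤
      (2 * W * (K * S)) * (2 * W * (K * M)) := by
    have a1 : (a + b) / 2 ≤ 2 * W := by rw [hW]; linarith
    have a2 : (a' + b') / 2 ≤ 2 * W := by rw [hW]; linarith
    have a3 : (a + a') / 2 ≤ 2 * W := by rw [hW]; linarith
    have : 0 ≤ (a + a') / 2 := by linarith
    calc _ ≤ ((2 * W) * (K * m) + (2 * W) * (K * m')) * ((2 * W) * (K * M)) := by gcongr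
      _ = _ := by rw [hS]; ring
  have e0 : K * m + K * m' = K * S := by rw [hS]; ring
  rw [e0, ← hW, ← hS]
  have c1 : c * T * K ^ 4 / 2 * (((a + b) / 2 * (K * m) + (a' + b') / 2 * (K * m'))
      * ((a + a') / 2 * (K * M))) ≤ K / 2 * K ^ 4 / 2 * ((2 * W * (K * S)) * (2 * W * (K * M))) := by
    have : c * T ≤ K / 2 := by linarith
    have h0 : 0 ≤ ((a + b) / 2 * (K * m) + (a' + b') / 2 * (K * m')) * ((a + a') / 2 * (K * M)) := by
      have : 0 < a := by linarith
      have : 0 < b := by linarith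
      have : 0 < a' := by linarith
      have : 0 < b' := by linarith
      positivity
    gcongr
  have c2 : K / 2 * K ^ 4 / 2 * ((2 * W * (K * S)) * (2 * W * (K * M)))
      = W ^ 2 * (S * M) * K ^ 7 := by ring
  have c4 : W * (K * S * (K * M) / 2) ≤ W ^ 2 * (S * M) * K / 2 := by
    have e1 : W * (K * S * (K * M) / 2) = K * W * (S * M) / 2 * K := by ring
    have e2 : W ^ 2 * (S * M) * K / 2 = K * W * (S * M) / 2 * W := by ring
    rw [e1, e2]; gcongr
  have d1 : (1 : ℝ) ≤ K ^ 7 := one_le_pow₀ hK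
  have d2 : K ≤ K ^ 7 := le_self_pow₀ hK (by norm_num)
  have d3 : W ^ 2 * N * 1 ≤ W ^ 2 * N * K ^ 7 := by gcongr
  have d4 : W ^ 2 * (S * M) * 1 ≤ W ^ 2 * (S * M) * K ^ 7 := by gcongr
  have d5 : W ^ 2 * (S * M) * K ≤ W ^ 2 * (S * M) * K ^ 7 := by gcongr
  have d6 : 0 ≤ W ^ 2 * N * K ^ 7 := by positivity
  have e1 : W * (W * (N + S * M / 2) + K * S * (K * M) / 2)
      = W ^ 2 * N + W ^ 2 * (S * M) / 2 + W * (K * S * (K * M) / 2) := by ring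
  have key : W * (W * (N + S * M / 2) + K * S * (K * M) / 2) + c * T * K ^ 4 / 2 *
      (((a + b) / 2 * (K * m) + (a' + b') / 2 * (K * m')) * ((a + a') / 2 * (K * M)))
      ≤ 2 * (W ^ 2 * N * K ^ 7) + 2 * (W ^ 2 * (S * M) * K ^ 7) := by
    rw [e1]; linarith
  calc _ = (W * (W * (N + S * M / 2) + K * S * (K * M) / 2) + c * T * K ^ 4 / 2 *
      (((a + b) / 2 * (K * m) + (a' + b') / 2 * (K * m')) * ((a + a') / 2 * (K * M)))) * K := by ring
    _ ≤ (2 * (W ^ 2 * N * K ^ 7) + 2 * (W ^ 2 * (S * M) * K ^ 7)) * K := by gcongr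
    _ = _ := by ring

variable (hF : Flow P s₁ s₂ c T f g V X)
include hF

theorem Flow.s₂_le_one : s₂ ≤ 1 := by
  have := hF.exponents
  have := hF.s₁_pos
  linarith

theorem Flow.lb_V {t r : ℝ} (ht : 0 ≤ t) (htr : t ≤ r) (hr : r ≤ T) (x : E) :
    LB P s₁ (fun ω => V r (X t r x ω)) (V t x) := hF.proc.V_le t r ht htr hr x

theorem Flow.lb_nd {t r : ℝ} (ht : 0 ≤ t) (htr : t ≤ r) (hr : r ≤ T) (x y : E) :
    LB P s₂ (fun ω => nd T (X t r x ω - X t r y ω)) (Real.exp (c * T) * nd T (x - y)) := by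
  have := hF.proc.two t r t r ht htr hr le_rfl htr hr x y
  simpa [td_self] using this

/-- Gronwall with one point: the terminal value and the term T|f(0)| contribute at most V(t,x) each.
-/
theorem Flow.abs_solution_le {u : ℝ → E → ℝ} (hu : Solution P T f g V X u) {t : ℝ}
    (ht : t ∈ Icc 0 T) (x : E) : |u t x| ≤ 2 * Real.exp (c * T) * V t x := by
  have hc := hF.c_pos
  have hV := hF.V_pos t x
  have h := hF.abs_comb_le hu (ι := Unit) (fun _ => 1) (χ := fun _ _ => ‖f 0‖ₑ) (by fun_prop) ?_ ht
    (fun _ => x) (A := 2 * V t x) (by positivity) ?_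
  · simp only [Finset.univ_unique, one_mul, Finset.sum_const, Finset.card_singleton, one_smul] at h
    refine h.trans ?_
    have : Real.exp (c * (T - t)) ≤ Real.exp (c * T) := Real.exp_le_exp.2 (by nlinarith [ht.1])
    nlinarith
  · intro s _ z
    simp only [Finset.univ_unique, one_mul, Finset.sum_singleton, Real.enorm_eq_ofReal_abs]
    rw [← ENNReal.ofReal_mul hc.le, ← ENNReal.ofReal_add (by positivity) (by positivity)]
    refine ENNReal.ofReal_le_ofReal ?_
    rw [add_comm]; exact hF.abs_f_le _
  · simp only [Finset.univ_unique, one_mul, Finset.sum_const, Finset.card_singleton, one_smul]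
    rw [two_mul, ENNReal.ofReal_add hV.le hV.le]
    refine add_le_add ?_ ?_
    · simpa only [Real.enorm_eq_ofReal_abs] using (hF.lb_g ht x).lintegral_le
    · refine (lintegral_Icc_le (M := |f 0|) (abs_nonneg _) fun s _ => ?_).trans
        (ENNReal.ofReal_le_ofReal ?_)
      · simp [Real.enorm_eq_ofReal_abs]
      · refine le_trans ?_ (hF.f_zero t x)
        nlinarith [abs_nonneg (f 0), ht.1]

/-- Gronwall with two points. The Lipschitz condition on f leaves no inhomogeneity, so only the
difference of terminal values has to be estimated, by Hölder's inequality. -/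
theorem Flow.solution_lip {u : ℝ → E → ℝ} (hu : Solution P T f g V X u) {t : ℝ}
    (ht : t ∈ Icc 0 T) (x y : E) :
    |u t x - u t y| ≤ Real.exp (c * T) ^ 2 * ((V t x + V t y) / 2) * nd T (x - y) := by
  have hc := hF.c_pos
  have hV := hF.V_pos t x
  have hV' := hF.V_pos t y
  have hn := nd_nonneg T (x - y)
  have h := hF.abs_comb_le hu (ι := Fin 2) ![1, -1] (χ := fun _ _ => 0) (by fun_prop) ?_ ht
    ![x, y] (A := (V t x + V t y) / 2 * (Real.exp (c * T) * nd T (x - y))) (by positivity) ?_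
  · simp only [Fin.sum_univ_two, Matrix.cons_val_zero, Matrix.cons_val_one, one_mul, neg_one_mul,
      ← sub_eq_add_neg] at h
    refine h.trans ?_
    have h1 : Real.exp (c * (T - t)) ≤ Real.exp (c * T) := Real.exp_le_exp.2 (by nlinarith [ht.1])
    calc _ ≤ (V t x + V t y) / 2 * (Real.exp (c * T) * nd T (x - y)) * Real.exp (c * T) := by gcongr
      _ = _ := by ring
  · intro s _ z
    simp only [Fin.sum_univ_two, Matrix.cons_val_zero, Matrix.cons_val_one, one_mul, neg_one_mul,
      ← sub_eq_add_neg, Real.enorm_eq_ofReal_abs, add_zero]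
    rw [← ENNReal.ofReal_mul hc.le]
    exact ENNReal.ofReal_le_ofReal (hF.f_lip _ _)
  · simp only [Fin.sum_univ_two, Matrix.cons_val_zero, Matrix.cons_val_one, one_mul, neg_one_mul,
      ← sub_eq_add_neg, Real.enorm_eq_ofReal_abs, lintegral_zero, add_zero]
    have hex := hF.exponents
    have := hF.s₁_pos
    have := hF.s₂_pos
    have l1 := ((((hF.lb_V ht.1 ht.2 le_rfl x).add' (hF.lb_V ht.1 ht.2 le_rfl y)).const_mul
      (a := 1 / 2) (by norm_num)).mul (hF.lb_nd ht.1 ht.2 le_rfl x y) (r := 1) (by linarith) le_rfl)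
    have l2 := l1.of_le (Z' := fun ω => g (X t T x ω) - g (X t T y ω))
      ((hF.g_meas.comp (hF.measurable_X t T x)).sub
        (hF.g_meas.comp (hF.measurable_X t T y))).aestronglyMeasurable
      (Filter.Eventually.of_forall fun ω => (hF.g_lip _ _).trans (le_of_eq (by ring)))
    exact (l2.mono_bound (le_of_eq (by ring))).lintegral_le

/-- Gronwall with the four points of a second difference. The quadratic part of the second-order
condition on f becomes the inhomogeneity and is controlled by the Lipschitz bound already available;
the second differences of g and X control the terminal term. -/
theorem Flow.solution_diff {u : ℝ → E → ℝ} (hu : Solution P T f g V X u) {t : ℝ}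
    (ht : t ∈ Icc 0 T) (x y x' y' : E) :
    |(u t x - u t y) - (u t x' - u t y')| ≤ 2 * Real.exp (c * T) ^ 8
      * ((V t x + V t y + V t x' + V t y') / 4) ^ 2
      * (nd T ((x - y) - (x' - y')) + (nd T (x - y) + nd T (x' - y')) * nd T (x - x')) := by
  have hc := hF.c_pos
  have hT := hF.T_pos
  have hK := hF.one_le_exp
  have hyK := two_mul_le_exp (c * T)
  have hKV := hF.exp_le_V t
  have hcT : 0 < c * T := mul_pos hc hT
  obtain ⟨K, hKdef⟩ : ∃ K, K = Real.exp (c * T) := ⟨_, rfl⟩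
  rw [← hKdef] at hK hyK hKV ⊢
  have n2 := nd_nonneg T ((x - y) - (x' - y'))
  have n01 := nd_nonneg T (x - y)
  have n23 := nd_nonneg T (x' - y')
  have n02 := nd_nonneg T (x - x')
  have hVp := hF.V_pos
  have p0 := hVp t x
  have p1 := hVp t y
  have p2 := hVp t x'
  have p3 := hVp t y'
  have hK0 : 0 < K := by linarith
  have hVm := hF.V_meas
  have hnm := measurable_nd (E := E) T
  have hex := hF.exponents
  have hs₁ := hF.s₁_pos
  have hs₂ := hF.s₂_pos
  have h := hF.abs_comb_le hu (ι := Fin 4) ![1, -1, -1, 1] (χ := fun s z => ENNReal.ofReal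
      (c * K ^ 4 / 2 * (((V s (z 0) + V s (z 1)) / 2 * nd T (z 0 - z 1)
        + (V s (z 2) + V s (z 3)) / 2 * nd T (z 2 - z 3)) * ((V s (z 0) + V s (z 2)) / 2
        * nd T (z 0 - z 2))))) ?_ ?_ ht
    ![x, y, x', y'] (A := (V t x + V t y + V t x' + V t y') / 4
      * ((V t x + V t y + V t x' + V t y') / 4 * (nd T ((x - y) - (x' - y'))
        + (nd T (x - y) + nd T (x' - y')) * nd T (x - x') / 2)
        + (K * nd T (x - y) + K * nd T (x' - y')) * (K * nd T (x - x')) / 2)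
      + c * K ^ 4 / 2 * (((V t x + V t y) / 2 * (K * nd T (x - y))
        + (V t x' + V t y') / 2 * (K * nd T (x' - y'))) * ((V t x + V t x') / 2
        * (K * nd T (x - x')))) * T) (by positivity) ?_
  · simp only [Fin.sum_univ_four, Matrix.cons_val, one_mul, neg_one_mul] at h
    have e : u t x + -u t y + -u t x' + u t y' = (u t x - u t y) - (u t x' - u t y') := by ring
    rw [e] at h
    refine h.trans ?_
    have h1 : Real.exp (c * (T - t)) ≤ K := by
      rw [hKdef]; exact Real.exp_le_exp.2 (by nlinarith [ht.1])
    refine (mul_le_mul_of_nonneg_left h1 (by positivity)).trans ?_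
    exact second_diff_bound (hKV x) (hKV y) (hKV x') (hKV y') hK hyK n2 n01 n23 n02
  · have hVi : ∀ i : Fin 4, Measurable fun q : ℝ × (Fin 4 → E) => V q.1 (q.2 i) := fun i =>
      hVm.comp (f := fun q : ℝ × (Fin 4 → E) => (q.1, q.2 i)) (by fun_prop)
    have hni : ∀ i j : Fin 4, Measurable fun q : ℝ × (Fin 4 → E) => nd T (q.2 i - q.2 j) :=
      fun i j => hnm.comp (by fun_prop)
    have := hVi 0
    have := hVi 1
    have := hVi 2
    have := hVi 3
    have := hni 0 1
    have := hni 2 3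
    have := hni 0 2
    fun_prop
  · intro s hs z
    simp only [Fin.sum_univ_four, Matrix.cons_val, one_mul, neg_one_mul,
      Real.enorm_eq_ofReal_abs]
    have q0 := hVp s (z 0)
    have q1 := hVp s (z 1)
    have q2 := hVp s (z 2)
    have q3 := hVp s (z 3)
    have m0 := nd_nonneg T (z 0 - z 1)
    have m1 := nd_nonneg T (z 2 - z 3)
    have m2 := nd_nonneg T (z 0 - z 2)
    rw [← ENNReal.ofReal_mul hc.le, ← ENNReal.ofReal_add (by positivity) (by positivity)]
    refine ENNReal.ofReal_le_ofReal ?_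
    have e : ∀ a b c d : ℝ, a + -b + -c + d = (a - b) - (c - d) := fun a b c d => by ring
    rw [e, e]
    refine (hF.f_diff _ _ _ _).trans (add_le_add le_rfl ?_)
    -- Each of the two factors of the quadratic term brings a Lipschitz constant K², whence the
    -- coefficient cK⁴/2 of the inhomogeneity.
    have l1 := hF.solution_lip hu hs (z 0) (z 1)
    have l2 := hF.solution_lip hu hs (z 2) (z 3)
    have l3 := hF.solution_lip hu hs (z 0) (z 2)
    rw [← hKdef] at l1 l2 l3
    calc _ ≤ c * (K ^ 2 * ((V s (z 0) + V s (z 1)) / 2) * nd T (z 0 - z 1)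
          + K ^ 2 * ((V s (z 2) + V s (z 3)) / 2) * nd T (z 2 - z 3))
          * (K ^ 2 * ((V s (z 0) + V s (z 2)) / 2) * nd T (z 0 - z 2)) / 2 := by gcongr
      _ = _ := by ring
  · simp only [Fin.sum_univ_four, Matrix.cons_val, one_mul, neg_one_mul,
      Real.enorm_eq_ofReal_abs]
    rw [ENNReal.ofReal_add (by positivity) (by positivity)]
    have lV := fun {r : ℝ} (hr : r ∈ Icc t T) (z : E) => hF.lb_V ht.1 hr.1 hr.2 z
    have ln := fun {r : ℝ} (hr : r ∈ Icc t T) (z w : E) => hF.lb_nd ht.1 hr.1 hr.2 z w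
    rw [← hKdef] at ln
    refine add_le_add ?_ ?_
    · have hTT : T ∈ Icc t T := ⟨ht.2, le_rfl⟩
      have k1 := ((((lV hTT x).add' (lV hTT y)).add' (lV hTT x')).add' (lV hTT y')).const_mul
        (a := 1 / 4) (by norm_num)
      have k2 := hF.X_diff t T ht.1 ht.2 le_rfl x y x' y'
      have k3 := ((((ln hTT x y).add' (ln hTT x' y')).mul (ln hTT x x') (r := 2 * s₂)
        (by linarith) (by linarith))).const_mul (a := 1 / 2) (by norm_num)
      have k4 := k1.mul (k2.add k3 (r := 2 * s₂) (by linarith) le_rfl (by linarith)) (r := 1)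
        (by linarith) le_rfl
      have hgx := fun z => hF.g_meas.comp (hF.measurable_X t T z)
      have k5 := k4.of_le (Z' := fun ω => g (X t T x ω) + -g (X t T y ω) + -g (X t T x' ω)
          + g (X t T y' ω))
        ((((hgx x).add (hgx y).neg).add (hgx x').neg).add (hgx y')).aestronglyMeasurable
        (Filter.Eventually.of_forall fun ω => by
          have e : ∀ a b c d : ℝ, a + -b + -c + d = (a - b) - (c - d) := fun a b c d => by ring
          rw [e]
          exact (hF.g_diff _ _ _ _).trans (le_of_eq (by ring)))
      exact (k5.mono_bound (le_of_eq (by ring))).lintegral_le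
    · refine (lintegral_Icc_le (M := c * K ^ 4 / 2 * (((V t x + V t y) / 2 * (K * nd T (x - y))
        + (V t x' + V t y') / 2 * (K * nd T (x' - y'))) * ((V t x + V t x') / 2
        * (K * nd T (x - x'))))) (by positivity) fun s hs => ?_).trans
        (ENNReal.ofReal_le_ofReal ?_)
      · have k1 := fun z w => (((lV hs z).add' (lV hs w)).const_mul (a := 1 / 2) (by norm_num)).mul
          (ln hs z w) (r := s₁ + s₂) le_rfl (by linarith)
        have k2 := ((((k1 x y).add' (k1 x' y')).mul (k1 x x') (r := 1) (by linarith)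
          le_rfl)).const_mul (a := c * K ^ 4 / 2) (by positivity)
        have k3 := (k2.mono_bound (b' := c * K ^ 4 / 2 * (((V t x + V t y) / 2 * (K * nd T (x - y))
          + (V t x' + V t y') / 2 * (K * nd T (x' - y'))) * ((V t x + V t x') / 2
          * (K * nd T (x - x'))))) (le_of_eq (by ring))).lintegral_le
        refine le_trans (lintegral_mono fun ω => ENNReal.ofReal_le_ofReal ?_) k3
        refine le_trans (le_of_eq ?_) (le_abs_self _)
        ring
      · refine mul_le_mul_of_nonneg_left ?_ (by positivity)
        linarith [ht.1]

end Estimates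

/-! ### Hölder-1/2 regularity of the solution in time. -/

section TimeRegularity

variable {E : Type u} {Ω : Type v} [NormedAddCommGroup E] [MeasurableSpace E] [BorelSpace E]
  [SecondCountableTopology E] [MeasurableSpace Ω] {P : Measure Ω} [IsProbabilityMeasure P]
  {s₁ s₂ c T : ℝ} {f : ℝ → ℝ} {g : E → ℝ} {V : ℝ → E → ℝ} {X : ℝ → ℝ → E → Ω → E}

/-- Here d is the parabolic time distance. Because d ≤ 1 and cT ≤ K/2, the time integral of length
d²T costs only one power of d and fits into the slack of the main term. -/
theorem diff_time_bound {a b a' b' K N m m' M c T d : ℝ} (ha : 1 ≤ a) (hb : 1 ≤ b) (ha' : 1 ≤ a')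
    (hb' : 1 ≤ b') (hK : 1 ≤ K) (hyK : 2 * (c * T) ≤ K) (hN : 0 ≤ N) (hm : 0 ≤ m)
    (hm' : 0 ≤ m') (hM : 0 ≤ M) (hd : 0 ≤ d) (hd1 : d ≤ 1) :
    2 * K ^ 8 * ((1 / 4 * (a + b + a' + b')) ^ (1 + 1) * ((a + b) / 2 * m * d + N
        + (K * m + m') * ((a + a') / 2 * (d / 2) + K * M)))
      + c * K ^ 3 * ((a + b) / 2) * m * (d ^ 2 * T) ≤
    2 * K ^ 10 * ((a + b + a' + b') / 4) ^ 2 *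
      (N + (m + m') * (4 * ((a + b + a' + b') / 4) * d + M)) := by
  obtain ⟨W, hW⟩ : ∃ W, W = (a + b + a' + b') / 4 := ⟨_, rfl⟩
  obtain ⟨S, hS⟩ : ∃ S, S = m + m' := ⟨_, rfl⟩
  have hS0 : 0 ≤ S := by rw [hS]; positivity
  have hK0 : 0 < K := by linarith
  have hW1 : 1 ≤ W := by rw [hW]; linarith
  have hW0 : 0 < W := by linarith
  have e0 : 1 / 4 * (a + b + a' + b') = W := by rw [hW]; ring
  rw [e0, ← hW, ← hS]
  have a1 : (a + b) / 2 ≤ 2 * W := by rw [hW]; linarith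
  have a3 : (a + a') / 2 ≤ 2 * W := by rw [hW]; linarith
  have mS : m ≤ S := by rw [hS]; linarith
  have kS : K * m + m' ≤ K * S := by rw [hS, mul_add]; nlinarith
  have c1 : c * K ^ 3 * ((a + b) / 2) * m * (d ^ 2 * T) ≤ K ^ 4 * W * S * d := by
    have h1 : c * K ^ 3 * ((a + b) / 2) * m * (d ^ 2 * T)
        = (c * T) * (K ^ 3 * ((a + b) / 2) * m * (d * d)) := by ring
    have h2 : 0 ≤ K ^ 3 * ((a + b) / 2) * m * (d * d) := by positivity
    have h3 : (c * T) * (K ^ 3 * ((a + b) / 2) * m * (d * d)) ≤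
        K / 2 * (K ^ 3 * (2 * W) * S * (d * 1)) := by
      refine mul_le_mul (by linarith) ?_ h2 (by positivity)
      gcongr
    rw [h1]; refine h3.trans (le_of_eq (by ring))
  have c2 : (a + b) / 2 * m * d + N + (K * m + m') * ((a + a') / 2 * (d / 2) + K * M) ≤
      2 * W * S * d + N + (K * S) * (2 * W * (d / 2) + K * M) := by gcongr
  have k10 : ∀ j ≤ 10, K ^ j ≤ K ^ 10 := fun j hj => pow_le_pow_right₀ hK hj
  have c3 : K ^ 4 * W * S * d ≤ K ^ 10 * (W ^ 3 * S * d) := by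
    have : W ≤ W ^ 3 := le_self_pow₀ hW1 (by norm_num)
    calc K ^ 4 * W * S * d ≤ K ^ 10 * W ^ 3 * S * d := by gcongr; norm_num
      _ = _ := by ring
  have c4 : 2 * K ^ 8 * (W ^ (1 + 1) * ((a + b) / 2 * m * d + N
      + (K * m + m') * ((a + a') / 2 * (d / 2) + K * M))) ≤
      2 * K ^ 8 * (W ^ (1 + 1) * (2 * W * S * d + N + (K * S) * (2 * W * (d / 2) + K * M))) := by
    gcongr
  have e1 : 2 * K ^ 8 * (W ^ (1 + 1) * (2 * W * S * d + N + (K * S) * (2 * W * (d / 2) + K * M)))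
      = 4 * (K ^ 8 * (W ^ 3 * S * d)) + 2 * (K ^ 8 * (W ^ 2 * N)) + 2 * (K ^ 9 * (W ^ 3 * S * d))
        + 2 * (K ^ 10 * (W ^ 2 * S * M)) := by ring
  have e2 : 2 * K ^ 10 * W ^ 2 * (N + S * (4 * W * d + M)) = 8 * (K ^ 10 * (W ^ 3 * S * d))
      + 2 * (K ^ 10 * (W ^ 2 * N)) + 2 * (K ^ 10 * (W ^ 2 * S * M)) := by ring
  rw [e2]
  have q1 : K ^ 8 * (W ^ 3 * S * d) ≤ K ^ 10 * (W ^ 3 * S * d) :=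
    mul_le_mul_of_nonneg_right (k10 8 (by norm_num)) (by positivity)
  have q2 : K ^ 8 * (W ^ 2 * N) ≤ K ^ 10 * (W ^ 2 * N) :=
    mul_le_mul_of_nonneg_right (k10 8 (by norm_num)) (by positivity)
  have q3 : K ^ 9 * (W ^ 3 * S * d) ≤ K ^ 10 * (W ^ 3 * S * d) :=
    mul_le_mul_of_nonneg_right (k10 9 (by norm_num)) (by positivity)
  have q4 : 0 ≤ K ^ 10 * (W ^ 3 * S * d) := by positivity
  linarith

variable (hF : Flow P s₁ s₂ c T f g V X)
include hF

/-- Dynamic programming: the equation at the random point (s,X^x_{t,s}) is averaged, Fubini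
exchanges the integrals, and the Markov property turns both terms into quantities of the flow
started at (t,x). -/
theorem Flow.solution_flow {u : ℝ → E → ℝ} (hu : Solution P T f g V X u) {t s : ℝ}
    (ht : 0 ≤ t) (hts : t ≤ s) (hs : s ≤ T) (x : E) :
    u t x = ∫ ω, u s (X t s x ω) ∂P + ∫ r in t..s, ∫ ω, f (u r (X t r x ω)) ∂P := by
  obtain ⟨C, hC⟩ := hu.growth
  have hsI : s ∈ Icc 0 T := ⟨ht.trans hts, hs⟩
  have hXm := hF.measurable_X t s x
  obtain ⟨h, hh⟩ : ∃ h : ℝ → E → ℝ, h = fun r z => ∫ ω, f (u r (X s r z ω)) ∂P := ⟨_, rfl⟩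
  have hhm : Measurable fun q : ℝ × E => h q.1 q.2 := by
    rw [hh]
    exact (hF.measurable_integral_f hC.meas).comp (f := fun q : ℝ × E => (s, q.2, q.1))
      (by fun_prop)
  have hhb : ∀ r ∈ Ioc s T, ∀ z, |h r z| ≤ |f 0| + c * (C * V s z) := fun r hr z => by
    rw [hh]; exact (hF.lb_f_comp hC hsI.1 hr.1.le hr.2 z).abs_integral_le
  have hVi : Integrable (fun ω => |f 0| + c * (C * V s (X t s x ω))) P :=
    (integrable_const _).add ((((hF.lb_V ht hts hs x).integrable).const_mul _).const_mul _)
  have hprod : Integrable (fun q : Ω × ℝ => h q.2 (X t s x q.1))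
      (P.prod (volume.restrict (Ioc s T))) := by
    refine Integrable.mono' (hVi.comp_fst _) ?_ ?_
    · exact (hhm.comp (measurable_snd.prodMk (hXm.comp measurable_fst))).aestronglyMeasurable
    · have e : P.prod (volume.restrict (Ioc s T)) = (P.prod volume).restrict (univ ×ˢ Ioc s T) := by
        rw [← Measure.prod_restrict, Measure.restrict_univ]
      rw [e]
      refine (ae_restrict_iff' (MeasurableSet.univ.prod measurableSet_Ioc)).2
        (Filter.Eventually.of_forall fun q hq => hhb q.2 hq.2 _)
  have e1 : ∫ ω, u s (X t s x ω) ∂P = ∫ ω, g (X t T x ω) ∂P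
      + ∫ r in s..T, ∫ ω, f (u r (X t r x ω)) ∂P := by
    have e2 : ∀ ω', u s (X t s x ω') = ∫ ω, g (X s T (X t s x ω') ω) ∂P
        + ∫ r in Ioc s T, h r (X t s x ω') := fun ω' => by
      rw [hu.eq s hsI, picardStep, intervalIntegral.integral_of_le hs, hh]
    have hg1 : Integrable (fun ω' => ∫ ω, g (X s T (X t s x ω') ω) ∂P) P := by
      refine Integrable.mono' (hF.lb_V ht hts hs x).integrable ?_
        (Filter.Eventually.of_forall fun ω' => (hF.lb_g hsI _).abs_integral_le)
      have : Measurable fun q : Ω × Ω => g (X s T (X t s x q.1) q.2) :=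
        hF.g_meas.comp (hF.proc.meas.comp (f := fun q : Ω × Ω => (s, T, X t s x q.1, q.2))
          (by fun_prop))
      exact this.stronglyMeasurable.integral_prod_right'.aestronglyMeasurable
    simp only [e2]
    rw [integral_add hg1 hprod.integral_prod_left,
      hF.markov_integral ht hts hs le_rfl x hF.g_meas (hF.lb_g ⟨ht, hts.trans hs⟩ x).integrable,
      integral_integral_swap (f := fun ω r => h r (X t s x ω)) hprod,
      intervalIntegral.integral_of_le hs]
    congr 1
    refine setIntegral_congr_fun measurableSet_Ioc fun r hr => ?_
    simp only [hh]
    exact hF.markov_integral ht hts hr.1.le hr.2 x (G := fun z => f (u r z))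
      (hF.f_meas.comp (hC.meas.comp measurable_prodMk_left))
      (hF.lb_f_comp hC ht (hts.trans hr.1.le) hr.2 x).integrable
  rw [hu.eq t ⟨ht, hts.trans hs⟩, picardStep, e1, add_assoc, add_comm (∫ r in s..T, _),
    intervalIntegral.integral_add_adjacent_intervals
      (hF.intervalIntegrable_f hC ht le_rfl hts hs x)
      (hF.intervalIntegrable_f hC ht hts hs le_rfl x)]

theorem Flow.measurable_solution_comp {u : ℝ → E → ℝ} (hu : Solution P T f g V X u)
    (t s : ℝ) (x : E) : Measurable fun ω => u s (X t s x ω) := by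
  obtain ⟨C, hC⟩ := hu.growth
  exact hC.meas.comp (measurable_const.prodMk (hF.measurable_X t s x))

theorem Flow.solution_growth {u : ℝ → E → ℝ} (hu : Solution P T f g V X u) :
    Growth T V (2 * Real.exp (c * T)) u := by
  obtain ⟨C, hC⟩ := hu.growth
  exact ⟨hC.meas, by positivity, fun t ht x => hF.abs_solution_le hu ht x⟩

/-- The point x is first moved to time s by the flow. There spatial Lipschitz continuity compares it
with y, and the remaining time integral has length s - t, which is of higher order. -/
theorem Flow.solution_time {u : ℝ → E → ℝ} (hu : Solution P T f g V X u) {t s : ℝ}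
    (ht : 0 ≤ t) (hts : t ≤ s) (hs : s ≤ T) (x y : E) :
    |u t x - u s y| ≤ Real.exp (c * T) ^ 2 * ((V t x + V s y) / 2)
      * (5 / 2 * ((V t x + V s y) / 2) * td T t s + Real.exp (c * T) * nd T (x - y)) := by
  have hc := hF.c_pos
  have hT := hF.T_pos
  have hK := hF.one_le_exp
  have hyK := two_mul_le_exp (c * T)
  have hC := hF.solution_growth hu
  have hsI : s ∈ Icc 0 T := ⟨ht.trans hts, hs⟩
  have htI : t ∈ Icc 0 T := ⟨ht, hts.trans hs⟩
  have v0 := hF.one_le_V t x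
  have v1 := hF.one_le_V s y
  have hex := hF.exponents
  have hs₁ := hF.s₁_pos
  have hs₂ := hF.s₂_pos
  have htd := td_nonneg T t s
  have htd1 := td_le_one hT htI hsI
  have hn := nd_nonneg T (x - y)
  have lV := hF.lb_V ht hts hs x
  have ln : LB P s₂ (fun ω => nd T (X t s x ω - y)) ((V t x + V s y) / 2 * (td T t s / 2)
      + Real.exp (c * T) * nd T (x - y)) := by
    have h1 := hF.proc.two t s s s ht hts hs hts le_rfl hs x y
    rw [td_self, add_zero] at h1
    refine h1.congr ?_
    filter_upwards [hF.start s hsI y] with ω hω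
    rw [hω]
  have l1 := (((lV.add' (LB.const hs₁ hF.s₁_le_one (a := V s y) (by linarith))).const_mul
    (a := Real.exp (c * T) ^ 2 / 2) (by positivity)).mul ln (r := 1) (by linarith) le_rfl)
  have l2 := l1.of_le (Z' := fun ω => u s (X t s x ω) - u s y)
    ((hF.measurable_solution_comp hu t s x).sub_const _).aestronglyMeasurable
    (Filter.Eventually.of_forall fun ω => (hF.solution_lip hu hsI _ _).trans
      (le_of_eq (by ring)))
  have h2 : |∫ r in t..s, ∫ ω, f (u r (X t r x ω)) ∂P| ≤
      (|f 0| + c * (2 * Real.exp (c * T) * V t x)) * |s - t| := by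
    refine intervalIntegral.norm_integral_le_of_norm_le_const (E := ℝ) fun r hr => ?_
    rw [uIoc_of_le hts] at hr
    exact (hF.lb_f_comp hC ht hr.1.le (hr.2.trans hs) x).abs_integral_le
  have h3 : |∫ ω, (u s (X t s x ω) - u s y) ∂P| ≤ _ := l2.abs_integral_le
  rw [integral_sub (hF.lb_comp hC ht hts hs x).integrable (integrable_const _)] at h3
  simp only [integral_const, probReal_univ, one_smul] at h3
  rw [hF.solution_flow hu ht hts hs x, add_sub_right_comm]
  refine (abs_add_le _ _).trans ((add_le_add h3 h2).trans ?_)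
  have h4 : |s - t| = td T t s ^ 2 * T := by
    rw [td_sq hT, abs_sub_comm]; field_simp
  -- One of the two factors of the squared time distance is bounded by 1, and the other is kept as
  -- the Hölder-1/2 modulus.
  have h5 : (|f 0| + c * (2 * Real.exp (c * T) * V t x)) * |s - t| ≤
      2 * Real.exp (c * T) ^ 2 * V t x * td T t s := by
    have a1 := hF.f_zero t x
    have a2 : (|f 0| + c * (2 * Real.exp (c * T) * V t x)) * |s - t|
        = (T * |f 0| + 2 * (c * T) * (Real.exp (c * T) * V t x)) * (td T t s * td T t s) := by
      rw [h4]; ring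
    have a3 : (T * |f 0| + 2 * (c * T) * (Real.exp (c * T) * V t x)) ≤
        1 * V t x + Real.exp (c * T) * (Real.exp (c * T) * V t x) := by
      rw [one_mul]; gcongr
    have a4 : 1 * V t x ≤ Real.exp (c * T) ^ 2 * V t x := by
      gcongr; exact one_le_pow₀ hK
    have a5 : td T t s * td T t s ≤ 1 * td T t s := by gcongr
    rw [a2]
    calc _ ≤ (2 * Real.exp (c * T) ^ 2 * V t x) * (1 * td T t s) :=
          mul_le_mul (by linarith) a5 (by positivity) (by positivity)
      _ = _ := by ring
  have h6 : V t x ≤ ((V t x + V s y) / 2) * ((V t x + V s y) / 2) := by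
    have : V t x * 1 ≤ V t x * V s y := by gcongr
    nlinarith [sq_nonneg (V t x - V s y)]
  have h7 : 2 * Real.exp (c * T) ^ 2 * V t x * td T t s ≤ 2 * Real.exp (c * T) ^ 2
      * (((V t x + V s y) / 2) * ((V t x + V s y) / 2)) * td T t s := by gcongr
  refine (add_le_add le_rfl (h5.trans h7)).trans (le_of_eq ?_)
  ring

/-- Both points are moved to time s by the same flow, where the second-difference bound at equal
times applies; the difference of the time integrals is of order s - t. -/
theorem Flow.solution_diff_time {u : ℝ → E → ℝ} (hu : Solution P T f g V X u) {t s : ℝ}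
    (ht : 0 ≤ t) (hts : t ≤ s) (hs : s ≤ T) (x y x' y' : E) :
    |(u t x - u t y) - (u s x' - u s y')| ≤ 2 * Real.exp (c * T) ^ 10
      * ((V t x + V t y + V s x' + V s y') / 4) ^ 2
      * (nd T ((x - y) - (x' - y')) + (nd T (x - y) + nd T (x' - y'))
        * (4 * ((V t x + V t y + V s x' + V s y') / 4) * td T t s + nd T (x - x'))) := by
  have hc := hF.c_pos
  have hT := hF.T_pos
  have hK := hF.one_le_exp
  have hyK := two_mul_le_exp (c * T)
  have hC := hF.solution_growth hu
  have hsI : s ∈ Icc 0 T := ⟨ht.trans hts, hs⟩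
  have htI : t ∈ Icc 0 T := ⟨ht, hts.trans hs⟩
  have v0 := hF.one_le_V t x
  have v1 := hF.one_le_V t y
  have v2 := hF.one_le_V s x'
  have v3 := hF.one_le_V s y'
  have hex := hF.exponents
  have hs₁ := hF.s₁_pos
  have hs₂ := hF.s₂_pos
  have htd := td_nonneg T t s
  have htd1 := td_le_one hT htI hsI
  have n2 := nd_nonneg T ((x - y) - (x' - y'))
  have n01 := nd_nonneg T (x - y)
  have n23 := nd_nonneg T (x' - y')
  have n02 := nd_nonneg T (x - x')
  have hnm := measurable_nd (E := E) T
  have hXx := hF.measurable_X t s x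
  have hXy := hF.measurable_X t s y
  have lVx := hF.lb_V ht hts hs x
  have lVy := hF.lb_V ht hts hs y
  have k1 := (((lVx.add' lVy).add' (LB.const hs₁ hF.s₁_le_one (a := V s x') (by linarith))).add'
    (LB.const hs₁ hF.s₁_le_one (a := V s y') (by linarith))).const_mul (a := 1 / 4) (by norm_num)
  have k1' := k1.pow 1 (r := 2 * s₁) (by norm_num) (by linarith)
  -- The distance between two particles changes over [t,s] by at most a multiple of √(s-t) times
  -- their initial distance, by `X_incr`; this keeps the factor |x - y| in the time modulus.
  have k2 : LB P s₂ (fun ω => nd T ((X t s x ω - X t s y ω) - (x' - y')))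
      ((V t x + V t y) / 2 * nd T (x - y) * td T s t + nd T ((x - y) - (x' - y'))) := by
    refine ((hF.X_incr t s ht hts hs x y).add' (LB.const hs₂ hF.s₂_le_one n2)).of_le
      (hnm.comp ((hXx.sub hXy).sub_const _)).aestronglyMeasurable
      (Filter.Eventually.of_forall fun ω => ?_)
    rw [abs_of_nonneg (nd_nonneg _ _)]
    refine le_trans (le_of_eq ?_) (nd_add_le _ _ _)
    congr 1; abel
  have k3 : LB P s₂ (fun ω => nd T (X t s x ω - x')) ((V t x + V s x') / 2 * (td T t s / 2)
      + Real.exp (c * T) * nd T (x - x')) := by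
    have h1 := hF.proc.two t s s s ht hts hs hts le_rfl hs x x'
    rw [td_self, add_zero] at h1
    refine h1.congr ?_
    filter_upwards [hF.start s hsI x'] with ω hω
    rw [hω]
  have k4 := (hF.lb_nd ht hts hs x y).add' (LB.const hs₂ hF.s₂_le_one n23)
  have k5 := (k1'.mul (k2.add (k4.mul k3 (r := 2 * s₂) (by linarith) (by linarith))
    (r := 2 * s₂) (by linarith) le_rfl (by linarith)) (r := 1) (by linarith) le_rfl).const_mul
    (a := 2 * Real.exp (c * T) ^ 8) (by positivity)
  have k6 := k5.of_le (Z' := fun ω => (u s (X t s x ω) - u s (X t s y ω)) - (u s x' - u s y'))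
    (((hF.measurable_solution_comp hu t s x).sub
      (hF.measurable_solution_comp hu t s y)).sub_const _).aestronglyMeasurable
    (Filter.Eventually.of_forall fun ω => (hF.solution_diff hu hsI _ _ _ _).trans
      (le_of_eq (by ring)))
  have h3 : |∫ ω, ((u s (X t s x ω) - u s (X t s y ω)) - (u s x' - u s y')) ∂P| ≤ _ :=
    k6.abs_integral_le
  have ix := (hF.lb_comp hC ht hts hs x).integrable
  have iy := (hF.lb_comp hC ht hts hs y).integrable
  have ixy : Integrable (fun ω => u s (X t s x ω) - u s (X t s y ω)) P := ix.sub iy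
  rw [integral_sub ixy (integrable_const _), integral_sub ix iy] at h3
  simp only [integral_const, probReal_univ, one_smul] at h3
  have h2 : |(∫ r in t..s, ∫ ω, f (u r (X t r x ω)) ∂P) - ∫ r in t..s, ∫ ω, f (u r (X t r y ω)) ∂P|
      ≤ (c * Real.exp (c * T) ^ 3 * ((V t x + V t y) / 2) * nd T (x - y)) * |s - t| := by
    rw [← intervalIntegral.integral_sub (μ := volume) (hF.intervalIntegrable_f hC ht le_rfl hts hs x)
      (hF.intervalIntegrable_f hC ht le_rfl hts hs y)]
    refine intervalIntegral.norm_integral_le_of_norm_le_const (E := ℝ) fun r hr => ?_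
    rw [uIoc_of_le hts] at hr
    have jx := (hF.lb_f_comp hC ht hr.1.le (hr.2.trans hs) x)
    have jy := (hF.lb_f_comp hC ht hr.1.le (hr.2.trans hs) y)
    rw [← integral_sub jx.integrable jy.integrable]
    have m1 := ((((hF.lb_V ht hr.1.le (hr.2.trans hs) x).add'
      (hF.lb_V ht hr.1.le (hr.2.trans hs) y)).const_mul (a := c * Real.exp (c * T) ^ 2 / 2)
      (by positivity)).mul (hF.lb_nd ht hr.1.le (hr.2.trans hs) x y) (r := 1) (by linarith) le_rfl)
    have m2 := m1.of_le (Z' := fun ω => f (u r (X t r x ω)) - f (u r (X t r y ω)))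
      (jx.meas.sub jy.meas) (Filter.Eventually.of_forall fun ω => by
        refine (hF.f_lip _ _).trans ?_
        refine (mul_le_mul_of_nonneg_left (hF.solution_lip hu
          ⟨ht.trans hr.1.le, hr.2.trans hs⟩ _ _) hc.le).trans (le_of_eq ?_)
        ring)
    exact m2.abs_integral_le.trans (le_of_eq (by ring))
  have e : (u t x - u t y) - (u s x' - u s y') =
      ((∫ ω, u s (X t s x ω) ∂P - ∫ ω, u s (X t s y ω) ∂P) - (u s x' - u s y'))
      + ((∫ r in t..s, ∫ ω, f (u r (X t r x ω)) ∂P) - ∫ r in t..s, ∫ ω, f (u r (X t r y ω)) ∂P) := by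
    rw [hF.solution_flow hu ht hts hs x, hF.solution_flow hu ht hts hs y]; ring
  rw [e]
  refine (abs_add_le _ _).trans ((add_le_add h3 h2).trans ?_)
  have h4 : |s - t| = td T t s ^ 2 * T := by
    rw [td_sq hT, abs_sub_comm]; field_simp
  rw [h4, td_comm T s t]
  exact diff_time_bound v0 v1 v2 v3 hK hyK n2 n01 n23 n02 htd htd1

end TimeRegularity

/-! ### The tree of indices. -/

section Indices

/-- The indices which extend `θ` properly. -/
def strictExt (θ : Idx) : Set Idx := {ζ | θ.1 <+: ζ.1 ∧ θ.1.length < ζ.1.length}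

/-- The indices which extend `(θ, ℓ)`. -/
def levelSet (θ : Idx) (ℓ : ℤ) : Set Idx := {ζ | (θ.1 ++ [ℓ]) <+: ζ.1}

/-- The indices which extend `(θ, ℓ, i)` or `(θ, ℓ, -i)`. -/
def branch (θ : Idx) (ℓ : ℤ) (i : ℕ) : Set Idx :=
  {ζ | ∃ j : ℤ, j.natAbs = i ∧ (θ.1 ++ [ℓ, j]) <+: ζ.1}

/-- Source of the disjointness statements for levels, branches and subtrees: an index determines its
prefix of any given length. -/
theorem prefix_unique {l₁ l₂ l : List ℤ} (h₁ : l₁ <+: l) (h₂ : l₂ <+: l)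
    (hl : l₁.length = l₂.length) : l₁ = l₂ :=
  (List.prefix_of_prefix_length_le h₁ h₂ hl.le).eq_of_length hl

theorem ext_mem_branch (θ : Idx) (ℓ j : ℤ) : θ.ext ℓ j ∈ branch θ ℓ j.natAbs :=
  ⟨j, rfl, List.prefix_rfl⟩

theorem strictExt_ext_subset_branch (θ : Idx) (ℓ j : ℤ) :
    strictExt (θ.ext ℓ j) ⊆ branch θ ℓ j.natAbs := fun _ h => ⟨j, rfl, h.1⟩

theorem branch_subset_levelSet (θ : Idx) (ℓ : ℤ) (i : ℕ) : branch θ ℓ i ⊆ levelSet θ ℓ := by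
  rintro ζ ⟨j, -, h⟩
  refine List.IsPrefix.trans ?_ h
  exact ⟨[j], by simp⟩

theorem levelSet_subset_strictExt (θ : Idx) (ℓ : ℤ) : levelSet θ ℓ ⊆ strictExt θ := by
  intro ζ h
  have h' : (θ.1 ++ [ℓ]) <+: ζ.1 := h
  refine ⟨(List.prefix_append _ _).trans h', ?_⟩
  have := h'.length_le
  simp at this; omega

theorem disjoint_branch (θ : Idx) (ℓ : ℤ) {i i' : ℕ} (h : i ≠ i') :
    Disjoint (branch θ ℓ i) (branch θ ℓ i') := by
  rw [Set.disjoint_left]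
  rintro ζ ⟨j, hj, h1⟩ ⟨j', hj', h2⟩
  have := prefix_unique h1 h2 (by simp)
  simp at this
  exact h (by rw [← hj, ← hj', this])

theorem disjoint_levelSet (θ : Idx) {ℓ ℓ' : ℤ} (h : ℓ ≠ ℓ') :
    Disjoint (levelSet θ ℓ) (levelSet θ ℓ') := by
  rw [Set.disjoint_left]
  intro ζ h1 h2
  have := prefix_unique h1 h2 (by simp)
  simp at this
  exact h this

theorem disjoint_strictExt (θ : Idx) (ℓ : ℤ) {j j' : ℤ} (h : j ≠ j') :
    Disjoint (strictExt (θ.ext ℓ j)) (strictExt (θ.ext ℓ j')) := by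
  rw [Set.disjoint_left]
  rintro ζ ⟨h1, -⟩ ⟨h2, -⟩
  have := prefix_unique h1 h2 (by simp [Idx.ext])
  simp [Idx.ext] at this
  exact h this

/-- A strict extension of θ is longer than θ, so an index that is no longer than θ never occurs
inside the approximation rooted at θ. -/
theorem disjoint_singleton_strictExt {η θ : Idx} (h : η.1.length ≤ θ.1.length) :
    Disjoint {η} (strictExt θ) := by
  rw [Set.disjoint_singleton_left]
  rintro ⟨-, h'⟩
  omega

end Indices

/-! ### The multilevel recursion and its measurability. -/

section Recursion

variable {E : Type u} {Ω : Type v}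

/-- The summand `g(𝒳^k_{t,T}) + (T-t) f(U_ℓ(ρ, 𝒳^k_{t,ρ}))`, where the time and the path carry the
index `η` and `U_ℓ` carries the index `η'`. -/
noncomputable def fullVal (T : ℝ) (f : ℝ → ℝ) (g : E → ℝ) (τ : Idx → Ω → ℝ)
    (Y : ℕ → Idx → ℝ → ℝ → E → Ω → E) (m k ℓ : ℕ) (η η' : Idx) (t : ℝ) (x : E) (ω : Ω) : ℝ :=
  g (Y k η t T x ω) + (T - t) * f (mlp T f g τ Y m ℓ η' (t + (T - t) * τ η ω)
    (Y k η t (t + (T - t) * τ η ω) x ω) ω)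

/-- The summand of level `ℓ` and number `i` in the multilevel Picard approximation. -/
noncomputable def mlpTerm (T : ℝ) (f : ℝ → ℝ) (g : E → ℝ) (τ : Idx → Ω → ℝ)
    (Y : ℕ → Idx → ℝ → ℝ → E → Ω → E) (m ℓ : ℕ) (θ : Idx) (i : ℕ) (t : ℝ) (x : E) (ω : Ω) : ℝ :=
  fullVal T f g τ Y m (m ^ ℓ) ℓ (θ.ext ℓ i) (θ.ext ℓ i) t x ω
    - if 1 ≤ ℓ then fullVal T f g τ Y m (m ^ (ℓ - 1)) (ℓ - 1) (θ.ext ℓ i) (θ.ext ℓ (-(i : ℤ))) t x ω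
      else 0

/-- Samples are numbered i + 1 with i starting at 0, which suits range sums and keeps the roots
(θ,ℓ,i+1) and (θ,ℓ,-(i+1)) distinct. -/
theorem mlp_eq (T : ℝ) (f : ℝ → ℝ) (g : E → ℝ) (τ : Idx → Ω → ℝ)
    (Y : ℕ → Idx → ℝ → ℝ → E → Ω → E) (m n : ℕ) (θ : Idx) (t : ℝ) (x : E) (ω : Ω) :
    mlp T f g τ Y m n θ t x ω = ∑ ℓ ∈ Finset.range n, 1 / (m : ℝ) ^ (n - ℓ) *
      ∑ i ∈ Finset.range (m ^ (n - ℓ)), mlpTerm T f g τ Y m ℓ θ (i + 1) t x ω := by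
  rw [mlp, ← Fin.sum_univ_eq_sum_range (fun ℓ => 1 / (m : ℝ) ^ (n - ℓ) *
      ∑ i ∈ Finset.range (m ^ (n - ℓ)), mlpTerm T f g τ Y m ℓ θ (i + 1) t x ω)]
  refine Finset.sum_congr rfl fun ℓ _ => ?_
  congr 1
  rw [Finset.range_eq_Ico, Finset.sum_Ico_add' (fun i => mlpTerm T f g τ Y m ℓ θ i t x ω), zero_add]
  refine Finset.sum_congr (by ext; simp) fun i _ => ?_
  simp only [mlpTerm, fullVal]
  split_ifs <;> ring

theorem mlp_zero (T : ℝ) (f : ℝ → ℝ) (g : E → ℝ) (τ : Idx → Ω → ℝ)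
    (Y : ℕ → Idx → ℝ → ℝ → E → Ω → E) (m : ℕ) (θ : Idx) (t : ℝ) (x : E) (ω : Ω) :
    mlp T f g τ Y m 0 θ t x ω = 0 := by
  rw [mlp_eq]; simp

/-- Joint measurability of a two-parameter random field of positions. -/
def FieldMeas [MeasurableSpace E] (m : MeasurableSpace Ω) (Z : ℝ → ℝ → E → Ω → E) : Prop :=
  Measurable fun z : ℝ × ℝ × E × Ω => Z z.1 z.2.1 z.2.2.1 z.2.2.2

theorem FieldMeas.mono [MeasurableSpace E] {m m' : MeasurableSpace Ω} {Z : ℝ → ℝ → E → Ω → E}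
    (h : FieldMeas m Z) (hm : m ≤ m') : FieldMeas m' Z := by
  unfold FieldMeas at h ⊢
  have hid : @Measurable Ω Ω m' m id := measurable_id'' hm
  have : @Measurable (ℝ × ℝ × E × Ω) (ℝ × ℝ × E × Ω)
      (@Prod.instMeasurableSpace _ _ _ (@Prod.instMeasurableSpace _ _ _
        (@Prod.instMeasurableSpace _ _ _ m')))
      (@Prod.instMeasurableSpace _ _ _ (@Prod.instMeasurableSpace _ _ _
        (@Prod.instMeasurableSpace _ _ _ m)))
      (fun z => (z.1, z.2.1, z.2.2.1, id z.2.2.2)) :=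
    measurable_fst.prodMk ((measurable_fst.comp measurable_snd).prodMk
      ((measurable_fst.comp (measurable_snd.comp measurable_snd)).prodMk
      (hid.comp (measurable_snd.comp (measurable_snd.comp measurable_snd)))))
  exact h.comp this

theorem FieldMeas.comp [MeasurableSpace E] {m : MeasurableSpace Ω} {Z : ℝ → ℝ → E → Ω → E}
    (h : FieldMeas m Z) {A : Type*} {mA : MeasurableSpace A} {s t : A → ℝ} {x : A → E} {w : A → Ω}
    (hs : Measurable s) (ht : Measurable t) (hx : Measurable x) (hw : Measurable w) :
    Measurable fun a => Z (s a) (t a) (x a) (w a) :=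
  Measurable.comp (g := fun z : ℝ × ℝ × E × Ω => Z z.1 z.2.1 z.2.2.1 z.2.2.2) h
    (hs.prodMk (ht.prodMk (hx.prodMk hw)))

variable {T : ℝ} {f : ℝ → ℝ} {g : E → ℝ} {τ : Idx → Ω → ℝ}
    {Y : ℕ → Idx → ℝ → ℝ → E → Ω → E} {M : ℕ}

/-- The random times and paths with indices in `A` are measurable with respect to `m`. -/
structure Known [MeasurableSpace E] (τ : Idx → Ω → ℝ) (Y : ℕ → Idx → ℝ → ℝ → E → Ω → E)
    (m : MeasurableSpace Ω) (A : Set Idx) : Prop where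
  time : ∀ ζ ∈ A, Measurable (τ ζ)
  path : ∀ k, 1 ≤ k → ∀ ζ ∈ A, FieldMeas m (Y k ζ)

theorem Known.subset [MeasurableSpace E] {m : MeasurableSpace Ω} {A B : Set Idx}
    (h : Known τ Y m B) (hAB : A ⊆ B) : Known τ Y m A :=
  ⟨fun ζ hζ => h.time ζ (hAB hζ), fun k hk ζ hζ => h.path k hk ζ (hAB hζ)⟩

theorem measurable_fullVal_of [MeasurableSpace E] {m : MeasurableSpace Ω} (hf : Measurable f)
    (hg : Measurable g) {k ℓ : ℕ} (hk : 1 ≤ k) {η η' : Idx} (h : Known τ Y m {η})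
    (hU : Measurable fun z : ℝ × E × Ω => mlp T f g τ Y M ℓ η' z.1 z.2.1 z.2.2) :
    Measurable fun z : ℝ × E × Ω => fullVal T f g τ Y M k ℓ η η' z.1 z.2.1 z.2.2 := by
  have hτ := h.time η rfl
  have hY := h.path k hk η rfl
  have hρ : Measurable fun z : ℝ × E × Ω => z.1 + (T - z.1) * τ η z.2.2 := by fun_prop
  have h1 : Measurable fun z : ℝ × E × Ω => Y k η z.1 T z.2.1 z.2.2 :=
    hY.comp (by fun_prop) (by fun_prop) (by fun_prop) (by fun_prop)
  have h2 : Measurable fun z : ℝ × E × Ω =>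
      Y k η z.1 (z.1 + (T - z.1) * τ η z.2.2) z.2.1 z.2.2 :=
    hY.comp (by fun_prop) hρ (by fun_prop) (by fun_prop)
  have h3 : Measurable fun z : ℝ × E × Ω => mlp T f g τ Y M ℓ η' (z.1 + (T - z.1) * τ η z.2.2)
      (Y k η z.1 (z.1 + (T - z.1) * τ η z.2.2) z.2.1 z.2.2) z.2.2 :=
    hU.comp (f := fun z : ℝ × E × Ω => (z.1 + (T - z.1) * τ η z.2.2,
      Y k η z.1 (z.1 + (T - z.1) * τ η z.2.2) z.2.1 z.2.2, z.2.2)) (hρ.prodMk (h2.prodMk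
        (by fun_prop)))
  exact (hg.comp h1).add ((measurable_const.sub measurable_fst).mul (hf.comp h3))

/-- An approximation rooted at θ involves only times and paths whose indices strictly extend θ. The
σ-algebra on Ω is left arbitrary so that the information of exactly those indices can be inserted.
-/
theorem measurable_mlp [MeasurableSpace E] {m : MeasurableSpace Ω} (hf : Measurable f)
    (hg : Measurable g) (hM : 1 ≤ M) (n : ℕ) : ∀ θ : Idx, Known τ Y m (strictExt θ) →
    Measurable fun z : ℝ × E × Ω => mlp T f g τ Y M n θ z.1 z.2.1 z.2.2 := by
  induction n using Nat.strong_induction_on with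
  | _ n ih =>
    intro θ h
    simp only [mlp_eq]
    refine Finset.measurable_fun_sum _ fun ℓ hℓ => Measurable.const_mul
      (Finset.measurable_fun_sum _ fun i _ => ?_) _
    have hℓn : ℓ < n := Finset.mem_range.1 hℓ
    have hsub : ∀ j : ℤ, insert (θ.ext ℓ j) (strictExt (θ.ext ℓ j)) ⊆ strictExt θ := fun j =>
      (insert_subset (ext_mem_branch θ ℓ j) (strictExt_ext_subset_branch θ ℓ j)).trans
        ((branch_subset_levelSet _ _ _).trans (levelSet_subset_strictExt _ _))
    have hη : ∀ j : ℤ, Known τ Y m {θ.ext ℓ j} := fun j => h.subset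
      ((singleton_subset_iff.2 (mem_insert _ _)).trans (hsub j))
    have hS : ∀ j : ℤ, Known τ Y m (strictExt (θ.ext ℓ j)) := fun j => h.subset
      ((subset_insert _ _).trans (hsub j))
    unfold mlpTerm
    refine Measurable.sub (measurable_fullVal_of hf hg (Nat.one_le_pow _ _ hM) (hη _)
      (ih ℓ hℓn _ (hS _))) ?_
    split_ifs with h1
    · exact measurable_fullVal_of hf hg (Nat.one_le_pow _ _ hM) (hη _) (ih (ℓ - 1) (by omega) _ (hS _))
    · exact measurable_const

theorem measurable_fullVal [MeasurableSpace E] {m : MeasurableSpace Ω} (hf : Measurable f)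
    (hg : Measurable g) (hM : 1 ≤ M) {k : ℕ} (ℓ : ℕ) (hk : 1 ≤ k) {η η' : Idx}
    (h : Known τ Y m {η}) (h' : Known τ Y m (strictExt η')) :
    Measurable fun z : ℝ × E × Ω => fullVal T f g τ Y M k ℓ η η' z.1 z.2.1 z.2.2 :=
  measurable_fullVal_of hf hg hk h (measurable_mlp hf hg hM ℓ η' h')

theorem measurable_mlpTerm [MeasurableSpace E] {m : MeasurableSpace Ω} (hf : Measurable f)
    (hg : Measurable g) (hM : 1 ≤ M) (ℓ : ℕ) (θ : Idx) (i : ℕ) (h : Known τ Y m (branch θ ℓ i)) :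
    Measurable fun z : ℝ × E × Ω => mlpTerm T f g τ Y M ℓ θ i z.1 z.2.1 z.2.2 := by
  have h1 : Known τ Y m {θ.ext ℓ i} := h.subset
    (singleton_subset_iff.2 (by simpa using ext_mem_branch θ ℓ i))
  have h2 : Known τ Y m (strictExt (θ.ext ℓ i)) := h.subset
    (by simpa using strictExt_ext_subset_branch θ ℓ i)
  have h3 : Known τ Y m (strictExt (θ.ext ℓ (-(i : ℤ)))) := h.subset
    (by simpa using strictExt_ext_subset_branch θ ℓ (-(i : ℤ)))
  unfold mlpTerm
  refine (measurable_fullVal hf hg hM ℓ (Nat.one_le_pow _ _ hM) h1 h2).sub ?_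
  split_ifs with h0
  · exact measurable_fullVal hf hg hM (ℓ - 1) (Nat.one_le_pow _ _ hM) h1 h3
  · exact measurable_const

end Recursion

/-! ### Information carried by sets of indices. -/

section Independence

variable {E : Type u} {Ω : Type v} [NormedAddCommGroup E] [MeasurableSpace E]

/-- The information carried by the random times with indices in `A` and by the paths with indices
in `B`. -/
@[reducible] def info (τ : Idx → Ω → ℝ) (mY : Idx → MeasurableSpace Ω) (A B : Set Idx) : MeasurableSpace Ω :=
  (⨆ θ ∈ A, MeasurableSpace.comap (τ θ) inferInstance) ⊔ ⨆ θ ∈ B, mY θ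

variable [mΩ : MeasurableSpace Ω]

/-- The random times and the approximating paths in normalized form; `mY θ` is the information
carried by the paths with index `θ`. -/
structure Approx (P : Measure Ω) (s₁ s₂ c T : ℝ) (V : ℝ → E → ℝ) (τ : Idx → Ω → ℝ)
    (Y : ℕ → Idx → ℝ → ℝ → E → Ω → E) (mY : Idx → MeasurableSpace Ω) : Prop where
  τ_meas : ∀ θ, Measurable (τ θ)
  τ_mem : ∀ θ ω, τ θ ω ∈ Icc (0 : ℝ) 1
  τ_law : ∀ θ, P.map (τ θ) = volume.restrict (Icc 0 1)
  mY_le : ∀ θ, mY θ ≤ mΩ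
  Y_meas : ∀ k, 1 ≤ k → ∀ θ, FieldMeas (mY θ) (Y k θ)
  τ_indep : iIndep (fun θ => MeasurableSpace.comap (τ θ) inferInstance) P
  Y_indep : iIndep mY P
  τY_indep : Indep (⨆ θ, MeasurableSpace.comap (τ θ) inferInstance) (⨆ θ, mY θ) P
  proc : ∀ k, 1 ≤ k → ∀ θ, Proc P s₁ s₂ c T V (Y k θ)
  close : ∀ n k, 1 ≤ n → 1 ≤ k → ∀ θ,
    Close P s₂ T V (Y n θ) (Y k θ) (1 / √(n : ℝ) + 1 / √(k : ℝ))
  ident : ∀ θ θ' (n : ℕ) (q : Fin n → ℕ × ℝ × ℝ × E), (∀ i, 1 ≤ (q i).1) →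
    IdentDistrib (fun ω i => Y (q i).1 θ (q i).2.1 (q i).2.2.1 (q i).2.2.2 ω)
      (fun ω i => Y (q i).1 θ' (q i).2.1 (q i).2.2.1 (q i).2.2.2 ω) P P

variable {P : Measure Ω} [IsProbabilityMeasure P]
  {s₁ s₂ c T : ℝ} {V : ℝ → E → ℝ} {τ : Idx → Ω → ℝ}
  {Y : ℕ → Idx → ℝ → ℝ → E → Ω → E} {mY : Idx → MeasurableSpace Ω}

theorem info_mono {A A' B B' : Set Idx} (hA : A ⊆ A') (hB : B ⊆ B') :
    info τ mY A B ≤ info τ mY A' B' :=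
  sup_le_sup (biSup_mono fun _ h => hA h) (biSup_mono fun _ h => hB h)

theorem comap_le_info {A B : Set Idx} {θ : Idx} (h : θ ∈ A) :
    MeasurableSpace.comap (τ θ) inferInstance ≤ info τ mY A B :=
  le_sup_of_le_left (le_iSup₂_of_le θ h le_rfl)

theorem mY_le_info {A B : Set Idx} {θ : Idx} (h : θ ∈ B) : mY θ ≤ info τ mY A B :=
  le_sup_of_le_right (le_iSup₂_of_le θ h le_rfl)

variable (hA : Approx P s₁ s₂ c T V τ Y mY)
include hA

theorem Approx.comap_le (θ : Idx) : MeasurableSpace.comap (τ θ) inferInstance ≤ mΩ :=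
  (hA.τ_meas θ).comap_le

theorem Approx.info_le (A B : Set Idx) : info τ mY A B ≤ mΩ :=
  sup_le (iSup₂_le fun θ _ => hA.comap_le θ) (iSup₂_le fun θ _ => hA.mY_le θ)

theorem Approx.known (A : Set Idx) : Known τ Y (info τ mY A A) A := by
  refine ⟨fun ζ hζ => ?_, fun k hk ζ hζ => (hA.Y_meas k hk ζ).mono (mY_le_info hζ)⟩
  exact (comap_measurable (τ ζ)).mono (comap_le_info hζ) le_rfl

/-- Times are independent across indices, so are paths, and the whole family of times is independent
of the whole family of paths; `Indep.sup_sup` combines the three facts. -/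
theorem Approx.indep_info {A A' B B' : Set Idx} (h : Disjoint A A') (h' : Disjoint B B') :
    Indep (info τ mY A B) (info τ mY A' B') P := by
  refine Indep.sup_sup (iSup₂_le fun θ _ => hA.comap_le θ) (iSup₂_le fun θ _ => hA.comap_le θ)
    (iSup₂_le fun θ _ => hA.mY_le θ) (iSup₂_le fun θ _ => hA.mY_le θ)
    (indep_iSup_of_disjoint hA.comap_le hA.τ_indep h)
    (indep_iSup_of_disjoint hA.mY_le hA.Y_indep h') ?_
  refine indep_of_indep_of_le_left (indep_of_indep_of_le_right hA.τY_indep ?_) ?_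
  · exact sup_le (iSup₂_le fun θ _ => le_iSup _ θ) (iSup₂_le fun θ _ => le_iSup _ θ)
  · exact sup_le (iSup₂_le fun θ _ => le_iSup
      (fun θ => MeasurableSpace.comap (τ θ) inferInstance) θ) (iSup₂_le fun θ _ => le_iSup
      (fun θ => MeasurableSpace.comap (τ θ) inferInstance) θ)

/-- A function of a random time, of a path at this time and of independent information. -/
theorem Approx.eval_freeze {S Ω' : Type*} [MeasurableSpace S] [mΩ' : MeasurableSpace Ω'] {η : Idx}
    {W' : Ω → Ω'} (hW' : Measurable W')
    (hind : Indep (info τ mY {η} {η}) (MeasurableSpace.comap W' mΩ') P) {Z : ℝ → Ω → S}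
    (hZ : @Measurable (ℝ × Ω) S (@Prod.instMeasurableSpace _ _ _ (mY η)) _ fun q => Z q.1 q.2)
    {F : ℝ × S → Ω' → ℝ} (hF : Measurable fun q : (ℝ × S) × Ω' => F q.1 q.2)
    {p : ℝ} (hp : 1 ≤ p) {w : ℝ → ℝ} {b : ℝ → S → ℝ} (hb : Measurable fun q : ℝ × S => b q.1 q.2)
    (hw : Measurable w) (hw0 : ∀ r, 0 ≤ w r) {W β : ℝ}
    (h1 : ∀ r ∈ Icc (0 : ℝ) 1, ∀ z, eLpNorm (fun ω => F (r, z) (W' ω)) (ENNReal.ofReal p) P ≤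
      ENNReal.ofReal (w r * b r z))
    (h2 : ∀ r ∈ Icc (0 : ℝ) 1, LB P p⁻¹ (fun ω => b r (Z r ω)) β)
    (hW : LB P p⁻¹ (fun ω => w (τ η ω)) W) :
    LB P p⁻¹ (fun ω => F (τ η ω, Z (τ η ω) ω) (W' ω)) (W * β) := by
  have hp0 : 0 < p := by linarith
  have hZΩ : Measurable fun q : ℝ × Ω => Z q.1 q.2 := by
    have : @Measurable (ℝ × Ω) (ℝ × Ω) _ (@Prod.instMeasurableSpace _ _ _ (mY η))
        (fun q => (q.1, id q.2)) :=
      measurable_fst.prodMk ((measurable_id'' (hA.mY_le η)).comp measurable_snd)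
    exact hZ.comp this
  have hτ := hA.τ_meas η
  have hQ : Measurable fun ω => (τ η ω, Z (τ η ω) ω) :=
    hτ.prodMk (hZΩ.comp (hτ.prodMk measurable_id))
  have hQinfo : MeasurableSpace.comap (fun ω => (τ η ω, Z (τ η ω) ω)) inferInstance ≤
      info τ mY {η} {η} := by
    refine Measurable.comap_le ?_
    have t1 : Measurable[info τ mY {η} {η}] (τ η) :=
      (comap_measurable (τ η)).mono (comap_le_info rfl) le_rfl
    have t2 : @Measurable Ω Ω (info τ mY {η} {η}) (mY η) id := measurable_id'' (mY_le_info rfl)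
    exact t1.prodMk (hZ.comp (t1.prodMk t2))
  have i1 : IndepFun (fun ω => (τ η ω, Z (τ η ω) ω)) W' P :=
    (IndepFun_iff_Indep _ _ _).2 (indep_of_indep_of_le_left hind hQinfo)
  -- Two freezings: here the independent information is integrated with time and path position
  -- fixed; in `e2` the path is integrated with the time fixed, so that only the weight w of the
  -- random time remains.
  have e1 := eLpNorm_freeze_le hp0 hQ hW' i1 hF
    (b := fun ω => w (τ η ω) * b (τ η ω) (Z (τ η ω) ω)) fun ω' => h1 _ (hA.τ_mem η ω') _
  have i2 : @IndepFun Ω ℝ Ω mΩ _ (mY η) (τ η) id P := by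
    refine indepFun_id_of_indep ?_
    exact indep_of_indep_of_le_left (indep_of_indep_of_le_right hA.τY_indep (le_iSup _ η))
      (le_iSup (fun θ => MeasurableSpace.comap (τ θ) inferInstance) η)
  have hβ : 0 ≤ β := (h2 0 ⟨le_rfl, zero_le_one⟩).nonneg
  have e2 := eLpNorm_freeze_le (mΩ' := mY η) hp0 hτ (measurable_id'' (hA.mY_le η)) i2
    (F := fun r ω => w r * b r (Z r ω)) (b := fun ω => w (τ η ω) * β) ?_ ?_
  · have e3 := (hW.const_mul hβ)
    refine ⟨by positivity, inv_le_one_of_one_le₀ hp, ?_, mul_nonneg hW.nonneg hβ, ?_⟩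
    · exact (hF.comp (hQ.prodMk hW')).aestronglyMeasurable
    · rw [inv_inv]
      refine e1.trans (e2.trans ?_)
      have := e3.norm_le
      rw [inv_inv] at this
      simpa only [mul_comm] using this
  · exact (hw.comp measurable_fst).mul (hb.comp (measurable_fst.prodMk hZ))
  · intro ω'
    have := ((h2 _ (hA.τ_mem η ω')).const_mul (hw0 (τ η ω'))).norm_le
    rwa [inv_inv] at this

/-- The law of a function of a random time, of a path at this time and of independent information
depends only on the laws of the ingredients. -/
theorem Approx.eval_identDistrib {S Ω' Ω₂ : Type*} [MeasurableSpace S] [mΩ' : MeasurableSpace Ω']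
    [mΩ₂ : MeasurableSpace Ω₂] {η η₂ : Idx} {W' : Ω → Ω'} {W₂ : Ω → Ω₂} (hW' : Measurable W')
    (hW₂ : Measurable W₂) (hind : Indep (info τ mY {η} {η}) (MeasurableSpace.comap W' mΩ') P)
    (hind₂ : Indep (info τ mY {η₂} {η₂}) (MeasurableSpace.comap W₂ mΩ₂) P)
    {Z Z₂ : ℝ → Ω → S}
    (hZ : @Measurable (ℝ × Ω) S (@Prod.instMeasurableSpace _ _ _ (mY η)) _ fun q => Z q.1 q.2)
    (hZ₂ : @Measurable (ℝ × Ω) S (@Prod.instMeasurableSpace _ _ _ (mY η₂)) _ fun q => Z₂ q.1 q.2)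
    {F : ℝ × S → Ω' → ℝ} {F₂ : ℝ × S → Ω₂ → ℝ}
    (hF : Measurable fun q : (ℝ × S) × Ω' => F q.1 q.2)
    (hF₂ : Measurable fun q : (ℝ × S) × Ω₂ => F₂ q.1 q.2)
    (hZZ : ∀ r ∈ Icc (0 : ℝ) 1, IdentDistrib (Z r) (Z₂ r) P P)
    (hFF : ∀ r ∈ Icc (0 : ℝ) 1, ∀ z, IdentDistrib (fun ω => F (r, z) (W' ω))
      (fun ω => F₂ (r, z) (W₂ ω)) P P) :
    IdentDistrib (fun ω => F (τ η ω, Z (τ η ω) ω) (W' ω))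
      (fun ω => F₂ (τ η₂ ω, Z₂ (τ η₂ ω) ω) (W₂ ω)) P P := by
  have mQ : ∀ {η : Idx} {Z : ℝ → Ω → S},
      (@Measurable (ℝ × Ω) S (@Prod.instMeasurableSpace _ _ _ (mY η)) _ fun q => Z q.1 q.2) →
      Measurable fun ω => (τ η ω, Z (τ η ω) ω) := fun {η Z} hZ => by
    have : @Measurable Ω (ℝ × Ω) _ (@Prod.instMeasurableSpace _ _ _ (mY η))
        (fun ω => (τ η ω, id ω)) := (hA.τ_meas η).prodMk (measurable_id'' (hA.mY_le η))
    exact (hA.τ_meas η).prodMk (hZ.comp this)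
  have iQ : ∀ {η : Idx} {Z : ℝ → Ω → S},
      (@Measurable (ℝ × Ω) S (@Prod.instMeasurableSpace _ _ _ (mY η)) _ fun q => Z q.1 q.2) →
      MeasurableSpace.comap (fun ω => (τ η ω, Z (τ η ω) ω)) inferInstance ≤
      info τ mY {η} {η} := fun {η Z} hZ => by
    refine Measurable.comap_le ?_
    have t1 : Measurable[info τ mY {η} {η}] (τ η) :=
      (comap_measurable (τ η)).mono (comap_le_info rfl) le_rfl
    have t2 : @Measurable Ω Ω (info τ mY {η} {η}) (mY η) id := measurable_id'' (mY_le_info rfl)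
    exact t1.prodMk (hZ.comp (t1.prodMk t2))
  have i2 : ∀ η, @IndepFun Ω ℝ Ω mΩ _ (mY η) (τ η) id P := fun η => by
    refine indepFun_id_of_indep ?_
    exact indep_of_indep_of_le_left (indep_of_indep_of_le_right hA.τY_indep (le_iSup _ η))
      (le_iSup (fun θ => MeasurableSpace.comap (τ θ) inferInstance) η)
  have hττ : IdentDistrib (τ η) (τ η₂) P P :=
    ⟨(hA.τ_meas η).aemeasurable, (hA.τ_meas η₂).aemeasurable, by rw [hA.τ_law, hA.τ_law]⟩
  have hrange : ∀ r ∈ range (τ η) ∪ range (τ η₂), r ∈ Icc (0 : ℝ) 1 := by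
    rintro r (⟨ω, rfl⟩ | ⟨ω, rfl⟩)
    · exact hA.τ_mem η ω
    · exact hA.τ_mem η₂ ω
  -- The laws are matched in two layers: first the pair formed by the time and the path at that
  -- time, then the independent information on top of it.
  have h1 := IndepFun.identDistrib_prodMk (mΩ' := mY η) (mΩ₂' := mY η₂) (hA.τ_meas η)
    (hA.τ_meas η₂) (measurable_id'' (hA.mY_le η)) (measurable_id'' (hA.mY_le η₂)) (i2 η) (i2 η₂)
    hZ hZ₂ hττ fun r hr => hZZ r (hrange r hr)
  have h2 := IndepFun.identDistrib_prodMk (mQ hZ) (mQ hZ₂) hW' hW₂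
    ((IndepFun_iff_Indep _ _ _).2 (indep_of_indep_of_le_left hind (iQ hZ)))
    ((IndepFun_iff_Indep _ _ _).2 (indep_of_indep_of_le_left hind₂ (iQ hZ₂))) hF hF₂ h1
    fun q hq => by
      refine hFF q.1 ?_ q.2
      rcases hq with ⟨ω, rfl⟩ | ⟨ω, rfl⟩
      · exact hA.τ_mem η ω
      · exact hA.τ_mem η₂ ω
  exact h2.comp measurable_snd

end Independence

/-! ### Laws, means and fluctuations of the approximations. -/

section Laws

variable {E : Type u} {Ω : Type v} [NormedAddCommGroup E] [MeasurableSpace E]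
variable [mΩ : MeasurableSpace Ω] {P : Measure Ω} [IsProbabilityMeasure P]
  {s₁ s₂ c T : ℝ} {V : ℝ → E → ℝ} {τ : Idx → Ω → ℝ}
  {Y : ℕ → Idx → ℝ → ℝ → E → Ω → E} {mY : Idx → MeasurableSpace Ω}
  {f : ℝ → ℝ} {g : E → ℝ} {M : ℕ}

theorem IdentDistrib.sum_range {Z Z' : ℕ → Ω → ℝ} (n : ℕ)
    (h : ∀ k < n, IdentDistrib (Z k) (Z' k) P P)
    (hi : ∀ k < n, IndepFun (fun ω => ∑ i ∈ Finset.range k, Z i ω) (Z k) P)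
    (hi' : ∀ k < n, IndepFun (fun ω => ∑ i ∈ Finset.range k, Z' i ω) (Z' k) P) :
    IdentDistrib (fun ω => ∑ i ∈ Finset.range n, Z i ω) (fun ω => ∑ i ∈ Finset.range n, Z' i ω)
      P P := by
  induction n with
  | zero => simpa using IdentDistrib.refl aemeasurable_const
  | succ n ih =>
    have h1 := ih (fun k hk => h k (by omega)) (fun k hk => hi k (by omega))
      (fun k hk => hi' k (by omega))
    simp only [Finset.sum_range_succ]
    exact (IdentDistrib.prodMk h1 (h n (by omega)) (hi n (by omega)) (hi' n (by omega))).comp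
      (u := fun q : ℝ × ℝ => q.1 + q.2) (by fun_prop)

theorem sum_telescope (φ : ℕ → ℝ) (n : ℕ) :
    ∑ ℓ ∈ Finset.range (n + 1), (φ ℓ - if 1 ≤ ℓ then φ (ℓ - 1) else 0) = φ n := by
  induction n with
  | zero => simp
  | succ n ih => rw [Finset.sum_range_succ, ih]; simp

theorem measurable_pi_of {α ι F : Type*} {mα : MeasurableSpace α} {mF : MeasurableSpace F}
    {G : α → ι → F} (h : ∀ i, Measurable fun a => G a i) : Measurable G :=
  measurable_pi_lambda _ h

variable (hA : Approx P s₁ s₂ c T V τ Y mY)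
include hA

/-- The first k summands use only indices in a union of sets disjoint from the one used by the next
summand. This successive independence is the form required by the moment inequality for sums. -/
theorem Approx.indep_partial_sum {A : ℕ → Set Idx} (hAd : ∀ i j, i ≠ j → Disjoint (A i) (A j))
    {Z : ℕ → Ω → ℝ} (hZ : ∀ i, Measurable[info τ mY (A i) (A i)] (Z i)) (k : ℕ) :
    IndepFun (fun ω => ∑ i ∈ Finset.range k, Z i ω) (Z k) P := by
  have h1 : Measurable[info τ mY (⋃ i ∈ Finset.range k, A i) (⋃ i ∈ Finset.range k, A i)]
      fun ω => ∑ i ∈ Finset.range k, Z i ω := by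
    refine Finset.measurable_fun_sum _ fun i hi => (hZ i).mono (info_mono ?_ ?_) le_rfl
    · exact subset_biUnion_of_mem (u := A) hi
    · exact subset_biUnion_of_mem (u := A) hi
  have hd : Disjoint (⋃ i ∈ Finset.range k, A i) (A k) := by
    rw [disjoint_iUnion₂_left]
    intro i hi
    exact hAd i k (Finset.mem_range.1 hi).ne
  exact (IndepFun_iff_Indep _ _ _).2 (indep_of_indep_of_le_left (indep_of_indep_of_le_right
    (hA.indep_info hd hd) (hZ k).comap_le) h1.comap_le)

theorem Approx.indep_strictExt {η η' : Idx} (h : η.1.length ≤ η'.1.length) :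
    Indep (info τ mY {η} {η}) (info τ mY (strictExt η') (strictExt η')) P :=
  hA.indep_info (disjoint_singleton_strictExt h) (disjoint_singleton_strictExt h)

theorem Approx.measurable_mlp_info (hf : Measurable f) (hg : Measurable g) (hM : 1 ≤ M) (n : ℕ)
    (θ : Idx) {A : Set Idx} (h : strictExt θ ⊆ A) :
    @Measurable (ℝ × E × Ω) ℝ (@Prod.instMeasurableSpace _ _ _ (@Prod.instMeasurableSpace _ _ _
      (info τ mY A A))) _ fun z => mlp T f g τ Y M n θ z.1 z.2.1 z.2.2 :=
  measurable_mlp (m := info τ mY A A) hf hg hM n θ ((hA.known A).subset h)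

theorem Approx.measurable_mlp_apply (hf : Measurable f) (hg : Measurable g) (hM : 1 ≤ M) (n : ℕ)
    (θ : Idx) {A : Set Idx} (h : strictExt θ ⊆ A) (t : ℝ) (x : E) :
    Measurable[info τ mY A A] (mlp T f g τ Y M n θ t x) := by
  have h1 : @Measurable Ω (ℝ × E × Ω) (info τ mY A A) (@Prod.instMeasurableSpace _ _ _
      (@Prod.instMeasurableSpace _ _ _ (info τ mY A A))) (fun ω => (t, x, id ω)) :=
    measurable_const.prodMk (measurable_const.prodMk measurable_id)
  exact (hA.measurable_mlp_info hf hg hM n θ h).comp h1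

theorem Approx.measurable_mlpTerm_apply (hf : Measurable f) (hg : Measurable g) (hM : 1 ≤ M)
    (ℓ : ℕ) (θ : Idx) (i : ℕ) (t : ℝ) (x : E) :
    Measurable[info τ mY (branch θ ℓ i) (branch θ ℓ i)] (mlpTerm T f g τ Y M ℓ θ i t x) := by
  have h1 : @Measurable Ω (ℝ × E × Ω) (info τ mY (branch θ ℓ i) (branch θ ℓ i))
      (@Prod.instMeasurableSpace _ _ _ (@Prod.instMeasurableSpace _ _ _
        (info τ mY (branch θ ℓ i) (branch θ ℓ i)))) (fun ω => (t, x, id ω)) :=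
    measurable_const.prodMk (measurable_const.prodMk measurable_id)
  exact (measurable_mlpTerm (m := info τ mY (branch θ ℓ i) (branch θ ℓ i)) hf hg hM ℓ θ i
    (hA.known _)).comp h1

theorem Approx.measurable_path (k : ℕ) (hk : 1 ≤ k) (η : Idx) (t : ℝ) (x : E) {a : ℝ → ℝ}
    (ha : Measurable a) : @Measurable (ℝ × Ω) E (@Prod.instMeasurableSpace _ _ _ (mY η)) _
      fun q => Y k η t (a q.1) x q.2 :=
  FieldMeas.comp (m := mY η) (hA.Y_meas k hk η) measurable_const (ha.comp measurable_fst)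
    measurable_const measurable_snd

/-- With the time and the path frozen, a summand is a function of two lower-level approximations
rooted at (θ,ℓ,i) and (θ,ℓ,-i). For i ≥ 1 these roots differ, so the two are independent and the
induction hypothesis determines their joint law. -/
theorem Approx.identDistrib_term (hf : Measurable f) (hg : Measurable g) (hM : 1 ≤ M) (ℓ : ℕ)
    (ih : ∀ l ≤ ℓ, ∀ (θ θ' : Idx) (t : ℝ) (x : E), IdentDistrib (mlp T f g τ Y M l θ t x)
      (mlp T f g τ Y M l θ' t x) P P) (θ θ' : Idx) {i : ℕ} (hi : 1 ≤ i) (t : ℝ) (x : E) :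
    IdentDistrib (mlpTerm T f g τ Y M ℓ θ i t x) (mlpTerm T f g τ Y M ℓ θ' i t x) P P := by
  let A : Idx → Set Idx := fun θ => strictExt (θ.ext ℓ i) ∪ strictExt (θ.ext ℓ (-(i : ℤ)))
  let ρ : ℝ → ℝ := fun r => t + (T - t) * r
  have hρ : Measurable ρ := by fun_prop
  -- The fine and the coarse path share one index and are therefore dependent; their terminal and
  -- intermediate values have to be treated as a single vector.
  let Z : Idx → ℝ → Ω → Fin 4 → E := fun θ r ω =>
    ![Y (M ^ ℓ) (θ.ext ℓ i) t T x ω, Y (M ^ (ℓ - 1)) (θ.ext ℓ i) t T x ω,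
      Y (M ^ ℓ) (θ.ext ℓ i) t (ρ r) x ω, Y (M ^ (ℓ - 1)) (θ.ext ℓ i) t (ρ r) x ω]
  let G : (ℝ × (Fin 4 → E)) → ℝ × ℝ → ℝ := fun q a => g (q.2 0) + (T - t) * f a.1
    - if 1 ≤ ℓ then g (q.2 1) + (T - t) * f a.2 else 0
  let F : Idx → (ℝ × (Fin 4 → E)) → Ω → ℝ := fun θ q ω =>
    G q (mlp T f g τ Y M ℓ (θ.ext ℓ i) (ρ q.1) (q.2 2) ω,
      mlp T f g τ Y M (ℓ - 1) (θ.ext ℓ (-(i : ℤ))) (ρ q.1) (q.2 3) ω)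
  have hp : ∀ j, 1 ≤ M ^ j := fun j => Nat.one_le_pow _ _ hM
  have hind : ∀ θ : Idx, Indep (info τ mY {θ.ext ℓ i} {θ.ext ℓ i})
      (MeasurableSpace.comap id (info τ mY (A θ) (A θ))) P := fun θ => by
    rw [MeasurableSpace.comap_id]
    have hd : Disjoint {θ.ext ℓ i} (A θ) := Set.disjoint_union_right.2
      ⟨disjoint_singleton_strictExt le_rfl, disjoint_singleton_strictExt (by simp [Idx.ext])⟩
    exact hA.indep_info hd hd
  have hZ : ∀ θ : Idx, @Measurable (ℝ × Ω) (Fin 4 → E)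
      (@Prod.instMeasurableSpace _ _ _ (mY (θ.ext ℓ i))) _ fun q => Z θ q.1 q.2 := fun θ => by
    refine measurable_pi_of fun j => ?_
    fin_cases j
    · exact hA.measurable_path _ (hp _) _ t x measurable_const
    · exact hA.measurable_path _ (hp _) _ t x measurable_const
    · exact hA.measurable_path _ (hp _) _ t x hρ
    · exact hA.measurable_path _ (hp _) _ t x hρ
  have hG : Measurable fun q : (ℝ × (Fin 4 → E)) × (ℝ × ℝ) => G q.1 q.2 := by
    have hg0 : Measurable fun q : (ℝ × (Fin 4 → E)) × (ℝ × ℝ) => g (q.1.2 0) :=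
      hg.comp (by fun_prop)
    have hg1 : Measurable fun q : (ℝ × (Fin 4 → E)) × (ℝ × ℝ) => g (q.1.2 1) :=
      hg.comp (by fun_prop)
    have hf0 : Measurable fun q : (ℝ × (Fin 4 → E)) × (ℝ × ℝ) => f q.2.1 := hf.comp (by fun_prop)
    have hf1 : Measurable fun q : (ℝ × (Fin 4 → E)) × (ℝ × ℝ) => f q.2.2 := hf.comp (by fun_prop)
    simp only [G]
    split_ifs
    · fun_prop
    · fun_prop
  have hF : ∀ θ : Idx, @Measurable ((ℝ × (Fin 4 → E)) × Ω) ℝ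
      (@Prod.instMeasurableSpace _ _ _ (info τ mY (A θ) (A θ))) _ fun q => F θ q.1 q.2 := by
    intro θ
    have c1 : ∀ j : Fin 4, @Measurable ((ℝ × (Fin 4 → E)) × Ω) (ℝ × E × Ω)
        (@Prod.instMeasurableSpace _ _ _ (info τ mY (A θ) (A θ)))
        (@Prod.instMeasurableSpace _ _ _ (@Prod.instMeasurableSpace _ _ _
          (info τ mY (A θ) (A θ)))) (fun q => (ρ q.1.1, q.1.2 j, q.2)) := fun j =>
      (hρ.comp (measurable_fst.comp measurable_fst)).prodMk
        (((measurable_pi_apply j).comp (measurable_snd.comp measurable_fst)).prodMk measurable_snd)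
    exact hG.comp (measurable_fst.prodMk (((hA.measurable_mlp_info hf hg hM ℓ (θ.ext ℓ i)
      subset_union_left).comp (c1 2)).prodMk
      ((hA.measurable_mlp_info hf hg hM (ℓ - 1) (θ.ext ℓ (-(i : ℤ))) subset_union_right).comp
        (c1 3))))
  have key := hA.eval_identDistrib (mΩ' := info τ mY (A θ) (A θ)) (mΩ₂ := info τ mY (A θ') (A θ'))
    (measurable_id'' (hA.info_le _ _)) (measurable_id'' (hA.info_le _ _)) (hind θ) (hind θ')
    (hZ θ) (hZ θ') (hF θ) (hF θ') (fun r _ => ?_) (fun r _ z => ?_)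
  · refine (Eq.mp (congrArg₂ (fun a b => IdentDistrib a b P P) ?_ ?_) key)
    · funext ω; simp [F, G, Z, ρ, mlpTerm, fullVal]
    · funext ω; simp [F, G, Z, ρ, mlpTerm, fullVal]
  · have := hA.ident (θ.ext ℓ i) (θ'.ext ℓ i) 4 ![(M ^ ℓ, t, T, x), (M ^ (ℓ - 1), t, T, x),
      (M ^ ℓ, t, ρ r, x), (M ^ (ℓ - 1), t, ρ r, x)] (fun j => by
        fin_cases j
        · exact hp _
        · exact hp _
        · exact hp _
        · exact hp _)
    refine (Eq.mp (congrArg₂ (fun a b => IdentDistrib a b P P) ?_ ?_) this)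
    · funext ω j; fin_cases j <;> rfl
    · funext ω j; fin_cases j <;> rfl
  · have hUU : ∀ θ : Idx, IndepFun (mlp T f g τ Y M ℓ (θ.ext ℓ i) (ρ r) (z 2))
        (mlp T f g τ Y M (ℓ - 1) (θ.ext ℓ (-(i : ℤ))) (ρ r) (z 3)) P := fun θ => by
      have hd := disjoint_strictExt θ ℓ (j := i) (j' := -(i : ℤ)) (by omega)
      exact (IndepFun_iff_Indep _ _ _).2 (indep_of_indep_of_le_left (indep_of_indep_of_le_right
        (hA.indep_info hd hd) (hA.measurable_mlp_apply hf hg hM _ _ Subset.rfl _ _).comap_le)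
        (hA.measurable_mlp_apply hf hg hM _ _ Subset.rfl _ _).comap_le)
    exact (IdentDistrib.prodMk (ih ℓ le_rfl (θ.ext ℓ i) (θ'.ext ℓ i) (ρ r) (z 2))
      (ih (ℓ - 1) (by omega) (θ.ext ℓ (-(i : ℤ))) (θ'.ext ℓ (-(i : ℤ))) (ρ r) (z 3))
      (hUU θ) (hUU θ')).comp (u := G (r, z)) (hG.comp measurable_prodMk_left)

/-- The law of the multilevel Picard approximation does not depend on the index. -/
theorem Approx.identDistrib_mlp (hf : Measurable f) (hg : Measurable g) (hM : 1 ≤ M) (n : ℕ) :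
    ∀ (θ θ' : Idx) (t : ℝ) (x : E), IdentDistrib (mlp T f g τ Y M n θ t x)
      (mlp T f g τ Y M n θ' t x) P P := by
  induction n using Nat.strong_induction_on with
  | _ n ih =>
    intro θ θ' t x
    have hin : ∀ (θ : Idx) (ℓ k : ℕ), IndepFun
        (fun ω => ∑ i ∈ Finset.range k, mlpTerm T f g τ Y M ℓ θ (i + 1) t x ω)
        (mlpTerm T f g τ Y M ℓ θ (k + 1) t x) P := fun θ ℓ k =>
      hA.indep_partial_sum (A := fun i => branch θ ℓ (i + 1))
        (Z := fun i => mlpTerm T f g τ Y M ℓ θ (i + 1) t x)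
        (fun i j hij => disjoint_branch θ ℓ (by omega))
        (fun i => hA.measurable_mlpTerm_apply hf hg hM ℓ θ (i + 1) t x) k
    have hout : ∀ (θ : Idx) (k : ℕ), IndepFun
        (fun ω => ∑ ℓ ∈ Finset.range k, 1 / (M : ℝ) ^ (n - ℓ) *
          ∑ i ∈ Finset.range (M ^ (n - ℓ)), mlpTerm T f g τ Y M ℓ θ (i + 1) t x ω)
        (fun ω => 1 / (M : ℝ) ^ (n - k) *
          ∑ i ∈ Finset.range (M ^ (n - k)), mlpTerm T f g τ Y M k θ (i + 1) t x ω) P := fun θ k =>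
      hA.indep_partial_sum (A := fun ℓ => levelSet θ ℓ)
        (Z := fun ℓ ω => 1 / (M : ℝ) ^ (n - ℓ) *
          ∑ i ∈ Finset.range (M ^ (n - ℓ)), mlpTerm T f g τ Y M ℓ θ (i + 1) t x ω)
        (fun i j hij => disjoint_levelSet θ (by exact_mod_cast hij))
        (fun ℓ => Measurable.const_mul (Finset.measurable_fun_sum _ fun i _ =>
          (hA.measurable_mlpTerm_apply hf hg hM ℓ θ (i + 1) t x).mono
            (info_mono (branch_subset_levelSet _ _ _) (branch_subset_levelSet _ _ _)) le_rfl) _) k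
    have e : ∀ θ, mlp T f g τ Y M n θ t x = fun ω => ∑ ℓ ∈ Finset.range n,
        1 / (M : ℝ) ^ (n - ℓ) * ∑ i ∈ Finset.range (M ^ (n - ℓ)),
          mlpTerm T f g τ Y M ℓ θ (i + 1) t x ω := fun θ => by
      funext ω; exact mlp_eq T f g τ Y M n θ t x ω
    rw [e, e]
    refine IdentDistrib.sum_range n (fun ℓ hℓ => ?_) (fun k _ => hout θ k) (fun k _ => hout θ' k)
    exact (IdentDistrib.sum_range _ (fun i _ => hA.identDistrib_term hf hg hM ℓ
      (fun l hl => ih l (by omega)) θ θ' (by omega) t x) (fun k _ => hin θ ℓ k)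
      (fun k _ => hin θ' ℓ k)).comp (u := fun a => 1 / (M : ℝ) ^ (n - ℓ) * a) (by fun_prop)

/-- Only the relative position of the two indices matters. The subtracted part of a summand, whose
approximation is rooted at (θ,ℓ,-i), thus has the law of the main part of the previous level, which
is what makes the means telescope. -/
theorem Approx.identDistrib_fullVal (hf : Measurable f) (hg : Measurable g) (hM : 1 ≤ M) {k : ℕ}
    (hk : 1 ≤ k) (ℓ : ℕ) {η η' ζ ζ' : Idx} (h : η.1.length ≤ η'.1.length)
    (h' : ζ.1.length ≤ ζ'.1.length) (t : ℝ) (x : E) :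
    IdentDistrib (fullVal T f g τ Y M k ℓ η η' t x) (fullVal T f g τ Y M k ℓ ζ ζ' t x) P P := by
  let ρ : ℝ → ℝ := fun r => t + (T - t) * r
  have hρ : Measurable ρ := by fun_prop
  let Z : Idx → ℝ → Ω → Fin 2 → E := fun η r ω => ![Y k η t T x ω, Y k η t (ρ r) x ω]
  let F : Idx → (ℝ × (Fin 2 → E)) → Ω → ℝ := fun η' q ω =>
    g (q.2 0) + (T - t) * f (mlp T f g τ Y M ℓ η' (ρ q.1) (q.2 1) ω)
  have hind : ∀ {η η' : Idx}, η.1.length ≤ η'.1.length → Indep (info τ mY {η} {η})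
      (MeasurableSpace.comap id (info τ mY (strictExt η') (strictExt η'))) P := fun h => by
    rw [MeasurableSpace.comap_id]
    exact hA.indep_strictExt h
  have hZ : ∀ η : Idx, @Measurable (ℝ × Ω) (Fin 2 → E)
      (@Prod.instMeasurableSpace _ _ _ (mY η)) _ fun q => Z η q.1 q.2 := fun η => by
    refine measurable_pi_of fun j => ?_
    fin_cases j
    · exact hA.measurable_path _ hk _ t x measurable_const
    · exact hA.measurable_path _ hk _ t x hρ
  have hF : ∀ η' : Idx, @Measurable ((ℝ × (Fin 2 → E)) × Ω) ℝ (@Prod.instMeasurableSpace _ _ _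
      (info τ mY (strictExt η') (strictExt η'))) _ fun q => F η' q.1 q.2 := by
    intro η'
    have c1 : @Measurable ((ℝ × (Fin 2 → E)) × Ω) (ℝ × E × Ω)
        (@Prod.instMeasurableSpace _ _ _ (info τ mY (strictExt η') (strictExt η')))
        (@Prod.instMeasurableSpace _ _ _ (@Prod.instMeasurableSpace _ _ _
          (info τ mY (strictExt η') (strictExt η')))) (fun q => (ρ q.1.1, q.1.2 1, q.2)) :=
      (hρ.comp (measurable_fst.comp measurable_fst)).prodMk
        (((measurable_pi_apply 1).comp (measurable_snd.comp measurable_fst)).prodMk measurable_snd)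
    have c2 := (hA.measurable_mlp_info hf hg hM ℓ η' Subset.rfl).comp c1
    have c3 : @Measurable ((ℝ × (Fin 2 → E)) × Ω) ℝ (@Prod.instMeasurableSpace _ _ _
      (info τ mY (strictExt η') (strictExt η'))) _ fun q => g (q.1.2 0) :=
      hg.comp ((measurable_pi_apply 0).comp (measurable_snd.comp measurable_fst))
    exact c3.add ((hf.comp c2).const_mul _)
  have key := hA.eval_identDistrib (mΩ' := info τ mY (strictExt η') (strictExt η'))
    (mΩ₂ := info τ mY (strictExt ζ') (strictExt ζ'))
    (measurable_id'' (hA.info_le _ _)) (measurable_id'' (hA.info_le _ _)) (hind h) (hind h')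
    (hZ η) (hZ ζ) (hF η') (hF ζ') (fun r _ => ?_) (fun r _ z => ?_)
  · refine (Eq.mp (congrArg₂ (fun a b => IdentDistrib a b P P) ?_ ?_) key)
    · funext ω; simp [F, Z, ρ, fullVal]
    · funext ω; simp [F, Z, ρ, fullVal]
  · have := hA.ident η ζ 2 ![(k, t, T, x), (k, t, ρ r, x)] (fun j => by
        fin_cases j
        · exact hk
        · exact hk)
    refine (Eq.mp (congrArg₂ (fun a b => IdentDistrib a b P P) ?_ ?_) this)
    · funext ω j; fin_cases j <;> rfl
    · funext ω j; fin_cases j <;> rfl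
  · exact (hA.identDistrib_mlp hf hg hM ℓ η' ζ' (ρ r) (z 1)).comp
      (u := fun a => g (z 0) + (T - t) * f a) ((hf.const_mul _).const_add _)

/-- The expectation of the multilevel Picard approximation telescopes. -/
theorem Approx.integral_mlp (hf : Measurable f) (hg : Measurable g) (hM : 1 ≤ M) (n : ℕ)
    (θ : Idx) (t : ℝ) (x : E)
    (hint : ∀ ℓ ≤ n, Integrable (fullVal T f g τ Y M (M ^ ℓ) ℓ Idx.zero Idx.zero t x) P) :
    ∫ ω, mlp T f g τ Y M (n + 1) θ t x ω ∂P
      = ∫ ω, fullVal T f g τ Y M (M ^ n) n Idx.zero Idx.zero t x ω ∂P := by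
  obtain ⟨φ, hφ⟩ : ∃ φ : ℕ → ℝ, φ = fun ℓ =>
    ∫ ω, fullVal T f g τ Y M (M ^ ℓ) ℓ Idx.zero Idx.zero t x ω ∂P := ⟨_, rfl⟩
  have hp : ∀ j, 1 ≤ M ^ j := fun j => Nat.one_le_pow _ _ hM
  have hid : ∀ (ℓ : ℕ) {η η' : Idx}, η.1.length ≤ η'.1.length →
      IdentDistrib (fullVal T f g τ Y M (M ^ ℓ) ℓ η η' t x)
        (fullVal T f g τ Y M (M ^ ℓ) ℓ Idx.zero Idx.zero t x) P P := fun ℓ η η' h =>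
    hA.identDistrib_fullVal hf hg hM (hp ℓ) ℓ h le_rfl t x
  have hi : ∀ ℓ ≤ n, ∀ {η η' : Idx}, η.1.length ≤ η'.1.length →
      Integrable (fullVal T f g τ Y M (M ^ ℓ) ℓ η η' t x) P := fun ℓ hℓ η η' h =>
    (hid ℓ h).integrable_iff.2 (hint ℓ hℓ)
  have hm : ∀ ℓ, ∀ {η η' : Idx}, η.1.length ≤ η'.1.length →
      ∫ ω, fullVal T f g τ Y M (M ^ ℓ) ℓ η η' t x ω ∂P = φ ℓ := fun ℓ η η' h => by
    rw [hφ]; exact (hid ℓ h).integral_eq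
  have hterm : ∀ ℓ ≤ n, ∀ i : ℕ, Integrable (mlpTerm T f g τ Y M ℓ θ i t x) P ∧
      ∫ ω, mlpTerm T f g τ Y M ℓ θ i t x ω ∂P = φ ℓ - if 1 ≤ ℓ then φ (ℓ - 1) else 0 := by
    intro ℓ hℓ i
    have l1 : (θ.ext ℓ i).1.length ≤ (θ.ext ℓ i).1.length := le_rfl
    have l2 : (θ.ext ℓ i).1.length ≤ (θ.ext ℓ (-(i : ℤ))).1.length := by simp [Idx.ext]
    unfold mlpTerm
    split_ifs with h1
    · refine ⟨(hi ℓ hℓ l1).sub (hi (ℓ - 1) (by omega) l2), ?_⟩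
      rw [integral_sub (hi ℓ hℓ l1) (hi (ℓ - 1) (by omega) l2), hm ℓ l1, hm (ℓ - 1) l2]
    · simp only [sub_zero]
      exact ⟨hi ℓ hℓ l1, hm ℓ l1⟩
  have hM0 : (M : ℝ) ≠ 0 := by positivity
  have hgoal : ∫ ω, mlp T f g τ Y M (n + 1) θ t x ω ∂P
      = ∑ ℓ ∈ Finset.range (n + 1), (φ ℓ - if 1 ≤ ℓ then φ (ℓ - 1) else 0) := by
    simp only [mlp_eq]
    rw [integral_finsetSum _ fun ℓ hℓ => (integrable_finsetSum _ fun i _ =>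
      (hterm ℓ (by have := Finset.mem_range.1 hℓ; omega) (i + 1)).1).const_mul _]
    refine Finset.sum_congr rfl fun ℓ hℓ => ?_
    have hℓn : ℓ ≤ n := by have := Finset.mem_range.1 hℓ; omega
    rw [integral_const_mul, integral_finsetSum _ fun i _ => (hterm ℓ hℓn (i + 1)).1]
    simp only [(hterm ℓ hℓn _).2, Finset.sum_const, Finset.card_range, nsmul_eq_mul]
    push_cast
    field_simp
  rw [hgoal, sum_telescope, hφ]

/-- The average of centred independent summands of one level. -/
theorem Approx.lb_average {p b : ℝ} (hp : 2 ≤ p) (hb : 0 < b) {N : ℕ} (hN : 1 ≤ N) (θ : Idx) (ℓ : ℕ)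
    {Z : ℕ → Ω → ℝ}
    (hm : ∀ i, Measurable[info τ mY (branch θ ℓ (i + 1)) (branch θ ℓ (i + 1))] (Z i))
    (hZ : ∀ i, LB P p⁻¹ (Z i) b) :
    LB P p⁻¹ (fun ω => 1 / (N : ℝ) * ∑ i ∈ Finset.range N, Z i ω
        - ∫ ω, 1 / (N : ℝ) * ∑ i ∈ Finset.range N, Z i ω ∂P)
      (2 * √(2 * (p - 1)) / √(N : ℝ) * b) := by
  have h0 : ∀ i, ∫ ω, (Z i ω - ∫ ω, Z i ω ∂P) ∂P = 0 := fun i => by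
    rw [integral_sub (hZ i).integrable (integrable_const _)]; simp
  -- Centring each summand doubles its bound; dividing the √N growth of the sum by N gives the rate
  -- 1/√N.
  have h1 := LB.sum_indep hp (b := 2 * b) (by positivity) (P := P)
    (Z := fun i ω => Z i ω - ∫ ω, Z i ω ∂P) N (fun i _ => (hZ i).sub_integral) (fun i _ => h0 i)
    fun k _ => hA.indep_partial_sum (A := fun i => branch θ ℓ (i + 1))
        (fun i j hij => disjoint_branch θ ℓ (by omega)) (fun i => (hm i).sub_const _) k
  have hN0 : (0 : ℝ) < N := by positivity
  have h2 := h1.const_mul (a := 1 / (N : ℝ)) (by positivity)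
  rw [integral_const_mul, integral_finsetSum (μ := P) (Finset.range N) (f := Z) fun i _ => (hZ i).integrable]
  refine (h2.congr (Filter.Eventually.of_forall fun ω => by
    simp only [Finset.sum_sub_distrib, mul_sub])).mono_bound (le_of_eq ?_)
  rw [Real.sqrt_mul (by linarith)]
  have : (N : ℝ) = √N * √N := (Real.mul_self_sqrt hN0.le).symm
  have hs0 : √(N : ℝ) ≠ 0 := by positivity
  field_simp
  rw [Real.sq_sqrt hN0.le]
  ring

end Laws

/-! ### Change of the forward path inside the Feynman–Kac integrand. -/

section PathDifference

variable {E : Type u} {Ω : Type v} [NormedAddCommGroup E] [MeasurableSpace E] [BorelSpace E]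
  [SecondCountableTopology E] [MeasurableSpace Ω] {P : Measure Ω} [IsProbabilityMeasure P]
  {s₁ s₂ c T : ℝ} {f : ℝ → ℝ} {g : E → ℝ} {V : ℝ → E → ℝ} {X : ℝ → ℝ → E → Ω → E}

/-- The modulus of continuity in the error estimates. -/
noncomputable def phi (V : ℝ → E → ℝ) (T t : ℝ) (x : E) (s : ℝ) (y : E) : ℝ :=
  ((V t x + V s y) / 2) ^ 9 * (4 * ((V t x + V s y) / 2) * td T t s + nd T (x - y))

/-- The difference of the integrands in the Feynman-Kac formula along two random fields. -/
noncomputable def pathDiff (T : ℝ) (f : ℝ → ℝ) (g : E → ℝ) (u : ℝ → E → ℝ)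
    (Z Z' : ℝ → ℝ → E → Ω → E) (r t : ℝ) (x : E) (ω : Ω) : ℝ :=
  g (Z t T x ω) - g (Z' t T x ω) + (T - t) *
    (f (u (t + (T - t) * r) (Z t (t + (T - t) * r) x ω))
      - f (u (t + (T - t) * r) (Z' t (t + (T - t) * r) x ω)))

theorem Proc.measurable {Z : ℝ → ℝ → E → Ω → E} (h : Proc P s₁ s₂ c T V Z) (t s : ℝ) (x : E) :
    Measurable (Z t s x) :=
  h.meas.comp (f := fun ω : Ω => (t, s, x, ω)) (by fun_prop)

theorem Proc.nd_le {Z : ℝ → ℝ → E → Ω → E} (h : Proc P s₁ s₂ c T V Z) {t s σ σ' : ℝ}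
    (ht : 0 ≤ t) (htσ : t ≤ σ) (hσ : σ ≤ T) (hts : t ≤ s) (hsσ : s ≤ σ') (hσ' : σ' ≤ T)
    (hd : td T σ σ' ≤ td T t s) {x y : E} (hx : 0 ≤ V t x) (hy : 0 ≤ V s y) :
    LB P s₂ (fun ω => nd T (Z t σ x ω - Z s σ' y ω))
      ((V t x + V s y) / 2 * td T t s + Real.exp (c * T) * nd T (x - y)) := by
  refine (h.two t σ s σ' ht htσ hσ hts hsσ hσ' x y).mono_bound ?_
  gcongr
  linarith

/-- The affine time change `r ↦ t + (T - t) r` maps `[0, 1]` to `[t, T]`. -/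
theorem time_change_mem {t r : ℝ} (ht : t ≤ T) (hr : r ∈ Icc (0 : ℝ) 1) :
    t ≤ t + (T - t) * r ∧ t + (T - t) * r ≤ T := by
  constructor
  · nlinarith [hr.1]
  · nlinarith [hr.2]

theorem time_change_mono {t s r : ℝ} (hts : t ≤ s) (hr : r ∈ Icc (0 : ℝ) 1) :
    t + (T - t) * r ≤ s + (T - s) * r := by nlinarith [hr.2]

theorem td_time_change_le {t s r : ℝ} (hr : r ∈ Icc (0 : ℝ) 1) :
    td T (t + (T - t) * r) (s + (T - s) * r) ≤ td T t s := by
  refine td_mono ?_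
  have e : t + (T - t) * r - (s + (T - s) * r) = (1 - r) * (t - s) := by ring
  rw [e, abs_mul, abs_of_nonneg (by linarith [hr.2])]
  nlinarith [abs_nonneg (t - s), hr.1]

/-- Writes (T-t)A - (T-s)B = (T-t)(A-B) + (s-t)B. The second-order condition on f treats A - B, and
s - t = Td² ≤ Td leaves a single power of the time distance in the second summand. -/
theorem drift_diff_bound {f : ℝ → ℝ} {c T t s K d dρ U1 U2 U3 U4 v1 v2 v3 v4 m4 m1 m1' m0 : ℝ}
    (hc : 0 < c) (hT : 0 < T) (hts : t ≤ s) (hTt : 0 ≤ T - t) (hK0 : 0 < K) (hd : 0 ≤ d)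
    (hd1 : d ≤ 1) (hst : s - t = T * (d * d)) (hdρ : dρ ≤ d) (q1 : 0 < v1) (q2 : 0 < v2)
    (q3 : 0 < v3) (q4 : 0 < v4) (n1 : 0 ≤ m1) (n1' : 0 ≤ m1')
    (u4 : |(U1 - U2) - (U3 - U4)| ≤ 2 * K ^ 10 * ((v1 + v2 + v3 + v4) / 4) ^ 2 * (m4 + (m1 + m1')
      * (4 * ((v1 + v2 + v3 + v4) / 4) * dρ + m0)))
    (u1 : |U1 - U2| ≤ K ^ 2 * ((v1 + v2) / 2) * m1)
    (u1' : |U3 - U4| ≤ K ^ 2 * ((v3 + v4) / 2) * m1')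
    (u3 : |U1 - U3| ≤ K ^ 2 * ((v1 + v3) / 2) * (5 / 2 * ((v1 + v3) / 2) * dρ + K * m0))
    (fd : |(f U1 - f U2) - (f U3 - f U4)| ≤ c * |(U1 - U2) - (U3 - U4)|
      + c * (|U1 - U2| + |U3 - U4|) * |U1 - U3| / 2)
    (fl : |f U3 - f U4| ≤ c * |U3 - U4|) :
    |(T - t) * (f U1 - f U2) - (T - s) * (f U3 - f U4)| ≤
        (T - t) * c * (2 * K ^ 10 * ((1 / 4 * (v1 + v2 + v3 + v4)) ^ (1 + 1) * (m4 + (m1 + m1') *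
          (4 * d * (1 / 4 * (v1 + v2 + v3 + v4)) + m0)))
        + 1 / 2 * (K ^ 2 * (1 / 2 * (v1 + v2) * m1 + 1 / 2 * (v3 + v4) * m1') *
          (K ^ 2 * (1 / 2 * (v1 + v3) * (5 / 2 * d * (1 / 2 * (v1 + v3)) + K * m0)))))
        + c * T * d * K ^ 2 * (1 / 2 * (v3 + v4) * m1') := by
  have e : (T - t) * (f U1 - f U2) - (T - s) * (f U3 - f U4)
      = (T - t) * ((f U1 - f U2) - (f U3 - f U4)) + (s - t) * (f U3 - f U4) := by ring
  have f1 : |(f U1 - f U2) - (f U3 - f U4)| ≤ c * (2 * K ^ 10 *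
      ((1 / 4 * (v1 + v2 + v3 + v4)) ^ (1 + 1) * (m4 + (m1 + m1') *
      (4 * d * (1 / 4 * (v1 + v2 + v3 + v4)) + m0)))
      + 1 / 2 * (K ^ 2 * (1 / 2 * (v1 + v2) * m1 + 1 / 2 * (v3 + v4) * m1') *
      (K ^ 2 * (1 / 2 * (v1 + v3) * (5 / 2 * d * (1 / 2 * (v1 + v3)) + K * m0))))) := by
    refine fd.trans ?_
    calc _ ≤ c * (2 * K ^ 10 * ((v1 + v2 + v3 + v4) / 4) ^ 2 * (m4 + (m1 + m1')
          * (4 * ((v1 + v2 + v3 + v4) / 4) * d + m0)))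
          + c * (K ^ 2 * ((v1 + v2) / 2) * m1 + K ^ 2 * ((v3 + v4) / 2) * m1')
            * (K ^ 2 * ((v1 + v3) / 2) * (5 / 2 * ((v1 + v3) / 2) * d + K * m0)) / 2 := by
          refine add_le_add (mul_le_mul_of_nonneg_left (u4.trans ?_) hc.le) ?_
          · gcongr
          · have u3' := u3.trans (b := K ^ 2 * ((v1 + v3) / 2) * (5 / 2 * ((v1 + v3) / 2)
              * dρ + K * m0)) (c := K ^ 2 * ((v1 + v3) / 2) * (5 / 2 * ((v1 + v3) / 2)
              * d + K * m0)) (by gcongr)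
            gcongr
      _ = _ := by ring
  have f2 : |f U3 - f U4| ≤ c * (K ^ 2 * (1 / 2 * (v3 + v4) * m1')) :=
    fl.trans (mul_le_mul_of_nonneg_left (u1'.trans (le_of_eq (by ring))) hc.le)
  have f3 : s - t ≤ T * d := by
    rw [hst]; exact mul_le_mul_of_nonneg_left (mul_le_of_le_one_right hd hd1) hT.le
  rw [e]
  refine (abs_add_le _ _).trans ?_
  rw [abs_mul, abs_mul, abs_of_nonneg hTt, abs_of_nonneg (sub_nonneg.2 hts), mul_assoc (T - t) c]
  refine add_le_add (mul_le_mul_of_nonneg_left f1 hTt) ?_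
  calc (s - t) * |f U3 - f U4| ≤ (T * d) * (c * (K ^ 2 * (1 / 2 * (v3 + v4) * m1'))) := by
        gcongr
    _ = _ := by ring

theorem path_diff_bound {a b K W d n δ c T l : ℝ} (hW : W = (a + b) / 2) (ha : K ≤ a) (hb : K ≤ b)
    (hK : 1 ≤ K) (hyK : 2 * (c * T) ≤ K) (hc : 0 ≤ c) (hd : 0 ≤ d) (hn : 0 ≤ n)
    (hδ : 0 ≤ δ) (hl : l ≤ T) :
    W * (W * (d + n) * δ + 1 / 2 * (W * δ * (W * d + K * n)))
      + l * c * (2 * K ^ 10 * (W ^ (1 + 1) * (W * (d + n) * δ + W * δ *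
          (4 * d * W + (W * d + K * n))))
        + 1 / 2 * (K ^ 2 * (a * (a / 2 * δ) + b * (b / 2 * δ)) *
          (K ^ 2 * (W * (5 / 2 * d * W + K * (W * d + K * n))))))
      + c * T * d * K ^ 2 * (b * (b / 2 * δ)) ≤
    5 * K ^ 6 * δ * (W ^ 9 * (4 * W * d + n)) := by
  have hKW : K ≤ W := by rw [hW]; linarith
  have hK0 : 0 < K := by linarith
  have hW0 : 0 < W := by linarith
  have hW1 : 1 ≤ W := by linarith
  have hab : a ^ 2 + b ^ 2 ≤ 4 * W ^ 2 := by
    rw [hW]; nlinarith [mul_nonneg (hK0.le.trans ha) (hK0.le.trans hb)]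
  have hbb : b ^ 2 ≤ 4 * W ^ 2 := by nlinarith [sq_nonneg a]
  have hlc : l * c ≤ K / 2 := by
    have : l * c ≤ T * c := by gcongr
    linarith
  have hcT : c * T ≤ K / 2 := by linarith
  have ha0 : 0 < a := by linarith
  have hb0 : 0 < b := by linarith
  -- A monomial short of the ninth power of W is filled up with powers of K, which is allowed by K ≤
  -- W. Every term is then dominated by K⁶W⁹ times Wd or n.
  have mono : ∀ i j k : ℕ, i ≤ 9 → j ≤ 6 + (9 - i) → K ^ j * W ^ i ≤ K ^ 6 * W ^ 9 := by
    intro i j k hi hj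
    have h1 : K ^ j ≤ K ^ (6 + (9 - i)) := pow_le_pow_right₀ hK hj
    have h2 : K ^ (9 - i) ≤ W ^ (9 - i) := pow_le_pow_left₀ hK0.le hKW _
    calc K ^ j * W ^ i ≤ K ^ (6 + (9 - i)) * W ^ i := by gcongr
      _ = K ^ 6 * K ^ (9 - i) * W ^ i := by rw [pow_add]
      _ ≤ K ^ 6 * W ^ (9 - i) * W ^ i := by gcongr
      _ = K ^ 6 * (W ^ (9 - i) * W ^ i) := by ring
      _ = K ^ 6 * W ^ 9 := by rw [← pow_add]; congr 2; omega
  obtain ⟨A, hA⟩ : ∃ A, A = δ * (K ^ 6 * W ^ 9) * (W * d) := ⟨_, rfl⟩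
  obtain ⟨B, hB⟩ : ∃ B, B = δ * (K ^ 6 * W ^ 9) * n := ⟨_, rfl⟩
  have hA0 : 0 ≤ A := by rw [hA]; positivity
  have hB0 : 0 ≤ B := by rw [hB]; positivity
  have mA : ∀ i j : ℕ, i ≤ 9 → j ≤ 6 + (9 - i) → δ * (K ^ j * W ^ i) * (W * d) ≤ A := by
    intro i j hi hj
    rw [hA]; have := mono i j 0 hi hj; gcongr
  have mB : ∀ i j : ℕ, i ≤ 9 → j ≤ 6 + (9 - i) → δ * (K ^ j * W ^ i) * n ≤ B := by
    intro i j hi hj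
    rw [hB]; have := mono i j 0 hi hj; gcongr
  have t1 : W * (W * (d + n) * δ + 1 / 2 * (W * δ * (W * d + K * n))) ≤ 3 / 2 * A + 3 / 2 * B := by
    have e : W * (W * (d + n) * δ + 1 / 2 * (W * δ * (W * d + K * n))) =
        δ * (K ^ 0 * W ^ 1) * (W * d) + δ * (K ^ 0 * W ^ 2) * n
        + 1 / 2 * (δ * (K ^ 0 * W ^ 2) * (W * d)) + 1 / 2 * (δ * (K ^ 1 * W ^ 2) * n) := by ring
    rw [e]
    linarith [mA 1 0 (by norm_num) (by norm_num), mA 2 0 (by norm_num) (by norm_num),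
      mB 2 0 (by norm_num) (by norm_num), mB 2 1 (by norm_num) (by norm_num)]
  have t2 : l * c * (2 * K ^ 10 * (W ^ (1 + 1) * (W * (d + n) * δ + W * δ *
          (4 * d * W + (W * d + K * n))))
        + 1 / 2 * (K ^ 2 * (a * (a / 2 * δ) + b * (b / 2 * δ)) *
          (K ^ 2 * (W * (5 / 2 * d * W + K * (W * d + K * n)))))) ≤ 10 * A + 3 * B := by
    have p1 : a * (a / 2 * δ) + b * (b / 2 * δ) ≤ 2 * W ^ 2 * δ := by
      have : a * (a / 2 * δ) + b * (b / 2 * δ) = (a ^ 2 + b ^ 2) / 2 * δ := by ring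
      rw [this]; gcongr; linarith
    have h2 : l * c * (2 * K ^ 10 * (W ^ (1 + 1) * (W * (d + n) * δ + W * δ *
          (4 * d * W + (W * d + K * n))))
        + 1 / 2 * (K ^ 2 * (a * (a / 2 * δ) + b * (b / 2 * δ)) *
          (K ^ 2 * (W * (5 / 2 * d * W + K * (W * d + K * n)))))) ≤
        K / 2 * (2 * K ^ 10 * (W ^ (1 + 1) * (W * (d + n) * δ + W * δ *
          (4 * d * W + (W * d + K * n))))
        + 1 / 2 * (K ^ 2 * (2 * W ^ 2 * δ) *
          (K ^ 2 * (W * (5 / 2 * d * W + K * (W * d + K * n)))))) := by gcongr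
    refine h2.trans ?_
    have e : K / 2 * (2 * K ^ 10 * (W ^ (1 + 1) * (W * (d + n) * δ + W * δ *
          (4 * d * W + (W * d + K * n))))
        + 1 / 2 * (K ^ 2 * (2 * W ^ 2 * δ) *
          (K ^ 2 * (W * (5 / 2 * d * W + K * (W * d + K * n)))))) =
        δ * (K ^ 11 * W ^ 2) * (W * d) + δ * (K ^ 11 * W ^ 3) * n
        + 5 * (δ * (K ^ 11 * W ^ 3) * (W * d)) + δ * (K ^ 12 * W ^ 3) * n
        + 5 / 4 * (δ * (K ^ 5 * W ^ 3) * (W * d)) + 1 / 2 * (δ * (K ^ 6 * W ^ 3) * (W * d))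
        + 1 / 2 * (δ * (K ^ 7 * W ^ 3) * n) := by ring
    rw [e]
    linarith [mA 2 11 (by norm_num) (by norm_num), mA 3 11 (by norm_num) (by norm_num),
      mA 3 5 (by norm_num) (by norm_num), mA 3 6 (by norm_num) (by norm_num),
      mB 3 11 (by norm_num) (by norm_num), mB 3 12 (by norm_num) (by norm_num),
      mB 3 7 (by norm_num) (by norm_num)]
  have t3 : c * T * d * K ^ 2 * (b * (b / 2 * δ)) ≤ A := by
    have p1 : b * (b / 2 * δ) ≤ 2 * W ^ 2 * δ := by
      have : b * (b / 2 * δ) = b ^ 2 / 2 * δ := by ring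
      rw [this]; gcongr; linarith
    have p2 : c * T * d * K ^ 2 * (b * (b / 2 * δ)) ≤ K / 2 * d * K ^ 2 * (2 * W ^ 2 * δ) := by
      gcongr
    have e : K / 2 * d * K ^ 2 * (2 * W ^ 2 * δ) = δ * (K ^ 3 * W ^ 1) * (W * d) := by ring
    rw [e] at p2
    exact p2.trans (mA 1 3 (by norm_num) (by norm_num))
  have e : 5 * K ^ 6 * δ * (W ^ 9 * (4 * W * d + n)) = 20 * A + 5 * B := by rw [hA, hB]; ring
  rw [e]; linarith

variable (hF : Flow P s₁ s₂ c T f g V X)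
include hF

theorem Flow.measurable_pathDiff {u : ℝ → E → ℝ} (hu : Solution P T f g V X u)
    {Z Z' : ℝ → ℝ → E → Ω → E} (hZ : Proc P s₁ s₂ c T V Z) (hZ' : Proc P s₁ s₂ c T V Z')
    (r t : ℝ) (x : E) : Measurable (pathDiff T f g u Z Z' r t x) := by
  have hum := (hF.solution_growth hu).meas
  have m1 : ∀ {Z}, Proc P s₁ s₂ c T V Z →
      Measurable fun ω => f (u (t + (T - t) * r) (Z t (t + (T - t) * r) x ω)) := fun h =>
    hF.f_meas.comp (hum.comp (measurable_const.prodMk (h.measurable _ _ _)))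
  exact ((hF.g_meas.comp (hZ.measurable _ _ _)).sub (hF.g_meas.comp (hZ'.measurable _ _ _))).add
    (((m1 hZ).sub (m1 hZ')).const_mul _)

/-- Lipschitz continuity of g and of f∘u reduces the claim to the distance of the two paths; the
factor (T-t)c is absorbed by K/2. -/
theorem Flow.pathDiff_le {u : ℝ → E → ℝ} (hu : Solution P T f g V X u)
    {Z Z' : ℝ → ℝ → E → Ω → E} (hZ : Proc P s₁ s₂ c T V Z) (hZ' : Proc P s₁ s₂ c T V Z') {δ : ℝ}
    (hδ : 0 ≤ δ) (hcl : Close P s₂ T V Z Z' δ) {q : ℝ} (hq : 10 * s₁ + 2 * s₂ ≤ q) (hq1 : q ≤ 1)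
    {r t : ℝ} (hr : r ∈ Icc (0 : ℝ) 1) (ht : t ∈ Icc 0 T) (x : E) :
    LB P q (pathDiff T f g u Z Z' r t x) (Real.exp (c * T) ^ 3 * δ * V t x ^ 2) := by
  have hc := hF.c_pos
  have hT := hF.T_pos
  have hK := hF.one_le_exp
  have hyK := two_mul_le_exp (c * T)
  have hs₁ := hF.s₁_pos
  have hs₂ := hF.s₂_pos
  have hV := hF.V_pos t x
  obtain ⟨hρ1, hρ2⟩ := time_change_mem ht.2 hr
  obtain ⟨ρ, hρ⟩ : ∃ ρ, ρ = t + (T - t) * r := ⟨_, rfl⟩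
  rw [← hρ] at hρ1 hρ2
  have hTt : 0 ≤ T - t := sub_nonneg.2 ht.2
  have k1 : ∀ σ, t ≤ σ → σ ≤ T → LB P q (fun ω => 1 / 2 * (V σ (Z t σ x ω) + V σ (Z' t σ x ω))
      * nd T (Z t σ x ω - Z' t σ x ω)) (1 / 2 * (V t x + V t x) * (V t x / 2 * δ)) :=
    fun σ h1 h2 => (((hZ.V_le t σ ht.1 h1 h2 x).add' (hZ'.V_le t σ ht.1 h1 h2 x)).const_mul
      (by norm_num)).mul (hcl.two t σ ht.1 h1 h2 x) (by linarith) hq1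
  have k2 := (k1 T ht.2 le_rfl).add' ((k1 ρ hρ1 hρ2).const_mul
    (a := (T - t) * (c * Real.exp (c * T) ^ 2)) (by positivity))
  refine (k2.of_le (hF.measurable_pathDiff hu hZ hZ' r t x).aestronglyMeasurable
    (Filter.Eventually.of_forall fun ω => ?_)).mono_bound ?_
  · rw [pathDiff, ← hρ]
    refine (abs_add_le _ _).trans (add_le_add ((hF.g_lip _ _).trans (le_of_eq (by ring))) ?_)
    rw [abs_mul, abs_of_nonneg hTt, mul_assoc]
    refine mul_le_mul_of_nonneg_left ((hF.f_lip _ _).trans ?_) hTt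
    rw [mul_assoc]
    refine mul_le_mul_of_nonneg_left ((hF.solution_lip hu ⟨ht.1.trans hρ1, hρ2⟩ _ _).trans
      (le_of_eq (by ring))) hc.le
  · have e : 1 / 2 * (V t x + V t x) * (V t x / 2 * δ) + (T - t) * (c * Real.exp (c * T) ^ 2) *
        (1 / 2 * (V t x + V t x) * (V t x / 2 * δ))
        = (1 / 2 + (T - t) * c * Real.exp (c * T) ^ 2 / 2) * (δ * V t x ^ 2) := by ring
    rw [e]
    have h1 : (T - t) * c ≤ Real.exp (c * T) / 2 := by nlinarith [mul_nonneg hc.le ht.1]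
    have h3 : (1 : ℝ) ≤ Real.exp (c * T) ^ 3 := one_le_pow₀ hK
    calc _ ≤ (1 / 2 + Real.exp (c * T) / 2 * Real.exp (c * T) ^ 2 / 2) * (δ * V t x ^ 2) := by gcongr
      _ ≤ (Real.exp (c * T) ^ 3) * (δ * V t x ^ 2) := by
        refine mul_le_mul_of_nonneg_right ?_ (by positivity)
        nlinarith
      _ = _ := by ring

/-- A second difference in which one direction is the change of path and the other the change of
starting point. `G` treats the terminal condition, `A1` the second difference of u, `A2` the product
of first differences created by f, and `A3` the change of the factor T - t. -/
theorem Flow.pathDiff_sub_le {u : ℝ → E → ℝ} (hu : Solution P T f g V X u)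
    {Z Z' : ℝ → ℝ → E → Ω → E} (hZ : Proc P s₁ s₂ c T V Z) (hZ' : Proc P s₁ s₂ c T V Z') {δ : ℝ}
    (hδ : 0 ≤ δ) (hcl : Close P s₂ T V Z Z' δ) {q : ℝ} (hq : 10 * s₁ + 2 * s₂ ≤ q) (hq1 : q ≤ 1)
    {r t s : ℝ} (hr : r ∈ Icc (0 : ℝ) 1) (ht : 0 ≤ t) (hts : t ≤ s) (hs : s ≤ T) (x y : E) :
    LB P q (fun ω => pathDiff T f g u Z Z' r t x ω - pathDiff T f g u Z Z' r s y ω)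
      (5 * Real.exp (c * T) ^ 6 * δ * phi V T t x s y) := by
  have hc := hF.c_pos
  have hT := hF.T_pos
  have hK := hF.one_le_exp
  have hyK := two_mul_le_exp (c * T)
  have hs₁ := hF.s₁_pos
  have hs₂ := hF.s₂_pos
  have hVx := hF.V_pos t x
  have hVy := hF.V_pos s y
  have hxK := hF.exp_le_V t x
  have hyV := hF.exp_le_V s y
  have hn := nd_nonneg T (x - y)
  have hd := td_nonneg T t s
  have hd1 := td_le_one hT ⟨ht, hts.trans hs⟩ ⟨ht.trans hts, hs⟩
  obtain ⟨hρ1, hρ2⟩ := time_change_mem (hts.trans hs) hr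
  obtain ⟨hρ1', hρ2'⟩ := time_change_mem hs hr
  have hρρ := time_change_mono (T := T) hts hr
  have hdρ := td_time_change_le (T := T) (t := t) (s := s) hr
  obtain ⟨ρ, hρ⟩ : ∃ ρ, ρ = t + (T - t) * r := ⟨_, rfl⟩
  obtain ⟨ρ', hρ'⟩ : ∃ ρ', ρ' = s + (T - s) * r := ⟨_, rfl⟩
  rw [← hρ] at hρ1 hρ2 hρρ hdρ
  rw [← hρ'] at hρ1' hρ2' hρρ hdρ
  have hTt : 0 ≤ T - t := by linarith
  have hTs : 0 ≤ T - s := by linarith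
  obtain ⟨K, hKdef⟩ : ∃ K, K = Real.exp (c * T) := ⟨_, rfl⟩
  obtain ⟨W, hW⟩ : ∃ W, W = (V t x + V s y) / 2 := ⟨_, rfl⟩
  have hK0 : 0 < K := by rw [hKdef]; positivity
  have hW0 : 0 < W := by rw [hW]; positivity
  -- moment bounds at a pair of times
  have kV : ∀ σ σ', t ≤ σ → σ ≤ T → s ≤ σ' → σ' ≤ T → LB P s₁ (fun ω => 1 / 4 *
      (V σ (Z t σ x ω) + V σ (Z' t σ x ω) + V σ' (Z s σ' y ω) + V σ' (Z' s σ' y ω))) W :=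
    fun σ σ' h1 h2 h3 h4 => ((((((hZ.V_le t σ ht h1 h2 x).add' (hZ'.V_le t σ ht h1 h2 x)).add'
      (hZ.V_le s σ' (ht.trans hts) h3 h4 y)).add' (hZ'.V_le s σ' (ht.trans hts) h3 h4 y)).const_mul
      (a := 1 / 4) (by norm_num))).mono_bound (le_of_eq (by rw [hW]; ring))
  have k4 : ∀ σ σ', t ≤ σ → σ ≤ T → s ≤ σ' → σ' ≤ T → td T σ σ' ≤ td T t s → LB P s₂ (fun ω =>
      nd T ((Z t σ x ω - Z' t σ x ω) - (Z s σ' y ω - Z' s σ' y ω)))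
      (W * (td T t s + nd T (x - y)) * δ) := fun σ σ' h1 h2 h3 h4 h5 =>
    (hcl.four t σ s σ' ht h1 h2 hts h3 h4 x y).mono_bound (by
      rw [← hW]; gcongr; linarith)
  have k2 : ∀ σ σ', t ≤ σ → σ ≤ T → s ≤ σ' → σ' ≤ T → LB P s₂ (fun ω =>
      nd T (Z t σ x ω - Z' t σ x ω) + nd T (Z s σ' y ω - Z' s σ' y ω)) (W * δ) :=
    fun σ σ' h1 h2 h3 h4 => ((hcl.two t σ ht h1 h2 x).add'
      (hcl.two s σ' (ht.trans hts) h3 h4 y)).mono_bound (le_of_eq (by rw [hW]; ring))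
  have kn : ∀ σ σ', t ≤ σ → σ ≤ T → s ≤ σ' → σ' ≤ T → td T σ σ' ≤ td T t s → LB P s₂ (fun ω =>
      nd T (Z t σ x ω - Z s σ' y ω)) (W * td T t s + K * nd T (x - y)) :=
    fun σ σ' h1 h2 h3 h4 h5 => (hZ.nd_le ht h1 h2 hts h3 h4 h5 hVx.le hVy.le).mono_bound
      (le_of_eq (by rw [hW, hKdef]))
  have htdT : td T T T ≤ td T t s := by rw [td_self]; exact hd
  have hq2 : s₂ + s₂ ≤ 1 := by linarith
  have hq3 : s₁ + s₂ + s₂ ≤ 1 := by linarith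
  -- the terminal condition
  have G := (kV T T (hts.trans hs) le_rfl hs le_rfl).mul
    ((k4 T T (hts.trans hs) le_rfl hs le_rfl htdT).add
      (((k2 T T (hts.trans hs) le_rfl hs le_rfl).mul
        (kn T T (hts.trans hs) le_rfl hs le_rfl htdT) le_rfl hq2).const_mul (a := 1 / 2)
        (by norm_num)) (r := s₂ + s₂) (by linarith) le_rfl hq2) (r := q) (by linarith) hq1
  -- second differences of the solution
  have A1 := (((kV ρ ρ' hρ1 hρ2 hρ1' hρ2').pow 1 (r := 2 * s₁) (by norm_num) (by linarith)).mul
    ((k4 ρ ρ' hρ1 hρ2 hρ1' hρ2' hdρ).add ((k2 ρ ρ' hρ1 hρ2 hρ1' hρ2').mul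
      (((kV ρ ρ' hρ1 hρ2 hρ1' hρ2').const_mul (a := 4 * td T t s) (by positivity)).add
        (kn ρ ρ' hρ1 hρ2 hρ1' hρ2' hdρ) (r := s₁ + s₂) (by linarith) (by linarith) (by linarith))
      (r := s₁ + s₂ + s₂) (by linarith) hq3) (r := s₁ + s₂ + s₂) (by linarith) le_rfl hq3)
    (r := q) (by linarith) hq1).const_mul (a := 2 * K ^ 10) (by positivity)
  -- products of first differences of the solution
  have B1 : ∀ τ σ z, 0 ≤ τ → τ ≤ σ → σ ≤ T → LB P (s₁ + s₂) (fun ω => 1 / 2 *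
      (V σ (Z τ σ z ω) + V σ (Z' τ σ z ω)) * nd T (Z τ σ z ω - Z' τ σ z ω))
      (V τ z * (V τ z / 2 * δ)) := fun τ σ z h1 h2 h3 =>
    ((((hZ.V_le τ σ h1 h2 h3 z).add' (hZ'.V_le τ σ h1 h2 h3 z)).const_mul (a := 1 / 2)
      (by norm_num)).mul (hcl.two τ σ h1 h2 h3 z) le_rfl (by linarith)).mono_bound
      (le_of_eq (by ring))
  have B2 : LB P s₁ (fun ω => 1 / 2 * (V ρ (Z t ρ x ω) + V ρ' (Z s ρ' y ω))) W :=
    (((hZ.V_le t ρ ht hρ1 hρ2 x).add' (hZ.V_le s ρ' (ht.trans hts) hρ1' hρ2' y)).const_mul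
      (a := 1 / 2) (by norm_num)).mono_bound (le_of_eq (by rw [hW]; ring))
  have A2 := (((((B1 t ρ x ht hρ1 hρ2).add' (B1 s ρ' y (ht.trans hts) hρ1' hρ2')).const_mul
    (a := K ^ 2) (by positivity)).mul ((B2.mul ((B2.const_mul (a := 5 / 2 * td T t s)
      (by positivity)).add ((kn ρ ρ' hρ1 hρ2 hρ1' hρ2' hdρ).const_mul (a := K) hK0.le)
      (r := s₁ + s₂) (by linarith) (by linarith) (by linarith)) (r := s₁ + (s₁ + s₂)) le_rfl
      (by linarith)).const_mul (a := K ^ 2) (by positivity)) (r := q) (by linarith) hq1).const_mul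
      (a := 1 / 2) (by norm_num))
  have A3 := ((B1 s ρ' y (ht.trans hts) hρ1' hρ2').mono_exponent (r := q) (by linarith)
    hq1).const_mul (a := c * T * td T t s * K ^ 2) (by positivity)
  have tot := (G.add' ((A1.add' A2).const_mul (a := (T - t) * c) (by positivity))).add' A3
  refine (tot.of_le ((hF.measurable_pathDiff hu hZ hZ' r t x).sub
    (hF.measurable_pathDiff hu hZ hZ' r s y)).aestronglyMeasurable
    (Filter.Eventually.of_forall fun ω => ?_)).mono_bound ?_
  · change |pathDiff T f g u Z Z' r t x ω - pathDiff T f g u Z Z' r s y ω| ≤ _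
    unfold pathDiff
    rw [← hρ, ← hρ']
    have hρI : ρ ∈ Icc 0 T := ⟨ht.trans hρ1, hρ2⟩
    have hρI' : ρ' ∈ Icc 0 T := ⟨(ht.trans hts).trans hρ1', hρ2'⟩
    have g1 := hF.g_diff (Z t T x ω) (Z' t T x ω) (Z s T y ω) (Z' s T y ω)
    have u4 := hF.solution_diff_time hu hρI.1 hρρ hρ2' (Z t ρ x ω) (Z' t ρ x ω) (Z s ρ' y ω)
      (Z' s ρ' y ω)
    have u1 := hF.solution_lip hu hρI (Z t ρ x ω) (Z' t ρ x ω)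
    have u1' := hF.solution_lip hu hρI' (Z s ρ' y ω) (Z' s ρ' y ω)
    have u3 := hF.solution_time hu hρI.1 hρρ hρ2' (Z t ρ x ω) (Z s ρ' y ω)
    have fd := hF.f_diff (u ρ (Z t ρ x ω)) (u ρ (Z' t ρ x ω)) (u ρ' (Z s ρ' y ω))
      (u ρ' (Z' s ρ' y ω))
    have fl := hF.f_lip (u ρ' (Z s ρ' y ω)) (u ρ' (Z' s ρ' y ω))
    have hst : s - t = T * (td T t s * td T t s) := by
      have := td_sq hT t s
      rw [abs_sub_comm, abs_of_nonneg (by linarith), eq_div_iff hT.ne'] at this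
      linarith
    rw [← hKdef] at u4 u1 u1' u3
    have n4 := nd_nonneg T (Z t ρ x ω - Z' t ρ x ω - (Z s ρ' y ω - Z' s ρ' y ω))
    have n1 := nd_nonneg T (Z t ρ x ω - Z' t ρ x ω)
    have n1' := nd_nonneg T (Z s ρ' y ω - Z' s ρ' y ω)
    have n0 := nd_nonneg T (Z t ρ x ω - Z s ρ' y ω)
    have q1 := hF.V_pos ρ (Z t ρ x ω)
    have q2 := hF.V_pos ρ (Z' t ρ x ω)
    have q3 := hF.V_pos ρ' (Z s ρ' y ω)
    have q4 := hF.V_pos ρ' (Z' s ρ' y ω)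
    generalize hU1 : u ρ (Z t ρ x ω) = U1 at *
    generalize hU2 : u ρ (Z' t ρ x ω) = U2 at *
    generalize hU3 : u ρ' (Z s ρ' y ω) = U3 at *
    generalize hU4 : u ρ' (Z' s ρ' y ω) = U4 at *
    generalize V ρ (Z t ρ x ω) = v1 at *
    generalize V ρ (Z' t ρ x ω) = v2 at *
    generalize V ρ' (Z s ρ' y ω) = v3 at *
    generalize V ρ' (Z' s ρ' y ω) = v4 at *
    generalize nd T (Z t ρ x ω - Z' t ρ x ω - (Z s ρ' y ω - Z' s ρ' y ω)) = m4 at *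
    generalize nd T (Z t ρ x ω - Z' t ρ x ω) = m1 at *
    generalize nd T (Z s ρ' y ω - Z' s ρ' y ω) = m1' at *
    generalize nd T (Z t ρ x ω - Z s ρ' y ω) = m0 at *
    have fin := drift_diff_bound (f := f) hc hT hts hTt hK0 hd hd1 hst hdρ q1 q2 q3 q4 n1 n1' u4
      u1 u1' u3 fd fl
    have e : ∀ a b a' b' X' Y' : ℝ, a - b + X' - (a' - b' + Y') = (a - b - (a' - b')) + (X' - Y') :=
      fun a b a' b' X' Y' => by ring
    rw [e, add_assoc]
    refine (abs_add_le _ _).trans (add_le_add (g1.trans (le_of_eq ?_)) fin)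
    ring
  · rw [phi, ← hW]
    have := path_diff_bound (c := c) (T := T) (l := T - t) hW (hKdef ▸ hxK) (hKdef ▸ hyV)
      (hKdef ▸ hK) (hKdef ▸ hyK) hc.le hd hn hδ (by linarith)
    rw [← hKdef]
    exact this

end PathDifference

/-! ### Propagation of errors through the nonlinearity. -/

section ErrorBounds

variable {E : Type u} {Ω : Type v} [NormedAddCommGroup E] [MeasurableSpace E] [BorelSpace E]
  [SecondCountableTopology E] [mΩ : MeasurableSpace Ω] {P : Measure Ω} [IsProbabilityMeasure P]
  {s₁ s₂ c T : ℝ} {f : ℝ → ℝ} {g : E → ℝ} {V : ℝ → E → ℝ} {X : ℝ → ℝ → E → Ω → E}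
  {τ : Idx → Ω → ℝ} {Y : ℕ → Idx → ℝ → ℝ → E → Ω → E} {mY : Idx → MeasurableSpace Ω}

/-- The exponential weight in time. -/
noncomputable def expWeight (a p T t : ℝ) : ℝ := Real.exp (a * ((T - t) / T) / p)

/-- Bounds for the moments of a random function and of its increments. -/
structure Err (P : Measure Ω) (q T : ℝ) (V : ℝ → E → ℝ) (w : ℝ → ℝ) (e : ℝ)
    (H : ℝ → E → Ω → ℝ) : Prop where
  val : ∀ t ∈ Icc 0 T, ∀ x, LB P q (fun ω => H t x ω) (e * w t * V t x ^ 2)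
  diff : ∀ t s, 0 ≤ t → t ≤ s → s ≤ T → ∀ x y,
    LB P q (fun ω => H t x ω - H s y ω) (e * w t * phi V T t x s y)

/-- The difference of the nonlinear terms belonging to a random approximation `U` and to `u`. -/
noncomputable def drift (T : ℝ) (f : ℝ → ℝ) (u : ℝ → E → ℝ) (σ : Ω → ℝ)
    (Z : ℝ → ℝ → E → Ω → E) (U : ℝ → E → Ω → ℝ) (t : ℝ) (x : E) (ω : Ω) : ℝ :=
  (T - t) * (f (U (t + (T - t) * σ ω) (Z t (t + (T - t) * σ ω) x ω) ω)
    - f (u (t + (T - t) * σ ω) (Z t (t + (T - t) * σ ω) x ω)))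

theorem phi_nonneg {t s : ℝ} {x y : E} (h : 0 ≤ V t x) (h' : 0 ≤ V s y) :
    0 ≤ phi V T t x s y := by
  have := td_nonneg T t s
  have := nd_nonneg T (x - y)
  unfold phi; positivity

theorem one_le_expWeight {a p T t : ℝ} (ha : 0 ≤ a) (hp : 0 ≤ p) (hT : 0 ≤ T) (ht : t ≤ T) :
    1 ≤ expWeight a p T t := by
  have : 0 ≤ T - t := by linarith
  exact Real.one_le_exp (by positivity)

theorem expWeight_anti {a p T t s : ℝ} (ha : 0 ≤ a) (hp : 0 ≤ p) (hT : 0 ≤ T) (h : t ≤ s) :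
    expWeight a p T s ≤ expWeight a p T t := by
  unfold expWeight; gcongr

theorem Err.add {q e e' : ℝ} {w : ℝ → ℝ} {H H' : ℝ → E → Ω → ℝ} (h : Err P q T V w e H)
    (h' : Err P q T V w e' H') : Err P q T V w (e + e') fun t x ω => H t x ω + H' t x ω := by
  refine ⟨fun t ht x => ((h.val t ht x).add' (h'.val t ht x)).mono_bound (le_of_eq (by ring)),
    fun t s h0 hts hs x y => ?_⟩
  refine (((h.diff t s h0 hts hs x y).add' (h'.diff t s h0 hts hs x y)).congr
    (Filter.Eventually.of_forall fun ω => ?_)).mono_bound (le_of_eq (by ring))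
  simp only; ring

theorem Err.neg {q e : ℝ} {w : ℝ → ℝ} {H : ℝ → E → Ω → ℝ} (h : Err P q T V w e H) :
    Err P q T V w e fun t x ω => -H t x ω := by
  refine ⟨fun t ht x => (h.val t ht x).neg, fun t s h0 hts hs x y => ?_⟩
  refine ((h.diff t s h0 hts hs x y).neg.congr (Filter.Eventually.of_forall fun ω => ?_))
  simp only; ring

theorem Err.sub {q e e' : ℝ} {w : ℝ → ℝ} {H H' : ℝ → E → Ω → ℝ} (h : Err P q T V w e H)
    (h' : Err P q T V w e' H') : Err P q T V w (e + e') fun t x ω => H t x ω - H' t x ω := by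
  simpa only [sub_eq_add_neg] using h.add h'.neg

theorem Err.mono {q e e' : ℝ} {w : ℝ → ℝ} {H : ℝ → E → Ω → ℝ} (h : Err P q T V w e H)
    (he : e ≤ e') (hw : ∀ t ≤ T, 0 ≤ w t) (hV : ∀ t x, 0 ≤ V t x) : Err P q T V w e' H := by
  refine ⟨fun t ht x => (h.val t ht x).mono_bound ?_, fun t s h0 hts hs x y =>
    (h.diff t s h0 hts hs x y).mono_bound ?_⟩
  · have := hw t ht.2
    have := hV t x
    gcongr
  · have := hw t (hts.trans hs)
    have := phi_nonneg (T := T) (hV t x) (hV s y)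
    gcongr

theorem Err.congr {q e : ℝ} {w : ℝ → ℝ} {H H' : ℝ → E → Ω → ℝ} (h : Err P q T V w e H)
    (hH : ∀ t x ω, H' t x ω = H t x ω) : Err P q T V w e H' := by
  have : H' = H := by ext; exact hH _ _ _
  rwa [this]

/-- With sl = √((T-t)/T), one factor sl of T - t is reserved for the exponential weight. In s - t =
Td² one factor d ≤ sl plays the same role and the other stays as the modulus of continuity. -/
theorem drift_weight_bound {c T t s e K W d dρ n sl wρ v1 v2 : ℝ} (hW : W = (v1 + v2) / 2)
    (hK : 1 ≤ K) (hv1 : K ≤ v1) (hv2 : K ≤ v2) (hc : 0 ≤ c) (hT : 0 ≤ T) (he : 0 ≤ e)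
    (hw : 0 ≤ wρ) (hd : 0 ≤ d) (hdρ : 0 ≤ dρ) (hn : 0 ≤ n) (hsl : 0 ≤ sl) (hsl1 : sl ≤ 1)
    (hts : T - t = T * (sl * sl)) (hst : s - t = T * (d * d)) (hdl : d ≤ sl) :
    (T - t) * (c * (e * wρ * (W ^ 9 * (4 * W * dρ + n)))
      + c * (K ^ 2 * W * (5 / 2 * W * dρ + K * n)) / 2 * (e * wρ * v1 ^ 2 + e * wρ * v2 ^ 2))
      + (s - t) * c * (e * wρ * v2 ^ 2) ≤
    sl * wρ * (c * T * e * (3 * (W ^ 9 * (4 * W * dρ + n)) + d * v2 ^ 2)) := by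
  have hKW : K ≤ W := by rw [hW]; linarith
  have hW1 : 1 ≤ W := hK.trans hKW
  have hW0 : 0 < W := by linarith
  have hK0 : 0 < K := by linarith
  have hv : v1 ^ 2 + v2 ^ 2 ≤ 4 * W ^ 2 := by
    rw [hW]; nlinarith [mul_nonneg (hK0.le.trans hv1) (hK0.le.trans hv2)]
  have p1 : K ^ 2 * W ^ 4 ≤ W ^ 10 := by
    calc K ^ 2 * W ^ 4 ≤ W ^ 2 * W ^ 4 := by gcongr
      _ = W ^ 6 := by ring
      _ ≤ W ^ 10 := pow_le_pow_right₀ hW1 (by norm_num)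
  have p2 : K ^ 3 * W ^ 3 ≤ W ^ 9 := by
    calc K ^ 3 * W ^ 3 ≤ W ^ 3 * W ^ 3 := by gcongr
      _ = W ^ 6 := by ring
      _ ≤ W ^ 9 := pow_le_pow_right₀ hW1 (by norm_num)
  obtain ⟨F, hF⟩ : ∃ F, F = W ^ 9 * (4 * W * dρ + n) := ⟨_, rfl⟩
  have hF0 : 0 ≤ F := by rw [hF]; positivity
  have h1 : (K ^ 2 * W * (5 / 2 * W * dρ + K * n)) / 2 * (v1 ^ 2 + v2 ^ 2) ≤ 2 * F := by
    calc (K ^ 2 * W * (5 / 2 * W * dρ + K * n)) / 2 * (v1 ^ 2 + v2 ^ 2)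
        ≤ (K ^ 2 * W * (5 / 2 * W * dρ + K * n)) / 2 * (4 * W ^ 2) := by gcongr
      _ = 5 * ((K ^ 2 * W ^ 4) * dρ) + 2 * ((K ^ 3 * W ^ 3) * n) := by ring
      _ ≤ 5 * (W ^ 10 * dρ) + 2 * (W ^ 9 * n) := by gcongr
      _ ≤ 8 * (W ^ 10 * dρ) + 2 * (W ^ 9 * n) := by
        have : 0 ≤ W ^ 10 * dρ := by positivity
        linarith
      _ = 2 * F := by rw [hF]; ring
  rw [← hF, hts, hst]
  have h2 : T * (d * d) * c * (e * wρ * v2 ^ 2) ≤ T * (d * sl) * c * (e * wρ * v2 ^ 2) := by gcongr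
  have h3 : T * (sl * sl) * (c * (e * wρ * (3 * F))) ≤ T * (sl * 1) * (c * (e * wρ * (3 * F))) := by
    gcongr
  have h4 : T * (sl * sl) * (c * (e * wρ)) * ((K ^ 2 * W * (5 / 2 * W * dρ + K * n)) / 2
      * (v1 ^ 2 + v2 ^ 2)) ≤ T * (sl * sl) * (c * (e * wρ)) * (2 * F) := by gcongr
  nlinarith [h2, h3, h4]

/-- Taking moments of the random positions replaces the distance n by Wd + Kn; the bound cT ≤ K/2
restores the original modulus with the constant 3K². -/
theorem drift_final_bound {c T K W d n v1 v2 : ℝ} (hW : W = (v1 + v2) / 2)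
    (hK : 1 ≤ K) (hv1 : K ≤ v1) (hv2 : K ≤ v2) (hyK : 2 * (c * T) ≤ K)
    (hd : 0 ≤ d) (hn : 0 ≤ n) :
    c * T * (3 * (W ^ 9 * (4 * W * d + (W * d + K * n))) + d * v2 ^ 2) ≤
    3 * K ^ 2 * (W ^ 9 * (4 * W * d + n)) := by
  have hKW : K ≤ W := by rw [hW]; linarith
  have hW1 : 1 ≤ W := hK.trans hKW
  have hW0 : 0 < W := by linarith
  have hK0 : 0 < K := by linarith
  have hv : v2 ^ 2 ≤ 4 * W ^ 2 := by
    rw [hW]; nlinarith [mul_nonneg (hK0.le.trans hv1) (hK0.le.trans hv2), sq_nonneg v1]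
  have p1 : W ^ 2 ≤ W ^ 10 := pow_le_pow_right₀ hW1 (by norm_num)
  have h1 : d * v2 ^ 2 ≤ d * (4 * W ^ 10) := by gcongr; linarith
  calc c * T * (3 * (W ^ 9 * (4 * W * d + (W * d + K * n))) + d * v2 ^ 2)
      ≤ K / 2 * (3 * (W ^ 9 * (4 * W * d + (W * d + K * n))) + d * (4 * W ^ 10)) := by
        gcongr; linarith
    _ = 19 / 2 * (K * (W ^ 10 * d)) + 3 / 2 * (K ^ 2 * (W ^ 9 * n)) := by ring
    _ ≤ 12 * (K ^ 2 * (W ^ 10 * d)) + 3 * (K ^ 2 * (W ^ 9 * n)) := by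
        have h2 : K * (W ^ 10 * d) ≤ K ^ 2 * (W ^ 10 * d) := by
          gcongr; nlinarith
        have h3 : 0 ≤ K ^ 2 * (W ^ 10 * d) := by positivity
        have h4 : 0 ≤ K ^ 2 * (W ^ 9 * n) := by positivity
        linarith
    _ = _ := by ring

theorem measurable_drift_kernel {m : MeasurableSpace Ω} (hf : Measurable f) {u : ℝ → E → ℝ}
    (hu : Measurable fun z : ℝ × E => u z.1 z.2) {U : ℝ → E → Ω → ℝ}
    (hU : Measurable fun z : ℝ × E × Ω => U z.1 z.2.1 z.2.2) {A : Type*} {mA : MeasurableSpace A}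
    {r : A → ℝ} {x : A → E} {w : A → Ω} (hr : Measurable r) (hx : Measurable x)
    (hw : Measurable w) (t : ℝ) :
    Measurable fun q => (T - t) * (f (U (t + (T - t) * r q) (x q) (w q))
      - f (u (t + (T - t) * r q) (x q))) := by
  have h1 : Measurable fun q => t + (T - t) * r q := by fun_prop
  have h2 : Measurable fun q => U (t + (T - t) * r q) (x q) (w q) :=
    hU.comp (f := fun q => (t + (T - t) * r q, x q, w q)) (h1.prodMk (hx.prodMk hw))
  have h3 : Measurable fun q => u (t + (T - t) * r q) (x q) :=
    hu.comp (f := fun q => (t + (T - t) * r q, x q)) (h1.prodMk hx)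
  exact ((hf.comp h2).sub (hf.comp h3)).const_mul _

theorem measurable_phi_comp (hV : Measurable fun z : ℝ × E => V z.1 z.2) {A : Type*}
    {mA : MeasurableSpace A} {t s : A → ℝ} {x y : A → E} (ht : Measurable t) (hs : Measurable s)
    (hx : Measurable x) (hy : Measurable y) :
    Measurable fun q => phi V T (t q) (x q) (s q) (y q) := by
  have h1 : Measurable fun q => V (t q) (x q) := hV.comp (ht.prodMk hx)
  have h2 : Measurable fun q => V (s q) (y q) := hV.comp (hs.prodMk hy)
  have h3 : Measurable fun q => nd T (x q - y q) := (measurable_nd T).comp (hx.sub hy)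
  have h4 : Measurable fun q => td T (t q) (s q) := by unfold td; fun_prop
  unfold phi
  fun_prop

variable (hF : Flow P s₁ s₂ c T f g V X) (hA : Approx P s₁ s₂ c T V τ Y mY)
include hF hA

/-- For a frozen time and position the error of U enters through its value bound. The moments of V
along the path return V(t,x)², and averaging the weight over the random time produces the gain
a^{-1/p}. -/
theorem Flow.drift_val {u : ℝ → E → ℝ} (hu : Solution P T f g V X u) {p a : ℝ} (hp : 2 ≤ p)
    (ha : 0 < a) (hq : 10 * s₁ + 2 * s₂ ≤ p⁻¹) {k : ℕ} (hk : 1 ≤ k) {η : Idx}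
    {A : Set Idx} (hind : Indep (info τ mY {η} {η}) (info τ mY A A) P)
    {U : ℝ → E → Ω → ℝ}
    (hU : @Measurable (ℝ × E × Ω) ℝ (@Prod.instMeasurableSpace _ _ _
      (@Prod.instMeasurableSpace _ _ _ (info τ mY A A))) _ fun z => U z.1 z.2.1 z.2.2) {e : ℝ} (he : 0 ≤ e)
    (h : Err P p⁻¹ T V (expWeight a p T) e fun t x ω => U t x ω - u t x)
    {t : ℝ} (ht : t ∈ Icc 0 T) (x : E) :
    LB P p⁻¹ (fun ω => drift T f u (τ η) (Y k η) U t x ω)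
      (3 * Real.exp (c * T) ^ 2 * a ^ (-p⁻¹) * e * expWeight a p T t * V t x ^ 2) := by
  have hT := hF.T_pos
  have hm := hA.info_le A A
  have hc := hF.c_pos
  have hs₁ := hF.s₁_pos
  have hs₂ := hF.s₂_pos
  have hK := hF.one_le_exp
  have hyK := two_mul_le_exp (c * T)
  have hp0 : 0 < p := by linarith
  have hp1 : p⁻¹ ≤ 1 := inv_le_one_of_one_le₀ (by linarith)
  have hum := (hF.solution_growth hu).meas
  have hl0 : 0 ≤ (T - t) / T := div_nonneg (by linarith [ht.2]) hT.le
  have hl1 : (T - t) / T ≤ 1 := (div_le_one hT).2 (by linarith [ht.1])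
  have hW := LB.exp_weight hp ha hl0 hl1 (hA.τ_meas η) (hA.τ_law η)
  have hV := hF.V_meas
  have key := hA.eval_freeze (mΩ' := info τ mY A A) (W' := id) (η := η) (measurable_id'' hm)
    (by rw [MeasurableSpace.comap_id]; exact hind)
    (Z := fun r ω => Y k η t (t + (T - t) * r) x ω)
    (hA.measurable_path k hk η t x (a := fun r => t + (T - t) * r) (by fun_prop))
    (F := fun q ω => (T - t) * (f (U (t + (T - t) * q.1) q.2 ω) - f (u (t + (T - t) * q.1) q.2)))
    (measurable_drift_kernel (m := info τ mY A A) hF.f_meas hum hU (measurable_fst.comp measurable_fst)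
      (measurable_snd.comp measurable_fst) measurable_snd t)
    (p := p) (by linarith)
    (w := fun r => √((T - t) / T) * Real.exp (a * ((T - t) / T * (1 - r)) / p))
    (b := fun r z => c * T * e * V (t + (T - t) * r) z ^ 2)
    (((hV.comp (f := fun q : ℝ × E => (t + (T - t) * q.1, q.2)) (by fun_prop)).pow_const 2).const_mul _)
    (by fun_prop) (fun r => by positivity) (W := a ^ (-p⁻¹) * Real.exp (a * ((T - t) / T) / p))
    (β := c * T * e * V t x ^ 2) ?_ ?_ hW
  · refine key.mono_bound ?_
    have h1 : c * T ≤ 3 * Real.exp (c * T) ^ 2 := by nlinarith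
    unfold expWeight
    calc _ = a ^ (-p⁻¹) * Real.exp (a * ((T - t) / T) / p) * (e * V t x ^ 2) * (c * T) := by ring
      _ ≤ a ^ (-p⁻¹) * Real.exp (a * ((T - t) / T) / p) * (e * V t x ^ 2)
        * (3 * Real.exp (c * T) ^ 2) := by gcongr
      _ = _ := by ring
  · intro r hr z
    obtain ⟨hρ1, hρ2⟩ := time_change_mem ht.2 hr
    have hρ : t + (T - t) * r ∈ Icc 0 T := ⟨ht.1.trans hρ1, hρ2⟩
    have h1 := ((h.val _ hρ z).abs.const_mul hc.le).const_mul (a := T - t) (by linarith [ht.2])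
    have h2 := h1.of_le (Z' := fun ω => (T - t) * (f (U (t + (T - t) * r) z ω)
      - f (u (t + (T - t) * r) z))) ?_ (Filter.Eventually.of_forall fun ω => ?_)
    · have h3 := h2.norm_le
      rw [inv_inv] at h3
      refine h3.trans (ENNReal.ofReal_le_ofReal ?_)
      have e1 : expWeight a p T (t + (T - t) * r)
          = Real.exp (a * ((T - t) / T * (1 - r)) / p) := by
        unfold expWeight; congr 1; ring
      -- Only the square root is retained, because that is the prefactor which `LB.exp_weight` can
      -- absorb.
      have e2 : T - t ≤ T * √((T - t) / T) := by
        have h4 : (T - t) / T ≤ √((T - t) / T) := Real.le_sqrt_of_sq_le (by nlinarith)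
        calc T - t = T * ((T - t) / T) := by field_simp
          _ ≤ _ := by gcongr
      rw [e1]
      calc (T - t) * (c * (e * Real.exp (a * ((T - t) / T * (1 - r)) / p)
            * V (t + (T - t) * r) z ^ 2))
          ≤ (T * √((T - t) / T)) * (c * (e * Real.exp (a * ((T - t) / T * (1 - r)) / p)
            * V (t + (T - t) * r) z ^ 2)) := by gcongr
        _ = _ := by ring
    · have h5 : Measurable fun ω => (T - t) * (f (U (t + (T - t) * r) z (id ω))
          - f (u (t + (T - t) * r) z)) :=
        measurable_drift_kernel (m := info τ mY A A) hF.f_meas hum hU (A := Ω) (r := fun _ => r)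
          (x := fun _ => z) (w := id) measurable_const measurable_const (measurable_id'' hm) t
      exact h5.aestronglyMeasurable
    · rw [abs_mul, abs_of_nonneg (by linarith [ht.2] : 0 ≤ T - t)]
      exact mul_le_mul_of_nonneg_left (hF.f_lip _ _) (by linarith [ht.2])
  · intro r hr
    obtain ⟨hρ1, hρ2⟩ := time_change_mem ht.2 hr
    exact (((hA.proc k hk η).V_le t _ ht.1 hρ1 hρ2 x).pow 1 (r := p⁻¹)
      (by norm_num; linarith) hp1).const_mul (by positivity)

/-- Both starting points use the same random time and the same path field, so the pair of positions
is frozen together and the increment bound for U - u applies to it. -/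
theorem Flow.drift_diff {u : ℝ → E → ℝ} (hu : Solution P T f g V X u) {p a : ℝ} (hp : 2 ≤ p)
    (ha : 0 < a) (hq : 10 * s₁ + 2 * s₂ ≤ p⁻¹) {k : ℕ} (hk : 1 ≤ k) {η : Idx}
    {A : Set Idx} (hind : Indep (info τ mY {η} {η}) (info τ mY A A) P)
    {U : ℝ → E → Ω → ℝ}
    (hU : @Measurable (ℝ × E × Ω) ℝ (@Prod.instMeasurableSpace _ _ _
      (@Prod.instMeasurableSpace _ _ _ (info τ mY A A))) _ fun z => U z.1 z.2.1 z.2.2) {e : ℝ} (he : 0 ≤ e)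
    (h : Err P p⁻¹ T V (expWeight a p T) e fun t x ω => U t x ω - u t x)
    {t s : ℝ} (ht : 0 ≤ t) (hts : t ≤ s) (hs : s ≤ T) (x y : E) :
    LB P p⁻¹ (fun ω => drift T f u (τ η) (Y k η) U t x ω - drift T f u (τ η) (Y k η) U s y ω)
      (3 * Real.exp (c * T) ^ 2 * a ^ (-p⁻¹) * e * expWeight a p T t * phi V T t x s y) := by
  have hT := hF.T_pos
  have hm := hA.info_le A A
  have hc := hF.c_pos
  have hs₁ := hF.s₁_pos
  have hs₂ := hF.s₂_pos
  have hK := hF.one_le_exp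
  have hyK := two_mul_le_exp (c * T)
  have hp0 : 0 < p := by linarith
  have hp1 : p⁻¹ ≤ 1 := inv_le_one_of_one_le₀ (by linarith)
  have hum := (hF.solution_growth hu).meas
  have htT : t ≤ T := hts.trans hs
  have hs0 : 0 ≤ s := ht.trans hts
  have hTt : 0 ≤ T - t := by linarith
  have hl0 : 0 ≤ (T - t) / T := div_nonneg hTt hT.le
  have hl1 : (T - t) / T ≤ 1 := (div_le_one hT).2 (by linarith)
  have hW := LB.exp_weight hp ha hl0 hl1 (hA.τ_meas η) (hA.τ_law η)
  have hV := hF.V_meas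
  have hd := td_nonneg T t s
  have hZm : @Measurable (ℝ × Ω) (E × E) (@Prod.instMeasurableSpace _ _ _ (mY η)) _ fun q =>
      (Y k η t (t + (T - t) * q.1) x q.2, Y k η s (s + (T - s) * q.1) y q.2) := by
    have h1 := hA.measurable_path k hk η t x (a := fun r => t + (T - t) * r) (by fun_prop)
    have h2 := hA.measurable_path k hk η s y (a := fun r => s + (T - s) * r) (by fun_prop)
    exact h1.prodMk h2
  have key := hA.eval_freeze (mΩ' := info τ mY A A) (W' := id) (η := η) (measurable_id'' hm)
    (by rw [MeasurableSpace.comap_id]; exact hind)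
    (Z := fun r ω => (Y k η t (t + (T - t) * r) x ω, Y k η s (s + (T - s) * r) y ω))
    hZm
    (F := fun q ω =>
      (T - t) * (f (U (t + (T - t) * q.1) q.2.1 ω) - f (u (t + (T - t) * q.1) q.2.1))
      - (T - s) * (f (U (s + (T - s) * q.1) q.2.2 ω) - f (u (s + (T - s) * q.1) q.2.2)))
    (Measurable.sub
      (measurable_drift_kernel (m := info τ mY A A) hF.f_meas hum hU (measurable_fst.comp measurable_fst)
        (measurable_fst.comp (measurable_snd.comp measurable_fst)) measurable_snd t)
      (measurable_drift_kernel (m := info τ mY A A) hF.f_meas hum hU (measurable_fst.comp measurable_fst)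
        (measurable_snd.comp (measurable_snd.comp measurable_fst)) measurable_snd s))
    (p := p) (by linarith)
    (w := fun r => √((T - t) / T) * Real.exp (a * ((T - t) / T * (1 - r)) / p))
    (b := fun r z => c * T * e * (3 * phi V T (t + (T - t) * r) z.1 (s + (T - s) * r) z.2
      + td T t s * V (s + (T - s) * r) z.2 ^ 2))
    ((((measurable_phi_comp hV (by fun_prop) (by fun_prop) (by fun_prop)
      (by fun_prop)).const_mul _).add (((hV.comp (f := fun q : ℝ × E × E => (s + (T - s) * q.1, q.2.2))
        (by fun_prop)).pow_const 2).const_mul _)).const_mul _)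
    (by fun_prop) (fun r => by positivity) (W := a ^ (-p⁻¹) * Real.exp (a * ((T - t) / T) / p))
    (β := c * T * e * (3 * (((V t x + V s y) / 2) ^ 9 * (4 * ((V t x + V s y) / 2) * td T t s
      + ((V t x + V s y) / 2 * td T t s + Real.exp (c * T) * nd T (x - y))))
      + td T t s * V s y ^ 2)) ?_ ?_ hW
  · refine key.mono_bound ?_
    have h1 := drift_final_bound (c := c) (T := T) (d := td T t s) (n := nd T (x - y)) rfl hK
      (hF.exp_le_V t x) (hF.exp_le_V s y) hyK hd (nd_nonneg _ _)
    unfold expWeight phi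
    generalize (V t x + V s y) / 2 = W at h1 ⊢
    generalize hQ : Real.exp (a * ((T - t) / T) / p) = Q
    have hQ0 : 0 ≤ Q := hQ ▸ (Real.exp_pos _).le
    have h2 := mul_le_mul_of_nonneg_left h1 (a := a ^ (-p⁻¹) * Q * e) (by positivity)
    calc _ = _ := by ring
      _ ≤ _ := h2
      _ = _ := by ring
  · rintro r hr ⟨z1, z2⟩
    obtain ⟨hρ1, hρ2⟩ := time_change_mem htT hr
    obtain ⟨hρ1', hρ2'⟩ := time_change_mem hs hr
    have hρρ := time_change_mono (T := T) hts hr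
    have hdρ := td_time_change_le (T := T) (t := t) (s := s) hr
    have e1 : expWeight a p T (t + (T - t) * r)
        = Real.exp (a * ((T - t) / T * (1 - r)) / p) := by
      unfold expWeight; congr 1; ring
    have m1 : ∀ (σ : ℝ) (z : E), Measurable fun ω =>
        (T - σ) * (f (U (σ + (T - σ) * r) z (id ω)) - f (u (σ + (T - σ) * r) z)) := fun σ z =>
      measurable_drift_kernel (m := info τ mY A A) hF.f_meas hum hU (A := Ω) (r := fun _ => r)
          (x := fun _ => z) (w := id) measurable_const measurable_const (measurable_id'' hm) σ
    have m2 := ((m1 t z1).sub (m1 s z2)).aestronglyMeasurable (μ := P)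
    simp only
    obtain ⟨ρ, hρ⟩ : ∃ ρ, ρ = t + (T - t) * r := ⟨_, rfl⟩
    obtain ⟨ρ', hρ'⟩ : ∃ ρ', ρ' = s + (T - s) * r := ⟨_, rfl⟩
    rw [← e1]
    simp only [← hρ, ← hρ', id] at *
    have hρI : ρ ∈ Icc 0 T := ⟨ht.trans hρ1, hρ2⟩
    have hρI' : ρ' ∈ Icc 0 T := ⟨hs0.trans hρ1', hρ2'⟩
    have hw0 : 0 ≤ expWeight a p T ρ := by unfold expWeight; positivity
    have hww : expWeight a p T ρ' ≤ expWeight a p T ρ := expWeight_anti ha.le hp0.le hT.le hρρ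
    have b1 := h.val ρ hρI z1
    have b2 : LB P p⁻¹ (fun ω => U ρ' z2 ω - u ρ' z2) (e * expWeight a p T ρ * V ρ' z2 ^ 2) :=
      (h.val ρ' hρI' z2).mono_bound (by gcongr)
    have b3 := h.diff ρ ρ' hρI.1 hρρ hρ2' z1 z2
    obtain ⟨G, hG⟩ : ∃ G, G = Real.exp (c * T) ^ 2 * ((V ρ z1 + V ρ' z2) / 2)
      * (5 / 2 * ((V ρ z1 + V ρ' z2) / 2) * td T ρ ρ' + Real.exp (c * T) * nd T (z1 - z2)) := ⟨_, rfl⟩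
    have hud := hF.solution_time hu hρI.1 hρρ hρ2' z1 z2
    rw [← hG] at hud
    have hG0 : 0 ≤ G := (abs_nonneg _).trans hud
    have tot := (((b3.abs.const_mul hc.le).add' ((b1.abs.add' b2.abs).const_mul (a := c * G / 2)
      (by positivity))).const_mul hTt).add' (b2.abs.const_mul (a := (s - t) * c)
      (mul_nonneg (by linarith) hc.le))
    have h2 := (tot.of_le m2 (Filter.Eventually.of_forall fun ω => ?_)).norm_le
    · rw [inv_inv] at h2
      refine h2.trans (ENNReal.ofReal_le_ofReal ?_)
      have hst : s - t = T * (td T t s * td T t s) := by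
        have := td_sq hT t s
        rw [abs_sub_comm, abs_of_nonneg (by linarith), eq_div_iff hT.ne'] at this
        linarith
      have hTl : T - t = T * (√((T - t) / T) * √((T - t) / T)) := by
        rw [Real.mul_self_sqrt hl0]; field_simp
      have hdl : td T t s ≤ √((T - t) / T) := by
        unfold td
        rw [← Real.sqrt_div (abs_nonneg _)]
        refine Real.sqrt_le_sqrt ?_
        rw [abs_sub_comm, abs_of_nonneg (by linarith)]
        gcongr
      have := drift_weight_bound (e := e) (wρ := expWeight a p T ρ) (dρ := td T ρ ρ')
        (n := nd T (z1 - z2)) (W := (V ρ z1 + V ρ' z2) / 2) rfl hK (hF.exp_le_V ρ z1)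
        (hF.exp_le_V ρ' z2) hc.le hT.le he hw0 hd (td_nonneg _ _ _) (nd_nonneg _ _)
        (Real.sqrt_nonneg _) (Real.sqrt_le_one.2 hl1) hTl hst hdl
      rw [hG]
      unfold phi
      exact this
    · change |(T - t) * (f (U ρ z1 ω) - f (u ρ z1)) - (T - s) * (f (U ρ' z2 ω) - f (u ρ' z2))| ≤ _
      -- The order of the arguments makes the last factor of the second-order condition |u(ρ,z₁) -
      -- u(ρ',z₂)|, a deterministic quantity bounded by G, so no product of two random errors
      -- appears.
      have fd := hF.f_diff (u ρ z1) (U ρ z1 ω) (u ρ' z2) (U ρ' z2 ω)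
      have fl := hF.f_lip (U ρ' z2 ω) (u ρ' z2)
      have e3 : (T - t) * (f (U ρ z1 ω) - f (u ρ z1)) - (T - s) * (f (U ρ' z2 ω) - f (u ρ' z2))
          = -((T - t) * ((f (u ρ z1) - f (U ρ z1 ω)) - (f (u ρ' z2) - f (U ρ' z2 ω))))
            + (s - t) * (f (U ρ' z2 ω) - f (u ρ' z2)) := by ring
      rw [e3]
      refine (abs_add_le _ _).trans (add_le_add ?_ ?_)
      · rw [abs_neg, abs_mul, abs_of_nonneg hTt]
        refine mul_le_mul_of_nonneg_left (fd.trans ?_) hTt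
        have e4 : (u ρ z1 - U ρ z1 ω) - (u ρ' z2 - U ρ' z2 ω)
            = -((U ρ z1 ω - u ρ z1) - (U ρ' z2 ω - u ρ' z2)) := by ring
        rw [e4, abs_neg, abs_sub_comm (u ρ z1) (U ρ z1 ω), abs_sub_comm (u ρ' z2) (U ρ' z2 ω)]
        calc _ ≤ c * |(U ρ z1 ω - u ρ z1) - (U ρ' z2 ω - u ρ' z2)|
            + c * (|U ρ z1 ω - u ρ z1| + |U ρ' z2 ω - u ρ' z2|) * G / 2 := by gcongr
          _ = _ := by ring
      · rw [abs_mul, abs_of_nonneg (by linarith : 0 ≤ s - t), mul_assoc]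
        exact mul_le_mul_of_nonneg_left fl (by linarith)
  · intro r hr
    obtain ⟨hρ1, hρ2⟩ := time_change_mem htT hr
    obtain ⟨hρ1', hρ2'⟩ := time_change_mem hs hr
    have hdρ := td_time_change_le (T := T) (t := t) (s := s) hr
    have hZ := hA.proc k hk η
    have hVx := hF.V_pos t x
    have hVy := hF.V_pos s y
    have k1 : LB P s₁ (fun ω => 1 / 2 * (V (t + (T - t) * r) (Y k η t (t + (T - t) * r) x ω)
        + V (s + (T - s) * r) (Y k η s (s + (T - s) * r) y ω))) ((V t x + V s y) / 2) :=
      (((hZ.V_le t _ ht hρ1 hρ2 x).add' (hZ.V_le s _ hs0 hρ1' hρ2' y)).const_mul (a := 1 / 2)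
        (by norm_num)).mono_bound (le_of_eq (by ring))
    have k2 := hZ.nd_le ht hρ1 hρ2 hts hρ1' hρ2' hdρ (x := x) (y := y) hVx.le hVy.le
    -- Nine factors V in front and one inside the modulus make the degree ten; this is where the
    -- share 10 s₁ of the exponent budget is spent.
    have k3 := (((k1.pow 8 (r := 9 * s₁) (by norm_num) (by linarith)).mul
      ((k1.const_mul (a := 4 * td T t s) (by positivity)).add k2 (r := s₁ + s₂) (by linarith)
        (by linarith) (by linarith)) (r := p⁻¹) (by linarith) hp1).const_mul (a := 3)
        (by norm_num)).add' (((hZ.V_le s _ hs0 hρ1' hρ2' y).pow 1 (r := p⁻¹)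
      (by norm_num; linarith) hp1).const_mul hd)
    refine ((k3.const_mul (a := c * T * e) (by positivity)).of_le ?_
      (Filter.Eventually.of_forall fun ω => ?_)).mono_bound (le_of_eq (by ring))
    · have n1 := hZ.measurable t (t + (T - t) * r) x
      have n2 := hZ.measurable s (s + (T - s) * r) y
      exact ((((measurable_phi_comp hV measurable_const measurable_const n1 n2).const_mul _).add
        (((hV.comp (measurable_const.prodMk n2)).pow_const 2).const_mul _)).const_mul
        _).aestronglyMeasurable
    · have q1 := hF.V_pos (t + (T - t) * r) (Y k η t (t + (T - t) * r) x ω)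
      have q2 := hF.V_pos (s + (T - s) * r) (Y k η s (s + (T - s) * r) y ω)
      have q3 := phi_nonneg (T := T) q1.le q2.le
      rw [abs_of_nonneg (by positivity)]
      have q4 := td_nonneg T (t + (T - t) * r) (s + (T - s) * r)
      have q5 := nd_nonneg T (Y k η t (t + (T - t) * r) x ω - Y k η s (s + (T - s) * r) y ω)
      unfold phi
      refine mul_le_mul_of_nonneg_left (add_le_add (mul_le_mul_of_nonneg_left ?_ (by norm_num))
        (le_of_eq (by ring))) (by positivity)
      generalize V (t + (T - t) * r) (Y k η t (t + (T - t) * r) x ω) = v1 at *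
      generalize V (s + (T - s) * r) (Y k η s (s + (T - s) * r) y ω) = v2 at *
      have e5 : (v1 + v2) / 2 = 1 / 2 * (v1 + v2) := by ring
      rw [e5]
      have e6 : 4 * td T t s * (1 / 2 * (v1 + v2)) = 4 * (1 / 2 * (v1 + v2)) * td T t s := by ring
      rw [e6]
      gcongr

theorem Flow.drift_err {u : ℝ → E → ℝ} (hu : Solution P T f g V X u) {p a : ℝ} (hp : 2 ≤ p)
    (ha : 0 < a) (hq : 10 * s₁ + 2 * s₂ ≤ p⁻¹) {k : ℕ} (hk : 1 ≤ k) {η : Idx}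
    {A : Set Idx} (hind : Indep (info τ mY {η} {η}) (info τ mY A A) P)
    {U : ℝ → E → Ω → ℝ}
    (hU : @Measurable (ℝ × E × Ω) ℝ (@Prod.instMeasurableSpace _ _ _
      (@Prod.instMeasurableSpace _ _ _ (info τ mY A A))) _ fun z => U z.1 z.2.1 z.2.2) {e : ℝ} (he : 0 ≤ e)
    (h : Err P p⁻¹ T V (expWeight a p T) e fun t x ω => U t x ω - u t x) :
    Err P p⁻¹ T V (expWeight a p T) (3 * Real.exp (c * T) ^ 2 * a ^ (-p⁻¹) * e)
      (drift T f u (τ η) (Y k η) U) :=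
  ⟨fun _ ht x => hF.drift_val hA hu hp ha hq hk hind hU he h ht x,
    fun _ _ ht hts hs x y => hF.drift_diff hA hu hp ha hq hk hind hU he h ht hts hs x y⟩

end ErrorBounds

/-! ### Errors of a single level. -/

section LevelErrors

variable {E : Type u} {Ω : Type v} [NormedAddCommGroup E] [MeasurableSpace E] [BorelSpace E]
  [SecondCountableTopology E] [mΩ : MeasurableSpace Ω] {P : Measure Ω} [IsProbabilityMeasure P]
  {s₁ s₂ c T : ℝ} {f : ℝ → ℝ} {g : E → ℝ} {V : ℝ → E → ℝ} {X : ℝ → ℝ → E → Ω → E}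
  {τ : Idx → Ω → ℝ} {Y : ℕ → Idx → ℝ → ℝ → E → Ω → E} {mY : Idx → MeasurableSpace Ω} {M : ℕ}

/-- The summand of the Feynman-Kac formula at a randomized time. -/
noncomputable def pathVal (T : ℝ) (f : ℝ → ℝ) (g : E → ℝ) (u : ℝ → E → ℝ)
    (Z : ℝ → ℝ → E → Ω → E) (r t : ℝ) (x : E) (ω : Ω) : ℝ :=
  g (Z t T x ω) + (T - t) * f (u (t + (T - t) * r) (Z t (t + (T - t) * r) x ω))

theorem measurable_pathVal {m : MeasurableSpace Ω} (hf : Measurable f) (hg : Measurable g)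
    {u : ℝ → E → ℝ} (hu : Measurable fun z : ℝ × E => u z.1 z.2) {Z : ℝ → ℝ → E → Ω → E}
    (hZ : FieldMeas m Z) (t : ℝ) (x : E) :
    Measurable fun q : ℝ × Ω => pathVal T f g u Z q.1 t x q.2 := by
  have h0 : Measurable fun q : ℝ × Ω => t + (T - t) * q.1 := by fun_prop
  have h1 : Measurable fun q : ℝ × Ω => Z t T x q.2 :=
    hZ.comp measurable_const measurable_const measurable_const measurable_snd
  have h2 : Measurable fun q : ℝ × Ω => Z t (t + (T - t) * q.1) x q.2 :=
    hZ.comp measurable_const h0 measurable_const measurable_snd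
  exact (hg.comp h1).add ((hf.comp (hu.comp (f := fun q : ℝ × Ω =>
    (t + (T - t) * q.1, Z t (t + (T - t) * q.1) x q.2)) (h0.prodMk h2))).const_mul _)

theorem pathDiff_eq (T : ℝ) (f : ℝ → ℝ) (g : E → ℝ) (u : ℝ → E → ℝ)
    (Z Z' : ℝ → ℝ → E → Ω → E) (r t : ℝ) (x : E) (ω : Ω) : pathDiff T f g u Z Z' r t x ω
      = pathVal T f g u Z r t x ω - pathVal T f g u Z' r t x ω := by
  unfold pathDiff pathVal; ring

theorem fullVal_eq (T : ℝ) (f : ℝ → ℝ) (g : E → ℝ) (τ : Idx → Ω → ℝ)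
    (Y : ℕ → Idx → ℝ → ℝ → E → Ω → E) (M k ℓ : ℕ) (η η' : Idx) (u : ℝ → E → ℝ) (t : ℝ) (x : E)
    (ω : Ω) : fullVal T f g τ Y M k ℓ η η' t x ω
      = drift T f u (τ η) (Y k η) (mlp T f g τ Y M ℓ η') t x ω
        + pathVal T f g u (Y k η) (τ η ω) t x ω := by
  unfold fullVal drift pathVal; ring

theorem sqrt_natCast_pow (M k : ℕ) : √(((M ^ k : ℕ) : ℝ)) = √(M : ℝ) ^ k := by
  rw [Nat.cast_pow, Real.sqrt_eq_iff_mul_self_eq (by positivity) (by positivity), ← mul_pow,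
    Real.mul_self_sqrt (by positivity)]

section Time

variable (hA : Approx P s₁ s₂ c T V τ Y mY)
include hA

/-- A function of a random time and of a path at this time. -/
theorem Approx.lb_eval_time {η : Idx} {G : ℝ → Ω → ℝ}
    (hG : @Measurable (ℝ × Ω) ℝ (@Prod.instMeasurableSpace _ _ _ (mY η)) _ fun q => G q.1 q.2)
    {p β : ℝ} (hp : 1 ≤ p) (h : ∀ r ∈ Icc (0 : ℝ) 1, LB P p⁻¹ (G r) β) :
    LB P p⁻¹ (fun ω => G (τ η ω) ω) β := by
  have hp0 : 0 < p := by linarith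
  have hp1 : p⁻¹ ≤ 1 := inv_le_one_of_one_le₀ hp
  have key := hA.eval_freeze (Ω' := Unit) (W' := fun _ => ()) (η := η) measurable_const
    (by rw [MeasurableSpace.comap_const]; exact indep_bot_right _) (Z := G) hG
    (F := fun q _ => q.2) (measurable_snd.comp measurable_fst) hp (w := fun _ => 1)
    (b := fun _ z => |z|) (measurable_snd.abs) measurable_const (fun _ => zero_le_one)
    (W := 1) (β := β) (fun r _ z => ?_) (fun r hr => (h r hr).abs)
    (LB.const (by positivity) hp1 zero_le_one)
  · exact key.mono_bound (by rw [one_mul])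
  · rw [eLpNorm_const _ (by simpa using hp0) (IsProbabilityMeasure.ne_zero P)]
    simp [Real.enorm_eq_ofReal_abs]

/-- The integral of a function of a random time and of a path at this time. -/
theorem Approx.integral_eval_time {η : Idx} {G : ℝ → Ω → ℝ}
    (hG : @Measurable (ℝ × Ω) ℝ (@Prod.instMeasurableSpace _ _ _ (mY η)) _ fun q => G q.1 q.2)
    {p β : ℝ} (hp : 1 ≤ p) (h : ∀ r ∈ Icc (0 : ℝ) 1, LB P p⁻¹ (G r) β) :
    ∫ ω, G (τ η ω) ω ∂P = ∫ r in Icc (0 : ℝ) 1, ∫ ω, G r ω ∂P := by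
  have hint := (hA.lb_eval_time hG hp h).integrable
  have hid := measurable_id'' (hA.mY_le η)
  have i2 : @IndepFun Ω ℝ Ω mΩ _ (mY η) (τ η) id P := by
    refine indepFun_id_of_indep ?_
    exact indep_of_indep_of_le_left (indep_of_indep_of_le_right hA.τY_indep (le_iSup _ η))
      (le_iSup (fun θ => MeasurableSpace.comap (τ θ) inferInstance) η)
  have h1 := IndepFun.integral_eq (mΩ' := mY η) (hA.τ_meas η) hid i2 (F := G) hG hint
  have hGΩ : Measurable fun q : ℝ × Ω => G q.1 q.2 := by
    have : @Measurable (ℝ × Ω) (ℝ × Ω) _ (@Prod.instMeasurableSpace _ _ _ (mY η))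
        (fun q => (q.1, id q.2)) := measurable_fst.prodMk (hid.comp measurable_snd)
    exact hG.comp this
  have h2 : Measurable fun r => ∫ ω, G r ω ∂P :=
    hGΩ.stronglyMeasurable.integral_prod_right'.measurable
  calc ∫ ω, G (τ η ω) ω ∂P = ∫ ω', (fun r => ∫ ω, G r ω ∂P) (τ η ω') ∂P := h1
    _ = ∫ r, (∫ ω, G r ω ∂P) ∂(P.map (τ η)) :=
      (integral_map (hA.τ_meas η).aemeasurable h2.aestronglyMeasurable).symm
    _ = _ := by rw [hA.τ_law η]

end Time

variable (hF : Flow P s₁ s₂ c T f g V X)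
include hF

theorem Flow.phi_nonneg (t : ℝ) (x : E) (s : ℝ) (y : E) : 0 ≤ phi V T t x s y :=
  MultigridFBSDE.phi_nonneg (hF.V_pos t x).le (hF.V_pos s y).le

theorem Flow.lb_pathVal {u : ℝ → E → ℝ} (hu : Solution P T f g V X u) {Z : ℝ → ℝ → E → Ω → E}
    (hZ : Proc P s₁ s₂ c T V Z) {q : ℝ} (hq : s₁ ≤ q) (hq1 : q ≤ 1)
    {r t : ℝ} (hr : r ∈ Icc (0 : ℝ) 1) (ht : t ∈ Icc 0 T) (x : E) :
    LB P q (pathVal T f g u Z r t x) (V t x + (T - t) * (|f 0|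
      + c * (2 * Real.exp (c * T) * V t x))) := by
  obtain ⟨hρ1, hρ2⟩ := time_change_mem ht.2 hr
  have hg := hF.solution_growth hu
  have hs := hF.s₁_pos
  have h1 := hZ.V_le t T ht.1 ht.2 le_rfl x
  have h2 := hZ.V_le t _ ht.1 hρ1 hρ2 x
  have h3 := h1.add' (((LB.const hs (hq.trans hq1) (abs_nonneg (f 0))).add'
    ((h2.const_mul hg.nonneg).const_mul hF.c_pos.le)).const_mul (a := T - t) (by linarith [ht.2]))
  refine (h3.of_le ?_ (Filter.Eventually.of_forall fun ω => ?_)).mono_exponent hq hq1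
  · exact ((measurable_pathVal hF.f_meas hF.g_meas hg.meas hZ.meas t x).comp
      (measurable_const.prodMk measurable_id)).aestronglyMeasurable
  · unfold pathVal
    refine (abs_add_le _ _).trans (add_le_add (hF.g_le _) ?_)
    rw [abs_mul, abs_of_nonneg (by linarith [ht.2] : 0 ≤ T - t)]
    refine mul_le_mul_of_nonneg_left ((hF.abs_f_le _).trans ?_) (by linarith [ht.2])
    have := mul_le_mul_of_nonneg_left
      (hg.le _ ⟨ht.1.trans hρ1, hρ2⟩ (Z t (t + (T - t) * r) x ω)) hF.c_pos.le
    linarith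

/-- The substitution r ↦ t + (T-t)r absorbs the factor T - t and exhibits u as the mean, over a
uniform time, of the quantity that the summands sample. -/
theorem Flow.solution_eq_integral {u : ℝ → E → ℝ} (hu : Solution P T f g V X u) {t : ℝ}
    (ht : t ∈ Icc 0 T) (x : E) :
    u t x = ∫ r in Icc (0 : ℝ) 1, ∫ ω, pathVal T f g u X r t x ω ∂P := by
  have hs₁ := hF.s₁_pos
  have hg := hF.solution_growth hu
  have e1 : ∀ r ∈ Icc (0 : ℝ) 1, ∫ ω, pathVal T f g u X r t x ω ∂P
      = ∫ ω, g (X t T x ω) ∂P + (T - t) * ∫ ω, f (u (t + (T - t) * r)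
        (X t (t + (T - t) * r) x ω)) ∂P := fun r hr => by
    obtain ⟨hρ1, hρ2⟩ := time_change_mem ht.2 hr
    unfold pathVal
    rw [integral_add (hF.lb_g ht x).integrable
      ((hF.lb_f_comp hg ht.1 hρ1 hρ2 x).integrable.const_mul _), integral_const_mul]
  rw [setIntegral_congr_fun measurableSet_Icc e1, integral_Icc_eq_integral_Ioc,
    ← intervalIntegral.integral_of_le zero_le_one, hu.eq t ht x, picardStep]
  have h3 : IntervalIntegrable (fun r => (T - t) * ∫ ω, f (u (t + (T - t) * r)
      (X t (t + (T - t) * r) x ω)) ∂P) volume 0 1 := by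
    refine IntervalIntegrable.const_mul ?_ _
    rw [intervalIntegrable_iff_integrableOn_Ioc_of_le zero_le_one]
    refine Integrable.mono' (g := fun _ => |f 0| + c * (2 * Real.exp (c * T) * V t x))
      (integrable_const _) ?_ ?_
    · exact ((hF.measurable_integral_f hg.meas).comp (f := fun r : ℝ => (t, x, t + (T - t) * r))
        (by fun_prop)).aestronglyMeasurable
    · refine (ae_restrict_iff' measurableSet_Ioc).2 (Filter.Eventually.of_forall fun r hr => ?_)
      obtain ⟨hρ1, hρ2⟩ := time_change_mem ht.2 ⟨hr.1.le, hr.2⟩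
      exact (hF.lb_f_comp hg ht.1 hρ1 hρ2 x).abs_integral_le
  rw [intervalIntegral.integral_add intervalIntegrable_const h3,
    intervalIntegral.integral_const_mul,
    intervalIntegral.mul_integral_comp_add_mul
      (f := fun r => ∫ ω, f (u r (X t r x ω)) ∂P) (T - t) t]
  simp

/-- On level zero f is evaluated at 0, so no earlier error enters. The constant 2 collects |g| ≤ V
and T|f(0)| ≤ V. -/
theorem Flow.level_zero_err (hA : Approx P s₁ s₂ c T V τ Y mY) {p a : ℝ} (hp : 2 ≤ p) (ha : 0 < a)
    (hq : 10 * s₁ + 2 * s₂ ≤ p⁻¹) {k : ℕ} (hk : 1 ≤ k) (η : Idx) :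
    Err P p⁻¹ T V (expWeight a p T) 2 fun t x ω => g (Y k η t T x ω) + (T - t) * f 0 := by
  have hT := hF.T_pos
  have hs₁ := hF.s₁_pos
  have hs₂ := hF.s₂_pos
  have hp1 : p⁻¹ ≤ 1 := inv_le_one_of_one_le₀ (by linarith)
  have hK := hF.one_le_exp
  have hZ := hA.proc k hk η
  have hw : ∀ t ≤ T, 1 ≤ expWeight a p T t := fun t ht =>
    one_le_expWeight ha.le (by linarith) hT.le ht
  have hm : ∀ t x, Measurable fun ω => g (Y k η t T x ω) + (T - t) * f 0 := fun t x =>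
    (hF.g_meas.comp (hZ.measurable t T x)).add_const _
  refine ⟨fun t ht x => ?_, fun t s ht hts hs x y => ?_⟩
  · have h1 := hZ.V_le t T ht.1 ht.2 le_rfl x
    have hV := hF.one_le_V t x
    refine ((((h1.add' (LB.const hs₁ (by linarith) (hF.V_pos t x).le)).mono_exponent
      (r := p⁻¹) (by linarith) hp1).of_le (hm t x).aestronglyMeasurable
      (Filter.Eventually.of_forall fun ω => ?_))).mono_bound ?_
    · refine (abs_add_le _ _).trans (add_le_add (hF.g_le _) ?_)
      rw [abs_mul, abs_of_nonneg (by linarith [ht.2] : 0 ≤ T - t)]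
      refine le_trans ?_ (hF.f_zero t x)
      gcongr; linarith [ht.1]
    · have := hw t ht.2
      have h3 : V t x ≤ V t x ^ 2 := by nlinarith
      calc V t x + V t x ≤ 2 * 1 * V t x ^ 2 := by linarith
        _ ≤ _ := by gcongr
  · have hs0 := ht.trans hts
    have htT := hts.trans hs
    have hVx := hF.V_pos t x
    have hVy := hF.V_pos s y
    have k1 : LB P s₁ (fun ω => 1 / 2 * (V T (Y k η t T x ω) + V T (Y k η s T y ω)))
        ((V t x + V s y) / 2) :=
      (((hZ.V_le t T ht htT le_rfl x).add' (hZ.V_le s T hs0 hs le_rfl y)).const_mul (a := 1 / 2)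
        (by norm_num)).mono_bound (le_of_eq (by ring))
    have hd := td_nonneg T t s
    have hn := nd_nonneg T (x - y)
    have k2 := hZ.nd_le ht htT le_rfl hts hs le_rfl (x := x) (y := y)
      (by rw [td_self]; exact hd) hVx.le hVy.le
    have k3 := (k1.mul k2 (r := p⁻¹) (by linarith) hp1).add' (LB.const (P := P) (s := p⁻¹)
      (a := td T t s * ((V t x + V s y) / 2)) (by positivity) hp1 (by positivity))
    refine (k3.of_le ((hm t x).sub (hm s y)).aestronglyMeasurable
      (Filter.Eventually.of_forall fun ω => ?_)).mono_bound ?_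
    · have e : g (Y k η t T x ω) + (T - t) * f 0 - (g (Y k η s T y ω) + (T - s) * f 0)
          = (g (Y k η t T x ω) - g (Y k η s T y ω)) + (s - t) * f 0 := by ring
      rw [Pi.sub_apply, e]
      refine (abs_add_le _ _).trans (add_le_add ((hF.g_lip _ _).trans (le_of_eq (by ring))) ?_)
      have hst : s - t = T * (td T t s * td T t s) := by
        have := td_sq hT t s
        rw [abs_sub_comm, abs_of_nonneg (by linarith), eq_div_iff hT.ne'] at this
        linarith
      have hd1 := td_le_one hT ⟨ht, htT⟩ ⟨hs0, hs⟩
      rw [abs_mul, abs_of_nonneg (by linarith : 0 ≤ s - t), hst]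
      calc T * (td T t s * td T t s) * |f 0| = td T t s * td T t s * (T * |f 0|) := by ring
        _ ≤ td T t s * 1 * ((V t x + V s y) / 2) := by
          gcongr
          have := hF.f_zero t x
          have := hF.f_zero s y
          linarith
        _ = _ := by ring
    · have hw1 := hw t htT
      have hφ := hF.phi_nonneg t x s y
      have hVK := hF.exp_le_V t x
      have hVK' := hF.exp_le_V s y
      have h5 : (V t x + V s y) / 2 * ((V t x + V s y) / 2 * td T t s
          + Real.exp (c * T) * nd T (x - y)) + td T t s * ((V t x + V s y) / 2)
          ≤ phi V T t x s y := by
        unfold phi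
        obtain ⟨W, hW⟩ : ∃ W, W = (V t x + V s y) / 2 := ⟨_, rfl⟩
        rw [← hW]
        have hKW : Real.exp (c * T) ≤ W := by rw [hW]; linarith
        have hW1 : 1 ≤ W := hK.trans hKW
        have p1 : W ^ 2 ≤ W ^ 10 := pow_le_pow_right₀ hW1 (by norm_num)
        have p2 : W ^ 2 ≤ W ^ 9 := pow_le_pow_right₀ hW1 (by norm_num)
        have p3 : W ≤ W ^ 10 := le_self_pow₀ hW1 (by norm_num)
        calc W * (W * td T t s + Real.exp (c * T) * nd T (x - y)) + td T t s * W
            ≤ W * (W * td T t s + W * nd T (x - y)) + td T t s * W := by gcongr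
          _ = W ^ 2 * td T t s + W ^ 2 * nd T (x - y) + W * td T t s := by ring
          _ ≤ W ^ 10 * td T t s + W ^ 9 * nd T (x - y) + W ^ 10 * td T t s := by gcongr
          _ ≤ 4 * (W ^ 10 * td T t s) + W ^ 9 * nd T (x - y) := by
            have : 0 ≤ W ^ 10 * td T t s := by positivity
            linarith
          _ = _ := by ring
      refine h5.trans ?_
      nlinarith [mul_nonneg (by linarith : 0 ≤ 2 * expWeight a p T t - 1) hφ]

/-- For a fixed random time this is a path difference between two discretizations carrying the same
index; integrating over the time preserves the bound. -/
theorem Flow.path_err (hA : Approx P s₁ s₂ c T V τ Y mY) {u : ℝ → E → ℝ}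
    (hu : Solution P T f g V X u) {p a : ℝ} (hp : 2 ≤ p) (ha : 0 < a)
    (hq : 10 * s₁ + 2 * s₂ ≤ p⁻¹) {k k' : ℕ} (hk : 1 ≤ k) (hk' : 1 ≤ k') (η : Idx) :
    Err P p⁻¹ T V (expWeight a p T)
      (5 * Real.exp (c * T) ^ 6 * (1 / √(k : ℝ) + 1 / √(k' : ℝ)))
      fun t x ω => pathVal T f g u (Y k η) (τ η ω) t x ω
        - pathVal T f g u (Y k' η) (τ η ω) t x ω := by
  have hT := hF.T_pos
  have hp1 : p⁻¹ ≤ 1 := inv_le_one_of_one_le₀ (by linarith)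
  have hK := hF.one_le_exp
  have hum := (hF.solution_growth hu).meas
  have hw : ∀ t ≤ T, 1 ≤ expWeight a p T t := fun t ht =>
    one_le_expWeight ha.le (by linarith) hT.le ht
  have hδ : 0 ≤ 1 / √(k : ℝ) + 1 / √(k' : ℝ) := by positivity
  generalize hδd : 1 / √(k : ℝ) + 1 / √(k' : ℝ) = δ at hδ
  have hcl := hA.close k k' hk hk' η
  rw [hδd] at hcl
  have hm : ∀ t x, @Measurable (ℝ × Ω) ℝ (@Prod.instMeasurableSpace _ _ _ (mY η)) _ fun q =>
      pathVal T f g u (Y k η) q.1 t x q.2 - pathVal T f g u (Y k' η) q.1 t x q.2 := fun t x =>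
    (measurable_pathVal (m := mY η) hF.f_meas hF.g_meas hum (hA.Y_meas k hk η) t x).sub
      (measurable_pathVal (m := mY η) hF.f_meas hF.g_meas hum (hA.Y_meas k' hk' η) t x)
  refine ⟨fun t ht x => ?_, fun t s ht hts hs x y => ?_⟩
  · have h1 := hA.lb_eval_time (G := fun r ω => pathVal T f g u (Y k η) r t x ω
      - pathVal T f g u (Y k' η) r t x ω) (hm t x) (p := p) (by linarith) fun r hr => by
        simp only [← pathDiff_eq]
        exact hF.pathDiff_le hu (hA.proc k hk η) (hA.proc k' hk' η) hδ hcl hq hp1 hr ht x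
    refine h1.mono_bound ?_
    have h2 : Real.exp (c * T) ^ 3 ≤ 5 * Real.exp (c * T) ^ 6 := by
      have := pow_le_pow_right₀ hK (show 3 ≤ 6 by norm_num)
      have : 0 < Real.exp (c * T) ^ 6 := by positivity
      linarith
    calc Real.exp (c * T) ^ 3 * δ * V t x ^ 2
        ≤ 5 * Real.exp (c * T) ^ 6 * δ * 1 * V t x ^ 2 := by rw [mul_one]; gcongr
      _ ≤ _ := by
        gcongr; exact hw t ht.2
  · have h1 := hA.lb_eval_time (G := fun r ω => (pathVal T f g u (Y k η) r t x ω
      - pathVal T f g u (Y k' η) r t x ω) - (pathVal T f g u (Y k η) r s y ω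
      - pathVal T f g u (Y k' η) r s y ω)) ((hm t x).sub (hm s y)) (p := p) (by linarith)
      fun r hr => by
        simp only [← pathDiff_eq]
        exact hF.pathDiff_sub_le hu (hA.proc k hk η) (hA.proc k' hk' η) hδ hcl hq hp1 hr ht hts hs x y
    refine h1.mono_bound ?_
    have hφ := hF.phi_nonneg t x s y
    calc 5 * Real.exp (c * T) ^ 6 * δ * phi V T t x s y
        = 5 * Real.exp (c * T) ^ 6 * δ * 1 * phi V T t x s y := by rw [mul_one]
      _ ≤ _ := by gcongr; exact hw t (hts.trans hs)

/-- The deterministic error which is caused by replacing the forward process. -/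
theorem Flow.path_bias (hA : Approx P s₁ s₂ c T V τ Y mY) {u : ℝ → E → ℝ}
    (hu : Solution P T f g V X u) {p a : ℝ} (hp : 2 ≤ p) (ha : 0 < a)
    (hq : 10 * s₁ + 2 * s₂ ≤ p⁻¹) {k : ℕ} (hk : 1 ≤ k) {η : Idx}
    (hcl : Close P s₂ T V (Y k η) X (1 / √(k : ℝ))) :
    Err P p⁻¹ T V (expWeight a p T) (5 * Real.exp (c * T) ^ 6 * (1 / √(k : ℝ)))
      fun t x _ => ∫ ω, pathVal T f g u (Y k η) (τ η ω) t x ω ∂P - u t x := by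
  have hT := hF.T_pos
  have hs₁ := hF.s₁_pos
  have hs₂ := hF.s₂_pos
  have hp0 : 0 < p⁻¹ := by positivity
  have hp1 : p⁻¹ ≤ 1 := inv_le_one_of_one_le₀ (by linarith)
  have hK := hF.one_le_exp
  have hum := (hF.solution_growth hu).meas
  have hw : ∀ t ≤ T, 1 ≤ expWeight a p T t := fun t ht =>
    one_le_expWeight ha.le (by linarith) hT.le ht
  have hZ := hA.proc k hk η
  have hδ : 0 ≤ 1 / √(k : ℝ) := by positivity
  generalize 1 / √(k : ℝ) = δ at hδ hcl
  have hq1 : s₁ ≤ p⁻¹ := by linarith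
  -- Both terms average over the same uniform time, so the bias is a mean of expected path
  -- differences against X and only one discretization error occurs.
  have rep : ∀ t ∈ Icc 0 T, ∀ x, ∫ ω, pathVal T f g u (Y k η) (τ η ω) t x ω ∂P - u t x
      = ∫ r in Icc (0 : ℝ) 1, ∫ ω, pathDiff T f g u (Y k η) X r t x ω ∂P := fun t ht x => by
    have b1 : ∀ {Z}, Proc P s₁ s₂ c T V Z → ∀ r ∈ Icc (0 : ℝ) 1, _ := fun {Z} hZ r hr =>
      hF.lb_pathVal hu (Z := Z) hZ hq1 hp1 hr ht x
    have b2 : ∀ {Z}, Proc P s₁ s₂ c T V Z → IntegrableOn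
        (fun r => ∫ ω, pathVal T f g u Z r t x ω ∂P) (Icc 0 1) := fun {Z} hZ => by
      refine Integrable.mono' (g := fun _ => V t x + (T - t) * (|f 0|
        + c * (2 * Real.exp (c * T) * V t x))) (integrable_const _) ?_ ?_
      · exact (measurable_pathVal hF.f_meas hF.g_meas hum hZ.meas t
          x).stronglyMeasurable.integral_prod_right'.measurable.aestronglyMeasurable
      · exact (ae_restrict_iff' measurableSet_Icc).2 (Filter.Eventually.of_forall fun r hr =>
          (b1 hZ r hr).abs_integral_le)
    rw [hF.solution_eq_integral hu ht x, hA.integral_eval_time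
      (G := fun r ω => pathVal T f g u (Y k η) r t x ω) (measurable_pathVal (m := mY η) hF.f_meas
        hF.g_meas hum (hA.Y_meas k hk η) t x) (p := p) (by linarith) (b1 hZ),
      ← integral_sub (b2 hZ) (b2 hF.proc)]
    refine setIntegral_congr_fun measurableSet_Icc fun r hr => ?_
    simp only [pathDiff_eq]
    exact (integral_sub (b1 hZ r hr).integrable (b1 hF.proc r hr).integrable).symm
  have bd : ∀ {G : ℝ → ℝ} {b : ℝ}, (∀ r ∈ Icc (0 : ℝ) 1, |G r| ≤ b) →
      |∫ r in Icc (0 : ℝ) 1, G r| ≤ b := fun {G b} h => by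
    have := norm_setIntegral_le_of_norm_le_const (μ := volume) (s := Icc (0 : ℝ) 1) (f := G)
      (C := b) (by simp) h
    simpa using this
  have lb : ∀ {z b : ℝ}, |z| ≤ b → LB P p⁻¹ (fun _ => z) b := fun {z b} h =>
    (LB.const hp0 hp1 ((abs_nonneg z).trans h)).of_le aestronglyMeasurable_const
      (Filter.Eventually.of_forall fun _ => h)
  have l1 : ∀ t ∈ Icc 0 T, ∀ x, ∀ r ∈ Icc (0 : ℝ) 1, _ := fun t ht x r hr =>
    hF.pathDiff_le hu hZ hF.proc hδ hcl hq hp1 hr ht x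
  refine ⟨fun t ht x => lb ?_, fun t s ht hts hs x y => lb ?_⟩
  · rw [rep t ht x]
    refine (bd fun r hr => (l1 t ht x r hr).abs_integral_le).trans ?_
    have h2 : Real.exp (c * T) ^ 3 ≤ 5 * Real.exp (c * T) ^ 6 := by
      have := pow_le_pow_right₀ hK (show 3 ≤ 6 by norm_num)
      have : 0 < Real.exp (c * T) ^ 6 := by positivity
      linarith
    calc Real.exp (c * T) ^ 3 * δ * V t x ^ 2
        ≤ 5 * Real.exp (c * T) ^ 6 * δ * 1 * V t x ^ 2 := by rw [mul_one]; gcongr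
      _ ≤ _ := by gcongr; exact hw t ht.2
  · have htI : t ∈ Icc 0 T := ⟨ht, hts.trans hs⟩
    have hsI : s ∈ Icc 0 T := ⟨ht.trans hts, hs⟩
    have hφ := hF.phi_nonneg t x s y
    have b2 : ∀ t ∈ Icc 0 T, ∀ x, IntegrableOn
        (fun r => ∫ ω, pathDiff T f g u (Y k η) X r t x ω ∂P) (Icc 0 1) := fun t ht x => by
      refine Integrable.mono' (g := fun _ => _) (integrable_const _) ?_
        ((ae_restrict_iff' measurableSet_Icc).2 (Filter.Eventually.of_forall fun r hr =>
          (l1 t ht x r hr).abs_integral_le))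
      simp only [pathDiff_eq]
      exact ((measurable_pathVal hF.f_meas hF.g_meas hum hZ.meas t x).sub
        (measurable_pathVal hF.f_meas hF.g_meas hum hF.proc.meas t
          x)).stronglyMeasurable.integral_prod_right'.measurable.aestronglyMeasurable
    rw [rep t htI x, rep s hsI y, ← integral_sub (b2 t htI x) (b2 s hsI y)]
    refine (bd (b := 5 * Real.exp (c * T) ^ 6 * δ * phi V T t x s y) fun r hr => ?_).trans ?_
    · rw [← integral_sub (l1 t htI x r hr).integrable (l1 s hsI y r hr).integrable]
      exact (hF.pathDiff_sub_le hu hZ hF.proc hδ hcl hq hp1 hr ht hts hs x y).abs_integral_le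
    · calc 5 * Real.exp (c * T) ^ 6 * δ * phi V T t x s y
          = 5 * Real.exp (c * T) ^ 6 * δ * 1 * phi V T t x s y := by rw [mul_one]
        _ ≤ _ := by gcongr; exact hw t (hts.trans hs)

end LevelErrors

/-! ### The error recursion for the multilevel Picard approximations. -/

section PicardError

variable {E : Type u} {Ω : Type v} [NormedAddCommGroup E] [MeasurableSpace E] [BorelSpace E]
  [SecondCountableTopology E] [mΩ : MeasurableSpace Ω] {P : Measure Ω} [IsProbabilityMeasure P]
  {s₁ s₂ c T : ℝ} {f : ℝ → ℝ} {g : E → ℝ} {V : ℝ → E → ℝ} {X : ℝ → ℝ → E → Ω → E}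
  {τ : Idx → Ω → ℝ} {Y : ℕ → Idx → ℝ → ℝ → E → Ω → E} {mY : Idx → MeasurableSpace Ω} {M : ℕ}

/-- The two drift parts cost 3 each and the path part costs 5. The factor s = √m inside C pays for
σ^k = sσ^{k+1} in the path part; in the drift of the lower level the gain σ compensates for it. -/
theorem term_const_le {K C B σ s : ℝ} {k : ℕ} (hK : 1 ≤ K) (hσ0 : 0 < σ) (hσ1 : σ ≤ 1)
    (hs : 1 ≤ s) (hsσ : s * σ = 1) (hC : C = 2 * s * K ^ 2) (hB : 1 ≤ B) :
    3 * K ^ 2 * σ * (C * B ^ (k + 1) * σ ^ (k + 1)) + 3 * K ^ 2 * σ * (C * B ^ k * σ ^ k)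
      + 5 * K ^ 6 * (σ ^ (k + 1) + σ ^ k) ≤ 11 * C * K ^ 4 * B ^ (k + 1) * σ ^ (k + 1) := by
  have hC0 : 0 < C := by rw [hC]; positivity
  have hBk : B ^ k ≤ B ^ (k + 1) := pow_le_pow_right₀ hB (by omega)
  have hB1 : 1 ≤ B ^ (k + 1) := one_le_pow₀ hB
  have hK2 : K ^ 2 ≤ K ^ 4 := pow_le_pow_right₀ hK (by norm_num)
  have e1 : σ ^ k = s * σ ^ (k + 1) := by rw [pow_succ]; linear_combination (-σ ^ k) * hsσ
  obtain ⟨S, hS⟩ : ∃ S, S = σ ^ (k + 1) := ⟨_, rfl⟩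
  have hS0 : 0 < S := by rw [hS]; positivity
  have t1 : 3 * K ^ 2 * σ * (C * B ^ (k + 1) * S) ≤ 3 * K ^ 4 * 1 * (C * B ^ (k + 1) * S) := by
    gcongr
  have t2 : 3 * K ^ 2 * σ * (C * B ^ k * (s * S)) ≤ 3 * K ^ 4 * (C * B ^ (k + 1) * S) := by
    calc 3 * K ^ 2 * σ * (C * B ^ k * (s * S)) = 3 * K ^ 2 * (C * B ^ k * S) * (s * σ) := by ring
      _ = 3 * K ^ 2 * (C * B ^ k * S) := by rw [hsσ, mul_one]
      _ ≤ _ := by gcongr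
  have t3 : 5 * K ^ 6 * (S + s * S) ≤ 5 * K ^ 4 * (C * B ^ (k + 1) * S) := by
    calc 5 * K ^ 6 * (S + s * S) ≤ 5 * K ^ 6 * (s * S + s * S) := by gcongr; nlinarith
      _ = 5 * K ^ 4 * (C * 1 * S) := by rw [hC]; ring
      _ ≤ _ := by gcongr
  rw [e1, ← hS]
  nlinarith [t1, t2, t3]

/-- As for the summands, but with one drift part and one discretization error: 3 + 5/2 ≤ 6. -/
theorem bias_const_le {K C B σ s : ℝ} {k : ℕ} (hK : 1 ≤ K) (hσ0 : 0 < σ)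
    (hs : 1 ≤ s) (hsσ : s * σ = 1) (hC : C = 2 * s * K ^ 2) (hB : 1 ≤ B) :
    3 * K ^ 2 * σ * (C * B ^ k * σ ^ k) + 5 * K ^ 6 * σ ^ k
      ≤ 6 * C * K ^ 4 * B ^ k * σ ^ (k + 1) := by
  have hC0 : 0 < C := by rw [hC]; positivity
  have hB1 : 1 ≤ B ^ k := one_le_pow₀ hB
  have hK2 : K ^ 2 ≤ K ^ 4 := pow_le_pow_right₀ hK (by norm_num)
  have e1 : σ ^ k = s * σ ^ (k + 1) := by rw [pow_succ]; linear_combination (-σ ^ k) * hsσ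
  obtain ⟨S, hS⟩ : ∃ S, S = σ ^ (k + 1) := ⟨_, rfl⟩
  have hS0 : 0 < S := by rw [hS]; positivity
  have t2 : 3 * K ^ 2 * σ * (C * B ^ k * (s * S)) ≤ 3 * K ^ 4 * (C * B ^ k * S) := by
    calc 3 * K ^ 2 * σ * (C * B ^ k * (s * S)) = 3 * K ^ 2 * (C * B ^ k * S) * (s * σ) := by ring
      _ = 3 * K ^ 2 * (C * B ^ k * S) := by rw [hsσ, mul_one]
      _ ≤ _ := by gcongr
  have t3 : 5 * K ^ 6 * (s * S) ≤ 5 / 2 * K ^ 4 * (C * B ^ k * S) := by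
    calc 5 * K ^ 6 * (s * S) = 5 / 2 * K ^ 4 * (C * 1 * S) := by rw [hC]; ring
      _ ≤ _ := by gcongr
  have t4 : 0 ≤ K ^ 4 * (C * B ^ k * S) := by positivity
  rw [e1, ← hS]
  nlinarith [t2, t3, t4]

/-- The powers of σ from sampling and from the level always combine to σ^{k+1}, leaving a geometric
series in B. The constant 74 is large enough for the series, with 22·1.42/73 < 1/2, and for the
bias, with 12 ≤ 74, to use at most one half each. -/
theorem total_const_le {K C B σ q : ℝ} {k : ℕ} (hK : 1 ≤ K) (hσ0 : 0 < σ) (hC : 0 ≤ C)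
    (hq : 1 ≤ q) (hB : B = 74 * K ^ 4 * q) :
    (∑ ℓ ∈ Finset.range (k + 1), 2 * (√2 * q) * σ ^ (k + 1 - ℓ)
        * (11 * C * K ^ 4 * B ^ ℓ * σ ^ ℓ)) + 6 * C * K ^ 4 * B ^ k * σ ^ (k + 1)
      ≤ C * B ^ (k + 1) * σ ^ (k + 1) := by
  have hK4 : 1 ≤ K ^ 4 := one_le_pow₀ hK
  have hB74 : 74 ≤ B := by rw [hB]; nlinarith
  have e1 : ∀ ℓ ∈ Finset.range (k + 1), 2 * (√2 * q) * σ ^ (k + 1 - ℓ)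
        * (11 * C * K ^ 4 * B ^ ℓ * σ ^ ℓ) = 22 * √2 * q * K ^ 4 * C * σ ^ (k + 1) * B ^ ℓ := by
    intro ℓ hℓ
    have : σ ^ (k + 1) = σ ^ (k + 1 - ℓ) * σ ^ ℓ := by
      rw [← pow_add]; congr 1; have := Finset.mem_range.1 hℓ; omega
    rw [this]; ring
  rw [Finset.sum_congr rfl e1, ← Finset.mul_sum]
  obtain ⟨S, hS⟩ : ∃ S, S = ∑ ℓ ∈ Finset.range (k + 1), B ^ ℓ := ⟨_, rfl⟩
  have hgeom : S * (B - 1) = B ^ (k + 1) - 1 := by rw [hS]; exact geom_sum_mul B (k + 1)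
  have hS0 : 0 ≤ S := by rw [hS]; exact Finset.sum_nonneg fun _ _ => by positivity
  rw [← hS]
  have h2 : √2 ≤ 1.42 := by
    rw [Real.sqrt_le_left (by norm_num)]; norm_num
  obtain ⟨R, hR⟩ : ∃ R, R = K ^ 4 * q := ⟨_, rfl⟩
  have hR1 : 1 ≤ R := by rw [hR]; nlinarith
  have hBR : B = 74 * R := by rw [hB, hR]; ring
  have hBk : 0 < B ^ (k + 1) := by positivity
  have h3 : 73 * R * S ≤ B ^ (k + 1) := by
    have : R * S ≥ S := by nlinarith
    nlinarith
  have h4 : 22 * √2 * q * K ^ 4 * S ≤ 1 / 2 * B ^ (k + 1) := by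
    calc 22 * √2 * q * K ^ 4 * S = 22 * √2 * (R * S) := by rw [hR]; ring
      _ ≤ 22 * 1.42 * (R * S) := by gcongr
      _ ≤ _ := by nlinarith [mul_nonneg (zero_le_one.trans hR1) hS0]
  have h5 : 6 * K ^ 4 * B ^ k ≤ 1 / 2 * B ^ (k + 1) := by
    rw [pow_succ B k]
    have h6 : 12 * K ^ 4 ≤ B := by rw [hB]; nlinarith
    have h7 : 0 < B ^ k := by positivity
    nlinarith
  calc 22 * √2 * q * K ^ 4 * C * σ ^ (k + 1) * S + 6 * C * K ^ 4 * B ^ k * σ ^ (k + 1)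
      = (22 * √2 * q * K ^ 4 * S + 6 * K ^ 4 * B ^ k) * (C * σ ^ (k + 1)) := by ring
    _ ≤ (1 / 2 * B ^ (k + 1) + 1 / 2 * B ^ (k + 1)) * (C * σ ^ (k + 1)) := by gcongr
    _ = _ := by ring

variable (hA : Approx P s₁ s₂ c T V τ Y mY)
include hA

/-- The moment inequality needs a strictly positive bound; a vanishing one is reached as a limit of
b + 1/(n+1). -/
theorem Approx.lb_average' {p b : ℝ} (hp : 2 ≤ p) (hb : 0 ≤ b) {N : ℕ} (hN : 1 ≤ N) (θ : Idx)
    (ℓ : ℕ) {Z : ℕ → Ω → ℝ}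
    (hm : ∀ i, Measurable[info τ mY (branch θ ℓ (i + 1)) (branch θ ℓ (i + 1))] (Z i))
    (hZ : ∀ i, LB P p⁻¹ (Z i) b) :
    LB P p⁻¹ (fun ω => 1 / (N : ℝ) * ∑ i ∈ Finset.range N, Z i ω
        - ∫ ω, 1 / (N : ℝ) * ∑ i ∈ Finset.range N, Z i ω ∂P)
      (2 * √(2 * (p - 1)) / √(N : ℝ) * b) := by
  refine LB.of_tendsto (ε := fun n : ℕ => 2 * √(2 * (p - 1)) / √(N : ℝ) * (1 / ((n : ℝ) + 1)))
    ?_ fun n => ?_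
  · simpa using tendsto_one_div_add_atTop_nhds_zero_nat.const_mul (2 * √(2 * (p - 1)) / √(N : ℝ))
  · have hn : (0 : ℝ) < 1 / ((n : ℝ) + 1) := by positivity
    have := hA.lb_average hp (b := b + 1 / ((n : ℝ) + 1)) (by linarith) hN θ ℓ hm
      fun i => (hZ i).mono_bound (by linarith)
    rwa [mul_add] at this

/-- From bounds for the summands to bounds for the multilevel Picard approximations. -/
theorem Approx.mlp_err_of_terms (hf : Measurable f) (hg : Measurable g) (hM : 1 ≤ M) {p : ℝ}
    (hp : 2 ≤ p) {w : ℝ → ℝ} {n : ℕ} {θ : Idx} {u : ℝ → E → ℝ} {e : ℕ → ℝ} {e' : ℝ}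
    (hterm : ∀ ℓ < n, ∀ i, Err P p⁻¹ T V w (e ℓ) (mlpTerm T f g τ Y M ℓ θ i))
    (hbias : Err P p⁻¹ T V w e' fun t x _ => ∫ ω, mlp T f g τ Y M n θ t x ω ∂P - u t x) :
    Err P p⁻¹ T V w ((∑ ℓ ∈ Finset.range n, 2 * √(2 * (p - 1)) * (√(M : ℝ))⁻¹ ^ (n - ℓ) * e ℓ) + e')
      fun t x ω => mlp T f g τ Y M n θ t x ω - u t x := by
  have hp0 : 0 < p⁻¹ := by positivity
  have hp1 : p⁻¹ ≤ 1 := inv_le_one_of_one_le₀ (by linarith)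
  -- Formulated for arbitrary summands so that it serves twice: increments of an average are
  -- averages of increments, with the same independence.
  have hcore : ∀ (Z : ℕ → ℕ → Ω → ℝ) (β : ℕ → ℝ), (∀ ℓ < n, ∀ i, LB P p⁻¹ (Z ℓ i) (β ℓ)) →
      (∀ (ℓ i : ℕ), Measurable[info τ mY (branch θ ℓ (i + 1)) (branch θ ℓ (i + 1))] (Z ℓ i)) →
      LB P p⁻¹ (fun ω => ∑ ℓ ∈ Finset.range n, 1 / (M : ℝ) ^ (n - ℓ)
          * ∑ i ∈ Finset.range (M ^ (n - ℓ)), Z ℓ i ω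
        - ∫ ω, ∑ ℓ ∈ Finset.range n, 1 / (M : ℝ) ^ (n - ℓ)
          * ∑ i ∈ Finset.range (M ^ (n - ℓ)), Z ℓ i ω ∂P)
        (∑ ℓ ∈ Finset.range n, 2 * √(2 * (p - 1)) * (√(M : ℝ))⁻¹ ^ (n - ℓ) * β ℓ) := by
    intro Z β hZ hm
    have h1 := LB.sum (P := P) (s := p⁻¹) (Finset.range n) hp0 hp1 fun ℓ hℓ =>
      hA.lb_average' hp (hZ ℓ (Finset.mem_range.1 hℓ) 0).nonneg
        (Nat.one_le_pow (n - ℓ) M hM) θ ℓ (hm ℓ) (hZ ℓ (Finset.mem_range.1 hℓ))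
    refine (h1.congr (Filter.Eventually.of_forall fun ω => ?_)).mono_bound
      (le_of_eq (Finset.sum_congr rfl fun ℓ _ => ?_))
    · simp only [Nat.cast_pow]
      rw [Finset.sum_sub_distrib, integral_finsetSum]
      intro ℓ hℓ
      exact (integrable_finsetSum _ fun i _ =>
        (hZ ℓ (Finset.mem_range.1 hℓ) i).integrable).const_mul _
    · rw [sqrt_natCast_pow, inv_pow, div_eq_mul_inv]
  have hint : ∀ t ∈ Icc 0 T, ∀ x, Integrable (fun ω => ∑ ℓ ∈ Finset.range n, 1 / (M : ℝ) ^ (n - ℓ)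
      * ∑ i ∈ Finset.range (M ^ (n - ℓ)), mlpTerm T f g τ Y M ℓ θ (i + 1) t x ω) P :=
    fun t ht x => integrable_finsetSum _ fun ℓ hℓ => (integrable_finsetSum _ fun i _ =>
      ((hterm ℓ (Finset.mem_range.1 hℓ) (i + 1)).val t ht x).integrable).const_mul _
  refine ⟨fun t ht x => ?_, fun t s ht hts hs x y => ?_⟩
  · have h1 := (hcore (fun ℓ i => mlpTerm T f g τ Y M ℓ θ (i + 1) t x)
      (fun ℓ => e ℓ * w t * V t x ^ 2)
      (fun ℓ hℓ i => (hterm ℓ hℓ (i + 1)).val t ht x)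
      (fun ℓ i => hA.measurable_mlpTerm_apply hf hg hM ℓ θ (i + 1) t x)).add' (hbias.val t ht x)
    refine (h1.congr (Filter.Eventually.of_forall fun ω => ?_)).mono_bound (le_of_eq ?_)
    · simp only [mlp_eq]; ring
    · rw [add_mul, add_mul, Finset.sum_mul, Finset.sum_mul]
      congr 1
      exact Finset.sum_congr rfl fun ℓ _ => by ring
  · have h1 := (hcore (fun ℓ i ω => mlpTerm T f g τ Y M ℓ θ (i + 1) t x ω
        - mlpTerm T f g τ Y M ℓ θ (i + 1) s y ω) (fun ℓ => e ℓ * w t * phi V T t x s y)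
      (fun ℓ hℓ i => (hterm ℓ hℓ (i + 1)).diff t s ht hts hs x y)
      (fun ℓ i => Measurable.sub (hA.measurable_mlpTerm_apply hf hg hM ℓ θ (i + 1) t x)
        (hA.measurable_mlpTerm_apply hf hg hM ℓ θ (i + 1) s y))).add'
      (hbias.diff t s ht hts hs x y)
    refine (h1.congr (Filter.Eventually.of_forall fun ω => ?_)).mono_bound (le_of_eq ?_)
    · simp only [mlp_eq, Finset.sum_sub_distrib, mul_sub]
      rw [integral_sub (hint t ⟨ht, hts.trans hs⟩ x) (hint s ⟨ht.trans hts, hs⟩ y)]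
      ring
    · rw [add_mul, add_mul, Finset.sum_mul, Finset.sum_mul]
      congr 1
      exact Finset.sum_congr rfl fun ℓ _ => by ring

variable (hF : Flow P s₁ s₂ c T f g V X)
include hF

/-- Base case of the recursion: the error of the approximation 0 is u itself, so the regularity of u
is the whole content. -/
theorem Flow.zero_err {u : ℝ → E → ℝ} (hu : Solution P T f g V X u) {p a C : ℝ} (hp : 2 ≤ p)
    (ha : 0 < a) (hC : 2 * Real.exp (c * T) ^ 2 ≤ C) :
    Err P p⁻¹ T V (expWeight a p T) C fun t x (_ : Ω) => 0 - u t x := by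
  have hT := hF.T_pos
  have hp0 : 0 < p⁻¹ := by positivity
  have hp1 : p⁻¹ ≤ 1 := inv_le_one_of_one_le₀ (by linarith)
  have hK := hF.one_le_exp
  have hw : ∀ t ≤ T, 1 ≤ expWeight a p T t := fun t ht =>
    one_le_expWeight ha.le (by linarith) hT.le ht
  have lb : ∀ {z b : ℝ}, |z| ≤ b → LB P p⁻¹ (fun _ => z) b := fun {z b} h =>
    (LB.const hp0 hp1 ((abs_nonneg z).trans h)).of_le aestronglyMeasurable_const
      (Filter.Eventually.of_forall fun _ => h)
  have hC0 : 0 ≤ C := by nlinarith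
  refine ⟨fun t ht x => lb ?_, fun t s ht hts hs x y => lb ?_⟩
  · have h1 := hF.abs_solution_le hu ht x
    have hV := hF.one_le_V t x
    rw [zero_sub, abs_neg]
    refine h1.trans ?_
    calc 2 * Real.exp (c * T) * V t x ≤ 2 * Real.exp (c * T) ^ 2 * V t x ^ 2 := by
          gcongr <;> exact le_self_pow₀ (by assumption) (by norm_num)
      _ ≤ C * 1 * V t x ^ 2 := by rw [mul_one]; gcongr
      _ ≤ _ := by gcongr; exact hw t ht.2
  · have h1 := hF.solution_time hu ht hts hs x y
    have hφ := hF.phi_nonneg t x s y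
    have e : 0 - u t x - (0 - u s y) = -(u t x - u s y) := by ring
    rw [e, abs_neg]
    refine h1.trans ?_
    have hd := td_nonneg T t s
    have hn := nd_nonneg T (x - y)
    have hVx := hF.exp_le_V t x
    have hVy := hF.exp_le_V s y
    have h2 : Real.exp (c * T) ^ 2 * ((V t x + V s y) / 2) * (5 / 2 * ((V t x + V s y) / 2) * td T t s
        + Real.exp (c * T) * nd T (x - y)) ≤ 2 * Real.exp (c * T) ^ 2 * phi V T t x s y := by
      unfold phi
      obtain ⟨W, hW⟩ : ∃ W, W = (V t x + V s y) / 2 := ⟨_, rfl⟩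
      rw [← hW]
      have hKW : Real.exp (c * T) ≤ W := by rw [hW]; linarith
      have hW1 : 1 ≤ W := hK.trans hKW
      have p1 : W ^ 2 ≤ W ^ 10 := pow_le_pow_right₀ hW1 (by norm_num)
      have p2 : W ^ 2 ≤ W ^ 9 := pow_le_pow_right₀ hW1 (by norm_num)
      calc Real.exp (c * T) ^ 2 * W * (5 / 2 * W * td T t s + Real.exp (c * T) * nd T (x - y))
          ≤ Real.exp (c * T) ^ 2 * W * (8 * W * td T t s + 2 * W * nd T (x - y)) := by
            gcongr <;> linarith
        _ = Real.exp (c * T) ^ 2 * (8 * (W ^ 2 * td T t s) + 2 * (W ^ 2 * nd T (x - y))) := by ring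
        _ ≤ Real.exp (c * T) ^ 2 * (8 * (W ^ 10 * td T t s) + 2 * (W ^ 9 * nd T (x - y))) := by
            gcongr
        _ = _ := by ring
    refine h2.trans ?_
    calc 2 * Real.exp (c * T) ^ 2 * phi V T t x s y ≤ C * 1 * phi V T t x s y := by
          rw [mul_one]; gcongr
      _ ≤ _ := by gcongr; exact hw t (hts.trans hs)

/-- The error of the multilevel Picard approximations. -/
theorem Flow.mlp_err {u : ℝ → E → ℝ} (hu : Solution P T f g V X u) {p : ℝ} (hp : 2 ≤ p)
    (hq : 10 * s₁ + 2 * s₂ ≤ p⁻¹) (hM : 1 ≤ M)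
    (hcl : ∀ k, 1 ≤ k → Close P s₂ T V (Y k Idx.zero) X (1 / √(k : ℝ))) (n : ℕ) : ∀ θ : Idx,
    Err P p⁻¹ T V (expWeight ((M : ℝ) ^ (p / 2)) p T) (2 * √(M : ℝ) * Real.exp (c * T) ^ 2
      * (74 * Real.exp (c * T) ^ 4 * √(p - 1)) ^ n * (√(M : ℝ))⁻¹ ^ n)
      fun t x ω => mlp T f g τ Y M n θ t x ω - u t x := by
  have hT := hF.T_pos
  have hp0 : 0 < p := by linarith
  have hp1 : p⁻¹ ≤ 1 := inv_le_one_of_one_le₀ (by linarith)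
  have hK := hF.one_le_exp
  have hMr : (1 : ℝ) ≤ M := by exact_mod_cast hM
  have ha : 0 < (M : ℝ) ^ (p / 2) := by positivity
  have hw : ∀ t ≤ T, 0 ≤ expWeight ((M : ℝ) ^ (p / 2)) p T t := fun t ht => (Real.exp_pos _).le
  have hV : ∀ t x, 0 ≤ V t x := fun t x => (hF.V_pos t x).le
  -- The rate a = m^{p/2} of the exponential weight is chosen so that the gain a^{-1/p} is exactly
  -- m^{-1/2}.
  have haσ : ((M : ℝ) ^ (p / 2)) ^ (-p⁻¹) = (√(M : ℝ))⁻¹ := by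
    rw [← Real.rpow_mul (by positivity), Real.sqrt_eq_rpow, ← Real.rpow_neg (by positivity)]
    congr 1; field_simp
  obtain ⟨K, hKd⟩ : ∃ K, K = Real.exp (c * T) := ⟨_, rfl⟩
  obtain ⟨s, hsd⟩ : ∃ s, s = √(M : ℝ) := ⟨_, rfl⟩
  obtain ⟨σ, hσd⟩ : ∃ σ, σ = (√(M : ℝ))⁻¹ := ⟨_, rfl⟩
  obtain ⟨C, hC⟩ : ∃ C, C = 2 * s * K ^ 2 := ⟨_, rfl⟩
  obtain ⟨B, hB⟩ : ∃ B, B = 74 * K ^ 4 * √(p - 1) := ⟨_, rfl⟩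
  have hs1 : 1 ≤ s := by rw [hsd]; exact Real.one_le_sqrt.2 hMr
  have hσ0 : 0 < σ := by rw [hσd, ← hsd]; positivity
  have hsσ : s * σ = 1 := by rw [hσd, ← hsd]; field_simp
  have hσ1 : σ ≤ 1 := by nlinarith
  have hq1 : 1 ≤ √(p - 1) := Real.one_le_sqrt.2 (by linarith)
  have hC0 : 0 < C := by rw [hC, hKd]; positivity
  rw [← hKd] at hK
  have hB1 : 1 ≤ B := by
    rw [hB]; have : 1 ≤ K ^ 4 := one_le_pow₀ hK
    nlinarith
  have hδ : ∀ k, 1 / √((M ^ k : ℕ) : ℝ) = σ ^ k := fun k => by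
    rw [sqrt_natCast_pow, hσd, inv_pow, one_div]
  rw [← hKd, ← hσd, ← hB, ← hsd, ← hC]
  induction n using Nat.strong_induction_on with
  | _ n ih =>
    intro θ
    have hpow : ∀ j, 1 ≤ M ^ j := fun j => Nat.one_le_pow _ _ hM
    have hdrift : ∀ ℓ < n, ∀ (k : ℕ), 1 ≤ k → ∀ (η η' : Idx), η.1.length ≤ η'.1.length →
        Err P p⁻¹ T V (expWeight ((M : ℝ) ^ (p / 2)) p T)
          (3 * K ^ 2 * σ * (C * B ^ ℓ * σ ^ ℓ))
          (drift T f u (τ η) (Y k η) (mlp T f g τ Y M ℓ η')) := fun ℓ hℓ k hk η η' hη => by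
      have := hF.drift_err hA hu hp ha hq hk (hA.indep_strictExt hη)
        (hA.measurable_mlp_info hF.f_meas hF.g_meas hM ℓ η' subset_rfl) (e := C * B ^ ℓ * σ ^ ℓ)
        (by positivity) (ih ℓ hℓ η')
      rwa [haσ, ← hKd, ← hσd] at this
    have hlen : ∀ (θ : Idx) (ℓ : ℕ) (i j : ℤ),
        (θ.ext ℓ i).1.length ≤ (θ.ext ℓ j).1.length := fun θ ℓ i j => by simp [Idx.ext]
    have hterm : ∀ ℓ < n, ∀ i, Err P p⁻¹ T V (expWeight ((M : ℝ) ^ (p / 2)) p T)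
        (11 * C * K ^ 4 * B ^ ℓ * σ ^ ℓ) (mlpTerm T f g τ Y M ℓ θ i) := by
      intro ℓ hℓ i
      rcases ℓ with _ | k
      · refine ((hF.level_zero_err hA hp ha hq le_rfl (θ.ext (0 : ℕ) i)).congr fun t x ω =>
          ?_).mono ?_ hw hV
        · simp [mlpTerm, fullVal, mlp_zero]
        · have : 1 ≤ K ^ 4 := one_le_pow₀ hK
          have h2 : 2 ≤ C := by rw [hC]; nlinarith [one_le_pow₀ hK (n := 2)]
          simp only [pow_zero, mul_one]
          nlinarith
      · have h1 := ((hdrift (k + 1) hℓ (M ^ (k + 1)) (hpow _) (θ.ext (k + 1 : ℕ) i)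
          (θ.ext (k + 1 : ℕ) i) le_rfl).sub (hdrift k (by omega) (M ^ k) (hpow _)
          (θ.ext (k + 1 : ℕ) i) (θ.ext (k + 1 : ℕ) (-(i : ℤ))) (hlen _ _ _ _))).add
          (hF.path_err hA hu hp ha hq (hpow (k + 1)) (hpow k) (θ.ext (k + 1 : ℕ) i))
        refine (h1.congr fun t x ω => ?_).mono ?_ hw hV
        · rw [mlpTerm, if_pos (by omega), Nat.add_sub_cancel, fullVal_eq _ _ _ _ _ _ _ _ _ _ u,
            fullVal_eq _ _ _ _ _ _ _ _ _ _ u]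
          ring
        · rw [hδ, hδ, ← hKd]
          exact term_const_le hK hσ0 hσ1 hs1 hsσ hC hB1
    rcases n with _ | k
    · refine ((hF.zero_err hA hu hp ha (C := C) ?_).congr fun t x ω => by rw [mlp_zero]).mono
        (by simp) hw hV
      rw [hC, ← hKd]; nlinarith [one_le_pow₀ hK (n := 2)]
    have hfull : ∀ ℓ ≤ k, ∀ t ∈ Icc 0 T, ∀ x,
        Integrable (fun ω => pathVal T f g u (Y (M ^ ℓ) Idx.zero) (τ Idx.zero ω) t x ω) P
        ∧ Integrable (fullVal T f g τ Y M (M ^ ℓ) ℓ Idx.zero Idx.zero t x) P :=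
      fun ℓ hℓ t ht x => by
      have hs₁ := hF.s₁_pos
      have hs₂ := hF.s₂_pos
      have h1 := (hA.lb_eval_time (η := Idx.zero)
        (G := fun r ω => pathVal T f g u (Y (M ^ ℓ) Idx.zero) r t x ω)
        (measurable_pathVal (m := mY Idx.zero) hF.f_meas hF.g_meas (hF.solution_growth hu).meas
          (hA.Y_meas _ (hpow ℓ) Idx.zero) t x) (p := p) (by linarith) fun r hr =>
            hF.lb_pathVal hu (hA.proc _ (hpow ℓ) Idx.zero) (by linarith) hp1 hr ht x).integrable
      refine ⟨h1, ?_⟩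
      have h2 := ((hdrift ℓ (by omega) (M ^ ℓ) (hpow ℓ) Idx.zero Idx.zero le_rfl).val t ht
        x).integrable.add h1
      refine h2.congr (Filter.Eventually.of_forall fun ω => ?_)
      rw [fullVal_eq _ _ _ _ _ _ _ _ _ _ u]
      rfl
    have hmean := hF.path_bias hA hu hp ha hq (hpow k) (hcl _ (hpow k))
    rw [hδ, ← hKd] at hmean
    have hdr := hdrift k (by omega) (M ^ k) (hpow k) Idx.zero Idx.zero le_rfl
    have hdmean : Err P p⁻¹ T V (expWeight ((M : ℝ) ^ (p / 2)) p T)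
        (3 * K ^ 2 * σ * (C * B ^ k * σ ^ k)) fun t x (_ : Ω) => ∫ ω, drift T f u (τ Idx.zero)
          (Y (M ^ k) Idx.zero) (mlp T f g τ Y M k Idx.zero) t x ω ∂P := by
      have lb : ∀ {z b : ℝ}, |z| ≤ b → LB P p⁻¹ (fun _ => z) b := fun {z b} h =>
        (LB.const (by positivity) hp1 ((abs_nonneg z).trans h)).of_le aestronglyMeasurable_const
          (Filter.Eventually.of_forall fun _ => h)
      refine ⟨fun t ht x => lb (hdr.val t ht x).abs_integral_le, fun t s ht hts hs x y => lb ?_⟩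
      rw [← integral_sub (hdr.val t ⟨ht, hts.trans hs⟩ x).integrable
        (hdr.val s ⟨ht.trans hts, hs⟩ y).integrable]
      exact (hdr.diff t s ht hts hs x y).abs_integral_le
    have hsum := hdmean.add hmean
    -- By telescoping, the mean is that of level k alone; it differs from u by the mean drift and by
    -- the path bias.
    have hrep : ∀ t ∈ Icc 0 T, ∀ x, ∫ ω, mlp T f g τ Y M (k + 1) θ t x ω ∂P - u t x
        = ∫ ω, drift T f u (τ Idx.zero) (Y (M ^ k) Idx.zero) (mlp T f g τ Y M k Idx.zero) t x ω ∂P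
        + (∫ ω, pathVal T f g u (Y (M ^ k) Idx.zero) (τ Idx.zero ω) t x ω ∂P - u t x) := by
      intro t ht x
      rw [hA.integral_mlp hF.f_meas hF.g_meas hM k θ t x fun ℓ hℓ => (hfull ℓ hℓ t ht x).2]
      simp only [fullVal_eq _ _ _ _ _ _ _ _ _ _ u]
      rw [integral_add (hdr.val t ht x).integrable (hfull k le_rfl t ht x).1]
      ring
    have hbias : Err P p⁻¹ T V (expWeight ((M : ℝ) ^ (p / 2)) p T)
        (6 * C * K ^ 4 * B ^ k * σ ^ (k + 1))
        fun t x (_ : Ω) => ∫ ω, mlp T f g τ Y M (k + 1) θ t x ω ∂P - u t x := by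
      refine Err.mono (e := 3 * K ^ 2 * σ * (C * B ^ k * σ ^ k) + 5 * K ^ 6 * σ ^ k) ⟨fun t ht x => ?_, fun t s ht hts hs x y => ?_⟩
        (bias_const_le hK hσ0 hs1 hsσ hC hB1) hw hV
      · rw [hrep t ht x]; exact hsum.val t ht x
      · rw [hrep t ⟨ht, hts.trans hs⟩ x, hrep s ⟨ht.trans hts, hs⟩ y]
        exact hsum.diff t s ht hts hs x y
    have htot := hA.mlp_err_of_terms hF.f_meas hF.g_meas hM hp hterm hbias
    refine htot.mono ?_ hw hV
    rw [← hσd, Real.sqrt_mul (by norm_num)]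
    exact total_const_le hK hσ0 hC0.le hq1 hB

end PicardError

/-! ### Linear interpolation on the time grids. -/

section Grid

/-- Lower and upper neighbours are consecutive grid points jT/k and (j+1)T/k. At t = T the
convention that excludes T from the lower neighbour gives j = k - 1, so the mesh is T/k there too.
-/
theorem grid_bounds {T t : ℝ} {k : ℕ} (hT : 0 < T) (hk : 1 ≤ k) (ht : t ∈ Icc 0 T) :
    0 ≤ gridFloor T k t ∧ gridFloor T k t ≤ t ∧ t ≤ gridCeil T k t ∧ gridCeil T k t ≤ T ∧
      gridCeil T k t - gridFloor T k t = T / k := by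
  have hk0 : (0 : ℝ) < k := by exact_mod_cast hk
  obtain ⟨j, hjt, hjk, hj⟩ : ∃ j : ℕ, (j : ℝ) * T / k ≤ t ∧ j < k ∧
      (t < ((j + 1 : ℕ) : ℝ) * T / k ∨ (t = T ∧ j + 1 = k)) := by
    rcases ht.2.lt_or_eq with h | h
    · have h0 : 0 ≤ t * k / T := div_nonneg (mul_nonneg ht.1 hk0.le) hT.le
      refine ⟨⌊t * k / T⌋₊, ?_, ?_, Or.inl ?_⟩
      · have := Nat.floor_le h0
        rw [le_div_iff₀ hT] at this
        rwa [div_le_iff₀ hk0]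
      · rw [Nat.floor_lt h0, div_lt_iff₀ hT, mul_comm]
        gcongr
      · have := Nat.lt_floor_add_one (t * k / T)
        rw [div_lt_iff₀ hT] at this
        rw [lt_div_iff₀ hk0]
        push_cast
        exact this
    · refine ⟨k - 1, ?_, by omega, Or.inr ⟨h, by omega⟩⟩
      rw [h, div_le_iff₀ hk0, mul_comm]
      have : ((k - 1 : ℕ) : ℝ) ≤ k := by exact_mod_cast Nat.sub_le k 1
      gcongr
  have cast_lt : ∀ {a b : ℕ}, (a : ℝ) * T / k < (b : ℝ) * T / k → a < b := fun {a b} h => by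
    rw [div_lt_div_iff_of_pos_right hk0, mul_lt_mul_iff_left₀ hT] at h
    exact_mod_cast h
  have cast_le : ∀ {a b : ℕ}, a ≤ b → (a : ℝ) * T / k ≤ (b : ℝ) * T / k := fun {a b} h => by
    have : (a : ℝ) ≤ b := by exact_mod_cast h
    gcongr
  have hkT : (k : ℝ) * T / k = T := by field_simp
  have hne : ∀ {a : ℕ}, (a : ℝ) * T / k = T → a = k := fun {a} h => by
    field_simp at h
    exact_mod_cast h
  have hfl : gridFloor T k t = (j : ℝ) * T / k := by
    refine IsGreatest.csSup_eq ⟨⟨⟨⟨by positivity, hjt⟩, fun h => ?_⟩, ⟨j, rfl⟩⟩, ?_⟩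
    · have := hne h; omega
    · rintro _ ⟨⟨⟨-, h1⟩, h2⟩, ⟨i, rfl⟩⟩
      refine cast_le ?_
      rcases hj with hj | ⟨rfl, hj⟩
      · have := cast_lt (h1.trans_lt hj); omega
      · by_contra h3
        have h4 : k ≤ i := by omega
        have h5 := cast_le h4
        rw [hkT] at h5
        exact h2 (le_antisymm h1 h5)
  have hce : gridCeil T k t = ((j + 1 : ℕ) : ℝ) * T / k := by
    refine IsLeast.csInf_eq ⟨⟨?_, ⟨j + 1, rfl⟩⟩, ?_⟩
    · rcases hj with hj | ⟨-, hj⟩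
      · exact Or.inl hj
      · right; rw [hj]; exact hkT
    · rintro _ ⟨h1 | h1, ⟨i, rfl⟩⟩
      · exact cast_le (cast_lt (hjt.trans_lt h1))
      · have := hne h1
        exact cast_le (by omega)
  rw [hfl, hce]
  refine ⟨by positivity, hjt, ?_, ?_, by push_cast; ring⟩
  · rcases hj with hj | ⟨rfl, hj⟩
    · exact hj.le
    · rw [hj, hkT]
  · exact (cast_le (a := j + 1) hjk).trans_eq hkT

/-- Linear interpolation is a convex combination of the values at the neighbouring grid points. -/
theorem interp_eq {T t : ℝ} {k : ℕ} (hT : 0 < T) (hk : 1 ≤ k) (ht : t ∈ Icc 0 T) :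
    ∃ a b α β : ℝ, 0 ≤ a ∧ a ≤ t ∧ t ≤ b ∧ b ≤ T ∧ b - a = T / k ∧ 0 ≤ α ∧ 0 ≤ β ∧ α + β = 1 ∧
      ∀ Z : ℝ → ℝ, interp T k Z t = α * Z a + β * Z b := by
  obtain ⟨h1, h2, h3, h4, h5⟩ := grid_bounds hT hk ht
  have hk0 : (0 : ℝ) < k := by exact_mod_cast hk
  refine ⟨_, _, _, _, h1, h2, h3, h4, h5, ?_, ?_, ?_, fun Z => rfl⟩
  · exact div_nonneg (by linarith) (by positivity)
  · exact div_nonneg (by linarith) (by positivity)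
  · rw [← add_div, div_eq_one_iff_eq (by positivity)]; linarith

variable {Ω : Type*} [MeasurableSpace Ω] {P : Measure Ω} [IsProbabilityMeasure P] {T q : ℝ}

theorem LB.interp_val {Z : ℝ → Ω → ℝ} {b : ℝ} (hT : 0 < T)
    (h : ∀ s ∈ Icc 0 T, LB P q (Z s) b) {k : ℕ} (hk : 1 ≤ k) {t : ℝ} (ht : t ∈ Icc 0 T) :
    LB P q (fun ω => interp T k (fun s => Z s ω) t) b := by
  obtain ⟨a, a', α, β, h1, h2, h3, h4, -, h6, h7, h8, h9⟩ := interp_eq hT hk ht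
  simp only [h9]
  refine (((h a ⟨h1, h2.trans ht.2⟩).const_mul h6).add'
    ((h a' ⟨ht.1.trans h3, h4⟩).const_mul h7)).mono_bound (le_of_eq ?_)
  rw [← add_mul, h8, one_mul]

/-- Interpolation is a convex combination of two values at distance at most T/k, where the
Hölder-1/2 modulus equals 1/√k. -/
theorem LB.interp_sub {Z : ℝ → Ω → ℝ} {D : ℝ} (hT : 0 < T) (hD : 0 ≤ D)
    (h : ∀ s s', 0 ≤ s → s ≤ s' → s' ≤ T → LB P q (fun ω => Z s ω - Z s' ω) (D * td T s s'))
    {k : ℕ} (hk : 1 ≤ k) {t : ℝ} (ht : t ∈ Icc 0 T) :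
    LB P q (fun ω => interp T k (fun s => Z s ω) t - Z t ω) (D * (1 / √(k : ℝ))) := by
  obtain ⟨a, a', α, β, h1, h2, h3, h4, h5, h6, h7, h8, h9⟩ := interp_eq hT hk ht
  simp only [h9]
  have hd : td T a a' = 1 / √(k : ℝ) := by
    unfold td
    rw [abs_sub_comm, abs_of_nonneg (by linarith), h5, Real.sqrt_div hT.le]
    field_simp
  have d1 : td T a t ≤ td T a a' := td_mono (by
    rw [abs_sub_comm, abs_of_nonneg (by linarith), abs_sub_comm, abs_of_nonneg (by linarith)]
    linarith)
  have d2 : td T t a' ≤ td T a a' := td_mono (by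
    rw [abs_sub_comm, abs_of_nonneg (by linarith), abs_sub_comm, abs_of_nonneg (by linarith)]
    linarith)
  rw [hd] at d1 d2
  refine ((((h a t h1 h2 ht.2).const_mul h6).sub' ((h t a' ht.1 h3 h4).const_mul h7)).congr
    (Filter.Eventually.of_forall fun ω => ?_)).mono_bound ?_
  · simp only
    have : β = 1 - α := by linarith
    rw [this]; ring
  · calc α * (D * td T a t) + β * (D * td T t a')
        ≤ α * (D * (1 / √(k : ℝ))) + β * (D * (1 / √(k : ℝ))) := by gcongr
      _ = _ := by rw [← add_mul, h8, one_mul]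

end Grid

/-! ### Errors along the forward path. -/

section MultigridError

variable {E : Type u} {Ω : Type v} [NormedAddCommGroup E] [MeasurableSpace E] [BorelSpace E]
  [SecondCountableTopology E] [mΩ : MeasurableSpace Ω] {P : Measure Ω} [IsProbabilityMeasure P]
  {s₁ s₂ c T : ℝ} {f : ℝ → ℝ} {g : E → ℝ} {V : ℝ → E → ℝ} {X : ℝ → ℝ → E → Ω → E}
  {τ : Idx → Ω → ℝ} {Y : ℕ → Idx → ℝ → ℝ → E → Ω → E} {mY : Idx → MeasurableSpace Ω} {M : ℕ}

/-- Interpolation is linear and the operator differences telescope to the interpolation on the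
finest grid. So y may be subtracted inside every level at the price of its own interpolation error
there. -/
theorem multigrid_sub (T : ℝ) (f : ℝ → ℝ) (g : E → ℝ) (τ : Idx → Ω → ℝ)
    (Y : ℕ → Idx → ℝ → ℝ → E → Ω → E) (θbar : ℕ → Idx) {n : ℕ} (hn : 1 ≤ n) (t : ℝ) (ω : Ω)
    (y : ℝ → ℝ) : multigrid T f g τ Y θbar n M t ω - y t
      = (∑ ℓ ∈ Finset.range n, (interp T (M ^ (ℓ + 1)) (fun s =>
          mlp T f g τ Y M (n - ℓ) (θbar ℓ) s (Y (M ^ n) Idx.zero 0 s 0 ω) ω - y s) t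
          - if 1 ≤ ℓ then interp T (M ^ ℓ) (fun s =>
          mlp T f g τ Y M (n - ℓ) (θbar ℓ) s (Y (M ^ n) Idx.zero 0 s 0 ω) ω - y s) t else 0))
        + (interp T (M ^ n) y t - y t) := by
  have h1 : ∀ (k : ℕ) (Z : ℝ → ℝ), interp T k (fun s => Z s - y s) t
      = interp T k Z t - interp T k y t := fun k Z => by unfold interp; ring
  have h2 : ∀ n, 1 ≤ n → ∑ ℓ ∈ Finset.range n, (interp T (M ^ (ℓ + 1)) y t
      - if 1 ≤ ℓ then interp T (M ^ ℓ) y t else 0) = interp T (M ^ n) y t := by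
    intro n hn
    induction n, hn using Nat.le_induction with
    | base => simp
    | succ n hn ih => rw [Finset.sum_range_succ, ih, if_pos hn]; ring
  rw [← h2 n hn, multigrid, add_sub, ← Finset.sum_add_distrib]
  congr 1
  refine Finset.sum_congr rfl fun ℓ _ => ?_
  rw [h1 _ (fun s => mlp T f g τ Y M (n - ℓ) (θbar ℓ) s (Y (M ^ n) Idx.zero 0 s 0 ω) ω),
    h1 _ (fun s => mlp T f g τ Y M (n - ℓ) (θbar ℓ) s (Y (M ^ n) Idx.zero 0 s 0 ω) ω)]
  split_ifs <;> ring

section Frozen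

variable (hA : Approx P s₁ s₂ c T V τ Y mY)
include hA

/-- A random function evaluated at an independent random point. -/
theorem Approx.lb_frozen {S : Type*} [MeasurableSpace S] {η : Idx} {A : Set Idx}
    (hind : Indep (info τ mY {η} {η}) (info τ mY A A) P) {Q : Ω → S}
    (hQ : Measurable[info τ mY {η} {η}] Q) {F : S → Ω → ℝ}
    (hF : @Measurable (S × Ω) ℝ (@Prod.instMeasurableSpace _ _ _ (info τ mY A A)) _
      fun q => F q.1 q.2) {p : ℝ} (hp : 1 ≤ p) {b : S → ℝ} {β : ℝ}
    (h1 : ∀ z, LB P p⁻¹ (F z) (b z)) (h2 : LB P p⁻¹ (fun ω => b (Q ω)) β) :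
    LB P p⁻¹ (fun ω => F (Q ω) ω) β := by
  have hp0 : 0 < p := by linarith
  have hQΩ : Measurable Q := hQ.mono (hA.info_le _ _) le_rfl
  have hid := measurable_id'' (hA.info_le A A)
  have hi : @IndepFun Ω S Ω mΩ _ (info τ mY A A) Q id P := by
    refine indepFun_id_of_indep (indep_of_indep_of_le_left hind ?_)
    exact hQ.comap_le
  have key := eLpNorm_freeze_le (mΩ' := info τ mY A A) hp0 hQΩ hid hi hF
    (b := fun ω => b (Q ω)) fun ω' => by
      have := (h1 (Q ω')).norm_le
      rwa [inv_inv] at this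
  refine ⟨by positivity, inv_le_one_of_one_le₀ hp, ?_, h2.nonneg, ?_⟩
  · have h3 : @Measurable Ω (S × Ω) _ (@Prod.instMeasurableSpace _ _ _ (info τ mY A A))
        (fun ω => (Q ω, id ω)) := hQΩ.prodMk hid
    exact (hF.comp h3).aestronglyMeasurable
  · rw [inv_inv]
    have := h2.norm_le
    rw [inv_inv] at this
    exact key.trans this

theorem Approx.measurable_path_info (k : ℕ) (hk : 1 ≤ k) (η : Idx) (s t : ℝ) (x : E) :
    Measurable[info τ mY {η} {η}] (Y k η s t x) := by
  have h := (hA.Y_meas k hk η).mono (mY_le_info (τ := τ) (mY := mY) (A := {η}) (B := {η}) rfl)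
  exact FieldMeas.comp (m := info τ mY {η} {η}) (mA := info τ mY {η} {η}) h measurable_const
    measurable_const measurable_const measurable_id

end Frozen

theorem lb_mean {Z Z' : Ω → ℝ} {q b : ℝ} (h : LB P q Z b) (h' : LB P q Z' b) :
    LB P q (fun ω => (Z ω + Z' ω) / 2) b :=
  (((h.add' h').const_mul (a := 1 / 2) (by norm_num)).congr
    (Filter.Eventually.of_forall fun ω => by simp only; ring)).mono_bound (le_of_eq (by ring))

variable (hF : Flow P s₁ s₂ c T f g V X)
include hF

/-- The time regularity of u is evaluated along the forward path; K ≤ V turns the constant into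
3K²V³. -/
theorem Flow.lb_solution_time {u : ℝ → E → ℝ} (hu : Solution P T f g V X u) {q : ℝ}
    (hq : 10 * s₁ + 2 * s₂ ≤ q) (hq1 : q ≤ 1) {s s' : ℝ} (hs : 0 ≤ s) (hss : s ≤ s')
    (hs' : s' ≤ T) (x : E) : LB P q (fun ω => u s (X 0 s x ω) - u s' (X 0 s' x ω))
      (3 * Real.exp (c * T) ^ 2 * V 0 x ^ 3 * td T s s') := by
  have hs₁ := hF.s₁_pos
  have hs₂ := hF.s₂_pos
  have hd := td_nonneg T s s'
  have hK := hF.one_le_exp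
  have hVK := hF.exp_le_V 0 x
  have hV1 := hF.one_le_V 0 x
  have k1 := lb_mean (hF.proc.V_le 0 s le_rfl hs (hss.trans hs') x)
    (hF.proc.V_le 0 s' le_rfl (hs.trans hss) hs' x)
  have k2 : LB P s₂ (fun ω => nd T (X 0 s x ω - X 0 s' x ω)) (V 0 x * td T s s' / 2) :=
    (hF.proc.two 0 s 0 s' le_rfl hs (hss.trans hs') le_rfl (hs.trans hss) hs' x x).mono_bound
      (le_of_eq (by rw [td_self, sub_self, nd_zero]; ring))
  have k3 := (k1.mul ((k1.const_mul (a := 5 / 2 * td T s s') (by positivity)).add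
    (k2.const_mul (a := Real.exp (c * T)) (by positivity)) (r := s₁ + s₂) (by linarith)
      (by linarith) (by linarith)) (r := q) (by linarith) hq1).const_mul
      (a := Real.exp (c * T) ^ 2) (by positivity)
  refine (k3.of_le ?_ (Filter.Eventually.of_forall fun ω => ?_)).mono_bound ?_
  · exact ((hF.measurable_solution_comp hu 0 s x).sub
      (hF.measurable_solution_comp hu 0 s' x)).aestronglyMeasurable
  · exact (hF.solution_time hu hs hss hs' _ _).trans (le_of_eq (by ring))
  · obtain ⟨v, hv⟩ : ∃ v, v = V 0 x := ⟨_, rfl⟩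
    rw [← hv] at hVK hV1 ⊢
    calc Real.exp (c * T) ^ 2 * (v * (5 / 2 * td T s s' * v + Real.exp (c * T) * (v * td T s s' / 2)))
        ≤ Real.exp (c * T) ^ 2 * (v * (5 / 2 * td T s s' * (v * v) + v * (v * td T s s' / 2))) := by
          gcongr; nlinarith
      _ = _ := by ring

theorem Flow.lb_path_solution {u : ℝ → E → ℝ} (hu : Solution P T f g V X u) {q : ℝ}
    (hq : 10 * s₁ + 2 * s₂ ≤ q) (hq1 : q ≤ 1) {Z : ℝ → ℝ → E → Ω → E}
    (hZ : Proc P s₁ s₂ c T V Z) {δ : ℝ} (hcl : Close P s₂ T V Z X δ) {s : ℝ}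
    (hs : s ∈ Icc 0 T) (x : E) :
    LB P q (fun ω => u s (Z 0 s x ω) - u s (X 0 s x ω))
      (Real.exp (c * T) ^ 2 * V 0 x ^ 2 * δ / 2) := by
  have hs₁ := hF.s₁_pos
  have hs₂ := hF.s₂_pos
  have k1 := lb_mean (hZ.V_le 0 s le_rfl hs.1 hs.2 x) (hF.proc.V_le 0 s le_rfl hs.1 hs.2 x)
  have k2 := hcl.two 0 s le_rfl hs.1 hs.2 x
  have k3 := (k1.mul k2 (r := q) (by linarith) hq1).const_mul
      (a := Real.exp (c * T) ^ 2) (by positivity)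
  refine (k3.of_le ?_ (Filter.Eventually.of_forall fun ω => ?_)).mono_bound (le_of_eq (by ring))
  · exact (((hF.solution_growth hu).meas.comp (measurable_const.prodMk (hZ.measurable 0 s x))).sub
      (hF.measurable_solution_comp hu 0 s x)).aestronglyMeasurable
  · exact (hF.solution_lip hu hs _ _).trans (le_of_eq (by ring))

/-- A second difference of u in which both the path and the time change. The factor K¹⁰ is reduced
to K⁴ by trading six powers of K for powers of V. -/
theorem Flow.lb_path_solution_diff {u : ℝ → E → ℝ} (hu : Solution P T f g V X u) {q : ℝ}
    (hq : 10 * s₁ + 2 * s₂ ≤ q) (hq1 : q ≤ 1) {Z : ℝ → ℝ → E → Ω → E}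
    (hZ : Proc P s₁ s₂ c T V Z) {δ : ℝ} (hδ : 0 ≤ δ) (hcl : Close P s₂ T V Z X δ) {s s' : ℝ}
    (hs : 0 ≤ s) (hss : s ≤ s') (hs' : s' ≤ T) (x : E) :
    LB P q (fun ω => (u s (Z 0 s x ω) - u s (X 0 s x ω))
        - (u s' (Z 0 s' x ω) - u s' (X 0 s' x ω)))
      (10 * Real.exp (c * T) ^ 4 * V 0 x ^ 10 * δ * td T s s') := by
  have hs₁ := hF.s₁_pos
  have hs₂ := hF.s₂_pos
  have hd := td_nonneg T s s'
  have hK := hF.one_le_exp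
  have hVK := hF.exp_le_V 0 x
  have hV1 := hF.one_le_V 0 x
  have hsT := hss.trans hs'
  have hs0 := hs.trans hss
  have k1 := lb_mean (lb_mean (hZ.V_le 0 s le_rfl hs hsT x) (hF.proc.V_le 0 s le_rfl hs hsT x))
    (lb_mean (hZ.V_le 0 s' le_rfl hs0 hs' x) (hF.proc.V_le 0 s' le_rfl hs0 hs' x))
  have k2 : LB P s₂ (fun ω => nd T (Z 0 s x ω - Z 0 s' x ω)) (V 0 x * td T s s' / 2) :=
    (hZ.two 0 s 0 s' le_rfl hs hsT le_rfl hs0 hs' x x).mono_bound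
      (le_of_eq (by rw [td_self, sub_self, nd_zero]; ring))
  have k4 : LB P s₂ (fun ω => nd T ((Z 0 s x ω - X 0 s x ω) - (Z 0 s' x ω - X 0 s' x ω)))
      (V 0 x * td T s s' / 2 * δ) :=
    (hcl.four 0 s 0 s' le_rfl hs hsT le_rfl hs0 hs' x x).mono_bound
      (le_of_eq (by rw [td_self, sub_self, nd_zero]; ring))
  have k5 := (hcl.two 0 s le_rfl hs hsT x).add' (hcl.two 0 s' le_rfl hs0 hs' x)
  have k3 := ((k1.pow 1 (r := 2 * s₁) (by norm_num) (by linarith)).mul (k4.add (k5.mul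
    ((k1.const_mul (a := 4 * td T s s') (by positivity)).add k2 (r := s₁ + s₂) (by linarith)
      (by linarith) (by linarith)) (r := s₂ + (s₁ + s₂)) le_rfl (by linarith))
    (r := s₂ + (s₁ + s₂)) (by linarith) le_rfl (by linarith)) (r := q) (by linarith)
    hq1).const_mul (a := 2 * Real.exp (c * T) ^ 10) (by positivity)
  refine (k3.of_le ?_ (Filter.Eventually.of_forall fun ω => ?_)).mono_bound ?_
  · have hum := (hF.solution_growth hu).meas
    have m1 : ∀ s, Measurable fun ω => u s (Z 0 s x ω) - u s (X 0 s x ω) := fun s =>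
      (hum.comp (measurable_const.prodMk (hZ.measurable 0 s x))).sub
      (hF.measurable_solution_comp hu 0 s x)
    exact ((m1 s).sub (m1 s')).aestronglyMeasurable
  · refine (hF.solution_diff_time hu hs hss hs' _ _ _ _).trans (le_of_eq ?_)
    ring
  · obtain ⟨v, hv⟩ : ∃ v, v = V 0 x := ⟨_, rfl⟩
    rw [← hv] at hVK hV1 ⊢
    have hv0 : 0 < v := by linarith
    generalize Real.exp (c * T) = K at *
    have hK0 : 0 < K := by linarith
    have p1 : K ^ 6 * v ^ 3 ≤ v ^ 10 := by
      calc K ^ 6 * v ^ 3 ≤ v ^ 6 * v ^ 3 := by gcongr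
        _ = v ^ 9 := by ring
        _ ≤ v ^ 10 := pow_le_pow_right₀ hV1 (by norm_num)
    have p2 : K ^ 6 * v ^ 4 ≤ v ^ 10 := by
      calc K ^ 6 * v ^ 4 ≤ v ^ 6 * v ^ 4 := by gcongr
        _ = v ^ 10 := by ring
    calc 2 * K ^ 10 * (v ^ (1 + 1) * (v * td T s s' / 2 * δ + (v / 2 * δ + v / 2 * δ)
          * (4 * td T s s' * v + v * td T s s' / 2)))
        = K ^ 4 * (K ^ 6 * v ^ 3) * (δ * td T s s') + 9 * (K ^ 4 * (K ^ 6 * v ^ 4)) * (δ * td T s s') := by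
          ring
      _ ≤ K ^ 4 * v ^ 10 * (δ * td T s s') + 9 * (K ^ 4 * v ^ 10) * (δ * td T s s') := by gcongr
      _ = _ := by ring

variable (hA : Approx P s₁ s₂ c T V τ Y mY)
include hA

/-- The path is independent of U, so its position may be frozen; the bound V² at that position then
integrates back to V(0,x)². -/
theorem Flow.frozen_val {u : ℝ → E → ℝ} (hu : Solution P T f g V X u) {p e : ℝ} (hp : 2 ≤ p)
    (hq : 10 * s₁ + 2 * s₂ ≤ p⁻¹) (he : 0 ≤ e) {w : ℝ → ℝ} {w₀ : ℝ}
    (hw : ∀ t ∈ Icc 0 T, w t ≤ w₀) (hw0 : ∀ t ∈ Icc 0 T, 0 ≤ w t) {k : ℕ} (hk : 1 ≤ k) {η : Idx}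
    {A : Set Idx} (hind : Indep (info τ mY {η} {η}) (info τ mY A A) P) {U : ℝ → E → Ω → ℝ}
    (hU : @Measurable (ℝ × E × Ω) ℝ (@Prod.instMeasurableSpace _ _ _
      (@Prod.instMeasurableSpace _ _ _ (info τ mY A A))) _ fun z => U z.1 z.2.1 z.2.2)
    (h : Err P p⁻¹ T V w e fun t x ω => U t x ω - u t x) {s : ℝ} (hs : s ∈ Icc 0 T) (x : E) :
    LB P p⁻¹ (fun ω => U s (Y k η 0 s x ω) ω - u s (Y k η 0 s x ω)) (e * w₀ * V 0 x ^ 2) := by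
  have hs₁ := hF.s₁_pos
  have hs₂ := hF.s₂_pos
  have hp1 : p⁻¹ ≤ 1 := inv_le_one_of_one_le₀ (by linarith)
  have hm : @Measurable (E × Ω) ℝ (@Prod.instMeasurableSpace _ _ _ (info τ mY A A)) _
      fun q => U s q.1 q.2 - u s q.1 := by
    have h1 : @Measurable (E × Ω) (ℝ × E × Ω) (@Prod.instMeasurableSpace _ _ _ (info τ mY A A))
        (@Prod.instMeasurableSpace _ _ _ (@Prod.instMeasurableSpace _ _ _ (info τ mY A A)))
        fun q => (s, q.1, q.2) := measurable_const.prodMk (measurable_fst.prodMk measurable_snd)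
    exact (hU.comp h1).sub ((hF.solution_growth hu).meas.comp (f := fun q : E × Ω => (s, q.1))
      (measurable_const.prodMk measurable_fst))
  refine hA.lb_frozen hind (hA.measurable_path_info k hk η 0 s x) (F := fun z ω => U s z ω - u s z)
    hm (by linarith) (fun z => h.val s hs z) ?_
  refine (((hA.proc k hk η).V_le 0 s le_rfl hs.1 hs.2 x).pow 1 (r := p⁻¹)
      (by norm_num; linarith) hp1).const_mul (a := e * w s) (mul_nonneg he (hw0 s hs))
      |>.mono_bound ?_
  have := hw s hs
  have := hF.V_pos 0 x
  gcongr

/-- The positions at both times are frozen together. The moments of the modulus of continuity have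
degree ten in V(0,x), with constant 4 + 1/2 ≤ 5. -/
theorem Flow.frozen_diff {u : ℝ → E → ℝ} (hu : Solution P T f g V X u) {p e : ℝ} (hp : 2 ≤ p)
    (hq : 10 * s₁ + 2 * s₂ ≤ p⁻¹) (he : 0 ≤ e) {w : ℝ → ℝ} {w₀ : ℝ}
    (hw : ∀ t ∈ Icc 0 T, w t ≤ w₀) (hw0 : ∀ t ∈ Icc 0 T, 0 ≤ w t) {k : ℕ} (hk : 1 ≤ k) {η : Idx}
    {A : Set Idx} (hind : Indep (info τ mY {η} {η}) (info τ mY A A) P) {U : ℝ → E → Ω → ℝ}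
    (hU : @Measurable (ℝ × E × Ω) ℝ (@Prod.instMeasurableSpace _ _ _
      (@Prod.instMeasurableSpace _ _ _ (info τ mY A A))) _ fun z => U z.1 z.2.1 z.2.2)
    (h : Err P p⁻¹ T V w e fun t x ω => U t x ω - u t x) {s s' : ℝ} (hs : 0 ≤ s) (hss : s ≤ s')
    (hs' : s' ≤ T) (x : E) :
    LB P p⁻¹ (fun ω => (U s (Y k η 0 s x ω) ω - u s (Y k η 0 s x ω))
        - (U s' (Y k η 0 s' x ω) ω - u s' (Y k η 0 s' x ω)))
      (5 * e * w₀ * V 0 x ^ 10 * td T s s') := by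
  have hs₁ := hF.s₁_pos
  have hs₂ := hF.s₂_pos
  have hp1 : p⁻¹ ≤ 1 := inv_le_one_of_one_le₀ (by linarith)
  have hd := td_nonneg T s s'
  have hsT := hss.trans hs'
  have hs0 := hs.trans hss
  have hZ := hA.proc k hk η
  have hV := hF.V_meas
  have hm : ∀ s (φ : E × E → E), Measurable φ →
      @Measurable ((E × E) × Ω) ℝ (@Prod.instMeasurableSpace _ _ _ (info τ mY A A)) _
      fun q => U s (φ q.1) q.2 - u s (φ q.1) := fun s φ hφ => by
    have h1 : @Measurable ((E × E) × Ω) (ℝ × E × Ω)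
        (@Prod.instMeasurableSpace _ _ _ (info τ mY A A))
        (@Prod.instMeasurableSpace _ _ _ (@Prod.instMeasurableSpace _ _ _ (info τ mY A A)))
        fun q => (s, φ q.1, q.2) :=
      measurable_const.prodMk ((hφ.comp measurable_fst).prodMk measurable_snd)
    exact (hU.comp h1).sub ((hF.solution_growth hu).meas.comp
      (f := fun q : (E × E) × Ω => (s, φ q.1)) (measurable_const.prodMk (hφ.comp measurable_fst)))
  have hQ : Measurable[info τ mY {η} {η}] fun ω => (Y k η 0 s x ω, Y k η 0 s' x ω) :=
    Measurable.prodMk (hA.measurable_path_info k hk η 0 s x) (hA.measurable_path_info k hk η 0 s' x)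
  refine hA.lb_frozen hind hQ
    (F := fun z ω => (U s z.1 ω - u s z.1) - (U s' z.2 ω - u s' z.2))
    ((hm s Prod.fst measurable_fst).sub (hm s' Prod.snd measurable_snd)) (by linarith)
    (fun z => h.diff s s' hs hss hs' z.1 z.2) ?_
  have k1 := lb_mean (hZ.V_le 0 s le_rfl hs hsT x) (hZ.V_le 0 s' le_rfl hs0 hs' x)
  have k2 : LB P s₂ (fun ω => nd T (Y k η 0 s x ω - Y k η 0 s' x ω)) (V 0 x * td T s s' / 2) :=
    (hZ.two 0 s 0 s' le_rfl hs hsT le_rfl hs0 hs' x x).mono_bound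
      (le_of_eq (by rw [td_self, sub_self, nd_zero]; ring))
  have k3 := ((k1.pow 8 (r := 9 * s₁) (by norm_num) (by linarith)).mul
    ((k1.const_mul (a := 4 * td T s s') (by positivity)).add k2 (r := s₁ + s₂) (by linarith)
      (by linarith) (by linarith)) (r := p⁻¹) (by linarith) hp1).const_mul (a := e * w s)
      (mul_nonneg he (hw0 s ⟨hs, hsT⟩))
  refine (k3.congr (Filter.Eventually.of_forall fun ω => ?_)).mono_bound ?_
  · simp only [phi]; ring
  · have h1 := hw s ⟨hs, hsT⟩
    have h2 := hF.V_pos 0 x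
    have h3 := hw0 s ⟨hs, hsT⟩
    calc e * w s * (V 0 x ^ (8 + 1) * (4 * td T s s' * V 0 x + V 0 x * td T s s' / 2))
        = 9 / 2 * (e * w s * V 0 x ^ 10 * td T s s') := by ring
      _ ≤ 5 * (e * w₀ * V 0 x ^ 10 * td T s s') := by gcongr; norm_num
      _ = _ := by ring

end MultigridError

/-! ### Summation over the grids. -/

section Total

variable {E : Type u} {Ω : Type v} [NormedAddCommGroup E] [MeasurableSpace E] [BorelSpace E]
  [SecondCountableTopology E] [mΩ : MeasurableSpace Ω] {P : Measure Ω} [IsProbabilityMeasure P]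
  {s₁ s₂ c T : ℝ} {f : ℝ → ℝ} {g : E → ℝ} {V : ℝ → E → ℝ} {X : ℝ → ℝ → E → Ω → E}
  {τ : Idx → Ω → ℝ} {Y : ℕ → Idx → ℝ → ℝ → E → Ω → E} {mY : Idx → MeasurableSpace Ω} {M : ℕ}

/-- Since B ≥ 2, the sum of B^{n-ℓ} is at most 2Bⁿ, giving 20·2; the interpolation error of u adds
one more. -/
theorem geom_total_le {B C S v ω₀ K : ℝ} {n : ℕ} (hB : 2 ≤ B) (hC : 0 ≤ C) (hS : 0 ≤ S)
    (hv : 1 ≤ v) (hω : 1 ≤ ω₀) (h3 : 3 * K ^ 2 ≤ C * B ^ n) :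
    (∑ ℓ ∈ Finset.range n, 20 * (C * B ^ (n - ℓ) * S * ω₀ * v ^ 10)) + 3 * K ^ 2 * v ^ 3 * S
      ≤ 41 * (C * B ^ n * S * ω₀ * v ^ 10) := by
  have h1 : ∀ n : ℕ, ∑ ℓ ∈ Finset.range n, B ^ (n - ℓ) ≤ 2 * B ^ n := by
    intro n
    induction n with
    | zero => simp
    | succ n ih =>
      rw [Finset.sum_range_succ']
      simp only [Nat.add_sub_add_right, Nat.sub_zero]
      have : 0 ≤ B ^ n := by positivity
      calc _ ≤ 2 * B ^ n + B ^ (n + 1) := by gcongr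
        _ ≤ B * B ^ n + B ^ (n + 1) := by gcongr
        _ = _ := by ring
  have h2 : ∑ ℓ ∈ Finset.range n, 20 * (C * B ^ (n - ℓ) * S * ω₀ * v ^ 10)
      = 20 * (C * S * ω₀ * v ^ 10) * ∑ ℓ ∈ Finset.range n, B ^ (n - ℓ) := by
    rw [Finset.mul_sum]
    exact Finset.sum_congr rfl fun ℓ _ => by ring
  have h4 : v ^ 3 ≤ v ^ 10 := pow_le_pow_right₀ hv (by norm_num)
  calc _ ≤ 20 * (C * S * ω₀ * v ^ 10) * (2 * B ^ n) + (C * B ^ n) * v ^ 10 * S := by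
        rw [h2]; gcongr; exact h1 n
    _ = 40 * (C * B ^ n * S * ω₀ * v ^ 10) + C * B ^ n * S * 1 * v ^ 10 := by ring
    _ ≤ 40 * (C * B ^ n * S * ω₀ * v ^ 10) + C * B ^ n * S * ω₀ * v ^ 10 := by gcongr
    _ = _ := by ring

variable (hF : Flow P s₁ s₂ c T f g V X)
include hF

/-- The error of the multigrid approximations. -/
theorem Flow.multigrid_err (hA : Approx P s₁ s₂ c T V τ Y mY) {u : ℝ → E → ℝ}
    (hu : Solution P T f g V X u) {p : ℝ} (hp : 2 ≤ p)
    (hq : 10 * s₁ + 2 * s₂ ≤ p⁻¹) (hM : 1 ≤ M)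
    (hcl : ∀ k, 1 ≤ k → Close P s₂ T V (Y k Idx.zero) X (1 / √(k : ℝ))) {n : ℕ} (hn : 1 ≤ n)
    (θbar : ℕ → Idx) {t : ℝ} (ht : t ∈ Icc 0 T) :
    LB P p⁻¹ (fun ω => multigrid T f g τ Y θbar n M t ω - u t (X 0 t 0 ω))
      (41 * (2 * √(M : ℝ) * Real.exp (c * T) ^ 2
      * (74 * Real.exp (c * T) ^ 4 * √(p - 1)) ^ n * (√(M : ℝ))⁻¹ ^ n
      * Real.exp ((M : ℝ) ^ (p / 2) / p) * V 0 0 ^ 10)) := by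
  have hT := hF.T_pos
  have hp1 : p⁻¹ ≤ 1 := inv_le_one_of_one_le₀ (by linarith)
  have hp0 : 0 < p⁻¹ := by positivity
  have hK := hF.one_le_exp
  have hv := hF.one_le_V 0 0
  have hMr : (1 : ℝ) ≤ M := by exact_mod_cast hM
  have ha : 0 < (M : ℝ) ^ (p / 2) := by positivity
  have hq1 : 1 ≤ √(p - 1) := Real.one_le_sqrt.2 (by linarith)
  have hs1 : 1 ≤ √(M : ℝ) := Real.one_le_sqrt.2 hMr
  obtain ⟨σ, hσd⟩ : ∃ σ, σ = (√(M : ℝ))⁻¹ := ⟨_, rfl⟩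
  obtain ⟨C, hC⟩ : ∃ C, C = 2 * √(M : ℝ) * Real.exp (c * T) ^ 2 := ⟨_, rfl⟩
  obtain ⟨B, hB⟩ : ∃ B, B = 74 * Real.exp (c * T) ^ 4 * √(p - 1) := ⟨_, rfl⟩
  obtain ⟨ω₀, hω⟩ : ∃ ω₀, ω₀ = Real.exp ((M : ℝ) ^ (p / 2) / p) := ⟨_, rfl⟩
  have hσ0 : 0 < σ := by rw [hσd]; positivity
  have hσ1 : σ ≤ 1 := by rw [hσd]; exact inv_le_one_of_one_le₀ hs1
  have hC2 : 2 * Real.exp (c * T) ^ 2 ≤ C := by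
    rw [hC]; nlinarith [one_le_pow₀ hK (n := 2)]
  have hC0 : 0 < C := by rw [hC]; positivity
  have hK4 : 1 ≤ Real.exp (c * T) ^ 4 := one_le_pow₀ hK
  have hBK : 74 * Real.exp (c * T) ^ 4 ≤ B := by rw [hB]; nlinarith
  have hB74 : 74 ≤ B := by linarith
  have hω1 : 1 ≤ ω₀ := by rw [hω]; exact Real.one_le_exp (by positivity)
  have hδ : ∀ k, 1 / √((M ^ k : ℕ) : ℝ) = σ ^ k := fun k => by
    rw [sqrt_natCast_pow, hσd, inv_pow, one_div]
  have hw : ∀ t ∈ Icc 0 T, expWeight ((M : ℝ) ^ (p / 2)) p T t ≤ ω₀ := fun t ht => by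
    refine (expWeight_anti ha.le (by linarith) hT.le ht.1).trans (le_of_eq ?_)
    rw [expWeight, hω, sub_zero, div_self hT.ne', mul_one]
  have hw0 : ∀ t ∈ Icc 0 T, 0 ≤ expWeight ((M : ℝ) ^ (p / 2)) p T t := fun t _ =>
    (Real.exp_pos _).le
  have hMn : 1 ≤ M ^ n := Nat.one_le_pow _ _ hM
  have hcln := hcl _ hMn
  rw [hδ] at hcln
  have hZ := hA.proc _ hMn Idx.zero
  rw [← hσd, ← hB, ← hC, ← hω]
  let W : ℕ → ℝ → Ω → ℝ := fun ℓ s ω =>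
    mlp T f g τ Y M (n - ℓ) (θbar ℓ) s (Y (M ^ n) Idx.zero 0 s 0 ω) ω - u s (X 0 s 0 ω)
  -- The path carries the index 0 of length one, whereas the approximation rooted at θ̄_ℓ uses
  -- strict extensions of a nonempty tuple, whose length is at least two.
  have hind : ∀ ℓ, Indep (info τ mY {Idx.zero} {Idx.zero})
      (info τ mY (strictExt (θbar ℓ)) (strictExt (θbar ℓ))) P := fun ℓ =>
    hA.indep_strictExt (by
      have := List.length_pos_iff.2 (θbar ℓ).2
      simp only [Idx.zero, List.length_singleton]
      omega)
  have hmeas := fun ℓ => hA.measurable_mlp_info hF.f_meas hF.g_meas hM (n - ℓ) (θbar ℓ)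
    (subset_refl (strictExt (θbar ℓ)))
  have herr : ∀ ℓ, Err P p⁻¹ T V (expWeight ((M : ℝ) ^ (p / 2)) p T) (C * B ^ (n - ℓ) * σ ^ (n - ℓ))
      fun t x ω => mlp T f g τ Y M (n - ℓ) (θbar ℓ) t x ω - u t x := fun ℓ => by
    have := hF.mlp_err hA hu hp hq hM hcl (n - ℓ) (θbar ℓ)
    rwa [← hσd, ← hB, ← hC] at this
  have hKB : ∀ j, 1 ≤ j → 74 * Real.exp (c * T) ^ 4 ≤ B ^ j := fun j hj =>
    hBK.trans (le_self_pow₀ (by linarith) (by omega))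
  have hKC : ∀ j, 1 ≤ j → 10 * Real.exp (c * T) ^ 4 ≤ C * B ^ j := fun j hj => by
    have h1 := hKB j hj
    have h2 : 1 ≤ C := by nlinarith [one_le_pow₀ hK (n := 2)]
    nlinarith
  -- Only ℓ = 0 needs the size of the error itself: there no coarser interpolation is subtracted,
  -- but the approximation already has full accuracy m^{-n/2}.
  have hval : ∀ s ∈ Icc 0 T, LB P p⁻¹ (W 0 s) (20 * (C * B ^ n * σ ^ n * ω₀ * V 0 0 ^ 10)) := by
    intro s hs
    have h1 := (hF.frozen_val hA hu hp hq (by positivity) hw hw0 hMn (hind 0) (hmeas 0) (herr 0)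
      hs 0).add' (hF.lb_path_solution hu hq hp1 hZ hcln hs 0)
    refine (h1.congr (Filter.Eventually.of_forall fun ω => ?_)).mono_bound ?_
    · simp only [W]; ring
    · rw [Nat.sub_zero]
      have h2 : V 0 0 ^ 2 ≤ V 0 0 ^ 10 := pow_le_pow_right₀ hv (by norm_num)
      have h3 : Real.exp (c * T) ^ 2 ≤ C * B ^ n := by
        have := hKC n hn
        have := pow_le_pow_right₀ hK (show 2 ≤ 4 by norm_num)
        nlinarith
      have h4 : Real.exp (c * T) ^ 2 * V 0 0 ^ 2 * σ ^ n ≤ C * B ^ n * σ ^ n * ω₀ * V 0 0 ^ 10 := by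
        calc Real.exp (c * T) ^ 2 * V 0 0 ^ 2 * σ ^ n ≤ C * B ^ n * V 0 0 ^ 10 * σ ^ n := by gcongr
          _ = C * B ^ n * σ ^ n * 1 * V 0 0 ^ 10 := by ring
          _ ≤ _ := by gcongr
      have h5 : C * B ^ n * σ ^ n * ω₀ * V 0 0 ^ 2 ≤ C * B ^ n * σ ^ n * ω₀ * V 0 0 ^ 10 := by gcongr
      have h6 : 0 ≤ C * B ^ n * σ ^ n * ω₀ * V 0 0 ^ 10 := by positivity
      linarith
  have hdiff : ∀ ℓ, ℓ < n → ∀ s s', 0 ≤ s → s ≤ s' → s' ≤ T →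
      LB P p⁻¹ (fun ω => W ℓ s ω - W ℓ s' ω)
        (5 * (C * B ^ (n - ℓ) * σ ^ (n - ℓ) + C * B ^ (n - ℓ) * σ ^ n) * ω₀ * V 0 0 ^ 10
          * td T s s') := by
    intro ℓ hℓ s s' hs hss hs'
    have h1 := (hF.frozen_diff hA hu hp hq (by positivity) hw hw0 hMn (hind ℓ) (hmeas ℓ) (herr ℓ)
      hs hss hs' 0).add' (hF.lb_path_solution_diff hu hq hp1 hZ (by positivity) hcln hs hss hs' 0)
    refine (h1.congr (Filter.Eventually.of_forall fun ω => ?_)).mono_bound ?_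
    · simp only [W]; ring
    · have h2 : 10 * Real.exp (c * T) ^ 4 ≤ 5 * (C * B ^ (n - ℓ)) := by
        have := hKC (n - ℓ) (by omega)
        nlinarith
      have hd := td_nonneg T s s'
      calc _ ≤ 5 * (C * B ^ (n - ℓ) * σ ^ (n - ℓ)) * ω₀ * V 0 0 ^ 10 * td T s s'
            + 5 * (C * B ^ (n - ℓ)) * V 0 0 ^ 10 * σ ^ n * td T s s' := by gcongr
        _ = 5 * (C * B ^ (n - ℓ) * σ ^ (n - ℓ)) * ω₀ * V 0 0 ^ 10 * td T s s'
            + 5 * (C * B ^ (n - ℓ)) * V 0 0 ^ 10 * σ ^ n * td T s s' * 1 := by ring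
        _ ≤ 5 * (C * B ^ (n - ℓ) * σ ^ (n - ℓ)) * ω₀ * V 0 0 ^ 10 * td T s s'
            + 5 * (C * B ^ (n - ℓ)) * V 0 0 ^ 10 * σ ^ n * td T s s' * ω₀ := by gcongr
        _ = _ := by ring
  have hterm : ∀ ℓ ∈ Finset.range n, LB P p⁻¹ (fun ω =>
      interp T (M ^ (ℓ + 1)) (fun s => W ℓ s ω) t
        - if 1 ≤ ℓ then interp T (M ^ ℓ) (fun s => W ℓ s ω) t else 0)
      (20 * (C * B ^ (n - ℓ) * σ ^ n * ω₀ * V 0 0 ^ 10)) := by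
    intro ℓ hℓ
    have hpow : ∀ j, 1 ≤ M ^ j := fun j => Nat.one_le_pow _ _ hM
    rcases Nat.eq_zero_or_pos ℓ with rfl | hℓ0
    · simp only [nonpos_iff_eq_zero, one_ne_zero, if_false, sub_zero]
      exact LB.interp_val hT hval (hpow _) ht
    -- For ℓ ≥ 1 the value at t cancels between the two grids, so only interpolation errors remain;
    -- the coarser mesh gives σ^ℓ, which completes σ^{n-ℓ} to σⁿ.
    · have hD : 0 ≤ 5 * (C * B ^ (n - ℓ) * σ ^ (n - ℓ) + C * B ^ (n - ℓ) * σ ^ n) * ω₀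
          * V 0 0 ^ 10 := by positivity
      have h1 := LB.interp_sub hT hD (hdiff ℓ (Finset.mem_range.1 hℓ)) (hpow (ℓ + 1)) ht
      have h2 := LB.interp_sub hT hD (hdiff ℓ (Finset.mem_range.1 hℓ)) (hpow ℓ) ht
      refine ((h1.sub' h2).congr (Filter.Eventually.of_forall fun ω => ?_)).mono_bound ?_
      · simp only [if_pos (show 1 ≤ ℓ from hℓ0)]; ring
      · rw [hδ, hδ]
        have e1 : σ ^ n = σ ^ (n - ℓ) * σ ^ ℓ := by
          rw [← pow_add]; congr 1; have := Finset.mem_range.1 hℓ; omega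
        have h3 : σ ^ (ℓ + 1) ≤ σ ^ ℓ := pow_le_pow_of_le_one hσ0.le hσ1 (by omega)
        have h4 : σ ^ n ≤ σ ^ (n - ℓ) := pow_le_pow_of_le_one hσ0.le hσ1 (by omega)
        calc _ ≤ 5 * (C * B ^ (n - ℓ) * σ ^ (n - ℓ) + C * B ^ (n - ℓ) * σ ^ (n - ℓ)) * ω₀
              * V 0 0 ^ 10 * σ ^ ℓ + 5 * (C * B ^ (n - ℓ) * σ ^ (n - ℓ)
              + C * B ^ (n - ℓ) * σ ^ (n - ℓ)) * ω₀ * V 0 0 ^ 10 * σ ^ ℓ := by gcongr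
          _ = _ := by rw [e1]; ring
  have hsol := LB.interp_sub (Z := fun s ω => u s (X 0 s 0 ω)) hT
    (D := 3 * Real.exp (c * T) ^ 2 * V 0 0 ^ 3) (by positivity) (fun s s' hs hss hs' =>
      hF.lb_solution_time hu hq hp1 hs hss hs' 0) hMn ht
  rw [hδ] at hsol
  refine (((LB.sum (Finset.range n) hp0 hp1 hterm).add' hsol).congr
    (Filter.Eventually.of_forall fun ω => ?_)).mono_bound ?_
  · exact multigrid_sub T f g τ Y θbar hn t ω fun s => u s (X 0 s 0 ω)
  · refine geom_total_le (by linarith) hC0.le (by positivity) hv hω1 ?_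
    have := hKC n hn
    have := pow_le_pow_right₀ hK (show 2 ≤ 4 by norm_num)
    nlinarith

end Total

/-! ### Transfer between the given data and the normalized data. -/

section Normalization

variable {E : Type u} {Ω : Type v} [NormedAddCommGroup E] [NormedSpace ℝ E]
  [MeasurableSpace E] [BorelSpace E]
  [SecondCountableTopology E] [mΩ : MeasurableSpace Ω] {P : Measure Ω} [IsProbabilityMeasure P]
  {p₁ p₂ c T : ℝ} {f : ℝ → ℝ} {g : E → ℝ} {V : ℝ → E → ℝ} {X : ℝ → ℝ → E → Ω → E}
  {τ : Idx → Ω → ℝ} {Y : ℕ → Idx → ℝ → ℝ → E → Ω → E}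

theorem map_eq_uniform {Z : Ω → ℝ} (hZ : Measurable Z) (hmem : ∀ ω, Z ω ∈ Icc (0 : ℝ) 1)
    (h : ∀ t ∈ Icc (0 : ℝ) 1, P {ω | Z ω ≤ t} = ENNReal.ofReal t) :
    P.map Z = volume.restrict (Icc 0 1) := by
  have := Measure.isProbabilityMeasure_map hZ.aemeasurable (μ := P)
  refine Measure.ext_of_Iic _ _ fun t => ?_
  rw [Measure.map_apply hZ measurableSet_Iic, Measure.restrict_apply measurableSet_Iic]
  have e : Iic t ∩ Icc (0 : ℝ) 1 = Icc 0 (min t 1) := by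
    ext x; simp only [mem_inter_iff, mem_Iic, mem_Icc, le_min_iff]; tauto
  rw [e, Real.volume_Icc, sub_zero]
  rcases lt_or_ge t 0 with ht | ht
  · have : Z ⁻¹' Iic t = ∅ := by
      ext ω; simpa using ht.trans_le (hmem ω).1
    rw [this, measure_empty, ENNReal.ofReal_of_nonpos ((min_le_left _ _).trans ht.le)]
  rcases le_total t 1 with ht1 | ht1
  · rw [min_eq_left ht1]; exact h t ⟨ht, ht1⟩
  · have : Z ⁻¹' Iic t = univ := by
      ext ω; simpa using (hmem ω).2.trans ht1
    rw [this, measure_univ, min_eq_right ht1, ENNReal.ofReal_one]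

theorem comap_comp_le {α β γ : Type*} [mβ : MeasurableSpace β] [mγ : MeasurableSpace γ]
    (F : α → β) {G : β → γ} (hG : Measurable G) :
    MeasurableSpace.comap (fun a => G (F a)) mγ ≤ MeasurableSpace.comap F mβ := by
  rw [show (fun a => G (F a)) = G ∘ F from rfl, ← MeasurableSpace.comap_comp]
  exact MeasurableSpace.comap_mono hG.comap_le

/-- The information of a path is the σ-algebra generated by its field over all discretization levels
and times; independence from the random times follows by projecting the joint independence of
forward and approximating fields. -/
theorem ApproxSetting.approx (hX : ForwardSetting P p₁ p₂ c T f g V X)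
    (hY : ApproxSetting P p₁ p₂ c T V X τ Y) :
    Approx P p₁⁻¹ p₂⁻¹ c T (fun t => V (clampTime T t)) τ (fun k θ => clampField T (Y k θ))
      (fun θ => MeasurableSpace.comap (approxField T (fun k => Y k θ)) inferInstance) := by
  have hT := hX.T_pos.le
  have hmeas : ∀ θ, Measurable (approxField T (fun k => Y k θ)) := fun θ =>
    measurable_pi_lambda _ fun z =>
      hY.measurable_Y hX z.1.2 θ z.2.1.2.1 z.2.1.2.2.1 z.2.1.2.2.2 z.2.2
  have hcl : ∀ s t, 0 ≤ clampTime T s ∧ clampTime T s ≤ max (clampTime T s) (clampTime T t) ∧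
      max (clampTime T s) (clampTime T t) ≤ T := fun s t =>
    ⟨(clampTime_mem hT s).1, le_max_left _ _,
      max_le (clampTime_mem hT s).2 (clampTime_mem hT t).2⟩
  refine ⟨hY.τ_meas, hY.τ_mem, fun θ => ?_, fun θ => (hmeas θ).comap_le, fun k hk θ => ?_,
    (iIndepFun_iff_iIndep _ _ _).1 hY.τ_indep, (iIndepFun_iff_iIndep _ _ _).1 hY.Y_indep, ?_,
    fun k hk θ => hY.proc_Y hX hk θ, fun n k hn hk θ => hY.close_Y hX hn hk θ,
    fun θ θ' n q hq => ?_⟩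
  · rw [(hY.τ_ident θ).map_eq]
    exact map_eq_uniform (hY.τ_meas _) (hY.τ_mem _) hY.τ_law
  · have h := hY.Y_meas_self k hk θ
    rw [augment_eq] at h
    exact measurable_clampField hT h
  · refine indep_of_indep_of_le_left (indep_of_indep_of_le_right hY.XY_τ_indep.symm ?_) ?_
    · exact iSup_le fun θ => comap_comp_le
        (fun ω => (flowField T X ω, fun θ : Idx => approxField T (fun k => Y k θ) ω))
        ((measurable_pi_apply (X := fun _ : Idx => ℕ+ × TimePair T × E → E) θ).comp
          (measurable_snd (α := TimePair T × E → E)))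
    · exact iSup_le fun θ => comap_comp_le (fun ω (θ : Idx) => τ θ ω) (measurable_pi_apply θ)
  · have h : ∀ θ, IdentDistrib
        (fun ω i => clampField T (Y (q i).1 θ) (q i).2.1 (q i).2.2.1 (q i).2.2.2 ω)
        (fun ω i => clampField T (Y (q i).1 Idx.zero) (q i).2.1 (q i).2.2.1 (q i).2.2.2 ω) P P :=
      fun θ => hY.identDistrib hX θ (q := fun i => ((q i).1, clampTime T (q i).2.1,
        max (clampTime T (q i).2.1) (clampTime T (q i).2.2.1), (q i).2.2.2))
        (fun i => ⟨hq i, hcl _ _⟩) (Ψ := id) measurable_id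
    exact (h θ).trans (h θ').symm

/-- Started at t in [0,T], the recursion only visits times in [t,T], where the extended fields
coincide with the given ones. -/
theorem mlp_clamp (hτ : ∀ θ ω, τ θ ω ∈ Icc (0 : ℝ) 1) (m n : ℕ) :
    ∀ (θ : Idx) {t : ℝ} (_ : t ∈ Icc 0 T) (x : E) (ω : Ω),
    mlp T f g τ (fun k θ => clampField T (Y k θ)) m n θ t x ω = mlp T f g τ Y m n θ t x ω := by
  induction n using Nat.strong_induction_on with
  | _ n ih =>
    intro θ t ht x ω
    have hρ : ∀ η, t ≤ t + (T - t) * τ η ω ∧ t + (T - t) * τ η ω ≤ T := fun η => by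
      have h1 := hτ η ω
      have h2 : 0 ≤ T - t := by linarith [ht.2]
      exact ⟨by nlinarith [h1.1], by nlinarith [h1.2]⟩
    have hval : ∀ k ℓ, ℓ < n → ∀ η η',
        fullVal T f g τ (fun k θ => clampField T (Y k θ)) m k ℓ η η' t x ω
          = fullVal T f g τ Y m k ℓ η η' t x ω := by
      intro k ℓ hℓ η η'
      unfold fullVal
      beta_reduce
      rw [ih ℓ hℓ η' ⟨ht.1.trans (hρ η).1, (hρ η).2⟩, clampField_of_le _ ht.1 ht.2 le_rfl,
        clampField_of_le _ ht.1 (hρ η).1 (hρ η).2]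
    rw [mlp_eq, mlp_eq]
    refine Finset.sum_congr rfl fun ℓ hℓ => ?_
    have hℓ := Finset.mem_range.1 hℓ
    congr 1
    refine Finset.sum_congr rfl fun i _ => ?_
    unfold mlpTerm
    rw [hval _ _ hℓ, hval _ _ (by omega)]

theorem multigrid_clamp (hT : 0 < T) (hτ : ∀ θ ω, τ θ ω ∈ Icc (0 : ℝ) 1) (θbar : ℕ → Idx)
    (n : ℕ) {m : ℕ} (hm : 1 ≤ m) {t : ℝ} (ht : t ∈ Icc 0 T) (ω : Ω) :
    multigrid T f g τ (fun k θ => clampField T (Y k θ)) θbar n m t ω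
      = multigrid T f g τ Y θbar n m t ω := by
  have hI : ∀ ℓ k, 1 ≤ k → interp T k (fun s => mlp T f g τ (fun k θ => clampField T (Y k θ)) m
      (n - ℓ) (θbar ℓ) s (clampField T (Y (m ^ n) Idx.zero) 0 s 0 ω) ω) t
      = interp T k (fun s => mlp T f g τ Y m (n - ℓ) (θbar ℓ) s (Y (m ^ n) Idx.zero 0 s 0 ω) ω) t := by
    intro ℓ k hk
    obtain ⟨h1, h2, h3, h4, -⟩ := grid_bounds hT hk ht
    have hf : gridFloor T k t ∈ Icc 0 T := ⟨h1, h2.trans ht.2⟩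
    have hc : gridCeil T k t ∈ Icc 0 T := ⟨ht.1.trans h3, h4⟩
    unfold interp
    beta_reduce
    rw [clampField_of_le _ le_rfl hf.1 hf.2, clampField_of_le _ le_rfl hc.1 hc.2,
      mlp_clamp hτ m _ _ hf, mlp_clamp hτ m _ _ hc]
  refine Finset.sum_congr rfl fun ℓ _ => ?_
  rw [hI _ _ (Nat.one_le_pow _ _ hm), hI _ _ (Nat.one_le_pow _ _ hm)]

theorem picardStep_clamp {u v : ℝ → E → ℝ} (huv : ∀ t ∈ Icc 0 T, ∀ x, u t x = v t x) {t : ℝ}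
    (ht : t ∈ Icc 0 T) (x : E) :
    picardStep P T f g (clampField T X) u t x
      = ∫ ω, g (X t T x ω) ∂P + ∫ r in t..T, ∫ ω, f (v r (X t r x ω)) ∂P := by
  unfold picardStep
  rw [clampField_of_le _ ht.1 ht.2 le_rfl]
  congr 1
  refine intervalIntegral.integral_congr fun r hr => ?_
  rw [uIcc_of_le ht.2] at hr
  simp only [clampField_of_le _ ht.1 hr.1 hr.2, huv r ⟨ht.1.trans hr.1, hr.2⟩]

/-- The finite supremum of |u|/V in the integrability condition is the growth constant. -/
theorem IsFixedPoint.solution (hT : 0 < T) {u : ℝ → E → ℝ}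
    (hV : ∀ t ∈ Icc 0 T, ∀ x, 1 ≤ V t x) (hu : IsFixedPoint P T f g V X u) :
    Solution P T f g (fun t => V (clampTime T t)) (clampField T X) (fun t => u (clampTime T t)) := by
  refine ⟨?_, fun t ht x => ?_⟩
  · have h1 := hu.finite 0 ⟨le_rfl, hT.le⟩ 0
    set S := ⨆ r ∈ Icc 0 T, ⨆ ξ : E, ENNReal.ofReal (|u r ξ| / V r ξ)
    have hS : S ≠ ∞ := ((le_add_self).trans_lt h1).ne
    refine ⟨S.toReal, ?_, ENNReal.toReal_nonneg, fun t ht x => ?_⟩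
    · exact hu.meas.comp (f := fun z : ℝ × E =>
        ((⟨clampTime T z.1, clampTime_mem hT.le z.1⟩ : Icc (0 : ℝ) T), z.2))
        ((Measurable.subtype_mk ((measurable_clampTime T).comp measurable_fst)).prodMk
          measurable_snd)
    · have hV0 : 0 < V t x := zero_lt_one.trans_le (hV t ht x)
      simp only [clampTime_of_mem ht]
      rw [← div_le_iff₀ hV0, ← ENNReal.ofReal_le_iff_le_toReal hS]
      exact le_iSup₂_of_le (f := fun r (_ : r ∈ Icc 0 T) =>
        ⨆ ξ : E, ENNReal.ofReal (|u r ξ| / V r ξ)) t ht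
        (le_iSup (fun ξ : E => ENNReal.ofReal (|u t ξ| / V t ξ)) x)
  · have h2 := picardStep_clamp (P := P) (f := f) (g := g) (X := X)
      (u := fun t => u (clampTime T t)) (v := u)
      (fun t ht x => by rw [clampTime_of_mem ht]) ht x
    rw [h2, ← hu.eq t ht x, clampTime_of_mem ht]

theorem Solution.isFixedPoint {s₁ s₂ : ℝ}
    (hF : Flow P s₁ s₂ c T f g (fun t => V (clampTime T t)) (clampField T X)) {u : ℝ → E → ℝ}
    (hu : Solution P T f g (fun t => V (clampTime T t)) (clampField T X) u) :
    IsFixedPoint P T f g V X u := by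
  obtain ⟨C, hC⟩ := hu.growth
  refine ⟨?_, fun t ht x => ?_, fun t ht x => ?_⟩
  · exact hC.meas.comp (f := fun z : Icc 0 T × E => ((z.1 : ℝ), z.2)) (by fun_prop)
  · refine ENNReal.add_lt_top.2 ⟨ENNReal.add_lt_top.2 ⟨?_, ?_⟩, ?_⟩
    · have := (hF.lb_g ht x).lintegral_le
      rw [clampField_of_le _ ht.1 ht.2 le_rfl] at this
      exact this.trans_lt ENNReal.ofReal_lt_top
    · have h1 : ∀ r ∈ Icc t T, ∫⁻ ω, ENNReal.ofReal |f (u r (X t r x ω))| ∂P ≤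
          ENNReal.ofReal (|f 0| + c * (C * V (clampTime T t) x)) := fun r hr => by
        have := (hF.lb_f_comp hC ht.1 hr.1 hr.2 x).lintegral_le
        rwa [clampField_of_le _ ht.1 hr.1 hr.2] at this
      refine (setLIntegral_mono' measurableSet_Icc h1).trans_lt ?_
      rw [setLIntegral_const, Real.volume_Icc]
      exact ENNReal.mul_lt_top ENNReal.ofReal_lt_top ENNReal.ofReal_lt_top
    · refine (iSup₂_le fun r hr => iSup_le fun ξ => ?_).trans_lt
        (ENNReal.ofReal_lt_top (r := C))
      have h1 := hC.le r hr ξ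
      have h2 := hF.V_pos r ξ
      simp only [clampTime_of_mem hr] at h1 h2
      exact ENNReal.ofReal_le_ofReal ((div_le_iff₀ h2).2 h1)
  · rw [hu.eq t ht x, picardStep_clamp (v := u) (fun _ _ _ => rfl) ht x]

end Normalization

end MultigridFBSDE

/-! ### The main theorem. -/

theorem theorem5p1
    {E Ω : Type*} [NormedAddCommGroup E] [NormedSpace ℝ E] [FiniteDimensional ℝ E] [Nontrivial E]
    [MeasurableSpace E] [BorelSpace E] [MeasurableSpace Ω]
    (P : Measure Ω) [IsProbabilityMeasure P]
    (p₁ p₂ c T : ℝ) (f : ℝ → ℝ) (g : E → ℝ) (V : ℝ → E → ℝ)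
    (X : ℝ → ℝ → E → Ω → E)
    (τ : MultigridFBSDE.Idx → Ω → ℝ)
    (Y : ℕ → MultigridFBSDE.Idx → ℝ → ℝ → E → Ω → E)
    (hX : MultigridFBSDE.ForwardSetting P p₁ p₂ c T f g V X)
    (hY : MultigridFBSDE.ApproxSetting P p₁ p₂ c T V X τ Y)
    (p q₁ q₂ : ℝ) (hp : 2 ≤ p) (hq₁ : 3 ≤ q₁) (hq₂ : 9 ≤ q₂)
    (hpq : (q₂ + 1) / p₁ + 2 / p₂ ≤ 1 / p) (hq : q₁ + 2 ≤ q₂)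
    (θbar : ℕ → MultigridFBSDE.Idx) :
    ∃ u : ℝ → E → ℝ,
      MultigridFBSDE.IsFixedPoint P T f g V X u ∧
      (∀ v : ℝ → E → ℝ, MultigridFBSDE.IsFixedPoint P T f g V X v →
        ∀ t ∈ Icc 0 T, ∀ x, v t x = u t x) ∧
      (∀ t ∈ Icc 0 T,
        MultigridFBSDE.rNorm P p (fun ω => u t (X 0 t 0 ω)) ≤
          ENNReal.ofReal (2 * Real.exp (2 * c * T) * V 0 0 ^ q₁)) ∧
      (∀ t ∈ Icc 0 T, ∀ s ∈ Icc 0 T, s ≠ t →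
        ENNReal.ofReal (√T) *
            MultigridFBSDE.rNorm P p (fun ω => u t (X 0 t 0 ω) - u s (X 0 s 0 ω)) /
            ENNReal.ofReal (√|t - s|) ≤
          ENNReal.ofReal (12 * Real.exp (2 * c * T) * V 0 0 ^ (q₂ + 1))) ∧
      (∀ n m : ℕ, 1 ≤ n → 1 ≤ m → ∀ t ∈ Icc 0 T,
        MultigridFBSDE.rNorm P p
            (fun ω => MultigridFBSDE.multigrid T f g τ Y θbar n m t ω - u t (X 0 t 0 ω)) ≤
          ENNReal.ofReal (959 * m * Real.exp (6 * c * T) * Real.exp ((m : ℝ) ^ (p / 2) / p)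
            * (m : ℝ) ^ (-(n : ℝ) / 2) * 74 ^ n * Real.exp (4 * n * c * T)
            * (p - 1) ^ ((n : ℝ) / 2) * V 0 0 ^ (q₂ + 1))) := by
  have hp₁ := hX.one_le_p₁
  have hp₂ := hX.one_le_p₂
  have hT := hX.T_pos
  have hc := hX.c_pos
  have h0 : (0 : ℝ) ∈ Icc 0 T := ⟨le_rfl, hT.le⟩
  have : ProperSpace E := FiniteDimensional.proper ℝ E
  -- The exponent budget used throughout: q₂ ≥ 9 provides the ten shares of 1/p₁.
  have hexp : 10 * p₁⁻¹ + 2 * p₂⁻¹ ≤ p⁻¹ := by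
    have h1 : 10 / p₁ ≤ (q₂ + 1) / p₁ := by gcongr; linarith
    simp only [div_eq_mul_inv, one_mul] at hpq h1
    linarith
  have hp2 : p⁻¹ ≤ 1 / 2 := by rw [one_div]; exact inv_anti₀ two_pos hp
  have hp1 : p⁻¹ ≤ 1 := by linarith
  have hF := hY.flow hX (hexp.trans hp2)
  obtain ⟨u, hu⟩ := hF.exists_solution
  set K := Real.exp (c * T) with hKdef
  set v := V 0 0 with hvdef
  have hK : 1 ≤ K := hF.one_le_exp
  have hv : 1 ≤ v := hX.one_le_V 0 h0 0
  have hKpow : ∀ j : ℕ, Real.exp (j * c * T) = K ^ j := fun j => by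
    rw [hKdef, ← Real.exp_nat_mul]; congr 1; ring
  have hK2 : Real.exp (2 * c * T) = K ^ 2 := by simpa using hKpow 2
  have hK6 : Real.exp (6 * c * T) = K ^ 6 := by simpa using hKpow 6
  have hvpow : ∀ (j : ℕ) (q : ℝ), (j : ℝ) ≤ q → v ^ j ≤ v ^ q := fun j q hq => by
    rw [← Real.rpow_natCast]; exact Real.rpow_le_rpow_of_exponent_le hv hq
  have hXt : ∀ t ∈ Icc 0 T, MultigridFBSDE.clampField T X 0 t = X 0 t := fun t ht =>
    MultigridFBSDE.clampField_of_le X le_rfl ht.1 ht.2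
  have hcl0 : MultigridFBSDE.clampTime T 0 = 0 := MultigridFBSDE.clampTime_of_mem h0
  have hnorm : ∀ {Z : Ω → ℝ} {b b' : ℝ}, MultigridFBSDE.LB P p⁻¹ Z b → b ≤ b' →
      MultigridFBSDE.rNorm P p Z ≤ ENNReal.ofReal b' := fun {Z b b'} h hb => by
    have := h.norm_le
    rw [inv_inv] at this
    exact this.trans (ENNReal.ofReal_le_ofReal hb)
  refine ⟨u, hu.isFixedPoint hF, fun w hw t ht x => ?_, fun t ht => ?_, ?_, ?_⟩
  · have := (hw.solution hT hX.one_le_V).unique hF hu t ht x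
    rwa [MultigridFBSDE.clampTime_of_mem ht] at this
  · have h1 := hF.lb_comp (hF.solution_growth hu) le_rfl ht.1 ht.2 0
    rw [hXt t ht, hcl0] at h1
    refine hnorm (h1.mono_exponent (by linarith [hF.s₁_pos, hF.s₂_pos]) hp1) ?_
    rw [hK2]
    have h2 : v ≤ v ^ q₁ := by simpa using hvpow 1 q₁ (by norm_num; linarith)
    have h3 : K ≤ K ^ 2 := le_self_pow₀ hK two_ne_zero
    gcongr
  · have key : ∀ t ∈ Icc 0 T, ∀ s ∈ Icc 0 T, s < t →
        ENNReal.ofReal (√T) *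
            MultigridFBSDE.rNorm P p (fun ω => u t (X 0 t 0 ω) - u s (X 0 s 0 ω)) /
            ENNReal.ofReal (√|t - s|) ≤
          ENNReal.ofReal (12 * Real.exp (2 * c * T) * v ^ (q₂ + 1)) := by
      intro t ht s hs hst
      have h1 := hF.lb_solution_time hu hexp hp1 hs.1 hst.le ht.2 0
      rw [hXt t ht, hXt s hs, hcl0] at h1
      have hd : 0 < √|t - s| := Real.sqrt_pos.2 (abs_pos.2 (by linarith))
      have hsT : 0 < √T := Real.sqrt_pos.2 hT
      have h2 : MultigridFBSDE.rNorm P p (fun ω => u t (X 0 t 0 ω) - u s (X 0 s 0 ω)) ≤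
          ENNReal.ofReal (3 * K ^ 2 * v ^ 3 * (√|t - s| / √T)) := by
        rw [show MultigridFBSDE.rNorm P p (fun ω => u t (X 0 t 0 ω) - u s (X 0 s 0 ω))
          = MultigridFBSDE.rNorm P p (fun ω => u s (X 0 s 0 ω) - u t (X 0 t 0 ω)) from
          eLpNorm_sub_comm (fun ω => u t (X 0 t 0 ω)) (fun ω => u s (X 0 s 0 ω)) _ _]
        refine hnorm h1 (le_of_eq ?_)
        rw [MultigridFBSDE.td_comm]; rfl
      refine ENNReal.div_le_of_le_mul ((mul_le_mul_right h2 _).trans ?_)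
      rw [← ENNReal.ofReal_mul hsT.le, ← ENNReal.ofReal_mul (by positivity)]
      refine ENNReal.ofReal_le_ofReal ?_
      have h3 : v ^ 3 ≤ v ^ (q₂ + 1) := by
        refine (hvpow 3 (q₂ + 1) ?_)
        norm_num; linarith
      rw [hK2]
      calc √T * (3 * K ^ 2 * v ^ 3 * (√|t - s| / √T)) = 3 * K ^ 2 * v ^ 3 * √|t - s| := by
            field_simp
        _ ≤ 12 * K ^ 2 * v ^ (q₂ + 1) * √|t - s| := by gcongr; norm_num
    intro t ht s hs hst
    rcases lt_or_gt_of_ne hst with h | h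
    · exact key t ht s hs h
    · have := key s hs t ht h
      rwa [abs_sub_comm, show MultigridFBSDE.rNorm P p (fun ω => u s (X 0 s 0 ω) - u t (X 0 t 0 ω))
          = MultigridFBSDE.rNorm P p (fun ω => u t (X 0 t 0 ω) - u s (X 0 s 0 ω)) from
          eLpNorm_sub_comm (fun ω => u s (X 0 s 0 ω)) (fun ω => u t (X 0 t 0 ω)) _ _] at this
  · intro n m hn hm t ht
    have h1 := hF.multigrid_err (hY.approx hX) hu hp hexp hm
      (fun k hk => (hY.close_X hX hk).clamp) hn θbar ht
    rw [hXt t ht, hcl0] at h1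
    simp only [MultigridFBSDE.multigrid_clamp hT hY.τ_mem θbar n hm ht] at h1
    refine hnorm h1 ?_
    have hm1 : (1 : ℝ) ≤ m := by exact_mod_cast hm
    have hm0 : (0 : ℝ) < m := by linarith
    have hpp : 0 ≤ p - 1 := by linarith
    have e1 : (m : ℝ) ^ (-(n : ℝ) / 2) = (√(m : ℝ))⁻¹ ^ n := by
      rw [Real.sqrt_eq_rpow, ← Real.rpow_neg hm0.le, ← Real.rpow_natCast, ← Real.rpow_mul hm0.le]
      congr 1; ring
    have e2 : (p - 1) ^ ((n : ℝ) / 2) = √(p - 1) ^ n := by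
      rw [Real.sqrt_eq_rpow, ← Real.rpow_natCast, ← Real.rpow_mul hpp]
      congr 1; ring
    have e3 : Real.exp (4 * n * c * T) = (K ^ 4) ^ n := by
      rw [← pow_mul, ← hKpow]; push_cast; rfl
    have h2 : √(m : ℝ) ≤ m := by
      rw [Real.sqrt_le_left hm0.le]; nlinarith
    have h3 : v ^ 10 ≤ v ^ (q₂ + 1) := by
      refine hvpow 10 (q₂ + 1) ?_
      norm_num; linarith
    have h4 : K ^ 2 ≤ K ^ 6 := pow_le_pow_right₀ hK (by norm_num)
    rw [e1, e2, e3, hK6, mul_pow, mul_pow]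
    -- The argument yields the constant 82 = 41·2 together with √m and K², which leaves ample room
    -- below 959, m and K⁶.
    calc _ = 82 * √(m : ℝ) * K ^ 2 * Real.exp ((m : ℝ) ^ (p / 2) / p) * (√(m : ℝ))⁻¹ ^ n * 74 ^ n
          * (K ^ 4) ^ n * √(p - 1) ^ n * v ^ 10 := by ring
      _ ≤ 959 * m * K ^ 6 * Real.exp ((m : ℝ) ^ (p / 2) / p) * (√(m : ℝ))⁻¹ ^ n * 74 ^ n
          * (K ^ 4) ^ n * √(p - 1) ^ n * v ^ (q₂ + 1) := by
        gcongr; norm_num
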